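/- \textbf{Setting.} For each sample size $n$ there is a population of individuals with potential outcomes $Y^1(1),Y^1(0),Y^0(1),Y^0(0)$ (integrable), treatment status $D\in\{0,1\}$ and covariates $W=(X,Z)$, $X\in\mathbb R^{p}$, $p>n$, $Z\in\mathcal Z\subset\mathbb R^{d}$, $\mathcal Z$ compact; the distribution, $p$, and all objects below may depend on $n$, while constants called fixed and $d,\mathcal Z$ do not. Treatment has no effect before period 1: $Y^1(0)=Y^0(0)$ a.s. on $\{D=1\}$. Put $Y(t)=DY^1(t)+(1-D)Y^0(t)$, $\Delta Y=Y(1)-Y(0)$, $\Delta Y_1=Y^1(1)-Y^0(0)$, $\Delta Y_0=Y^0(1)-Y^0(0)$, $\pi(W)=\mathbb P(D=1|W)$, $\Phi_1(W)=\mathbb E[\Delta Y_1|W,D=1]$, $\Phi_0(W)=\mathbb E[\Delta Y_0|W,D=0]$, $\epsilon_1=\Delta Y_1-\Phi_1(W)$, $\epsilon_0=\Delta Y_0-\Phi_0(W)$, $\epsilon=\frac{D}{\pi(W)}\epsilon_1-\frac{1-D}{1-\pi(W)}\epsilon_0$, $\bar X=X-\mathbb E[X|Z]$, $\Sigma_{\bar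 X}=\mathbb E[\bar X\bar X^\top]$, $\Sigma_\Pi=\mathbb E\big[\mathbb E[X|Z]\mathbb E[X|Z]^\top\big]$, $\sigma^2=\mathbb E[\epsilon^2|W]$, $\Omega_\beta=\mathbb E[\sigma^2\bar X\bar X^\top]$, $V_\beta=\Sigma_{\bar X}^{-1}\Omega_\beta\Sigma_{\bar X}^{-1}$. The main sample consists of $n$ i.i.d. individuals; the nuisance estimators $\hat\pi,\hat\Phi_1,\hat\Phi_0$ are computed from an auxiliary sample independent of it. $\mathbb E_n$ is the average over the main sample. \textbf{Estimators.} With $\hat\rho_i=\frac{D_i-\hat\pi(W_i)}{\hat\pi(W_i)(1-\hat\pi(W_i))}$ and $\hat S_i=\hat\rho_i\big(\Delta Y_i-(1-\hat\pi(W_i))\hat\Phi_1(W_i)-\hat\pi(W_i)\hat\Phi_0(W_i)\big)$, sieve basis $\psi=(\psi_1,\dots,\psi_{k})^\top$, $k\ge1$, and parameter set $\mathcal B\subseteq\mathbb R^p$, $(\hat\beta,\hat\gamma)$ minimizes $\mathbb E_n[(X_i^\top\beta+\psi(Z_i)^\top\gamma-\hat S_i)^2]+\lambda\|\beta\|_1$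 over $\mathcal B\times\mathbb R^{k}$, and $\hat f=\psi^\top\hat\gamma$. Let $\Psi$ be the $n\times k$ matrix with rows $\psi(Z_i)^\top$, $\tilde X=(I-\Psi(\Psi^\top\Psi)^{-1}\Psi^\top)\mathbf X$ with rows $\tilde X_i$, $\hat\Sigma_{\tilde X}=\mathbb E_n[\tilde X_i\tilde X_i^\top]$. For a known vector $\xi\in\mathbb R^p$, let $\hat w$ (a function of the covariates in the main sample) minimize $\|w\|_1$ subject to $\|\xi+\hat\Sigma_{\tilde X}w\|_\infty\le\lambda'$ whenever the constraint can be met. Put $\hat\epsilon_i=\hat S_i-X_i^\top\hat\beta-\hat f(Z_i)$ and $$\hat T=\xi^\top\hat\beta-\hat w^\top\mathbb E_n[\hat\epsilon_i\tilde X_i],\qquad \hat V_\beta=\hat w^\top\mathbb E_n[\hat\epsilon_i^2\tilde X_i\tilde X_i^\top]\hat w .$$ \textbf{Assumptions.} (The constants $K,C,C',c,\dots$ are fixed and positive.) (1) $\mathbb E[\Delta Y_0|W,D=1]=\mathbb E[\Delta Y_0|W,D=0]$. (2) $c<\pi(W)<1-c$ a.s. (3) $W\in\mathcal W$ a.s.,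 $\mathcal W\subset\mathbb R^p\times\mathcal Z$ compact with nonempty interior; $(\beta_0,f_0)$ is the only element of $\mathcal B\times\mathcal F$ with $\mathbb E[Y^1(1)-Y^0(1)|W,D=1]=X^\top\beta_0+f_0(Z)$, where $\mathcal F$ is contained in a fixed H\"older ball $C^\alpha_M(\mathcal Z)$, $\alpha>0$, $\alpha\ge d/2$; $\mathbb E[f_0(Z)|X]$ is not in the linear span of $X$. (4) $\mathbb E[\epsilon_1|W]=\mathbb E[\epsilon_0|W]=0$; $\mathbb E[|\epsilon|^{r}|W]\le C$ for a fixed $r>4$. (5) $(\mathbb E|v^\top X|^q)^{1/q}\le K\sqrt q$ for all unit $v$, $q\ge1$; with $S_0$ the support of $\beta_0$, $s_0=|S_0|$, the restricted eigenvalue $\Lambda^2=\min\{\delta^\top\Sigma_{\bar X}\delta/\|\delta_{S_0}\|_2^2:\delta\ne0,\|\delta_{S_0^c}\|_1\le3\sqrt{s_0}\|\delta_{S_0}\|_2\}$ exceeds a fixed positive constant (if $s_0>0$); the eigenvalues of $\Sigma_{\bar X}$ lie between fixed positive constants and those of $\Sigma_\Pi$ are bounded. (6) For each $f\in\mathcal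 F$ the error $r_f$ of its $L^2$-projection on the span of $\psi$ satisfies $\|r_f\|_{P,2}\le c_{k}$, $\sup_{\mathcal Z}|r_f|\le\ell_{k}c_{k}$. Write $r_n=r_{f_0}$. (7) $Z$ has a density on $\mathcal Z$ lying between fixed positive constants; the eigenvalues of $\mathbb E[\psi(Z)\psi(Z)^\top]$ exceed a fixed positive constant; $\sup_{\mathcal Z}\|\psi\|\le\xi_0$, $\xi_0^2\log k/n\to0$, $k\xi_0^2\log p/n\le C$; $\|\mathbb E[\tilde X_i\tilde X_i^\top-\bar X_i\bar X_i^\top]\|_{\max}\le C\sqrt{\log p/n}$. (8) $2\lambda^2s_0/\Lambda^2\lesssim R^2\lesssim\lambda$, where $R^2=\min(\ell_k^2c_k^2k/n,\ \xi_0^2c_k^2/n)+k/n$. (9) With $s_w$ the number of nonzero entries of $\Sigma_{\bar X}^{-1}\xi$: each of $\mathbb E_n[(1/\hat\pi-1/\pi)^2]$, $\mathbb E_n[(\hat\Phi_1-\Phi_1)^2]$, $\mathbb E_n[(\hat\Phi_0-\Phi_0)^2]$ is $o_p\big(\frac1{k\log k}\vee\frac1{s_w\log p}\big)$; $1/\hat\pi-1/\pi$,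 $\hat\Phi_1-\Phi_1$, $\hat\Phi_0-\Phi_0$ are $o_p(1)$ uniformly on $\mathcal W$; and $\mathbb E_n[(1/\hat\pi-1/\pi)^2(\hat\Phi_j-\Phi_j)^2]=o_p\big(\frac1{s_w^2n}\vee\frac1{kn}\big)$ for $j=0,1$. (10) $n^{-1/2}(s_w^2\sqrt{\log p}\vee s_w\log p)\to0$; $s_0\log p/\sqrt n\to0$; $s_w\max_{i,j}|\tilde X_{ij}r_n(Z_i)|=o_p(n^{-1/2})$; $s_w\|\mathbb E_n[\epsilon_i(\tilde X_i-\bar X_i)]\|_\infty=o_p(n^{-1/2})$; the eigenvalues of $\Omega_\beta$ and the norm $\|\xi\|_2$ lie between fixed positive constants. \textbf{Theorem.} There is a constant $C_0>0$ depending only on $d$, $\mathcal Z$ and the fixed constants in the assumptions such that, whenever $C_0\sqrt{\log p/n}\le\lambda,\lambda'\le C_1\sqrt{\log p/n}$ for some constant $C_1$ and all large $n$, $$\frac{\sqrt n(\hat T-\xi^\top\beta_0)}{(\xi^\top V_\beta\xi)^{1/2}}\to_dN(0,1);$$ in particular $\sqrt n(\hat T-\xi^\top\beta_0)\to_dN(0,v)$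 if $\xi^\top V_\beta\xi\to v$. If moreover $$\log(np)\Big(\frac{s_0\log p}{n}+\sqrt{\frac{\xi_0^2k}{n}}+\ell_{k}c_{k}\Big)\to0,$$ then $\hat V_\beta-\xi^\top V_\beta\xi\to_p0$. -/

import Mathlib

open MeasureTheory ProbabilityTheory Filter Topology
open scoped Matrix ENNReal NNReal

universe u

noncomputable section

namespace DiD

/-- `ℝ^d` with its Euclidean norm, where the low-dimensional covariate `Z` lives. -/
abbrev EZ (d : ℕ) : Type := EuclideanSpace ℝ (Fin d)

/-- Values of the covariates `W = (X, Z)`. -/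
abbrev Cov (p d : ℕ) : Type := (Fin p → ℝ) × EZ d

/-- The full record of one individual: the potential outcomes
`(Y¹(1), Y¹(0), Y⁰(1), Y⁰(0))`, the treatment status `D`, and the covariates `W = (X, Z)`. -/
abbrev Rec (p d : ℕ) : Type := (ℝ × ℝ × ℝ × ℝ) × Bool × Cov p d

section Record

variable {p d : ℕ}

def y11 (o : Rec p d) : ℝ := o.1.1
def y10 (o : Rec p d) : ℝ := o.1.2.1
def y01 (o : Rec p d) : ℝ := o.1.2.2.1
def y00 (o : Rec p d) : ℝ := o.1.2.2.2
/-- Treatment status as a number in `{0, 1}`. -/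
def dd (o : Rec p d) : ℝ := if o.2.1 then 1 else 0
def cov (o : Rec p d) : Cov p d := o.2.2
def xx (o : Rec p d) : Fin p → ℝ := o.2.2.1
def zz (o : Rec p d) : EZ d := o.2.2.2

/-- `ΔY = Y(1) - Y(0)` with the realized outcomes `Y(t) = D Y¹(t) + (1 - D) Y⁰(t)`. -/
def dY (o : Rec p d) : ℝ :=
  (dd o * y11 o + (1 - dd o) * y01 o) - (dd o * y10 o + (1 - dd o) * y00 o)
/-- `ΔY₁ = Y¹(1) - Y⁰(0)`. -/
def dY1 (o : Rec p d) : ℝ := y11 o - y00 o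
/-- `ΔY₀ = Y⁰(1) - Y⁰(0)`. -/
def dY0 (o : Rec p d) : ℝ := y01 o - y00 o

/-- The event `{D = 1}`. -/
def treated : Set (Rec p d) := {o | o.2.1 = true}
/-- The event `{D = 0}`. -/
def untreated : Set (Rec p d) := {o | o.2.1 = false}

/-- The σ-algebras generated by `W`, `X` and `Z`. -/
abbrev sigW (p d : ℕ) : MeasurableSpace (Rec p d) := MeasurableSpace.comap cov inferInstance
abbrev sigX (p d : ℕ) : MeasurableSpace (Rec p d) := MeasurableSpace.comap xx inferInstance
abbrev sigZ (p d : ℕ) : MeasurableSpace (Rec p d) := MeasurableSpace.comap zz inferInstance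

/-- `ρ (ΔY - (1 - π) Φ₁ - π Φ₀)` with `ρ = (D - π) / (π (1 - π))`, for functions
`pr = π`, `h1 = Φ₁`, `h0 = Φ₀` of the covariates. -/
def score (pr h1 h0 : Cov p d → ℝ) (o : Rec p d) : ℝ :=
  (dd o - pr (cov o)) / (pr (cov o) * (1 - pr (cov o))) *
    (dY o - (1 - pr (cov o)) * h1 (cov o) - pr (cov o) * h0 (cov o))

end Record

/-- The Hölder ball `C^α_M(𝒵)`. With `m` the largest integer strictly below `α`, the partial
derivatives `D^τ g` are the values of the iterated derivative on basis vectors, and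
`A + B ≤ M` bounds the sum of the two suprema in the Hölder norm. -/
def HolderBall {d : ℕ} (𝒵 : Set (EZ d)) (α M : ℝ) : Set (EZ d → ℝ) :=
  {g | ContinuousOn g 𝒵 ∧ ContDiffOn ℝ ((⌈α⌉₊ - 1 : ℕ) : ℕ∞) g (interior 𝒵) ∧
    ∃ A B : ℝ, 0 ≤ A ∧ 0 ≤ B ∧ A + B ≤ M ∧
      (∀ z ∈ 𝒵, |g z| ≤ A) ∧
      (∀ j ≤ ⌈α⌉₊ - 1, ∀ t : Fin j → Fin d, ∀ z ∈ interior 𝒵,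
        |iteratedFDeriv ℝ j g z (fun l => EuclideanSpace.single (t l) 1)| ≤ A) ∧
      (∀ t : Fin (⌈α⌉₊ - 1) → Fin d, ∀ z ∈ interior 𝒵, ∀ z' ∈ interior 𝒵,
        |iteratedFDeriv ℝ (⌈α⌉₊ - 1) g z (fun l => EuclideanSpace.single (t l) 1) -
          iteratedFDeriv ℝ (⌈α⌉₊ - 1) g z' (fun l => EuclideanSpace.single (t l) 1)|
          ≤ B * ‖z - z'‖ ^ (α - ((⌈α⌉₊ - 1 : ℕ) : ℝ)))}

/-- All eigenvalues of the symmetric matrix `S` are at least `lo`. -/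
def EigGE {ι : Type*} [Fintype ι] (S : Matrix ι ι ℝ) (lo : ℝ) : Prop :=
  ∀ v : ι → ℝ, lo * (v ⬝ᵥ v) ≤ v ⬝ᵥ (S *ᵥ v)

/-- All eigenvalues of the symmetric matrix `S` are at most `hi`. -/
def EigLE {ι : Type*} [Fintype ι] (S : Matrix ι ι ℝ) (hi : ℝ) : Prop :=
  ∀ v : ι → ℝ, v ⬝ᵥ (S *ᵥ v) ≤ hi * (v ⬝ᵥ v)

/-- The setting at sample size `n`: the population, the sieve, the first stage, the tuning
parameters and the second-stage estimators. -/
structure Experiment (d n : ℕ) where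
  /-- dimension of `X` -/
  p : ℕ
  /-- dimension of the sieve space -/
  k : ℕ
  /-- distribution of one individual -/
  P : Measure (Rec p d)
  isProbP : IsProbabilityMeasure P
  /-- compact set containing the values of `W` -/
  𝒲 : Set (Cov p d)
  /-- parameter sets and true parameters -/
  ℬ : Set (Fin p → ℝ)
  ℱ : Set (EZ d → ℝ)
  β0 : Fin p → ℝ
  f0 : EZ d → ℝ
  /-- propensity score and outcome regressions (`Regular` says what they are) -/
  pr : Cov p d → ℝ
  Φ1 : Cov p d → ℝ
  Φ0 : Cov p d → ℝ
  meas_pr : Measurable pr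
  meas_Φ1 : Measurable Φ1
  meas_Φ0 : Measurable Φ0
  /-- sieve basis functions `ψ^k` and sieve coefficients of `f0` -/
  ψ : EZ d → Fin k → ℝ
  meas_ψ : Measurable ψ
  γ0 : Fin k → ℝ
  /-- the constants `c_k`, `ℓ_k` and `ξ₀(k)` of the sieve -/
  ck : ℝ
  lk : ℝ
  ξ0 : ℝ
  /-- the auxiliary sample from which the nuisance functions are estimated -/
  Aux : Type u
  mAux : MeasurableSpace Aux
  ν : Measure Aux
  isProbν : IsProbabilityMeasure ν
  prHat : Aux → Cov p d → ℝ
  Φ1Hat : Aux → Cov p d → ℝ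
  Φ0Hat : Aux → Cov p d → ℝ
  meas_prHat : Measurable (Function.uncurry prHat)
  meas_Φ1Hat : Measurable (Function.uncurry Φ1Hat)
  meas_Φ0Hat : Measurable (Function.uncurry Φ0Hat)
  /-- the vector `ξ` of the linear functional -/
  ξ : Fin p → ℝ
  /-- tuning parameters `λ`, `λ'` and the rate `R` -/
  lam : ℝ
  lam' : ℝ
  R : ℝ
  /-- second-stage estimators: `(β̂, γ̂)` is computed from the main and the auxiliary sample,
  `ŵ` from the covariates of the main sample -/
  βHat : (Fin n → Rec p d) × Aux → Fin p → ℝ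
  γHat : (Fin n → Rec p d) × Aux → Fin k → ℝ
  wHat : (Fin n → Cov p d) → Fin p → ℝ
  meas_βHat : Measurable βHat
  meas_γHat : Measurable γHat
  meas_wHat : Measurable wHat

namespace Experiment

attribute [instance] Experiment.isProbP Experiment.mAux Experiment.isProbν

variable {d n : ℕ} (E : Experiment.{u} d n)

/-- Sample space: `n` individuals and the auxiliary sample. -/
abbrev Smp : Type u := (Fin n → Rec E.p d) × E.Aux

/-- The `n` individuals are i.i.d. from `P` and independent of the auxiliary sample. -/
def μ : Measure E.Smp := (Measure.pi fun _ : Fin n => E.P).prod E.ν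

instance : IsProbabilityMeasure E.μ := by
  unfold μ; infer_instance

/-- The covariates of the main sample. -/
def covs (ω : E.Smp) : Fin n → Cov E.p d := fun i => cov (ω.1 i)

/-! ### Population quantities -/

/-- `X̄ = X - 𝔼[X | Z]`. -/
def Xbar (o : Rec E.p d) : Fin E.p → ℝ :=
  fun j => xx o j - (condExp (sigZ E.p d) E.P (fun o' => xx o' j)) o

/-- `Σ_X̄ = 𝔼[X̄ X̄ᵀ]`. -/
def SigBar : Matrix (Fin E.p) (Fin E.p) ℝ :=
  Matrix.of fun j l => ∫ o, E.Xbar o j * E.Xbar o l ∂E.P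

/-- `Σ_Π = 𝔼[Π Πᵀ]` with `Π = 𝔼[X | Z]`. -/
def SigPi : Matrix (Fin E.p) (Fin E.p) ℝ :=
  Matrix.of fun j l => ∫ o, (condExp (sigZ E.p d) E.P (fun o' => xx o' j)) o *
    (condExp (sigZ E.p d) E.P (fun o' => xx o' l)) o ∂E.P

/-- `ε₁ = ΔY₁ - Φ₁(W)`. -/
def eps1 (o : Rec E.p d) : ℝ := dY1 o - E.Φ1 (cov o)
/-- `ε₀ = ΔY₀ - Φ₀(W)`. -/
def eps0 (o : Rec E.p d) : ℝ := dY0 o - E.Φ0 (cov o)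

/-- `ε = D ε₁ / π - (1 - D) ε₀ / (1 - π)`; in the model this is `S - Xᵀβ₀ - f₀(Z)`. -/
def eps (o : Rec E.p d) : ℝ :=
  dd o / E.pr (cov o) * E.eps1 o - (1 - dd o) / (1 - E.pr (cov o)) * E.eps0 o

/-- `σ² = 𝔼[ε² | W]`. -/
def sig2 : Rec E.p d → ℝ := condExp (sigW E.p d) E.P (fun o => E.eps o ^ 2)

/-- `Ω_β = 𝔼[σ² X̄ X̄ᵀ]`. -/
def Omega : Matrix (Fin E.p) (Fin E.p) ℝ :=
  Matrix.of fun j l => ∫ o, E.sig2 o * (E.Xbar o j * E.Xbar o l) ∂E.P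

/-- `V_β = Σ_X̄⁻¹ Ω_β Σ_X̄⁻¹`. -/
def Vbeta : Matrix (Fin E.p) (Fin E.p) ℝ := E.SigBar⁻¹ * E.Omega * E.SigBar⁻¹

/-- The asymptotic variance `ξᵀ V_β ξ`. -/
def avar : ℝ := E.ξ ⬝ᵥ (E.Vbeta *ᵥ E.ξ)

/-- `S₀`, the support of `β₀`, and `s₀ = |S₀|`. -/
def S0 : Finset (Fin E.p) := Finset.univ.filter fun j => E.β0 j ≠ 0
def s0 : ℕ := E.S0.card

/-- `s_w`, the number of non-zero entries of `Σ_X̄⁻¹ ξ`. -/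
def sw : ℕ := (Finset.univ.filter fun j => (E.SigBar⁻¹ *ᵥ E.ξ) j ≠ 0).card

/-- The restricted eigenvalue `Λ²_X̄(s₀)`. -/
def LamBar2 : ℝ :=
  sInf {q | ∃ δ : Fin E.p → ℝ, δ ≠ 0 ∧
    ∑ j ∈ E.S0ᶜ, |δ j| ≤ 3 * √(E.s0 : ℝ) * √(∑ j ∈ E.S0, δ j ^ 2) ∧
    q = (δ ⬝ᵥ (E.SigBar *ᵥ δ)) / ∑ j ∈ E.S0, δ j ^ 2}

/-- `𝔼[ψ^k(Z) ψ^k(Z)ᵀ]`. -/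
def gramψ : Matrix (Fin E.k) (Fin E.k) ℝ :=
  Matrix.of fun a b => ∫ o, E.ψ (zz o) a * E.ψ (zz o) b ∂E.P

/-- `ψ^kᵀ γ` is the `L²(P)`-projection of `f` on the sieve space. -/
def IsSieveProj (f : EZ d → ℝ) (γ : Fin E.k → ℝ) : Prop :=
  ∀ a, ∫ o, E.ψ (zz o) a * (f (zz o) - E.ψ (zz o) ⬝ᵥ γ) ∂E.P = 0

/-- The sieve approximation error `r_n = f₀ - ψ^kᵀ γ₀`. -/
def rn (z : EZ d) : ℝ := E.f0 z - E.ψ z ⬝ᵥ E.γ0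

/-- The partially linear model `𝔼[Y¹(1) - Y⁰(1) | W, D = 1] = Xᵀβ + f(Z)`. -/
def IsModel (β : Fin E.p → ℝ) (f : EZ d → ℝ) : Prop :=
  condExp (sigW E.p d) (ProbabilityTheory.cond E.P treated) (fun o => y11 o - y01 o)
    =ᵐ[ProbabilityTheory.cond E.P treated] fun o => xx o ⬝ᵥ β + f (zz o)

/-! ### Sample quantities -/

/-- The design matrix of the sieve, with rows `ψ^k(Z_i)ᵀ`. -/
def Psi (w : Fin n → Cov E.p d) : Matrix (Fin n) (Fin E.k) ℝ :=
  Matrix.of fun i a => E.ψ (w i).2 a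

/-- `P_Z = Ψ (Ψᵀ Ψ)⁻¹ Ψᵀ`. -/
def PZ (w : Fin n → Cov E.p d) : Matrix (Fin n) (Fin n) ℝ :=
  E.Psi w * ((E.Psi w)ᵀ * E.Psi w)⁻¹ * (E.Psi w)ᵀ

/-- The partialled-out covariates `X̃ = X - P_Z X`. -/
def Xtil (w : Fin n → Cov E.p d) : Matrix (Fin n) (Fin E.p) ℝ :=
  (Matrix.of fun i j => (w i).1 j) - E.PZ w * Matrix.of fun i j => (w i).1 j

/-- `Σ̂_X̃ = n⁻¹ ∑ X̃_i X̃_iᵀ`. -/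
def SigTil (w : Fin n → Cov E.p d) : Matrix (Fin E.p) (Fin E.p) ℝ :=
  (n : ℝ)⁻¹ • ((E.Xtil w)ᵀ * E.Xtil w)

/-- `Ŝ_i`. -/
def SHat (ω : E.Smp) (i : Fin n) : ℝ :=
  score (E.prHat ω.2) (E.Φ1Hat ω.2) (E.Φ0Hat ω.2) (ω.1 i)

/-- The penalized least-squares criterion. -/
def crit (ω : E.Smp) (β : Fin E.p → ℝ) (γ : Fin E.k → ℝ) : ℝ :=
  (n : ℝ)⁻¹ * ∑ i, (xx (ω.1 i) ⬝ᵥ β + E.ψ (zz (ω.1 i)) ⬝ᵥ γ - E.SHat ω i) ^ 2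
    + E.lam * ∑ j, |β j|

/-- The constraint `‖ξ + Σ̂_X̃ v‖_∞ ≤ λ'`. -/
def Feasible (w : Fin n → Cov E.p d) (v : Fin E.p → ℝ) : Prop :=
  ∀ j, |E.ξ j + (E.SigTil w *ᵥ v) j| ≤ E.lam'

/-- The second-stage residual `Ŝ_i - X_iᵀ β̂ - f̂(Z_i)`. -/
def resid (ω : E.Smp) (i : Fin n) : ℝ :=
  E.SHat ω i - xx (ω.1 i) ⬝ᵥ E.βHat ω - E.ψ (zz (ω.1 i)) ⬝ᵥ E.γHat ω

/-- The de-biased estimator `T̂`. -/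
def THat (ω : E.Smp) : ℝ :=
  E.ξ ⬝ᵥ E.βHat ω - E.wHat (E.covs ω) ⬝ᵥ
    (fun j => (n : ℝ)⁻¹ * ∑ i, E.resid ω i * E.Xtil (E.covs ω) i j)

/-- `Ω̂_β = 𝔼_n[σ̂_i² X̃_i X̃_iᵀ]`, where `σ̂_i` is the second-stage residual. -/
def OmegaHat (ω : E.Smp) : Matrix (Fin E.p) (Fin E.p) ℝ :=
  Matrix.of fun j l => (n : ℝ)⁻¹ *
    ∑ i, E.resid ω i ^ 2 * (E.Xtil (E.covs ω) i j * E.Xtil (E.covs ω) i l)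

/-- `V̂_β = ŵᵀ Ω̂_β ŵ`. -/
def VHat (ω : E.Smp) : ℝ :=
  E.wHat (E.covs ω) ⬝ᵥ (E.OmegaHat ω *ᵥ E.wHat (E.covs ω))

/-- `√n (T̂ - ξᵀ β₀)`. -/
def stat (ω : E.Smp) : ℝ := √(n : ℝ) * (E.THat ω - E.ξ ⬝ᵥ E.β0)

/-- `√(log p / n)`. -/
def rate : ℝ := √(Real.log E.p / n)

/-- `(β̂, f̂)` with `f̂ = ψ^kᵀ γ̂` minimizes the criterion over `ℬ` and the sieve space, and `ŵ`
has minimal `ℓ¹` norm under its constraint whenever the constraint can be met. -/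
structure IsEstimated : Prop where
  lasso : ∀ᵐ ω ∂E.μ, E.βHat ω ∈ E.ℬ ∧
    ∀ β ∈ E.ℬ, ∀ γ, E.crit ω (E.βHat ω) (E.γHat ω) ≤ E.crit ω β γ
  dantzig : ∀ w, (∃ v, E.Feasible w v) → E.Feasible w (E.wHat w) ∧
    ∀ v, E.Feasible w v → ∑ j, |E.wHat w j| ≤ ∑ j, |v j|

end Experiment

/-- The constants that do not depend on the sample size. -/
structure Consts where
  /-- overlap -/
  cπ : ℝ
  /-- moments of the errors -/
  rε : ℝ
  Cε : ℝ
  /-- sub-Gaussian norm of `X` -/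
  KX : ℝ
  /-- restricted eigenvalue, and eigenvalues of `Σ_X̄`, `Σ_Π`, `Ω_β` -/
  Cx : ℝ
  cSig : ℝ
  cPi : ℝ
  cOm : ℝ
  COm : ℝ
  /-- bounds on the density of `Z` -/
  bZ : ℝ
  BZ : ℝ
  /-- sieve: least eigenvalue, growth, projection error -/
  cψ : ℝ
  Cψ : ℝ
  Cproj : ℝ
  /-- bounds on the Euclidean norm of `ξ` -/
  cξ : ℝ
  Cξ : ℝ
  /-- smoothness and radius of the Hölder class -/
  α : ℝ
  M : ℝ

structure Consts.Valid (κ : Consts) (d : ℕ) : Prop where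
  cπ : 0 < κ.cπ
  rε : 4 < κ.rε
  Cε : 0 < κ.Cε
  KX : 0 < κ.KX
  Cx : 0 < κ.Cx
  cSig : 0 < κ.cSig
  cPi : 0 < κ.cPi
  cOm : 0 < κ.cOm
  COm : 0 < κ.COm
  bZ : 0 < κ.bZ
  BZ : 0 < κ.BZ
  cψ : 0 < κ.cψ
  Cψ : 0 < κ.Cψ
  Cproj : 0 < κ.Cproj
  cξ : 0 < κ.cξ
  Cξ : 0 < κ.Cξ
  α_pos : 0 < κ.α
  α_ge : (d : ℝ) / 2 ≤ κ.α

namespace Experiment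

variable {d n : ℕ}

/-- The assumptions that concern one sample size. -/
structure Regular (κ : Consts) (𝒵 : Set (EZ d)) (E : Experiment.{u} d n) : Prop where
  p_gt : n < E.p
  k_pos : 0 < E.k
  -- potential outcomes; treatment has no effect before it takes place
  int_y11 : Integrable y11 E.P
  int_y10 : Integrable y10 E.P
  int_y01 : Integrable y01 E.P
  int_y00 : Integrable y00 E.P
  no_anticipation : ∀ᵐ o ∂E.P, o ∈ treated → y10 o = y00 o
  -- the nuisance functions
  pr_eq : condExp (sigW E.p d) E.P dd =ᵐ[E.P] fun o => E.pr (cov o)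
  Φ1_eq : condExp (sigW E.p d) (ProbabilityTheory.cond E.P treated) dY1
    =ᵐ[E.P] fun o => E.Φ1 (cov o)
  Φ0_eq : condExp (sigW E.p d) (ProbabilityTheory.cond E.P untreated) dY0
    =ᵐ[E.P] fun o => E.Φ0 (cov o)
  -- conditional parallel trends
  parallel : condExp (sigW E.p d) (ProbabilityTheory.cond E.P treated) dY0
    =ᵐ[E.P] condExp (sigW E.p d) (ProbabilityTheory.cond E.P untreated) dY0
  -- overlap
  overlap : ∀ᵐ o ∂E.P, κ.cπ < E.pr (cov o) ∧ E.pr (cov o) < 1 - κ.cπ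
  -- support
  compact_W : IsCompact E.𝒲
  interior_W : (interior E.𝒲).Nonempty
  W_sub : ∀ w ∈ E.𝒲, w.2 ∈ 𝒵
  W_mem : ∀ᵐ o ∂E.P, cov o ∈ E.𝒲
  -- partially linear model and identification
  F_sub : E.ℱ ⊆ HolderBall 𝒵 κ.α κ.M
  β0_mem : E.β0 ∈ E.ℬ
  f0_mem : E.f0 ∈ E.ℱ
  model : E.IsModel E.β0 E.f0
  model_unique : ∀ β ∈ E.ℬ, ∀ f ∈ E.ℱ, E.IsModel β f → β = E.β0 ∧ Set.EqOn f E.f0 𝒵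
  f0_not_linear : ¬ ∃ b : Fin E.p → ℝ,
    condExp (sigX E.p d) E.P (fun o => E.f0 (zz o)) =ᵐ[E.P] fun o => xx o ⬝ᵥ b
  -- errors
  eps1_mean : condExp (sigW E.p d) E.P E.eps1 =ᵐ[E.P] 0
  eps0_mean : condExp (sigW E.p d) E.P E.eps0 =ᵐ[E.P] 0
  int_eps1 : Integrable E.eps1 E.P
  int_eps0 : Integrable E.eps0 E.P
  int_eps : Integrable (fun o => |E.eps o| ^ κ.rε) E.P
  eps_moment : ∀ᵐ o ∂E.P, (condExp (sigW E.p d) E.P (fun o' => |E.eps o'| ^ κ.rε)) o ≤ κ.Cε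
  -- covariates
  subGaussian : ∀ v : Fin E.p → ℝ, v ⬝ᵥ v = 1 → ∀ q : ℝ, 1 ≤ q →
    eLpNorm (fun o => v ⬝ᵥ xx o) (ENNReal.ofReal q) E.P ≤ ENNReal.ofReal (κ.KX * √q)
  restricted_eig : 0 < E.s0 → κ.Cx < E.LamBar2
  SigBar_ge : EigGE E.SigBar κ.cSig
  SigBar_le : EigLE E.SigBar (1 / κ.cSig)
  SigPi_le : EigLE E.SigPi (1 / κ.cPi)
  -- sieve approximation
  γ0_proj : E.IsSieveProj E.f0 E.γ0
  ck_nonneg : 0 ≤ E.ck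
  approx_L2 : ∀ f ∈ E.ℱ, ∀ γ, E.IsSieveProj f γ →
    √(∫ o, (f (zz o) - E.ψ (zz o) ⬝ᵥ γ) ^ 2 ∂E.P) ≤ E.ck
  approx_sup : ∀ f ∈ E.ℱ, ∀ γ, E.IsSieveProj f γ →
    ∀ z ∈ 𝒵, |f z - E.ψ z ⬝ᵥ γ| ≤ E.lk * E.ck
  density : ∃ g : EZ d → ℝ, Measurable g ∧ (∀ z ∈ 𝒵, κ.bZ ≤ g z ∧ g z ≤ κ.BZ) ∧
    E.P.map zz = (volume.restrict 𝒵).withDensity (fun z => ENNReal.ofReal (g z))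
  gram_ge : EigGE E.gramψ κ.cψ
  ξ0_nonneg : 0 ≤ E.ξ0
  ψ_sup : ∀ z ∈ 𝒵, √(∑ a, E.ψ z a ^ 2) ≤ E.ξ0
  ξ0_growth : E.k * E.ξ0 ^ 2 * Real.log E.p / n ≤ κ.Cψ
  proj_error : ∀ (i : Fin n) (j l : Fin E.p),
    |∫ ω, (E.Xtil (E.covs ω) i j * E.Xtil (E.covs ω) i l -
      E.Xbar (ω.1 i) j * E.Xbar (ω.1 i) l) ∂E.μ| ≤ κ.Cproj * E.rate
  -- eigenvalues of `Ω_β`, and the vector `ξ`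
  Omega_ge : EigGE E.Omega κ.cOm
  Omega_le : EigLE E.Omega κ.COm
  ξ_ge : κ.cξ ≤ √(∑ j, E.ξ j ^ 2)
  ξ_le : √(∑ j, E.ξ j ^ 2) ≤ κ.Cξ
  -- the rate `R`
  R_eq : E.R ^ 2 = min (E.lk ^ 2 * E.ck ^ 2 * E.k / n) (E.ξ0 ^ 2 * E.ck ^ 2 / n) + E.k / n

end Experiment

/-- `max_i |Y_n(i)| = o_p(1)` (supremum over the index set `ι n`) along a sequence of
probability spaces. -/
def SupOp {Ω : ℕ → Type*} [∀ n, MeasurableSpace (Ω n)] (μ : ∀ n, Measure (Ω n))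
    {ι : ℕ → Type*} (Y : ∀ n, Ω n → ι n → ℝ) : Prop :=
  ∀ δ : ℝ, 0 < δ → Tendsto (fun n => μ n {ω | ∃ i, δ < |Y n ω i|}) atTop (𝓝 0)

/-- `Y_n = o_p(1)` along a sequence of probability spaces. -/
def Op {Ω : ℕ → Type*} [∀ n, MeasurableSpace (Ω n)] (μ : ∀ n, Measure (Ω n))
    (Y : ∀ n, Ω n → ℝ) : Prop :=
  ∀ δ : ℝ, 0 < δ → Tendsto (fun n => μ n {ω | δ < |Y n ω|}) atTop (𝓝 0)

section Asymptotics

variable {d : ℕ} (E : ∀ n, Experiment.{u} d n)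

/-- Errors of the first-stage estimators at the covariate value `w`:
`1/π̂ - 1/π`, `Φ̂₁ - Φ₁` and `Φ̂₀ - Φ₀`. -/
def errPr {n : ℕ} (F : Experiment.{u} d n) (ω : F.Smp) (w : Cov F.p d) : ℝ :=
  1 / F.prHat ω.2 w - 1 / F.pr w
def errΦ1 {n : ℕ} (F : Experiment.{u} d n) (ω : F.Smp) (w : Cov F.p d) : ℝ :=
  F.Φ1Hat ω.2 w - F.Φ1 w
def errΦ0 {n : ℕ} (F : Experiment.{u} d n) (ω : F.Smp) (w : Cov F.p d) : ℝ :=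
  F.Φ0Hat ω.2 w - F.Φ0 w

/-- `𝔼_n g(W_i)²`. -/
def empSq {n : ℕ} (F : Experiment.{u} d n) (ω : F.Smp) (g : Cov F.p d → ℝ) : ℝ :=
  (n : ℝ)⁻¹ * ∑ i, g (F.covs ω i) ^ 2

/-- Rates of the first-stage estimators. The rates are of the form `o_p(a⁻¹ ∨ b⁻¹)`, written as
`(a ∧ b) · (·) = o_p(1)`. -/
structure FirstStage : Prop where
  pr_sq : Op (fun n => (E n).μ) fun n ω =>
    min ((E n).k * Real.log (E n).k) ((E n).sw * Real.log (E n).p) *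
      empSq (E n) ω (errPr (E n) ω)
  pr_sup : SupOp (fun n => (E n).μ) fun n ω (w : (E n).𝒲) => errPr (E n) ω w
  Φ1_sq : Op (fun n => (E n).μ) fun n ω =>
    min ((E n).k * Real.log (E n).k) ((E n).sw * Real.log (E n).p) *
      empSq (E n) ω (errΦ1 (E n) ω)
  Φ1_sup : SupOp (fun n => (E n).μ) fun n ω (w : (E n).𝒲) => errΦ1 (E n) ω w
  Φ0_sq : Op (fun n => (E n).μ) fun n ω =>
    min ((E n).k * Real.log (E n).k) ((E n).sw * Real.log (E n).p) *
      empSq (E n) ω (errΦ0 (E n) ω)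
  Φ0_sup : SupOp (fun n => (E n).μ) fun n ω (w : (E n).𝒲) => errΦ0 (E n) ω w
  prod1 : Op (fun n => (E n).μ) fun n ω =>
    min (((E n).sw : ℝ) ^ 2 * n) ((E n).k * n) *
      empSq (E n) ω (fun w => errPr (E n) ω w * errΦ1 (E n) ω w)
  prod0 : Op (fun n => (E n).μ) fun n ω =>
    min (((E n).sw : ℝ) ^ 2 * n) ((E n).k * n) *
      empSq (E n) ω (fun w => errPr (E n) ω w * errΦ0 (E n) ω w)

/-- Growth conditions. -/
structure Growth : Prop where
  sieve : Tendsto (fun n : ℕ => (E n).ξ0 ^ 2 * Real.log (E n).k / n) atTop (𝓝 0)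
  sparse_w : Tendsto (fun n : ℕ => max (((E n).sw : ℝ) ^ 2 * √(Real.log (E n).p))
    ((E n).sw * Real.log (E n).p) / √(n : ℝ)) atTop (𝓝 0)
  sparse_β : Tendsto (fun n : ℕ => (E n).s0 * Real.log (E n).p / √(n : ℝ)) atTop (𝓝 0)
  remainder : SupOp (fun n => (E n).μ) fun n ω (ij : Fin n × Fin (E n).p) =>
    √(n : ℝ) * (E n).sw *
      ((E n).Xtil ((E n).covs ω) ij.1 ij.2 * (E n).rn (zz (ω.1 ij.1)))
  proj_noise : SupOp (fun n => (E n).μ) fun n ω (j : Fin (E n).p) =>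
    √(n : ℝ) * (E n).sw * ((n : ℝ)⁻¹ * ∑ i, (E n).eps (ω.1 i) *
      ((E n).Xtil ((E n).covs ω) i j - (E n).Xbar (ω.1 i) j))

/-- Choice of the tuning parameters: `λ` and `λ'` are of the exact order `√(log p / n)`, with
lower constant `C₀` and upper constant `C₁`, and `2 λ² s₀ / Λ² ≲ R² ≲ λ`. -/
structure Tuning (C₀ C₁ : ℝ) : Prop where
  lam_ge : ∀ᶠ n in atTop, C₀ * (E n).rate ≤ (E n).lam
  lam_le : ∀ᶠ n in atTop, (E n).lam ≤ C₁ * (E n).rate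
  lam'_ge : ∀ᶠ n in atTop, C₀ * (E n).rate ≤ (E n).lam'
  lam'_le : ∀ᶠ n in atTop, (E n).lam' ≤ C₁ * (E n).rate
  R_ge : ∃ C : ℝ, ∀ᶠ n in atTop,
    2 * (E n).lam ^ 2 * (E n).s0 / (E n).LamBar2 ≤ C * (E n).R ^ 2
  R_le : ∃ C : ℝ, ∀ᶠ n in atTop, (E n).R ^ 2 ≤ C * (E n).lam

/-- The additional rate condition for consistency of the variance estimator. -/
def VarianceRate : Prop :=
  Tendsto (fun n : ℕ => Real.log (n * (E n).p) *
    ((E n).s0 * Real.log (E n).p / n + √((E n).ξ0 ^ 2 * (E n).k / n) +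
      (E n).lk * (E n).ck)) atTop (𝓝 0)

end Asymptotics

end DiD

end

noncomputable section

namespace DiD

open Real (exp log exp_log exp_neg exp_pos add_one_le_exp exp_sum exp_add exp_nat_mul toNNReal
  sqrt_mul norm_eq_abs sq_sqrt abs_le_sqrt sqrt_nonneg sqrt_sq rpow_nonneg rpow_one rpow_add
  norm_of_nonneg sqrt_le_left)
open Finset (univ sum_const card_univ mul_sum sum_comm sum_sub_distrib sum_div sum_mul_sum
  sum_congr sum_eq_single sum_le_sum sum_add_distrib sum_nonneg single_le_sum mem_univ sum_mul
  abs_sum_le_sum_abs measurable_sum sum_eq_zero)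
open ENNReal (ofReal ofReal_prod_of_nonneg ofReal_le_ofReal ofReal_ne_top ofReal_mul
  ofReal_inv_of_pos ofReal_pow div_le_div_right ofReal_lt_top ofReal_one ofReal_add
  ofReal_natCast)
open Matrix (transpose_mul nonsing_inv_mul mul_nonsing_inv det_transpose dotProduct_mulVec
  mulVec_transpose mulVec_mulVec mulVec_sub mulVec_add transpose_apply smul_mulVec of mulVec
  of_apply mulVec_neg one_mulVec)

local notation:72 a:72 "⬝" b:73 => dotProduct a b

/-- The squared Euclidean norm. -/
local notation "nsq" v:max => v ⬝ v

set_option linter.unusedSectionVars false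

lemma exp_sub_sq_le (y : ℝ) : exp (y - y ^ 2) ≤ 1 + y + y ^ 2 := by
  rcases le_or_gt 0 y with h0 | h0
  · have hpos : 0 < 1 + y := by linarith
    have h1 : y - y ^ 2 ≤ log (1 + y) := by
      have h2 := Real.one_sub_inv_le_log_of_pos hpos
      have : y - y ^ 2 ≤ 1 - (1 + y)⁻¹ := by
        have e : 1 - (1 + y)⁻¹ = y / (1 + y) := by field_simp; ring
        rw [e, le_div_iff₀ hpos]
        nlinarith [pow_nonneg h0 3]
      linarith
    calc exp (y - y ^ 2) ≤ exp (log (1 + y)) := Real.exp_le_exp.2 h1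
      _ = 1 + y := exp_log (by linarith)
      _ ≤ _ := by nlinarith [sq_nonneg y]
  rcases le_or_gt (-(1 / 2)) y with h | h
  · have hx : 0 ≤ y ^ 2 - y := by nlinarith
    have h2 := Real.quadratic_le_exp_of_nonneg hx
    have h3 : exp (y - y ^ 2) ≤ 1 - (y ^ 2 - y) + (y ^ 2 - y) ^ 2 / 2 := by
      rw [show y - y ^ 2 = -(y ^ 2 - y) by ring, exp_neg, inv_le_iff_one_le_mul₀ (exp_pos _)]
      have h4 : (0 : ℝ) ≤ 1 - (y ^ 2 - y) + (y ^ 2 - y) ^ 2 / 2 := by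
        nlinarith [sq_nonneg (y ^ 2 - y - 1)]
      nlinarith
    nlinarith [sq_nonneg y, mul_nonneg (sq_nonneg y) (show 0 ≤ 4 - (1 - y) ^ 2 by nlinarith)]
  · have h1 : exp (y - y ^ 2) ≤ exp (-(3 / 4)) := Real.exp_le_exp.2 (by nlinarith)
    have h2 : exp (-(3 / 4) : ℝ) ≤ 3 / 4 := by
      have := add_one_le_exp (3 / 4 : ℝ)
      rw [exp_neg, inv_le_comm₀ (exp_pos _) (by norm_num)]
      linarith
    nlinarith [sq_nonneg (y + 1 / 2)]

section Pi

variable {O : Type*} [MeasurableSpace O] (P : Measure O) [IsProbabilityMeasure P] (n : ℕ)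

/-- The law of `n` independent draws from `P`. -/
abbrev iid : Measure (Fin n → O) := Measure.pi fun _ : Fin n => P

lemma lintegral_iid_prod_dep {f : Fin n → O → ℝ≥0∞} (hf : ∀ i, Measurable (f i)) :
    ∫⁻ r, ∏ i, f i (r i) ∂(iid P n) = ∏ i, ∫⁻ o, f i o ∂P := by
  rw [lintegral_prod_eq_prod_lintegral_of_indepFun (μ := iid P n) univ
    (fun (i : Fin n) r => f i (r i)) (iIndepFun_pi (X := f) fun i => (hf i).aemeasurable)
    (fun i => (hf i).comp (measurable_pi_apply i))]
  exact Finset.prod_congr rfl fun i _ =>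
    (measurePreserving_eval (fun _ : Fin n => P) i).lintegral_comp (hf i)

lemma lintegral_iid_prod {f : O → ℝ≥0∞} (hf : Measurable f) :
    ∫⁻ r, ∏ i, f (r i) ∂(iid P n) = (∫⁻ o, f o ∂P) ^ n := by
  rw [lintegral_iid_prod_dep P n fun _ => hf]
  simp

variable {P n}

lemma integral_iid_eval {f : O → ℝ} (i : Fin n) (hf : AEStronglyMeasurable f P) :
    ∫ r, f (r i) ∂(iid P n) = ∫ o, f o ∂P :=
  integral_comp_eval (μ := fun _ : Fin n => P) hf

lemma integrable_iid_eval {f : O → ℝ} (i : Fin n) (hf : Integrable f P) :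
    Integrable (fun r => f (r i)) (iid P n) :=
  integrable_comp_eval (μ := fun _ : Fin n => P) hf

lemma ae_iid_of_ae {p : O → Prop} (h : ∀ᵐ o ∂P, p o) : ∀ᵐ r ∂(iid P n), ∀ i, p (r i) :=
  ae_all_iff.2 fun i => (Measure.quasiMeasurePreserving_eval (fun _ : Fin n => P) i).ae h

lemma iid_le_of_ae {p : O → Prop} {A B : Set (Fin n → O)} (h : ∀ᵐ o ∂P, p o)
    (hAB : ∀ r, (∀ i, p (r i)) → r ∈ A → r ∈ B) : iid P n A ≤ iid P n B := by
  apply measure_mono_ae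
  filter_upwards [ae_iid_of_ae (n := n) h] with r hr using hAB r hr

lemma iid_exists_le {p : O → Prop} : iid P n {r | ∃ i, p (r i)} ≤ n * P {o | p o} := by
  have : {r : Fin n → O | ∃ i, p (r i)} = ⋃ i : Fin n, {r | p (r i)} := by ext; simp
  rw [this]
  refine (measure_iUnion_le _).trans ?_
  rw [tsum_fintype]
  refine (Finset.sum_le_card_nsmul _ _ (P {o | p o}) fun i _ => ?_).trans (by simp)
  have hm := measurePreserving_eval (fun _ : Fin n => P) i
  calc iid P n {r | p (r i)} ≤ iid P n ((Function.eval i) ⁻¹' (toMeasurable P {o | p o})) :=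
        measure_mono fun r hr => subset_toMeasurable P _ hr
    _ = P (toMeasurable P {o | p o}) := hm.measure_preimage
        (measurableSet_toMeasurable _ _).nullMeasurableSet
    _ = _ := measure_toMeasurable _

/-- Chernoff's bound for sums of independent copies. -/
lemma iid_sum_ge_le {Y : O → ℝ} (hY : Measurable Y) {a x : ℝ}
    (ha : ∫⁻ o, ofReal (exp (Y o)) ∂P ≤ ofReal (exp a)) :
    iid P n {r | x ≤ ∑ i, Y (r i)} ≤ ofReal (exp (n * a - x)) := by
  have hm : Measurable fun o => ofReal (exp (Y o)) := by fun_prop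
  have h1 := lintegral_iid_prod P n hm
  have h2 : ∀ r : Fin n → O, ∏ i, ofReal (exp (Y (r i))) =
      ofReal (exp (∑ i, Y (r i))) := fun r => by
    rw [exp_sum, ofReal_prod_of_nonneg fun i _ => (exp_pos _).le]
  simp_rw [h2] at h1
  have h3 : iid P n {r | x ≤ ∑ i, Y (r i)} ≤
      iid P n {r | ofReal (exp x) ≤ ofReal (exp (∑ i, Y (r i)))} :=
    measure_mono fun r hr => ofReal_le_ofReal (Real.exp_le_exp.2 hr)
  refine h3.trans ((meas_ge_le_lintegral_div
    (Measurable.aemeasurable (by fun_prop)) ?_ ofReal_ne_top).trans ?_)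
  · simp [exp_pos]
  rw [h1, sub_eq_add_neg, exp_add, ofReal_mul (exp_pos _).le, exp_neg,
    ofReal_inv_of_pos (exp_pos _), ← div_eq_mul_inv]
  gcongr
  calc (∫⁻ o, ofReal (exp (Y o)) ∂P) ^ n ≤ (ofReal (exp a)) ^ n := by
        gcongr
    _ = _ := by rw [← ofReal_pow (exp_pos _).le, ← exp_nat_mul]

lemma memLp_iid_eval {f : O → ℝ} (hf : MemLp f 2 P) (i : Fin n) :
    MemLp (fun r : Fin n → O => f (r i)) 2 (iid P n) :=
  hf.comp_measurePreserving (measurePreserving_eval (fun _ : Fin n => P) i)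

lemma iid_avg {Y : O → ℝ} (hY : MemLp Y 2 P) (hn : 0 < n) :
    MemLp (fun r : Fin n → O => (n : ℝ)⁻¹ * ∑ i, Y (r i)) 2 (iid P n) ∧
      ∫ r, (n : ℝ)⁻¹ * ∑ i, Y (r i) ∂(iid P n) = ∫ o, Y o ∂P ∧
      Var[fun r : Fin n → O => (n : ℝ)⁻¹ * ∑ i, Y (r i); iid P n] ≤ (n : ℝ)⁻¹ * ∫ o, Y o ^ 2 ∂P := by
  refine ⟨(memLp_finsetSum _ fun i _ => memLp_iid_eval hY i).const_mul _, ?_, ?_⟩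
  · rw [integral_const_mul, integral_finsetSum _ fun i _ =>
      integrable_iid_eval i (hY.integrable (by norm_num))]
    simp [integral_iid_eval _ hY.1, hn.ne']
  · have e : (fun r : Fin n → O => ∑ i, Y (r i)) = ∑ i, fun r : Fin n → O => Y (r i) := by ext; simp
    rw [variance_const_mul, e, variance_sum_pi (μ := fun _ : Fin n => P) (X := fun _ => Y) fun _ => hY]
    simp only [sum_const, card_univ, Fintype.card_fin, nsmul_eq_mul]
    rw [show (n : ℝ)⁻¹ ^ 2 * (n * Var[Y; P]) = (n : ℝ)⁻¹ * Var[Y; P] by field_simp]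
    gcongr
    exact variance_le_expectation_sq hY.1

lemma iid_abs_avg_sub_gt_le {Y : O → ℝ} (hY : MemLp Y 2 P) {V δ : ℝ} (hδ : 0 < δ)
    (hV : ∫ o, Y o ^ 2 ∂P ≤ V) (hn : 0 < n) :
    iid P n {r | δ ≤ |(n : ℝ)⁻¹ * ∑ i, Y (r i) - ∫ o, Y o ∂P|} ≤ ofReal (V / (n * δ ^ 2)) := by
  obtain ⟨m, e, v⟩ := iid_avg hY hn
  have := meas_ge_le_variance_div_sq m hδ
  rw [e] at this
  refine this.trans (ofReal_le_ofReal ?_)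
  rw [← div_div, div_eq_inv_mul V]
  gcongr
  exact v.trans (by gcongr)

end Pi

section Mixing

lemma lintegral_gaussianReal_exp {Λ : ℝ} (hΛ : 0 < Λ) (s : ℝ) :
    ∫⁻ p, ofReal (exp (p * s - Λ * p ^ 2)) ∂(gaussianReal 0 (toNNReal (1 / (2 * Λ)))) =
      ofReal ((√2)⁻¹ * exp (s ^ 2 / (8 * Λ))) := by
  set v : ℝ≥0 := toNNReal (1 / (2 * Λ)) with hv
  set v' : ℝ≥0 := toNNReal (1 / (4 * Λ)) with hv'
  have hvr : (v : ℝ) = 1 / (2 * Λ) := Real.coe_toNNReal _ (by positivity)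
  have hvr' : (v' : ℝ) = 1 / (4 * Λ) := Real.coe_toNNReal _ (by positivity)
  have hv0 : v ≠ 0 := by positivity
  have hv0' : v' ≠ 0 := by positivity
  rw [gaussianReal_of_var_ne_zero _ hv0,
    lintegral_withDensity_eq_lintegral_mul _ (measurable_gaussianPDF _ _) (by fun_prop)]
  have key : ∀ p : ℝ, (gaussianPDF 0 v * fun p => ofReal (exp (p * s - Λ * p ^ 2))) p =
      ofReal ((√2)⁻¹ * exp (s ^ 2 / (8 * Λ))) * gaussianPDF (s / (4 * Λ)) v' p := by
    intro p
    rw [Pi.mul_apply, gaussianPDF_def, gaussianPDF_def, ← ofReal_mul (gaussianPDFReal_nonneg _ _ _),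
      ← ofReal_mul (by positivity)]
    congr 1
    rw [gaussianPDFReal_def, gaussianPDFReal_def]
    simp only [hvr, hvr']
    have e1 : √(2 * Real.pi * (1 / (2 * Λ))) = √2 * √(2 * Real.pi * (1 / (4 * Λ))) := by
      rw [← sqrt_mul (by norm_num)]; congr 1; field_simp; norm_num
    rw [e1, mul_inv]
    have e2 : exp (-(p - 0) ^ 2 / (2 * (1 / (2 * Λ)))) * exp (p * s - Λ * p ^ 2) =
        exp (s ^ 2 / (8 * Λ)) * exp (-(p - s / (4 * Λ)) ^ 2 / (2 * (1 / (4 * Λ)))) := by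
      rw [← exp_add, ← exp_add]; congr 1; field_simp; ring
    grind
  simp_rw [key]
  rw [lintegral_const_mul _ (measurable_gaussianPDF _ _), lintegral_gaussianPDF_eq_one _ hv0', mul_one]

variable {O : Type*} [MeasurableSpace O] {P : Measure O} {n k : ℕ}

lemma measurable_dotProduct {α : Type*} [MeasurableSpace α] {f g : α → Fin k → ℝ}
    (hf : Measurable f) (hg : Measurable g) : Measurable fun a => f a ⬝ g a := by
  unfold dotProduct; fun_prop

lemma memLp_dotProduct {u : O → Fin k → ℝ} (h2 : ∀ a, MemLp (fun o => u o a) 2 P)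
    (p : Fin k → ℝ) : MemLp (fun o => p ⬝ u o) 2 P := by
  unfold dotProduct
  exact memLp_finsetSum _ fun a _ => (h2 a).const_mul _

variable [IsProbabilityMeasure P]

lemma integral_dotProduct {u : O → Fin k → ℝ} (h2 : ∀ a, MemLp (fun o => u o a) 2 P)
    (p : Fin k → ℝ) : ∫ o, p ⬝ u o ∂P = p ⬝ fun a => ∫ o, u o a ∂P := by
  unfold dotProduct
  rw [integral_finsetSum _ fun a _ => ((h2 a).const_mul _).integrable (by norm_num)]
  simp [integral_const_mul]

lemma lintegral_exp_sub_sq_le {y : O → ℝ} (hy : MemLp y 2 P) (h0 : ∫ o, y o ∂P = 0) :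
    ∫⁻ o, ofReal (exp (y o - y o ^ 2)) ∂P ≤ ofReal (exp (∫ o, y o ^ 2 ∂P)) := by
  have h1 : Integrable (fun o => 1 + y o) P := (integrable_const 1).add (hy.integrable (by norm_num))
  refine (lintegral_mono fun o => ofReal_le_ofReal (exp_sub_sq_le _)).trans ?_
  have h2 : Integrable (fun o => 1 + y o + y o ^ 2) P := h1.add hy.integrable_sq
  rw [← ofReal_integral_eq_lintegral_ofReal h2 (.of_forall fun o =>
    (exp_pos _).le.trans (exp_sub_sq_le _))]
  refine ofReal_le_ofReal (le_trans (le_of_eq ?_) (add_one_le_exp _))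
  rw [integral_add h1 hy.integrable_sq, integral_add (integrable_const 1)
    (hy.integrable (by norm_num)), h0]
  simp [add_comm]

lemma iid_sq_norm_sum_ge_le {u : O → Fin k → ℝ} (hu : Measurable u)
    (h2 : ∀ a, MemLp (fun o => u o a) 2 P) (h0 : ∀ a, ∫ o, u o a ∂P = 0) {Λ : ℝ} (hΛ : 0 < Λ)
    (x : ℝ) :
    iid P n {r | (∀ p : Fin k → ℝ, ∑ i, (p ⬝ u (r i)) ^ 2 + n * ∫ o, (p ⬝ u o) ^ 2 ∂P
        ≤ Λ * nsq p) ∧ 8 * Λ * x ≤ ∑ a, (∑ i, u (r i) a) ^ 2} ≤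
      ofReal (√2 ^ k * exp (-x)) := by
  set γ : Measure (Fin k → ℝ) := iid (gaussianReal 0 (toNNReal (1 / (2 * Λ)))) k with hγ
  set q : (Fin k → ℝ) → ℝ := fun p => ∫ o, (p ⬝ u o) ^ 2 ∂P with hq
  have hqm : Measurable q := by
    have : StronglyMeasurable (Function.uncurry fun (p : Fin k → ℝ) o => (p ⬝ u o) ^ 2) := by
      apply Measurable.stronglyMeasurable
      fun_prop
    exact this.integral_prod_right.measurable
  set F : (Fin n → O) → (Fin k → ℝ) → ℝ≥0∞ := fun r p =>
    ofReal (exp (∑ i, (p ⬝ u (r i) - (p ⬝ u (r i)) ^ 2) - n * q p)) with hF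
  have hFm : Measurable (Function.uncurry F) := by fun_prop
  have hin : ∫⁻ r, ∫⁻ p, F r p ∂γ ∂(iid P n) ≤ 1 := by
    rw [lintegral_lintegral_swap hFm.aemeasurable]
    calc ∫⁻ p, ∫⁻ r, F r p ∂(iid P n) ∂γ ≤ ∫⁻ _, 1 ∂γ := by
          refine lintegral_mono fun p => ?_
          have hy := memLp_dotProduct h2 p
          have e : ∀ r, F r p = ofReal (exp (-(n * q p))) *
              ∏ i, ofReal (exp (p ⬝ u (r i) - (p ⬝ u (r i)) ^ 2)) := by
            intro r
            rw [← ofReal_prod_of_nonneg fun i _ => (exp_pos _).le, ← exp_sum,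
              ← ofReal_mul (exp_pos _).le, ← exp_add]
            simp only [hF]; congr 2; ring
          simp_rw [e]
          have hm : Measurable fun o => ofReal (exp (p ⬝ u o - (p ⬝ u o) ^ 2)) := by fun_prop
          have hm' : Measurable fun r : Fin n → O =>
              ∏ i, ofReal (exp (p ⬝ u (r i) - (p ⬝ u (r i)) ^ 2)) :=
            Finset.measurable_fun_prod _ fun i _ => hm.comp (measurable_pi_apply i)
          rw [lintegral_const_mul _ hm', lintegral_iid_prod P n hm]
          have hle := lintegral_exp_sub_sq_le hy ((integral_dotProduct h2 p).trans (by simp [h0]))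
          calc _ ≤ ofReal (exp (-(n * q p))) * (ofReal (exp (q p))) ^ n := by
                gcongr
            _ = 1 := by
                rw [← ofReal_pow (exp_pos _).le, ← exp_nat_mul,
                  ← ofReal_mul (exp_pos _).le, ← exp_add]
                simp
      _ = 1 := by simp
  have hlow : ∀ r, (∀ p : Fin k → ℝ, ∑ i, (p ⬝ u (r i)) ^ 2 + n * q p ≤ Λ * nsq p) →
      8 * Λ * x ≤ ∑ a, (∑ i, u (r i) a) ^ 2 →
      ofReal ((√2)⁻¹ ^ k * exp x) ≤ ∫⁻ p, F r p ∂γ := by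
    intro r hV hx
    set s : Fin k → ℝ := fun a => ∑ i, u (r i) a with hs
    have h1 : ∀ p : Fin k → ℝ, ∏ a, ofReal (exp (p a * s a - Λ * p a ^ 2)) ≤ F r p := by
      intro p
      rw [← ofReal_prod_of_nonneg fun i _ => (exp_pos _).le, ← exp_sum]
      apply ofReal_le_ofReal
      apply Real.exp_le_exp.2
      have h3 : ∑ i, p ⬝ u (r i) = ∑ a, p a * s a := by
        simp only [dotProduct, hs, mul_sum]
        exact sum_comm
      have h4 := hV p
      have h5 : nsq p = ∑ a, p a ^ 2 := by simp [dotProduct, sq]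
      rw [sum_sub_distrib, sum_sub_distrib, ← mul_sum, h3, ← h5]
      linarith
    calc _ ≤ ∏ a, ofReal ((√2)⁻¹ * exp (s a ^ 2 / (8 * Λ))) := by
          rw [← ofReal_prod_of_nonneg fun i _ => by positivity, Finset.prod_mul_distrib,
            ← exp_sum, ← sum_div]
          simp only [Finset.prod_const, card_univ, Fintype.card_fin]
          apply ofReal_le_ofReal
          gcongr
          rw [le_div_iff₀ (by positivity)]
          linarith
      _ = ∏ a, ∫⁻ p, ofReal (exp (p * s a - Λ * p ^ 2))
            ∂(gaussianReal 0 (toNNReal (1 / (2 * Λ)))) := by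
          simp_rw [lintegral_gaussianReal_exp hΛ]
      _ = ∫⁻ p, ∏ a, ofReal (exp (p a * s a - Λ * p a ^ 2)) ∂γ := by
          rw [hγ, lintegral_iid_prod_dep _ _ (f := fun a p =>
            ofReal (exp (p * s a - Λ * p ^ 2))) fun a => by fun_prop]
      _ ≤ _ := lintegral_mono h1
  have hHm : Measurable fun r => ∫⁻ p, F r p ∂γ := hFm.lintegral_prod_right'
  refine (measure_mono (t := {r | ofReal ((√2)⁻¹ ^ k * exp x) ≤ ∫⁻ p, F r p ∂γ})
    fun r hr => hlow r hr.1 hr.2).trans ?_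
  refine (meas_ge_le_lintegral_div hHm.aemeasurable ?_ ofReal_ne_top).trans ?_
  · positivity
  · refine (div_le_div_right hin _).trans ?_
    rw [one_div, ← ofReal_inv_of_pos (by positivity)]
    apply ofReal_le_ofReal
    rw [mul_inv, exp_neg, inv_pow, inv_inv]

/-- The scalar case of `iid_sq_norm_sum_ge_le`. -/
lemma iid_sq_sum_ge_le {y : O → ℝ} (hy : Measurable y) (h2 : MemLp y 2 P)
    (h0 : ∫ o, y o ∂P = 0) {Λ : ℝ} (hΛ : 0 < Λ) (x : ℝ) :
    iid P n {r | ∑ i, y (r i) ^ 2 + n * ∫ o, y o ^ 2 ∂P ≤ Λ ∧ 8 * Λ * x ≤ (∑ i, y (r i)) ^ 2} ≤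
      ofReal (2 * exp (-x)) := by
  refine le_trans (measure_mono ?_) ((iid_sq_norm_sum_ge_le (k := 1) (u := fun o _ => y o)
    (measurable_pi_lambda _ fun _ => hy) (fun _ => h2) (fun _ => h0) hΛ x).trans ?_)
  · rintro r ⟨h1, h2⟩
    refine ⟨fun p => ?_, by simpa using h2⟩
    simp only [dotProduct, Fin.sum_univ_one, mul_pow, integral_const_mul, ← mul_sum]
    nlinarith [sq_nonneg (p 0)]
  · apply ofReal_le_ofReal
    have : √2 ^ 1 ≤ 2 := by simp
    gcongr

end Mixing

section Orthogonality

lemma insertNth_comp {α β : Type*} {n : ℕ} (T : α → β) (i : Fin (n + 1)) (r : Fin (n + 1) → α) :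
    i.insertNth (α := fun _ => β) (T (r i)) (fun l => T (i.removeNth r l)) = fun l => T (r l) := by
  symm
  rw [Fin.eq_insertNth_iff]
  exact ⟨rfl, rfl⟩

variable {O J : Type*} [MeasurableSpace O] [MeasurableSpace J] {P : Measure O} {n : ℕ}

/-- `𝔼[u | T] = 0`, in terms of integrals against functions of `T`. -/
def CondZero (P : Measure O) (T : O → J) (u : O → ℝ) : Prop :=
  ∀ h : J → ℝ, Measurable h → Integrable (fun o => h (T o) * u o) P → ∫ o, h (T o) * u o ∂P = 0

lemma measurable_insertNth_comp {T : O → J} (hT : Measurable T) (i : Fin (n + 1)) :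
    Measurable fun z : J × (Fin n → O) => i.insertNth (α := fun _ => J) z.1 fun l => T (z.2 l) := by
  have h : Measurable fun z : J × (Fin n → O) => (z.1, fun l => T (z.2 l)) := measurable_fst.prodMk
      (measurable_pi_lambda _ fun l => hT.comp ((measurable_pi_apply l).comp measurable_snd))
  exact (MeasurableEquiv.piFinSuccAbove (fun _ : Fin (n + 1) => J) i).symm.measurable.comp h

variable [IsProbabilityMeasure P]

lemma condZero_of_condExp {T : O → J} (hT : Measurable T) {u : O → ℝ} (hu : Integrable u P)
    (h0 : P[u | MeasurableSpace.comap T inferInstance] =ᵐ[P] 0) : CondZero P T u := by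
  intro h hh hi
  have hm := hT.comap_le
  rw [← integral_condExp hm]
  have hsm : StronglyMeasurable[MeasurableSpace.comap T inferInstance] fun o => h (T o) :=
    (hh.comp (comap_measurable T)).stronglyMeasurable
  have h1 := condExp_mul_of_stronglyMeasurable_left hsm hi hu
  refine (integral_congr_ae h1).trans ?_
  have h2 : ((fun o => h (T o)) * P[u | MeasurableSpace.comap T inferInstance]) =ᵐ[P] 0 := by
    filter_upwards [h0] with o ho
    simp [ho]
  rw [integral_congr_ae h2]; simp

lemma CondZero.integral_iid_succ {T : O → J} {u : O → ℝ} (hu : CondZero P T u) (i : Fin (n + 1))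
    {G : J → (Fin n → O) → ℝ} (hG : Measurable (Function.uncurry G))
    (hi : Integrable (fun r => G (T (r i)) (i.removeNth r) * u (r i)) (iid P (n + 1))) :
    ∫ r, G (T (r i)) (i.removeNth r) * u (r i) ∂(iid P (n + 1)) = 0 := by
  have hmp := measurePreserving_piFinSuccAbove (fun _ : Fin (n + 1) => P) i
  set e := MeasurableEquiv.piFinSuccAbove (fun _ : Fin (n + 1) => O) i
  set F : O × (Fin n → O) → ℝ := fun z => G (T z.1) z.2 * u z.1 with hF
  have hcomp : (fun r => G (T (r i)) (i.removeNth r) * u (r i)) = F ∘ e := by ext r; rfl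
  rw [hcomp] at hi ⊢
  have hi' := (hmp.integrable_comp_emb e.measurableEmbedding).1 hi
  calc ∫ r, (F ∘ e) r ∂(iid P (n + 1)) = ∫ z, F z ∂(P.prod (iid P n)) :=
        hmp.integral_comp e.measurableEmbedding F
    _ = ∫ y, ∫ o, F (o, y) ∂P ∂(iid P n) := integral_prod_symm F hi'
    _ = ∫ _, 0 ∂(iid P n) := by
        apply integral_congr_ae
        filter_upwards [hi'.prod_left_ae] with y hy
        exact hu (fun t => G t y) (hG.comp (measurable_id.prodMk measurable_const)) hy
    _ = 0 := by simp

lemma CondZero.integral_iid {T : O → J} (hT : Measurable T) {u : O → ℝ} (hu : CondZero P T u)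
    (i : Fin n) {H : (Fin n → J) → ℝ} (hH : Measurable H)
    (hi : Integrable (fun r => H (fun l => T (r l)) * u (r i)) (iid P n)) :
    ∫ r, H (fun l => T (r l)) * u (r i) ∂(iid P n) = 0 := by
  obtain _ | m := n
  · exact i.elim0
  simp_rw [← insertNth_comp T i] at hi ⊢
  exact hu.integral_iid_succ i
    (G := fun t (y : Fin m → O) => H (i.insertNth (α := fun _ => J) t fun l => T (y l)))
    (hH.comp (measurable_insertNth_comp hT i)) hi

lemma CondZero.integral_iid_mul {T : O → J} (hT : Measurable T) {u : O → ℝ}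
    (hum : Measurable u) (hu : CondZero P T u)
    {i j : Fin n} (hij : i ≠ j) {H : (Fin n → J) → ℝ} (hH : Measurable H)
    (hi : Integrable (fun r => H (fun l => T (r l)) * u (r j) * u (r i)) (iid P n)) :
    ∫ r, H (fun l => T (r l)) * u (r j) * u (r i) ∂(iid P n) = 0 := by
  obtain _ | m := n
  · exact i.elim0
  obtain ⟨j', rfl⟩ := Fin.exists_succAbove_eq hij.symm
  simp_rw [← insertNth_comp T i] at hi ⊢
  exact hu.integral_iid_succ i
    (G := fun t (y : Fin m → O) => H (i.insertNth (α := fun _ => J) t fun l => T (y l)) * u (y j'))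
    ((hH.comp (measurable_insertNth_comp hT i)).mul (by fun_prop)) hi

/-- A weighted sum of conditionally centered terms, with weights that depend on the conditioning
variables only, has uncorrelated summands. -/
lemma CondZero.integral_sq_sum {T : O → J} (hT : Measurable T) {u : O → ℝ}
    (hum : Measurable u) (hu : CondZero P T u) (hu2 : MemLp u 2 P)
    {b : Fin n → (Fin n → J) → ℝ} (hb : ∀ i, Measurable (b i)) {B : ℝ} (hB : ∀ i t, |b i t| ≤ B) :
    ∫ r, (∑ i, b i (fun l => T (r l)) * u (r i)) ^ 2 ∂(iid P n) =
      ∫ r, ∑ i, b i (fun l => T (r l)) ^ 2 * u (r i) ^ 2 ∂(iid P n) := by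
  have hTT : Measurable fun (r : Fin n → O) (l : Fin n) => T (r l) := by fun_prop
  have hmem : ∀ i : Fin n, MemLp (fun r : Fin n → O => b i (fun l => T (r l)) * u (r i)) 2 (iid P n) := by
    intro i
    have h1 := hu2.comp_measurePreserving (measurePreserving_eval (fun _ : Fin n => P) i)
    refine (h1.const_mul B).mono ((((hb i).comp hTT).mul
      (hum.comp (measurable_pi_apply i))).aestronglyMeasurable) (.of_forall fun r => ?_)
    simp only [norm_mul, norm_eq_abs]
    exact mul_le_mul_of_nonneg_right ((hB i _).trans (le_abs_self B)) (abs_nonneg _)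
  have hin : ∀ i j : Fin n, Integrable (fun r : Fin n → O => b i (fun l => T (r l)) * u (r i) *
      (b j (fun l => T (r l)) * u (r j))) (iid P n) := fun i j => (hmem i).integrable_mul (hmem j)
  simp_rw [sq (Finset.sum _ _), sum_mul_sum]
  rw [integral_finsetSum _ fun i _ => integrable_finsetSum _ fun j _ => hin i j,
    integral_finsetSum _ fun i _ => by
      refine (hin i i).congr (.of_forall fun r => ?_); simp only; ring]
  refine sum_congr rfl fun i _ => ?_
  rw [integral_finsetSum _ fun j _ => hin i j, sum_eq_single i]
  · congr 1; ext r; ring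
  · intro j _ hji
    have := hu.integral_iid_mul hT hum (i := i) (j := j) hji.symm
      (H := fun t => b i t * b j t) ((hb i).mul (hb j)) ?_
    · rw [← this]; congr 1; ext r; ring
    · refine (hin i j).congr (.of_forall fun r => ?_); simp only; ring
  · simp

/-- `𝔼[u² | T] ≤ v`, in terms of integrals against functions of `T`. -/
def CondSqLE (P : Measure O) (T : O → J) (u : O → ℝ) (v : ℝ) : Prop :=
  ∀ h : J → ℝ≥0∞, Measurable h → ∫⁻ o, h (T o) * ofReal (u o ^ 2) ∂P ≤ ofReal v * ∫⁻ o, h (T o) ∂P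

lemma CondSqLE.lintegral_iid {T : O → J} (hT : Measurable T) {u : O → ℝ} (hum : Measurable u)
    {v : ℝ} (hu : CondSqLE P T u v) (i : Fin n) {H : (Fin n → J) → ℝ≥0∞} (hH : Measurable H) :
    ∫⁻ r, H (fun l => T (r l)) * ofReal (u (r i) ^ 2) ∂(iid P n) ≤
      ofReal v * ∫⁻ r, H (fun l => T (r l)) ∂(iid P n) := by
  obtain _ | m := n
  · exact i.elim0
  have hmp := measurePreserving_piFinSuccAbove (fun _ : Fin (m + 1) => P) i
  set e := MeasurableEquiv.piFinSuccAbove (fun _ : Fin (m + 1) => O) i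
  set G : J × (Fin m → O) → ℝ≥0∞ :=
    fun z => H (i.insertNth (α := fun _ => J) z.1 fun l => T (z.2 l)) with hG
  have hGm := hH.comp (measurable_insertNth_comp hT i)
  have key : ∀ r : Fin (m + 1) → O, H (fun l => T (r l)) = G (T (e r).1, (e r).2) := fun r => by
    rw [← insertNth_comp T i r]; rfl
  have hGe : Measurable fun z : O × (Fin m → O) => G (T z.1, z.2) :=
    hGm.comp ((hT.comp measurable_fst).prodMk measurable_snd)
  have hGu : Measurable fun z : O × (Fin m → O) => G (T z.1, z.2) * ofReal (u z.1 ^ 2) :=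
    hGe.mul (by fun_prop)
  have e1 : ∫⁻ r, H (fun l => T (r l)) * ofReal (u (r i) ^ 2) ∂(iid P (m + 1)) =
      ∫⁻ z, G (T z.1, z.2) * ofReal (u z.1 ^ 2) ∂(P.prod (iid P m)) := by
    rw [← hmp.lintegral_comp hGu]
    simp_rw [key]; rfl
  have e2 : ∫⁻ r, H (fun l => T (r l)) ∂(iid P (m + 1)) =
      ∫⁻ z, G (T z.1, z.2) ∂(P.prod (iid P m)) := by
    rw [← hmp.lintegral_comp hGe]
    simp_rw [key]
  rw [e1, e2, lintegral_prod_symm _ hGu.aemeasurable, lintegral_prod_symm _ hGe.aemeasurable,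
    ← lintegral_const_mul _ hGe.lintegral_prod_left']
  exact lintegral_mono fun y => hu (fun t => G (t, y)) (hGm.comp (measurable_id.prodMk measurable_const))

end Orthogonality

section SubGaussian

variable {O : Type*} [MeasurableSpace O] {P : Measure O} {c : ℝ} {U : O → ℝ}

/-- `U` is sub-Gaussian in the sense that `𝔼 exp(c U²) ≤ 2`. -/
structure SG (P : Measure O) (c : ℝ) (U : O → ℝ) : Prop where
  meas : Measurable U
  exp_le : ∫⁻ o, ofReal (exp (c * U o ^ 2)) ∂P ≤ 2

lemma sg_of_eLpNorm_le {K : ℝ} (hK : 0 < K) (hU : Measurable U)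
    (h : ∀ q : ℝ, 1 ≤ q → eLpNorm U (ofReal q) P ≤ ofReal (K * √q)) [IsProbabilityMeasure P] :
    SG P (1 / (4 * exp 1 * K ^ 2)) U := by
  refine ⟨hU, ?_⟩
  set c := 1 / (4 * exp 1 * K ^ 2) with hc
  have hmom : ∀ m : ℕ, ∫⁻ o, ofReal ((U o ^ 2) ^ m) ∂P ≤
      ofReal ((2 * K ^ 2 * m) ^ m) := by
    intro m
    obtain rfl | hm := Nat.eq_zero_or_pos m
    · simp
    have hm' : (1 : ℝ) ≤ m := by exact_mod_cast hm
    have h1 := h (2 * m) (by linarith)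
    have e : ofReal (2 * m : ℝ) = ((2 * m : ℝ≥0) : ℝ≥0∞) := by simp
    have h2 := eLpNorm_nnreal_pow_eq_lintegral (f := U) (μ := P) (p := (2 * m : ℝ≥0))
      (by positivity)
    have h3 : ∫⁻ o, ofReal ((U o ^ 2) ^ m) ∂P = ∫⁻ o, ‖U o‖ₑ ^ ((2 * m : ℝ≥0) : ℝ) ∂P := by
      refine lintegral_congr fun o => ?_
      have : ((2 * m : ℝ≥0) : ℝ) = ((2 * m : ℕ) : ℝ) := by push_cast; rfl
      rw [this, ENNReal.rpow_natCast, ← pow_mul, Real.enorm_eq_ofReal_abs,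
        ← ofReal_pow (abs_nonneg _), Even.pow_abs (even_two_mul m)]
    rw [h3, ← h2]
    have h4 : eLpNorm U ((2 * m : ℝ≥0) : ℝ≥0∞) P ≤ ofReal (K * √(2 * m)) := by rw [← e]; exact h1
    calc _ ≤ (ofReal (K * √(2 * m))) ^ ((2 * m : ℝ≥0) : ℝ) := by gcongr
      _ = ofReal ((2 * K ^ 2 * m) ^ m) := by
        have : ((2 * m : ℝ≥0) : ℝ) = ((2 * m : ℕ) : ℝ) := by push_cast; rfl
        rw [this, ENNReal.rpow_natCast, ← ofReal_pow (by positivity), pow_mul, mul_pow,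
          sq_sqrt (by positivity)]
        congr 2; ring
  have hser : ∀ o, ofReal (exp (c * U o ^ 2)) =
      ∑' m : ℕ, ofReal (c ^ m / m.factorial) * ofReal ((U o ^ 2) ^ m) := by
    intro o
    rw [Real.exp_eq_exp_ℝ, NormedSpace.exp_eq_tsum_div, ENNReal.ofReal_tsum_of_nonneg]
    · refine tsum_congr fun m => ?_
      rw [← ofReal_mul (by positivity)]
      congr 1; rw [mul_pow]; ring
    · intro m; positivity
    · exact NormedSpace.expSeries_div_summable _
  simp_rw [hser]
  rw [lintegral_tsum fun m => (by fun_prop)]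
  have hterm : ∀ m : ℕ, ∫⁻ o, ofReal (c ^ m / m.factorial) *
      ofReal ((U o ^ 2) ^ m) ∂P ≤ (2⁻¹ : ℝ≥0∞) ^ m := by
    intro m
    rw [lintegral_const_mul _ (by fun_prop)]
    calc _ ≤ ofReal (c ^ m / m.factorial) * ofReal ((2 * K ^ 2 * m) ^ m) := by
          gcongr; exact hmom m
      _ ≤ ofReal ((1 / 2) ^ m) := by
          rw [← ofReal_mul (by positivity)]
          apply ofReal_le_ofReal
          have h5 := Real.pow_div_factorial_le_exp (m : ℝ) (by positivity) m
          calc c ^ m / m.factorial * (2 * K ^ 2 * m) ^ m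
              = (c * (2 * K ^ 2)) ^ m * ((m : ℝ) ^ m / m.factorial) := by
                rw [mul_pow _ (m : ℝ), mul_pow c]; ring
            _ ≤ (c * (2 * K ^ 2)) ^ m * exp m := by gcongr
            _ = (1 / 2) ^ m := by
                rw [← mul_one (m : ℝ), exp_nat_mul, ← mul_pow]
                congr 1; rw [hc]; field_simp; norm_num
      _ = _ := by
          rw [ofReal_pow (by norm_num)]; congr 1
          simp
  calc _ ≤ ∑' m : ℕ, (2⁻¹ : ℝ≥0∞) ^ m := ENNReal.tsum_le_tsum hterm
    _ = 2 := by simp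

lemma SG.mono {c' : ℝ} (h : SG P c U) (hc : c' ≤ c) : SG P c' U :=
  ⟨h.meas, (lintegral_mono fun _ => ofReal_le_ofReal (Real.exp_le_exp.2
    (by gcongr))).trans h.exp_le⟩

lemma SG.tail (h : SG P c U) (B : ℝ) (hc : 0 < c) :
    P {o | B < U o ^ 2} ≤ ofReal (2 * exp (-(c * B))) := by
  have hm := h.meas
  have h1 : P {o | B < U o ^ 2} ≤ P {o | ofReal (exp (c * B)) ≤ ofReal (exp (c * U o ^ 2))} :=
    measure_mono fun o ho => ofReal_le_ofReal (Real.exp_le_exp.2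
      (mul_le_mul_of_nonneg_left (le_of_lt ho) hc.le))
  refine h1.trans ((meas_ge_le_lintegral_div (by fun_prop) ?_
    ofReal_ne_top).trans ((div_le_div_right h.exp_le _).trans ?_))
  · simp [exp_pos]
  · rw [ENNReal.div_eq_inv_mul, ← ofReal_inv_of_pos (exp_pos _), ← exp_neg,
      mul_comm 2, ofReal_mul (exp_pos _).le]
    simp

/-- Any nonnegative function dominated by `A exp(c U²)` is integrable, with integral at most
`2 A`. -/
lemma SG.integrable_of_le (h : SG P c U) {f : O → ℝ} (hf : AEStronglyMeasurable f P) {A : ℝ}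
    (hA : 0 ≤ A) (h0 : ∀ o, 0 ≤ f o) (hle : ∀ o, f o ≤ A * exp (c * U o ^ 2)) :
    Integrable f P ∧ ∫ o, f o ∂P ≤ 2 * A := by
  have h1 : ∫⁻ o, ofReal (f o) ∂P ≤ ofReal (2 * A) := by
    have hm := h.meas
    calc ∫⁻ o, ofReal (f o) ∂P
        ≤ ∫⁻ o, ofReal A * ofReal (exp (c * U o ^ 2)) ∂P :=
          lintegral_mono fun o => by rw [← ofReal_mul hA]; exact ofReal_le_ofReal (hle o)
      _ = ofReal A * ∫⁻ o, ofReal (exp (c * U o ^ 2)) ∂P := lintegral_const_mul _ (by fun_prop)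
      _ ≤ ofReal A * 2 := by gcongr; exact h.exp_le
      _ = ofReal (2 * A) := by rw [mul_comm 2 A, ofReal_mul hA]; simp
  constructor
  · refine ⟨hf, ?_⟩
    rw [hasFiniteIntegral_iff_ofReal (.of_forall h0)]
    exact h1.trans_lt ofReal_lt_top
  · rw [integral_eq_lintegral_of_nonneg_ae (.of_forall h0) hf]
    exact ENNReal.toReal_le_of_le_ofReal (by positivity) h1

lemma SG.sq (h : SG P c U) (hc : 0 < c) :
    Integrable (fun o => U o ^ 2) P ∧ ∫ o, U o ^ 2 ∂P ≤ 2 / c := by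
  have hm := h.meas
  have := h.integrable_of_le (f := fun o => U o ^ 2) (A := 1 / c)
    (by fun_prop) (by positivity) (fun _ => sq_nonneg _)
    fun o => by
      have := add_one_le_exp (c * U o ^ 2)
      rw [div_mul_eq_mul_div, le_div_iff₀ hc]; linarith
  grind

lemma sq_le_two_mul_exp {y : ℝ} (hy : 0 ≤ y) : y ^ 2 ≤ 2 * exp y := by
  have := Real.quadratic_le_exp_of_nonneg hy
  nlinarith

lemma SG.pow_four (h : SG P c U) (hc : 0 < c) :
    Integrable (fun o => U o ^ 4) P ∧ ∫ o, U o ^ 4 ∂P ≤ 4 / c ^ 2 := by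
  have hm := h.meas
  have := h.integrable_of_le (f := fun o => U o ^ 4) (A := 2 / c ^ 2)
    (by fun_prop) (by positivity) (fun o => by positivity)
    fun o => by
      have := sq_le_two_mul_exp (y := c * U o ^ 2) (by positivity)
      rw [div_mul_eq_mul_div, le_div_iff₀ (by positivity)]; linarith
  grind

lemma SG.pow_four_exp (h : SG P c U) (hc : 0 < c) :
    Integrable (fun o => U o ^ 4 * exp (c / 2 * U o ^ 2)) P ∧
      ∫ o, U o ^ 4 * exp (c / 2 * U o ^ 2) ∂P ≤ 16 / c ^ 2 := by
  have hm := h.meas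
  have := h.integrable_of_le (f := fun o => U o ^ 4 * exp (c / 2 * U o ^ 2)) (A := 8 / c ^ 2)
    (by fun_prop) (by positivity) (fun o => by positivity)
    fun o => by
      have h1 := sq_le_two_mul_exp (y := c / 2 * U o ^ 2) (by positivity)
      have h2 : exp (c * U o ^ 2) = exp (c / 2 * U o ^ 2) * exp (c / 2 * U o ^ 2) := by
        rw [← exp_add]; congr 1; ring
      rw [h2, ← mul_assoc]
      gcongr
      rw [div_mul_eq_mul_div, le_div_iff₀ (by positivity)]; linarith
  grind

lemma SG.memLp_two (h : SG P c U) (hc : 0 < c) : MemLp U 2 P :=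
  (memLp_two_iff_integrable_sq h.meas.aestronglyMeasurable).2 (h.sq hc).1

lemma SG.memLp_sq (h : SG P c U) (hc : 0 < c) : MemLp (fun o => U o ^ 2) 2 P :=
  (memLp_two_iff_integrable_sq (h.meas.pow_const 2).aestronglyMeasurable).2 (by
    refine (h.pow_four hc).1.congr (.of_forall fun o => ?_); simp only; ring)

/-- Excess of `U²` over `T`. -/
def excess {α : Type*} (T : ℝ) (U : α → ℝ) (o : α) : ℝ := max (U o ^ 2 - T) 0

lemma excess_nonneg {α : Type*} (T : ℝ) (U : α → ℝ) (o : α) : 0 ≤ excess T U o := le_max_right _ _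

lemma sq_le_add_excess {α : Type*} (T : ℝ) (U : α → ℝ) (o : α) : U o ^ 2 ≤ T + excess T U o := by
  have := le_max_left (U o ^ 2 - T) 0
  unfold excess; linarith

lemma SG.measurable_excess (h : SG P c U) (T : ℝ) : Measurable (excess T U) := by
  have hm := h.meas
  unfold excess; fun_prop

variable [IsProbabilityMeasure P]

lemma SG.exp_excess (h : SG P c U) (T : ℝ) : ∫⁻ o, ofReal (exp (c * excess T U o)) ∂P ≤
      ofReal (1 + 2 * exp (-(c * T))) := by
  have hm := h.meas
  calc ∫⁻ o, ofReal (exp (c * excess T U o)) ∂P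
      ≤ ∫⁻ o, (1 + ofReal (exp (-(c * T))) *
          ofReal (exp (c * U o ^ 2))) ∂P := by
        refine lintegral_mono fun o => ?_
        rw [← ofReal_mul (exp_pos _).le, ← exp_add, ← ofReal_one,
          ← ofReal_add zero_le_one (exp_pos _).le]
        apply ofReal_le_ofReal
        unfold excess
        rcases max_cases (U o ^ 2 - T) 0 with ⟨h1, _⟩ | ⟨h1, _⟩ <;> rw [h1]
        · have : c * (U o ^ 2 - T) = -(c * T) + c * U o ^ 2 := by ring
          rw [this]; linarith
        · simp; positivity
    _ = 1 + ofReal (exp (-(c * T))) *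
          ∫⁻ o, ofReal (exp (c * U o ^ 2)) ∂P := by
        rw [lintegral_add_left measurable_const, lintegral_const_mul _ (by fun_prop)]; simp
    _ ≤ 1 + ofReal (exp (-(c * T))) * 2 := by gcongr; exact h.exp_le
    _ = _ := by
        rw [ofReal_add zero_le_one (by positivity), mul_comm 2, ofReal_mul (exp_pos _).le]; simp

lemma SG.integral_excess (h : SG P c U) (hc : 0 < c) (T : ℝ) :
    Integrable (excess T U) P ∧ ∫ o, excess T U o ∂P ≤ 2 * exp (-(c * T)) / c := by
  have hm := h.measurable_excess T
  have h1 : ∫⁻ o, ofReal (1 + c * excess T U o) ∂P ≤ ofReal (1 + 2 * exp (-(c * T))) :=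
    (lintegral_mono fun o => ofReal_le_ofReal
      (by linarith [add_one_le_exp (c * excess T U o)])).trans (h.exp_excess T)
  have hnn : ∀ o, 0 ≤ 1 + c * excess T U o := fun o => by have := excess_nonneg T U o; positivity
  have hi : Integrable (fun o => 1 + c * excess T U o) P := by
    refine ⟨(by fun_prop), ?_⟩
    rw [hasFiniteIntegral_iff_ofReal (.of_forall hnn)]
    exact h1.trans_lt ofReal_lt_top
  have hi2 : Integrable (excess T U) P := by
    have := (hi.sub (integrable_const (1 : ℝ))).const_mul c⁻¹
    refine this.congr (.of_forall fun o => ?_)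
    simp only [Pi.sub_apply]; field_simp; ring
  refine ⟨hi2, ?_⟩
  have h2 : ∫ o, (1 + c * excess T U o) ∂P ≤ 1 + 2 * exp (-(c * T)) := by
    rw [integral_eq_lintegral_of_nonneg_ae (.of_forall hnn) hi.1]
    exact ENNReal.toReal_le_of_le_ofReal (by positivity) h1
  rw [integral_add (integrable_const _) (hi2.const_mul c), integral_const_mul] at h2
  simp only [integral_const, probReal_univ, smul_eq_mul, mul_one] at h2
  rw [le_div_iff₀ hc]; linarith

variable {n : ℕ}

lemma SG.iid_excess (h : SG P c U) (hc : 0 < c) (T x : ℝ) :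
    iid P n {r | x ≤ ∑ i, excess T U (r i)} ≤ ofReal (exp (n * (2 * exp (-(c * T))) - c * x)) := by
  have h1 := iid_sum_ge_le (P := P) (n := n) (Y := fun o => c * excess T U o)
    ((h.measurable_excess T).const_mul c) (a := 2 * exp (-(c * T))) (x := c * x)
    ((h.exp_excess T).trans (ofReal_le_ofReal (by linarith [add_one_le_exp (2 * exp (-(c * T)))])))
  refine (measure_mono fun r hr => ?_).trans h1
  simp only [Set.mem_ofPred_eq, ← mul_sum] at hr ⊢
  gcongr

lemma SG.iid_pow_four (h : SG P c U) (hc : 0 < c) {B : ℝ} (hB : 0 < B) :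
    iid P n {r | (∀ i, U (r i) ^ 2 ≤ B) ∧ n * (32 / c ^ 2) ≤ ∑ i, U (r i) ^ 4} ≤
      ofReal (exp (-(8 * n / (c * B)))) := by
  classical
  have hm := h.meas
  set t : ℝ := c / (2 * B) with ht
  have hθ0 : 0 < t := by positivity
  set Y : O → ℝ := fun o => if U o ^ 2 ≤ B then t * U o ^ 4 else 0 with hY
  have hYm : Measurable Y :=
    Measurable.ite (measurableSet_le (by fun_prop) measurable_const) (by fun_prop) measurable_const
  have hexp : ∫⁻ o, ofReal (exp (Y o)) ∂P ≤ ofReal (exp (t * (16 / c ^ 2))) := by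
    obtain ⟨hi, hle⟩ := h.pow_four_exp hc
    calc ∫⁻ o, ofReal (exp (Y o)) ∂P
        ≤ ∫⁻ o, ofReal (1 + t * (U o ^ 4 * exp (c / 2 * U o ^ 2))) ∂P := by
          refine lintegral_mono fun o => ofReal_le_ofReal ?_
          simp only [hY]
          split_ifs with hb
          · have h1 : t * U o ^ 4 ≤ c / 2 * U o ^ 2 := by
              rw [ht, div_mul_eq_mul_div, div_le_iff₀ (by positivity)]
              nlinarith [mul_le_mul_of_nonneg_left hb (show 0 ≤ c * U o ^ 2 by positivity)]
            have h2 := add_one_le_exp (-(t * U o ^ 4))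
            have h3 : exp (t * U o ^ 4) ≤ 1 + t * U o ^ 4 * exp (t * U o ^ 4) := by
              have h4 := mul_le_mul_of_nonneg_left h2 (exp_pos (t * U o ^ 4)).le
              rw [← exp_add] at h4; simp at h4
              linarith
            have h5 := Real.exp_le_exp.2 h1
            have h6 : 0 ≤ t * U o ^ 4 := by positivity
            nlinarith [mul_le_mul_of_nonneg_left h5 h6]
          · have : 0 ≤ t * (U o ^ 4 * exp (c / 2 * U o ^ 2)) := by positivity
            rw [Real.exp_zero]; linarith
      _ = ofReal (∫ o, (1 + t * (U o ^ 4 * exp (c / 2 * U o ^ 2))) ∂P) :=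
          (ofReal_integral_eq_lintegral_ofReal ((integrable_const 1).add (hi.const_mul t))
            (.of_forall fun o =>
              show (0 : ℝ) ≤ 1 + t * (U o ^ 4 * exp (c / 2 * U o ^ 2)) by positivity)).symm
      _ ≤ _ := by
          apply ofReal_le_ofReal
          rw [integral_add (integrable_const _) (hi.const_mul t), integral_const_mul]
          simp only [integral_const, probReal_univ, smul_eq_mul, mul_one]
          have := add_one_le_exp (t * (16 / c ^ 2))
          nlinarith
  have h1 := iid_sum_ge_le (P := P) (n := n) hYm (x := t * (n * (32 / c ^ 2))) hexp
  refine (measure_mono fun r hr => ?_).trans (h1.trans_eq ?_)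
  · simp only [Set.mem_ofPred_eq, hY, hr.1, if_true, ← mul_sum]
    exact mul_le_mul_of_nonneg_left hr.2 hθ0.le
  · congr 2; rw [ht]; field_simp; ring


end SubGaussian

section Concentration

variable {O : Type*} [MeasurableSpace O] {P : Measure O} [IsProbabilityMeasure P] {n k : ℕ} {c : ℝ}

lemma sq_integral_le {f : O → ℝ} (hf : MemLp f 2 P) : (∫ o, f o ∂P) ^ 2 ≤ ∫ o, f o ^ 2 ∂P := by
  have h := variance_nonneg f P
  rw [variance_eq_sub hf] at h
  simpa using h

lemma integral_sub_integral_sq_le {f : O → ℝ} (hf : MemLp f 2 P) :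
    ∫ o, (f o - ∫ o', f o' ∂P) ^ 2 ∂P ≤ ∫ o, f o ^ 2 ∂P := by
  have h := variance_le_expectation_sq hf.1
  rwa [variance_eq_integral hf.1.aemeasurable] at h

lemma memLp_two_mul_of_sq {f g : O → ℝ} (hf : Measurable f) (hg : Measurable g)
    (h : Integrable (fun o => f o ^ 2 * g o ^ 2) P) : MemLp (fun o => f o * g o) 2 P :=
  (memLp_two_iff_integrable_sq (hf.mul hg).aestronglyMeasurable).2
    (h.congr (.of_forall fun o => by simp only [Pi.mul_apply]; ring))

lemma SG.mul_sq {U V : O → ℝ} (hU : SG P c U) (hV : SG P c V) (hc : 0 < c) :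
    Integrable (fun o => U o ^ 2 * V o ^ 2) P ∧ ∫ o, U o ^ 2 * V o ^ 2 ∂P ≤ 4 / c ^ 2 := by
  have h1 := (hU.memLp_sq hc).integrable_mul (hV.memLp_sq hc)
  refine ⟨h1, ?_⟩
  obtain ⟨hu, hu'⟩ := hU.pow_four hc
  obtain ⟨hv, hv'⟩ := hV.pow_four hc
  have : ∫ o, U o ^ 2 * V o ^ 2 ∂P ≤ ∫ o, (1 / 2 * U o ^ 4 + 1 / 2 * V o ^ 4) ∂P := by
    refine integral_mono h1 ((hu.const_mul _).add (hv.const_mul _)) fun o => ?_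
    simp only
    nlinarith [sq_nonneg (U o ^ 2 - V o ^ 2)]
  rw [integral_add (hu.const_mul _) (hv.const_mul _), integral_const_mul, integral_const_mul] at this
  linarith

lemma SG.iid_mul {U V : O → ℝ} (hU : SG P c U) (hV : SG P c V) (hc : 0 < c) (hn : 0 < n) (x : ℝ) :
    iid P n {r | ∑ i, U (r i) ^ 4 ≤ n * (32 / c ^ 2) ∧ ∑ i, V (r i) ^ 4 ≤ n * (32 / c ^ 2) ∧
      8 * (n * (76 / c ^ 2)) * x ≤ (∑ i, U (r i) * V (r i) - n * ∫ o, U o * V o ∂P) ^ 2} ≤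
      ofReal (2 * exp (-x)) := by
  obtain ⟨hi, hle⟩ := hU.mul_sq hV hc
  have hm := memLp_two_mul_of_sq hU.meas hV.meas hi
  set m := ∫ o, U o * V o ∂P with hmdef
  have hm2 := (sq_integral_le hm).trans (by simpa [mul_pow] using hle)
  have hv2 := (integral_sub_integral_sq_le hm).trans (by simpa [mul_pow] using hle)
  have h := iid_sq_sum_ge_le (P := P) (n := n) (y := fun o => U o * V o - m)
    ((hU.meas.mul hV.meas).sub_const m) (hm.sub (memLp_const m))
    (by rw [integral_sub (hm.integrable (by norm_num)) (integrable_const _)]; simp [hmdef])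
    (Λ := n * (76 / c ^ 2)) (by positivity) x
  refine (measure_mono ?_).trans h
  rintro r ⟨h1, h2, h3⟩
  constructor
  · have hs : ∑ i, (U (r i) * V (r i) - m) ^ 2 ≤
        ∑ i, (U (r i) ^ 4 + V (r i) ^ 4 + 2 * m ^ 2) := by
      refine sum_le_sum fun i _ => ?_
      nlinarith [sq_nonneg (U (r i) * V (r i) + m), sq_nonneg (U (r i) ^ 2 - V (r i) ^ 2)]
    simp only [sum_add_distrib, sum_const, card_univ, Fintype.card_fin, nsmul_eq_mul] at hs
    have e : (n : ℝ) * (76 / c ^ 2) = n * (32 / c ^ 2) + n * (32 / c ^ 2) + n * (2 * (4 / c ^ 2))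
      + n * (4 / c ^ 2) := by ring
    nlinarith
  · simpa [sum_sub_distrib] using h3

/-- An orthonormal system in `L²(P)`, with a bound on its Euclidean norm. -/
structure OrthoSystem (P : Measure O) (q : O → Fin k → ℝ) (M : ℝ) : Prop where
  meas : Measurable q
  bound : ∀ᵐ o ∂P, q o ⬝ q o ≤ M
  ortho : ∀ a b, ∫ o, q o a * q o b ∂P = if a = b then 1 else 0

lemma sq_dotProduct_le {ι : Type*} [Fintype ι] (v w : ι → ℝ) :
    (v ⬝ w) ^ 2 ≤ nsq v * nsq w := by
  have := Finset.sum_mul_sq_le_sq_mul_sq univ v w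
  simpa [dotProduct, sq] using this

lemma nsq_nonneg {ι : Type*} [Fintype ι] (v : ι → ℝ) : 0 ≤ nsq v :=
  sum_nonneg fun i _ => mul_self_nonneg (v i)

namespace OrthoSystem

variable {q : O → Fin k → ℝ} {M : ℝ}

lemma memLp_mul (h : OrthoSystem P q M) {η : O → ℝ} (hη : MemLp η 2 P) (a : Fin k) :
    MemLp (fun o => q o a * η o) 2 P := by
  have hm := (measurable_pi_apply a).comp h.meas
  refine (hη.const_mul (√M)).mono (hm.aestronglyMeasurable.mul hη.1) ?_
  filter_upwards [h.bound] with o ho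
  simp only [norm_mul]
  refine mul_le_mul_of_nonneg_right ?_ (norm_nonneg _)
  rw [norm_eq_abs, norm_of_nonneg (sqrt_nonneg _)]
  refine abs_le_sqrt (le_trans ?_ ho)
  rw [dotProduct, sq]
  exact single_le_sum (f := fun a => q o a * q o a) (fun a _ => mul_self_nonneg _) (mem_univ a)

lemma memLp (h : OrthoSystem P q M) (a : Fin k) : MemLp (fun o => q o a) 2 P := by
  simpa using h.memLp_mul (memLp_const 1) a

lemma integral_sq (h : OrthoSystem P q M) (t : Fin k → ℝ) :
    ∫ o, (t ⬝ q o) ^ 2 ∂P = nsq t := by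
  have hi : ∀ a b, Integrable (fun o => t a * q o a * (t b * q o b)) P := fun a b =>
    ((h.memLp a).const_mul _).integrable_mul ((h.memLp b).const_mul _)
  simp only [dotProduct, sq, sum_mul_sum]
  rw [integral_finsetSum _ fun a _ => integrable_finsetSum _ fun b _ => hi a b]
  refine sum_congr rfl fun a _ => ?_
  rw [integral_finsetSum _ fun b _ => hi a b]
  have : ∀ b, ∫ o, t a * q o a * (t b * q o b) ∂P = t a * t b * if a = b then 1 else 0 := by
    intro b
    rw [← h.ortho a b, ← integral_const_mul]
    congr 1; ext o; ring
  simp [this]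

lemma k_le (h : OrthoSystem P q M) : (k : ℝ) ≤ M := by
  have hi : ∀ a, Integrable (fun o => q o a * q o a) P := fun a =>
    (h.memLp a).integrable_mul (h.memLp a)
  have h1 : ∫ o, q o ⬝ q o ∂P = k := by
    simp only [dotProduct]
    rw [integral_finsetSum _ fun a _ => hi a]
    simp [h.ortho]
  have h2 : ∫ o, q o ⬝ q o ∂P ≤ ∫ _, M ∂P :=
    integral_mono_ae (integrable_finsetSum _ fun a _ => hi a) (integrable_const _) h.bound
  simpa [h1] using h2

/-- The empirical Gram matrix is within `τ` of the identity. -/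
def GramOK (q : O → Fin k → ℝ) (τ : ℝ) {n : ℕ} (r : Fin n → O) : Prop :=
  ∀ t : Fin k → ℝ, |(n : ℝ)⁻¹ * ∑ i, (t ⬝ q (r i)) ^ 2 - nsq t| ≤ τ * nsq t

lemma iid_gram (h : OrthoSystem P q M) (hn : 0 < n) {τ : ℝ} (hτ : 0 < τ) :
    iid P n {r | ¬ GramOK q τ r} ≤ ofReal (k * M / (n * τ ^ 2)) := by
  have hp := fun a b => h.memLp_mul (h.memLp b) a
  set Y : Fin k → Fin k → (Fin n → O) → ℝ := fun a b r =>
    (n : ℝ)⁻¹ * ∑ i, q (r i) a * q (r i) b - (if a = b then 1 else 0) with hY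
  have hv : ∀ a b, Integrable (fun r => Y a b r ^ 2) (iid P n) ∧
      ∫ r, Y a b r ^ 2 ∂(iid P n) ≤ (n : ℝ)⁻¹ * ∫ o, (q o a * q o b) ^ 2 ∂P := fun a b => by
    obtain ⟨m, e, v⟩ := iid_avg (hp a b) hn
    rw [variance_eq_integral m.1.aemeasurable, e, h.ortho] at v
    exact ⟨(m.sub (memLp_const _)).integrable_sq, v⟩
  have hi := fun a => integrable_finsetSum univ fun b _ => (hv a b).1
  have htot : ∫ r, ∑ a, ∑ b, Y a b r ^ 2 ∂(iid P n) ≤ k * M / n := by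
    have h1 : ∀ a, ∫ r, ∑ b, Y a b r ^ 2 ∂(iid P n) ≤ (n : ℝ)⁻¹ * (M * 1) := fun a => by
      rw [integral_finsetSum _ fun b _ => (hv a b).1]
      refine (sum_le_sum fun b _ => (hv a b).2).trans ?_
      rw [← mul_sum, ← integral_finsetSum _ fun b _ => (hp a b).integrable_sq]
      refine mul_le_mul_of_nonneg_left ((integral_mono_ae (integrable_finsetSum _ fun b _ =>
        (hp a b).integrable_sq) (((hp a a).integrable (by norm_num)).const_mul M)
        (h.bound.mono fun o ho => ?_)).trans_eq (by simp [integral_const_mul, h.ortho]))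
        (by positivity)
      simp only [mul_pow, ← mul_sum, ← sq] at ho ⊢
      rw [mul_comm]
      simp only [dotProduct, ← sq] at ho
      gcongr
    rw [integral_finsetSum _ fun a _ => hi a]
    exact (sum_le_sum fun a _ => h1 a).trans_eq (by simp; ring)
  have hsub : {r : Fin n → O | ¬ GramOK q τ r} ⊆ {r | τ ^ 2 ≤ ∑ a, ∑ b, Y a b r ^ 2} := by
    intro r hr
    by_contra hlt
    rw [Set.mem_ofPred_eq, not_le] at hlt
    refine hr fun t => ?_
    have e : (n : ℝ)⁻¹ * ∑ i, (t ⬝ q (r i)) ^ 2 - nsq t = ∑ a, ∑ b, Y a b r * (t a * t b) := by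
      simp only [hY, sub_mul, sum_sub_distrib, ite_mul, one_mul, zero_mul, Finset.sum_ite_eq,
        mem_univ, if_true, dotProduct, sq, mul_sum, sum_mul]
      rw [sum_comm]
      refine congrArg (· - _) (sum_congr rfl fun a _ => ?_)
      rw [sum_comm]
      grind
    have c := Finset.sum_mul_sq_le_sq_mul_sq univ (fun x : Fin k × Fin k => Y x.1 x.2 r)
      fun x => t x.1 * t x.2
    simp only [Fintype.sum_prod_type, mul_pow, ← sum_mul_sum] at c
    have h4 := nsq_nonneg t
    rw [e]
    refine abs_le_of_sq_le_sq (c.trans ?_) (by positivity)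
    simp only [dotProduct, ← sq] at h4 ⊢
    rw [mul_pow, sq (∑ i, t i ^ 2)]
    gcongr
  have hmk := mul_meas_ge_le_integral_of_nonneg (μ := iid P n) (f := fun r => ∑ a, ∑ b, Y a b r ^ 2)
    (.of_forall fun r => sum_nonneg fun a _ => sum_nonneg fun b _ => sq_nonneg _)
    (integrable_finsetSum _ fun a _ => hi a) (τ ^ 2)
  refine (measure_mono hsub).trans ?_
  rw [← ENNReal.ofReal_toReal (measure_ne_top (iid P n) _)]
  refine ofReal_le_ofReal ?_
  rw [← div_div, le_div_iff₀ (by positivity), mul_comm]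
  exact hmk.trans htot

lemma iid_vec (h : OrthoSystem P q M) {U : O → ℝ} (hU : SG P c U) (hc : 0 < c)
    {T x₁ Λ : ℝ} (hT : 0 ≤ T) (hΛ0 : 0 < Λ)
    (hΛ : 7 * n * T + 2 * M * x₁ + 3 * n * M * (2 * exp (-(c * T)) / c) ≤ Λ) (x : ℝ) :
    iid P n {r | GramOK q 1 r ∧ ∑ i, excess T U (r i) ≤ x₁ ∧
      8 * Λ * x ≤ ∑ a, (∑ i, q (r i) a * U (r i) - n * ∫ o, q o a * U o ∂P) ^ 2} ≤
      ofReal (√2 ^ k * exp (-x)) := by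
  have hm := h.meas
  have hUm := hU.meas
  have hM := (Nat.cast_nonneg k).trans h.k_le
  set u : O → Fin k → ℝ := fun o a => q o a * U o with hu
  have hmem : ∀ a, MemLp (fun o => u o a) 2 P := h.memLp_mul (hU.memLp_two hc)
  set m : Fin k → ℝ := fun a => ∫ o, u o a ∂P with hmdef
  obtain ⟨hei, hele⟩ := hU.integral_excess hc T
  have hpt : ∀ (t : Fin k → ℝ) o, nsq (q o) ≤ M →
      (t ⬝ u o) ^ 2 ≤ T * (t ⬝ q o) ^ 2 + nsq t * M * excess T U o := fun t o ho => by
    have e : t ⬝ u o = (t ⬝ q o) * U o := by simp only [hu, dotProduct, sum_mul, mul_assoc]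
    have h3 := (sq_dotProduct_le t (q o)).trans (mul_le_mul_of_nonneg_left ho (nsq_nonneg t))
    rw [e, mul_pow]
    nlinarith [mul_le_mul_of_nonneg_left (sq_le_add_excess T U o) (sq_nonneg (t ⬝ q o)),
      mul_le_mul_of_nonneg_right h3 (excess_nonneg T U o)]
  have ht := memLp_dotProduct hmem
  have hpop : ∀ t : Fin k → ℝ, ∫ o, (t ⬝ u o) ^ 2 ∂P ≤
      (T + M * (2 * exp (-(c * T)) / c)) * nsq t := fun t => by
    have hi := (memLp_dotProduct (fun a => h.memLp a) t).integrable_sq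
    have := integral_mono_ae (ht t).integrable_sq ((hi.const_mul T).add
      (hei.const_mul (nsq t * M))) (h.bound.mono fun o => hpt t o)
    rw [integral_add' (hi.const_mul T) (hei.const_mul _), integral_const_mul,
      integral_const_mul, h.integral_sq] at this
    nlinarith [mul_le_mul_of_nonneg_left hele (mul_nonneg (nsq_nonneg t) hM)]
  refine le_trans ?_ (iid_sq_norm_sum_ge_le (P := P) (n := n) (u := fun o a => u o a - m a)
    (measurable_pi_lambda _ fun a => by fun_prop) (fun a => (hmem a).sub (memLp_const _))
    (fun a => by
      rw [integral_sub ((hmem a).integrable (by norm_num)) (integrable_const _)]; simp [hmdef])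
    hΛ0 x)
  refine iid_le_of_ae h.bound ?_
  rintro r hΞω ⟨h1, h2, h3⟩
  refine ⟨fun t => ?_, by simpa [sum_sub_distrib, hmdef] using h3⟩
  have hd : ∀ o, (t ⬝ fun a => u o a - m a) = t ⬝ u o - t ⬝ m := fun o => dotProduct_sub ..
  simp_rw [hd]
  have hθθ := nsq_nonneg t
  have hs : ∑ i, (t ⬝ u (r i) - t ⬝ m) ^ 2 ≤
      ∑ i, (2 * (t ⬝ u (r i)) ^ 2 + 2 * (t ⬝ m) ^ 2) := by
    refine sum_le_sum fun i _ => ?_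
    nlinarith [sq_nonneg (t ⬝ u (r i) + t ⬝ m)]
  simp only [sum_add_distrib, ← mul_sum, sum_const, card_univ, Fintype.card_fin, nsmul_eq_mul] at hs
  have hs2 := sum_le_sum fun i (_ : i ∈ univ) => hpt t _ (hΞω i)
  rw [sum_add_distrib, ← mul_sum, ← mul_sum] at hs2
  have hg : ∑ i, (t ⬝ q (r i)) ^ 2 ≤ 2 * n * nsq t := by
    have := (abs_le.1 (h1 t)).2
    rcases Nat.eq_zero_or_pos n with rfl | hn
    · simp
    have h5 : (n : ℝ)⁻¹ * ∑ i, (t ⬝ q (r i)) ^ 2 ≤ 2 * nsq t := by linarith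
    rw [inv_mul_le_iff₀ (by exact_mod_cast hn)] at h5
    linarith
  have hm2 := sq_integral_le (ht t)
  have hv2 := (integral_sub_integral_sq_le (ht t)).trans (hpop t)
  rw [integral_dotProduct hmem] at hm2 hv2
  have hn0 : (0 : ℝ) ≤ n := Nat.cast_nonneg n
  have a2 := mul_le_mul_of_nonneg_left (hm2.trans (hpop t)) hn0
  have a4 := mul_le_mul_of_nonneg_left h2 (mul_nonneg hθθ hM)
  nlinarith

end OrthoSystem
end Concentration

section Poisson

variable {O : Type*} [MeasurableSpace O] {P : Measure O} [IsProbabilityMeasure P] {n : ℕ}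

/-- Exponential tail bound for sums of bounded nonnegative variables with a small mean. -/
lemma iid_sum_nonneg_ge_le {Y : O → ℝ} (hY : Measurable Y) (h0 : ∀ o, 0 ≤ Y o)
    (hi : Integrable Y P) {g M s x : ℝ} (hg : ∫ o, Y o ∂P ≤ g) (hM : 0 < M) (hs : 0 ≤ s) :
    iid P n {r | (∀ i, Y (r i) ≤ M) ∧ x ≤ ∑ i, Y (r i)} ≤
      ofReal (exp (n * (g * exp s / M) - s * x / M)) := by
  set Y' : O → ℝ := fun o => s * min (Y o) M / M with hY'
  have hY'm : Measurable Y' := by fun_prop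
  have hpt : ∀ o, exp (Y' o) ≤ 1 + Y o / M * exp s := by
    intro o
    set y := min (Y o) M / M with hy
    have hy0 := div_nonneg (le_min (h0 o) hM.le) hM.le
    have hy1 : y ≤ 1 := (div_le_one hM).2 (min_le_right _ _)
    have hyY : y ≤ Y o / M := div_le_div_of_nonneg_right (min_le_left _ _) hM.le
    have hc := convexOn_exp.2 (Set.mem_univ (0 : ℝ)) (Set.mem_univ s) (sub_nonneg.2 hy1) hy0 (by ring)
    simp only [smul_eq_mul, mul_zero, zero_add, Real.exp_zero, mul_one] at hc
    have : Y' o = y * s := by simp only [hY', hy]; ring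
    rw [this]
    have hes := exp_pos s
    nlinarith
  have hmgf : ∫⁻ o, ofReal (exp (Y' o)) ∂P ≤
      ofReal (exp (g * exp s / M)) := by
    have hin : Integrable (fun o => 1 + Y o / M * exp s) P :=
      (integrable_const _).add ((hi.div_const M).mul_const _)
    calc ∫⁻ o, ofReal (exp (Y' o)) ∂P
        ≤ ∫⁻ o, ofReal (1 + Y o / M * exp s) ∂P := lintegral_mono fun o => ofReal_le_ofReal (hpt o)
      _ = ofReal (∫ o, 1 + Y o / M * exp s ∂P) := by
          rw [ofReal_integral_eq_lintegral_ofReal hin (.of_forall fun o => ?_)]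
          have := h0 o
          positivity
      _ ≤ _ := by
          apply ofReal_le_ofReal
          rw [integral_add (integrable_const _) ((hi.div_const M).mul_const _), integral_mul_const,
            integral_div, integral_const, probReal_univ, one_smul]
          have h1 : (∫ o, Y o ∂P) / M * exp s ≤ g * exp s / M := by
            rw [div_mul_eq_mul_div]
            gcongr
          linarith [add_one_le_exp (g * exp s / M)]
  refine (measure_mono ?_).trans (iid_sum_ge_le (x := s * x / M) hY'm hmgf)
  rintro r ⟨hb, hx⟩
  have : ∑ i, Y' (r i) = s * (∑ i, Y (r i)) / M := by
    simp only [hY', mul_sum, sum_div]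
    simp_all
  show s * x / M ≤ ∑ i, Y' (r i)
  rw [this]
  gcongr

/-- A law of large numbers bound under a moment of order `s ∈ (1, 2]`. -/
lemma iid_avg_ge_le {Y : O → ℝ} (hY : Measurable Y) (h0 : ∀ o, 0 ≤ Y o) {s C : ℝ}
    (hs1 : 1 < s) (hs2 : s ≤ 2) (hi : Integrable (fun o => Y o ^ s) P)
    (hC : ∫ o, Y o ^ s ∂P ≤ C) (hn : 0 < n) :
    iid P n {r | n * (C + 2) ≤ ∑ i, Y (r i)} ≤ ofReal (2 * C * (n : ℝ) ^ (1 - s)) := by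
  have hnR : (0 : ℝ) < n := by exact_mod_cast hn
  have hY1 : ∀ o, Y o ≤ 1 + Y o ^ s := by
    intro o
    rcases le_total (Y o) 1 with h | h
    · linarith [rpow_nonneg (h0 o) s]
    · have := Real.rpow_le_rpow_of_exponent_le h hs1.le
      rw [rpow_one] at this; linarith
  set Y' : O → ℝ := fun o => min (Y o) n with hY'
  have hY'm : Measurable Y' := by fun_prop
  have hY'0 : ∀ o, 0 ≤ Y' o := fun o => le_min (h0 o) hnR.le
  have hsq : ∀ o, Y' o ^ 2 ≤ (n : ℝ) ^ (2 - s) * Y o ^ s := by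
    intro o
    rcases (hY'0 o).eq_or_lt with h | h
    · rw [← h]
      have := rpow_nonneg (h0 o) s
      simpa using by positivity
    · rw [← Real.rpow_natCast, show ((2 : ℕ) : ℝ) = (2 - s) + s by push_cast; ring, rpow_add h]
      exact mul_le_mul (Real.rpow_le_rpow h.le (min_le_right _ _) (by linarith))
        (Real.rpow_le_rpow h.le (min_le_left _ _) (by linarith)) (by positivity) (by positivity)
  have hmem : MemLp Y' 2 P := by
    refine (memLp_two_iff_integrable_sq hY'm.aestronglyMeasurable).2 ?_
    refine (hi.const_mul ((n : ℝ) ^ (2 - s))).mono' (by fun_prop) (.of_forall fun o => ?_)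
    rw [norm_of_nonneg (sq_nonneg _)]; exact hsq o
  have hV : ∫ o, Y' o ^ 2 ∂P ≤ (n : ℝ) ^ (2 - s) * C := by
    calc _ ≤ ∫ o, (n : ℝ) ^ (2 - s) * Y o ^ s ∂P :=
          integral_mono hmem.integrable_sq (hi.const_mul _) hsq
      _ = (n : ℝ) ^ (2 - s) * ∫ o, Y o ^ s ∂P := integral_const_mul _ _
      _ ≤ _ := mul_le_mul_of_nonneg_left hC (by positivity)
  have hC0 := (integral_nonneg fun o => rpow_nonneg (h0 o) s).trans hC
  have hmean : ∫ o, Y' o ∂P ≤ 1 + C := by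
    calc _ ≤ ∫ o, (1 + Y o ^ s) ∂P := integral_mono (hmem.integrable one_le_two)
          ((integrable_const _).add hi) fun o => (min_le_left _ _).trans (hY1 o)
      _ ≤ _ := by
          rw [integral_add (integrable_const _) hi, integral_const, probReal_univ, one_smul]
          linarith
  have hcheb := iid_abs_avg_sub_gt_le hmem one_pos hV hn
  have htail : P {o | (n : ℝ) < Y o} ≤ ofReal (C * (n : ℝ) ^ (-s)) := by
    have hns := Real.rpow_pos_of_pos hnR s
    have := mul_meas_ge_le_integral_of_nonneg (μ := P) (f := fun o => Y o ^ s)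
      (.of_forall fun o => rpow_nonneg (h0 o) s) hi ((n : ℝ) ^ s)
    have h2 : P.real {o | (n : ℝ) ^ s ≤ Y o ^ s} ≤ C * (n : ℝ) ^ (-s) := by
      rw [Real.rpow_neg hnR.le, ← div_eq_mul_inv, le_div_iff₀ hns]; linarith
    calc P {o | (n : ℝ) < Y o} ≤ P {o | (n : ℝ) ^ s ≤ Y o ^ s} := measure_mono fun o ho =>
          Real.rpow_le_rpow hnR.le (le_of_lt ho) (by linarith)
      _ = ofReal (P.real {o | (n : ℝ) ^ s ≤ Y o ^ s}) := (ofReal_measureReal).symm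
      _ ≤ _ := ofReal_le_ofReal h2
  have hexp : (n : ℝ) * (n : ℝ) ^ (-s) = (n : ℝ) ^ (1 - s) := by
    rw [sub_eq_add_neg, rpow_add hnR, rpow_one]
  have hexp2 : (n : ℝ) ^ (2 - s) = (n : ℝ) * (n : ℝ) ^ (1 - s) := by
    rw [show 2 - s = 1 + (1 - s) by ring, rpow_add hnR, rpow_one]
  calc iid P n {r | n * (C + 2) ≤ ∑ i, Y (r i)}
      ≤ iid P n ({r | 1 ≤ |(n : ℝ)⁻¹ * ∑ i, Y' (r i) - ∫ o, Y' o ∂P|} ∪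
          {r | ∃ i, (n : ℝ) < Y (r i)}) := by
        refine measure_mono fun r hr => ?_
        by_cases hb : ∃ i, (n : ℝ) < Y (r i)
        · exact Or.inr hb
        · left
          push Not at hb
          have e : ∑ i, Y' (r i) = ∑ i, Y (r i) := sum_congr rfl fun i _ => min_eq_left (hb i)
          show 1 ≤ |(n : ℝ)⁻¹ * ∑ i, Y' (r i) - ∫ o, Y' o ∂P|
          rw [e]
          refine le_trans ?_ (le_abs_self _)
          have : C + 2 ≤ (n : ℝ)⁻¹ * ∑ i, Y (r i) := by
            rw [inv_mul_eq_div, le_div_iff₀ hnR]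
            grind
          linarith
    _ ≤ ofReal ((n : ℝ) ^ (2 - s) * C / (n * 1 ^ 2)) + n * ofReal (C * (n : ℝ) ^ (-s)) :=
        (measure_union_le _ _).trans (add_le_add hcheb
          (iid_exists_le.trans (mul_le_mul_right htail _)))
    _ = ofReal (2 * C * (n : ℝ) ^ (1 - s)) := by
        rw [← ofReal_natCast n, ← ofReal_mul hnR.le, ← ofReal_add (by positivity) (by positivity)]
        grind

end Poisson

section CLT

lemma norm_exp_I_sub_taylor_le (x : ℝ) :
    ‖Complex.exp (x * Complex.I) - (1 + x * Complex.I - x ^ 2 / 2)‖ ≤ 4 * |x| ^ 3 := by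
  rcases le_total |x| 1 with h | h
  · have := Complex.norm_exp_sub_sum_le_norm_mul_exp (x * Complex.I) 3
    simp only [Finset.sum_range_succ, Finset.sum_range_zero, norm_mul, Complex.norm_real,
      Complex.norm_I, mul_one, norm_eq_abs] at this
    have e : (x * Complex.I : ℂ) ^ 2 = -(x ^ 2 : ℂ) := by rw [mul_pow, Complex.I_sq]; ring
    simp only [pow_zero, pow_one, e, Nat.factorial, Nat.cast_one, zero_add, div_one] at this
    have e2 : (1 + x * Complex.I + -(x ^ 2 : ℂ) / ((Nat.succ 1 * 1 : ℕ) : ℂ)) =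
        1 + x * Complex.I - x ^ 2 / 2 := by push_cast; ring
    norm_num at this e2
    have e3 : (1 + x * Complex.I + -(x ^ 2 : ℂ) / 2) = 1 + x * Complex.I - x ^ 2 / 2 := by ring
    rw [e3] at this
    refine this.trans ?_
    have : exp |x| ≤ 4 := (Real.exp_le_exp.2 h).trans (by linarith [Real.exp_one_lt_d9])
    nlinarith [pow_nonneg (abs_nonneg x) 3]
  · have h1 : ‖Complex.exp (x * Complex.I) - (1 + x * Complex.I - x ^ 2 / 2)‖ ≤
        1 + (1 + |x| + x ^ 2 / 2) := by
      refine (norm_sub_le _ _).trans ?_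
      rw [Complex.norm_exp_ofReal_mul_I]
      refine add_le_add_right ((norm_sub_le _ _).trans (add_le_add ((norm_add_le _ _).trans ?_) ?_)) _
      · simp
      · simp
    refine h1.trans ?_
    have h2 : |x| ≤ |x| ^ 3 := le_self_pow₀ h (by norm_num)
    have h3 : x ^ 2 ≤ |x| ^ 3 := by rw [← sq_abs]; exact pow_le_pow_right₀ h (by norm_num)
    linarith

variable {O : ℕ → Type*} [∀ n, MeasurableSpace (O n)]

/-- Central limit theorem for a triangular array with independent identically distributed rows,
in terms of characteristic functions along a convergent sequence of arguments. -/
lemma tendsto_charFun_iid (P : ∀ n, Measure (O n)) [∀ n, IsProbabilityMeasure (P n)]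
    (Y : ∀ n, O n → ℝ) (hm : ∀ n, Measurable (Y n)) {B : ℝ}
    (hi : ∀ᶠ n in atTop, Integrable (fun o => Y n o ^ 4) (P n))
    (h0 : ∀ᶠ n in atTop, ∫ o, Y n o ∂(P n) = 0)
    (h1 : ∀ᶠ n in atTop, ∫ o, Y n o ^ 2 ∂(P n) = 1)
    (h4 : ∀ᶠ n in atTop, ∫ o, Y n o ^ 4 ∂(P n) ≤ B)
    {t : ℕ → ℝ} {t₀ : ℝ} (ht : Tendsto t atTop (𝓝 t₀)) :
    Tendsto (fun n => ∫ r, Complex.exp ((t n * ((√n)⁻¹ * ∑ i, Y n (r i)) : ℝ) * Complex.I)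
      ∂(iid (P n) n)) atTop (𝓝 (Complex.exp (-(t₀ ^ 2 / 2) : ℝ))) := by
  have hprod : ∀ n, ∫ r, Complex.exp ((t n * ((√n)⁻¹ * ∑ i, Y n (r i)) : ℝ) * Complex.I)
      ∂(iid (P n) n) =
        (∫ o, Complex.exp ((t n * ((√n)⁻¹ * Y n o) : ℝ) * Complex.I) ∂(P n)) ^ n := by
    intro n
    have := integral_fintype_prod_eq_pow (ι := Fin n) (μ := P n)
      (fun o => Complex.exp ((t n * ((√n)⁻¹ * Y n o) : ℝ) * Complex.I))
    rw [Fintype.card_fin] at this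
    rw [← this]
    refine integral_congr_ae (.of_forall fun r => ?_)
    simp only [mul_sum, Complex.ofReal_sum, sum_mul, Complex.exp_sum]
  simp_rw [hprod]
  set K := |t₀| + 1
  have hK : ∀ᶠ n in atTop, |t n| ≤ K := ht.abs.eventually (Iic_mem_nhds (by simp [K]))
  have hbound : ∀ᶠ n : ℕ in atTop,
      ‖(∫ o, Complex.exp ((t n * ((√n)⁻¹ * Y n o) : ℝ) * Complex.I) ∂(P n)) -
        (1 + ((-(t n ^ 2 / 2) : ℝ) : ℂ) / n)‖ ≤ 4 * K ^ 3 * (1 + B) * ((√n)⁻¹ * (n : ℝ)⁻¹) := by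
    filter_upwards [hi, h0, h1, h4, hK, eventually_gt_atTop 0] with n hi h0 h1 h4 hK hn
    set s := (√n)⁻¹ with hs
    have hs0 : 0 < s := by positivity
    have hs2 : s ^ 2 = (n : ℝ)⁻¹ := by simp_all
    have hi2 : Integrable (fun o => Y n o ^ 2) (P n) := by
      by_contra hne
      rw [integral_undef hne] at h1
      exact zero_ne_one h1
    have hmem := (memLp_two_iff_integrable_sq (hm n).aestronglyMeasurable).2 hi2
    have hi1 := hmem.integrable one_le_two
    set x : O n → ℝ := fun o => t n * (s * Y n o) with hx
    have hxi := (hi1.const_mul s).const_mul (t n)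
    have hx2 : Integrable (fun o => x o ^ 2) (P n) :=
      (hi2.const_mul ((t n * s) ^ 2)).congr (.of_forall fun o => by simp only [hx]; ring)
    have hx0 : ∫ o, x o ∂(P n) = 0 := by
      simp only [hx]
      rw [integral_const_mul, integral_const_mul, h0]; ring
    have hxx : ∫ o, x o ^ 2 ∂(P n) = t n ^ 2 / n := by
      have : ∀ o, x o ^ 2 = (t n ^ 2 * (n : ℝ)⁻¹) * Y n o ^ 2 := fun o => by
        rw [← hs2]; simp only [hx]; ring
      simp_rw [this]
      rw [integral_const_mul, h1]; field_simp
    have hexpi : Integrable (fun o => Complex.exp ((x o : ℝ) * Complex.I)) (P n) := by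
      refine Integrable.of_bound (C := 1) ?_ (.of_forall fun o => ?_)
      · fun_prop
      · rw [Complex.norm_exp_ofReal_mul_I]
    have hpoly : ∫ o, (1 + (x o : ℂ) * Complex.I - (x o : ℂ) ^ 2 / 2) ∂(P n) =
        1 + ((-(t n ^ 2 / 2) : ℝ) : ℂ) / n := by
      have e1 : ∫ o, (x o : ℂ) ∂(P n) = 0 := by rw [integral_complex_ofReal, hx0]; simp
      have e2 : ∫ o, (x o : ℂ) ^ 2 ∂(P n) = (t n ^ 2 / n : ℝ) := by
        rw [← hxx, ← integral_complex_ofReal]; push_cast; rfl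
      have i2 : Integrable (fun o => (x o : ℂ) ^ 2) (P n) := by
        have := hx2.ofReal (𝕜 := ℂ)
        refine this.congr (.of_forall fun o => ?_)
        simp
      have i1 : Integrable (fun o => 1 + (x o : ℂ) * Complex.I) (P n) :=
        (integrable_const _).add (hxi.ofReal.mul_const _)
      rw [integral_sub i1 (i2.div_const _), integral_add (integrable_const _) (hxi.ofReal.mul_const _), integral_mul_const,
        integral_div, integral_const, probReal_univ, one_smul, e1, e2]
      push_cast; ring
    have hpi : Integrable (fun o => 1 + (x o : ℂ) * Complex.I - (x o : ℂ) ^ 2 / 2) (P n) := by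
      have i2 : Integrable (fun o => (x o : ℂ) ^ 2) (P n) := by
        have := hx2.ofReal (𝕜 := ℂ)
        refine this.congr (.of_forall fun o => ?_)
        simp
      exact ((integrable_const _).add (hxi.ofReal.mul_const _)).sub (i2.div_const _)
    rw [← hpoly, ← integral_sub hexpi hpi]
    have hcube : ∀ o, |Y n o| ^ 3 ≤ Y n o ^ 2 + Y n o ^ 4 := by
      intro o
      have h1 := sq_abs (Y n o)
      have h2 : |Y n o| ^ 4 = Y n o ^ 4 := by grind
      rw [← h1, ← h2]
      nlinarith [sq_nonneg (|Y n o| * (|Y n o| - 1)), abs_nonneg (Y n o), sq_nonneg |Y n o|]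
    calc ‖∫ o, (Complex.exp (((x o : ℝ) : ℂ) * Complex.I) -
          (1 + (x o : ℂ) * Complex.I - (x o : ℂ) ^ 2 / 2)) ∂(P n)‖
        ≤ ∫ o, 4 * K ^ 3 * (s * (n : ℝ)⁻¹) * (Y n o ^ 2 + Y n o ^ 4) ∂(P n) := by
          refine norm_integral_le_of_norm_le ((hi2.add hi).const_mul _) (.of_forall fun o => ?_)
          refine (norm_exp_I_sub_taylor_le (x o)).trans ?_
          have : |x o| ^ 3 = |t n| ^ 3 * (s * (n : ℝ)⁻¹) * |Y n o| ^ 3 := by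
            simp only [hx, abs_mul, abs_of_pos hs0, ← hs2]; ring
          rw [this]
          have := hcube o
          calc 4 * (|t n| ^ 3 * (s * (n : ℝ)⁻¹) * |Y n o| ^ 3)
              ≤ 4 * (K ^ 3 * (s * (n : ℝ)⁻¹) * (Y n o ^ 2 + Y n o ^ 4)) := by gcongr
            _ = _ := by ring
      _ ≤ _ := by
          rw [integral_const_mul, integral_add hi2 hi, h1]
          have : 0 ≤ 4 * K ^ 3 * (s * (n : ℝ)⁻¹) := by positivity
          nlinarith
  have key : Tendsto (fun n : ℕ => (n : ℂ) *
      ((∫ o, Complex.exp ((t n * ((√n)⁻¹ * Y n o) : ℝ) * Complex.I) ∂(P n)) - 1))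
      atTop (𝓝 ((-(t₀ ^ 2 / 2) : ℝ) : ℂ)) := by
    have hl : Tendsto (fun n : ℕ => ((-(t n ^ 2 / 2) : ℝ) : ℂ)) atTop
        (𝓝 ((-(t₀ ^ 2 / 2) : ℝ) : ℂ)) :=
      (Complex.continuous_ofReal.tendsto _).comp ((ht.pow 2).div_const 2).neg
    refine tendsto_of_tendsto_of_dist hl ?_
    have hz : Tendsto (fun n : ℕ => 4 * K ^ 3 * (1 + B) * (√n)⁻¹) atTop (𝓝 0) := by
      have := tendsto_inv_atTop_zero.comp (Real.tendsto_sqrt_atTop.comp tendsto_natCast_atTop_atTop)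
      simpa using this.const_mul (4 * K ^ 3 * (1 + B))
    refine squeeze_zero' (.of_forall fun n => dist_nonneg) ?_ hz
    filter_upwards [hbound, eventually_gt_atTop 0] with n hb hn
    have := hn.ne'
    rw [dist_comm, dist_eq_norm]
    set I := ∫ o, Complex.exp ((t n * ((√n)⁻¹ * Y n o) : ℝ) * Complex.I) ∂(P n)
    have e : (n : ℂ) * (I - 1) - ((-(t n ^ 2 / 2) : ℝ) : ℂ) =
        n * (I - (1 + ((-(t n ^ 2 / 2) : ℝ) : ℂ) / n)) := by
      field_simp; ring
    rw [e, norm_mul, Complex.norm_natCast]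
    calc (n : ℝ) * ‖I - (1 + ((-(t n ^ 2 / 2) : ℝ) : ℂ) / n)‖
        ≤ n * (4 * K ^ 3 * (1 + B) * ((√n)⁻¹ * (n : ℝ)⁻¹)) := by gcongr
      _ = _ := by field_simp
  have := Complex.tendsto_one_add_pow_exp_of_tendsto key
  refine this.congr fun n => ?_
  congr 1; ring

lemma norm_exp_I_sub_exp_I_le (x y : ℝ) :
    ‖Complex.exp (x * Complex.I) - Complex.exp (y * Complex.I)‖ ≤ |x - y| := by
  have : Complex.exp (x * Complex.I) - Complex.exp (y * Complex.I) =
      Complex.exp (y * Complex.I) * (Complex.exp (Complex.I * (x - y : ℝ)) - 1) := by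
    rw [mul_sub, ← Complex.exp_add, mul_one]
    congr 2; push_cast; ring
  rw [this, norm_mul, Complex.norm_exp_ofReal_mul_I, one_mul]
  exact Real.norm_exp_I_mul_ofReal_sub_one_le

/-- Slutsky's lemma for characteristic functions along a sequence of probability spaces. -/
lemma tendsto_charFun_of_op (μ : ∀ n, Measure (O n)) [∀ n, IsProbabilityMeasure (μ n)]
    {X Y : ∀ n, O n → ℝ} (hX : ∀ n, Measurable (X n)) (hY : ∀ n, Measurable (Y n))
    (h : Op μ fun n r => X n r - Y n r) {c : ℂ}
    (hc : Tendsto (fun n => ∫ r, Complex.exp ((Y n r : ℝ) * Complex.I) ∂(μ n)) atTop (𝓝 c)) :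
    Tendsto (fun n => ∫ r, Complex.exp ((X n r : ℝ) * Complex.I) ∂(μ n)) atTop (𝓝 c) := by
  have hin : ∀ (Z : ∀ n, O n → ℝ), (∀ n, Measurable (Z n)) → ∀ n,
      Integrable (fun r => Complex.exp ((Z n r : ℝ) * Complex.I)) (μ n) := fun Z hZ n => by
    refine Integrable.of_bound (C := 1) ?_ (.of_forall fun o => ?_)
    · fun_prop
    · rw [Complex.norm_exp_ofReal_mul_I]
  refine tendsto_of_tendsto_of_dist hc ?_
  rw [Metric.tendsto_atTop]
  intro e he
  have h2 := h (e / 4) (by positivity)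
  have h3 : Tendsto (fun n => (μ n).real {r | e / 4 < |X n r - Y n r|}) atTop (𝓝 0) := by
    have := (ENNReal.tendsto_toReal ENNReal.zero_ne_top).comp h2
    rw [ENNReal.toReal_zero] at this
    exact this
  obtain ⟨N, hN⟩ := (Metric.tendsto_atTop.1 h3) (e / 4) (by positivity)
  refine ⟨N, fun n hn => ?_⟩
  have hNn := hN n hn
  rw [Real.dist_eq, sub_zero, abs_of_nonneg measureReal_nonneg] at hNn
  rw [Real.dist_eq, sub_zero, abs_of_nonneg dist_nonneg, dist_comm, dist_eq_norm,
    ← integral_sub (hin X hX n) (hin Y hY n)]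
  set A := {r | e / 4 < |X n r - Y n r|} with hA
  have hAm : MeasurableSet A := measurableSet_lt measurable_const ((hX n).sub (hY n)).abs
  calc ‖∫ r, (Complex.exp ((X n r : ℝ) * Complex.I) - Complex.exp ((Y n r : ℝ) * Complex.I)) ∂(μ n)‖
      ≤ ∫ r, (e / 4 + A.indicator (fun _ => (2 : ℝ)) r) ∂(μ n) := by
        refine norm_integral_le_of_norm_le
          ((integrable_const _).add ((integrable_const _).indicator hAm)) (.of_forall fun r => ?_)
        by_cases hr : r ∈ A
        · rw [Set.indicator_of_mem hr]
          refine (norm_sub_le _ _).trans ?_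
          rw [Complex.norm_exp_ofReal_mul_I, Complex.norm_exp_ofReal_mul_I]
          linarith
        · rw [Set.indicator_of_notMem hr, add_zero]
          exact (norm_exp_I_sub_exp_I_le _ _).trans (not_lt.1 hr)
    _ = e / 4 + (μ n).real A * 2 := by
        rw [integral_add (integrable_const _) ((integrable_const _).indicator hAm), integral_const,
          probReal_univ, one_smul, integral_indicator_const _ hAm, smul_eq_mul]
    _ < e := by linarith

lemma tendstoInDistribution_gaussian (μ : ∀ n, Measure (O n)) [∀ n, IsProbabilityMeasure (μ n)]
    {X : ∀ n, O n → ℝ} (hX : ∀ n, Measurable (X n)) (v : ℝ≥0)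
    (h : ∀ t : ℝ, Tendsto (fun n => ∫ r, Complex.exp ((t * X n r : ℝ) * Complex.I) ∂(μ n)) atTop
      (𝓝 (Complex.exp (-(v * t ^ 2 / 2) : ℝ)))) :
    TendstoInDistribution X atTop (id : ℝ → ℝ) μ (gaussianReal 0 v) where
  forall_aemeasurable n := (hX n).aemeasurable
  tendsto := by
    refine ProbabilityMeasure.tendsto_iff_tendsto_charFun.2 fun t => ?_
    simp only [ProbabilityMeasure.coe_mk, Measure.map_id]
    rw [charFun_gaussianReal]
    have e : Complex.exp (t * (0 : ℝ) * Complex.I - v * t ^ 2 / 2) =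
        Complex.exp (-(v * t ^ 2 / 2) : ℝ) := by
      congr 1; push_cast; ring
    rw [e]
    refine (h t).congr fun n => ?_
    rw [charFun_apply_real, integral_map (hX n).aemeasurable (by fun_prop)]
    simp

end CLT

section LinearAlgebra

variable {n k p : ℕ}

/-- `G (Gᵀ G)⁻¹ Gᵀ`, the orthogonal projection on the column space of `G` if `G` has full column
rank, and `0` otherwise. -/
def projM (G : Matrix (Fin n) (Fin k) ℝ) : Matrix (Fin n) (Fin n) ℝ := G * (Gᵀ * G)⁻¹ * Gᵀ

lemma projM_transpose (G : Matrix (Fin n) (Fin k) ℝ) : (projM G)ᵀ = projM G := by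
  simp only [projM, transpose_mul, Matrix.transpose_transpose, Matrix.transpose_nonsing_inv,
    Matrix.mul_assoc]

lemma projM_mul_self (G : Matrix (Fin n) (Fin k) ℝ) : projM G * projM G = projM G := by
  by_cases h : IsUnit (Gᵀ * G).det
  · have : projM G * projM G = G * ((Gᵀ * G)⁻¹ * (Gᵀ * G)) * (Gᵀ * G)⁻¹ * Gᵀ := by
      simp only [projM, Matrix.mul_assoc]
    rw [this, nonsing_inv_mul _ h, Matrix.mul_one]; rfl
  · simp [projM, Matrix.nonsing_inv_apply_not_isUnit _ h]

lemma projM_mul (G : Matrix (Fin n) (Fin k) ℝ) (h : IsUnit (Gᵀ * G).det) : projM G * G = G := by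
  rw [projM, Matrix.mul_assoc, Matrix.mul_assoc, nonsing_inv_mul _ h, Matrix.mul_one]

lemma projM_trace_le (G : Matrix (Fin n) (Fin k) ℝ) : (projM G).trace ≤ k := by
  rw [projM, Matrix.trace_mul_comm, ← Matrix.mul_assoc]
  by_cases h : IsUnit (Gᵀ * G).det
  · simp_all
  · simp [Matrix.nonsing_inv_apply_not_isUnit _ h]

lemma projM_mul_right (G : Matrix (Fin n) (Fin k) ℝ) {C : Matrix (Fin k) (Fin k) ℝ}
    (hC : IsUnit C.det) : projM (G * C) = projM G := by
  have e : (G * C)ᵀ * (G * C) = Cᵀ * ((Gᵀ * G) * C) := by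
    simp only [transpose_mul, Matrix.mul_assoc]
  have hCt : IsUnit (Cᵀ).det := by rwa [det_transpose]
  rw [projM, e, Matrix.mul_inv_rev, Matrix.mul_inv_rev, transpose_mul]
  calc G * C * (C⁻¹ * (Gᵀ * G)⁻¹ * (Cᵀ)⁻¹) * (Cᵀ * Gᵀ)
      = G * (C * C⁻¹) * (Gᵀ * G)⁻¹ * ((Cᵀ)⁻¹ * Cᵀ) * Gᵀ := by simp only [Matrix.mul_assoc]
    _ = _ := by
        rw [mul_nonsing_inv _ hC, nonsing_inv_mul _ hCt, Matrix.mul_one, Matrix.mul_one]; rfl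

lemma projM_dot (G : Matrix (Fin n) (Fin k) ℝ) (u v : Fin n → ℝ) :
    (projM G *ᵥ u) ⬝ v = u ⬝ (projM G *ᵥ v) := by
  rw [dotProduct_mulVec, ← mulVec_transpose, projM_transpose]

lemma projM_dot_projM (G : Matrix (Fin n) (Fin k) ℝ) (u v : Fin n → ℝ) :
    (projM G *ᵥ u) ⬝ (projM G *ᵥ v) = u ⬝ (projM G *ᵥ v) := by
  rw [projM_dot, mulVec_mulVec, projM_mul_self]

/-- The residual of `v` after projection on the columns of `G`. -/
def residM (G : Matrix (Fin n) (Fin k) ℝ) (v : Fin n → ℝ) : Fin n → ℝ := v - projM G *ᵥ v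

lemma residM_dot (G : Matrix (Fin n) (Fin k) ℝ) (u v : Fin n → ℝ) :
    residM G u ⬝ v = u ⬝ residM G v := by
  rw [residM, residM, sub_dotProduct, dotProduct_sub, projM_dot]

lemma residM_dot_residM (G : Matrix (Fin n) (Fin k) ℝ) (u v : Fin n → ℝ) :
    residM G u ⬝ residM G v = u ⬝ v - u ⬝ (projM G *ᵥ v) := by
  simp only [residM, sub_dotProduct, dotProduct_sub, projM_dot_projM]
  rw [projM_dot]; ring

lemma residM_residM (G : Matrix (Fin n) (Fin k) ℝ) (v : Fin n → ℝ) :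
    residM G (residM G v) = residM G v := by
  simp [residM, mulVec_sub, mulVec_mulVec, projM_mul_self]

lemma residM_add (G : Matrix (Fin n) (Fin k) ℝ) (u v : Fin n → ℝ) :
    residM G (u + v) = residM G u + residM G v := by
  simp [residM, mulVec_add]; abel

lemma residM_sub (G : Matrix (Fin n) (Fin k) ℝ) (u v : Fin n → ℝ) :
    residM G (u - v) = residM G u - residM G v := by
  simp [residM, mulVec_sub]; abel

lemma dot_self_eq_projM_add (G : Matrix (Fin n) (Fin k) ℝ) (v : Fin n → ℝ) :
    nsq v = nsq (projM G *ᵥ v) + nsq (residM G v) := by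
  rw [residM_dot_residM, projM_dot_projM]; ring

lemma residM_dot_self_le (G : Matrix (Fin n) (Fin k) ℝ) (v : Fin n → ℝ) :
    nsq (residM G v) ≤ nsq v := by
  rw [dot_self_eq_projM_add G v]
  linarith [nsq_nonneg (projM G *ᵥ v)]

lemma projM_dot_self_le (G : Matrix (Fin n) (Fin k) ℝ) (v : Fin n → ℝ) :
    nsq (projM G *ᵥ v) ≤ nsq v := by
  rw [dot_self_eq_projM_add G v]
  linarith [nsq_nonneg (residM G v)]

lemma projM_diag (G : Matrix (Fin n) (Fin k) ℝ) (i : Fin n) :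
    projM G i i = ∑ j, projM G i j ^ 2 := by
  conv_lhs => rw [← projM_mul_self, Matrix.mul_apply]
  refine sum_congr rfl fun j _ => ?_
  rw [sq]
  congr 1
  conv_lhs => rw [← projM_transpose, transpose_apply]

lemma projM_diag_mem (G : Matrix (Fin n) (Fin k) ℝ) (i : Fin n) :
    0 ≤ projM G i i ∧ projM G i i ≤ 1 := by
  have h := projM_diag G i
  have h0 := h ▸ sum_nonneg fun j _ => sq_nonneg _
  refine ⟨h0, ?_⟩
  have h1 : projM G i i ^ 2 ≤ projM G i i := by
    conv_rhs => rw [h]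
    exact single_le_sum (f := fun j => projM G i j ^ 2) (fun j _ => sq_nonneg _) (mem_univ i)
  nlinarith

lemma abs_projM_le_one (G : Matrix (Fin n) (Fin k) ℝ) (i j : Fin n) : |projM G i j| ≤ 1 := by
  have h1 : projM G i j ^ 2 ≤ 1 := by
    refine le_trans ?_ (projM_diag_mem G i).2
    rw [projM_diag]
    exact single_le_sum (f := fun j => projM G i j ^ 2) (fun j _ => sq_nonneg _) (mem_univ j)
  simp_all

lemma sum_projM_diag_le (G : Matrix (Fin n) (Fin k) ℝ) : ∑ i, projM G i i ≤ k := projM_trace_le G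

lemma isUnit_gram {G : Matrix (Fin n) (Fin k) ℝ} {c : ℝ} (hc : 0 < c)
    (h : ∀ z : Fin k → ℝ, c * nsq z ≤ nsq (G *ᵥ z)) : IsUnit (Gᵀ * G).det := by
  rw [← Matrix.isUnit_iff_isUnit_det, ← Matrix.mulVec_injective_iff_isUnit]
  intro u v huv
  rw [← sub_eq_zero, ← mulVec_sub] at huv
  have h2 : nsq (G *ᵥ (u - v)) = 0 := by
    rw [dotProduct_mulVec, Matrix.vecMul_mulVec, ← dotProduct_mulVec, huv]
    simp
  have h3 := h (u - v)
  rw [h2] at h3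
  have h4 := le_antisymm (by nlinarith) (nsq_nonneg _)
  exact sub_eq_zero.1 (dotProduct_self_eq_zero.1 h4)

lemma projM_mulVec_eq (G : Matrix (Fin n) (Fin k) ℝ) (v : Fin n → ℝ) :
    projM G *ᵥ v = G *ᵥ ((Gᵀ * G)⁻¹ *ᵥ (Gᵀ *ᵥ v)) := by
  simp only [projM, mulVec_mulVec, Matrix.mul_assoc]

lemma projM_dot_self_le_of_gram {G : Matrix (Fin n) (Fin k) ℝ} {c : ℝ} (hc : 0 < c)
    (h : ∀ z : Fin k → ℝ, c * nsq z ≤ nsq (G *ᵥ z)) (v : Fin n → ℝ) :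
    nsq (projM G *ᵥ v) ≤ nsq (Gᵀ *ᵥ v) / c := by
  set z := (Gᵀ * G)⁻¹ *ᵥ (Gᵀ *ᵥ v) with hz
  have e : projM G *ᵥ v = G *ᵥ z := projM_mulVec_eq G v
  set N := nsq (projM G *ᵥ v) with hN
  have hN0 : 0 ≤ N := nsq_nonneg _
  have h1 : N = (Gᵀ *ᵥ v) ⬝ z := by rw [hN, projM_dot_projM, e, dotProduct_mulVec, mulVec_transpose]
  have h2 := sq_dotProduct_le (Gᵀ *ᵥ v) z
  have h3 := h z
  rw [← e] at h3
  rw [← h1] at h2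
  have hV : 0 ≤ nsq (Gᵀ *ᵥ v) := nsq_nonneg _
  rw [le_div_iff₀ hc]
  rcases hN0.eq_or_lt with h0 | h0
  · rw [← h0]; simpa using hV
  · nlinarith

lemma abs_dotProduct_le_of_forall_le {ι : Type*} [Fintype ι] {v w : ι → ℝ} {M : ℝ}
    (h : ∀ i, |w i| ≤ M) : |v ⬝ w| ≤ M * ∑ i, |v i| := by
  rw [dotProduct, mul_sum]
  refine (abs_sum_le_sum_abs _ _).trans (sum_le_sum fun i _ => ?_)
  rw [abs_mul, mul_comm]
  exact mul_le_mul_of_nonneg_right (h i) (abs_nonneg _)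

lemma two_mul_dotProduct_le {ι : Type*} [Fintype ι] (u v : ι → ℝ) :
    2 * (u ⬝ v) ≤ nsq u + nsq v := by
  have := nsq_nonneg (u - v)
  simp only [sub_dotProduct, dotProduct_sub, dotProduct_comm v u] at this
  linarith

lemma abs_dotProduct_le_sqrt {ι : Type*} [Fintype ι] (u v : ι → ℝ) :
    |u ⬝ v| ≤ √(nsq u) * √(nsq v) := by
  rw [← sqrt_mul (nsq_nonneg u), ← Real.sqrt_sq_eq_abs]
  exact Real.sqrt_le_sqrt (sq_dotProduct_le u v)

lemma add_dotProduct_self_le {ι : Type*} [Fintype ι] (u v : ι → ℝ) :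
    nsq (u + v) ≤ 2 * nsq u + 2 * nsq v := by
  have := two_mul_dotProduct_le u v
  simp only [add_dotProduct, dotProduct_add, dotProduct_comm v u]
  linarith

end LinearAlgebra

section Dantzig

variable {n p : ℕ}

lemma exists_dantzig_feasible (A : Matrix (Fin n) (Fin p) ℝ) (ξ w₀ : Fin p → ℝ)
    (b : Fin n → ℝ) {lam g : ℝ} (hlam : 0 < lam)
    (h1 : ∀ j, |ξ j + (n : ℝ)⁻¹ * (Aᵀ *ᵥ b) j| ≤ lam / 2)
    (hg : (n : ℝ)⁻¹ * nsq (A *ᵥ w₀ - b) ≤ g) :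
    ∃ v, (∀ j, |ξ j + (((n : ℝ)⁻¹ • (Aᵀ * A)) *ᵥ v) j| ≤ lam) ∧
      ∑ j, |v j| ≤ 3 * ∑ j, |w₀ j| + g / lam := by
  set F : (Fin p → ℝ) → ℝ := fun v =>
    (n : ℝ)⁻¹ * nsq (A *ᵥ v) / 2 + ξ ⬝ v + lam * ∑ j, |v j| with hF
  have hFc : Continuous F := by fun_prop
  have hinner : ∀ v, |ξ ⬝ v + (n : ℝ)⁻¹ * ((A *ᵥ v) ⬝ b)| ≤ lam / 2 * ∑ j, |v j| := by
    intro v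
    have e : ξ ⬝ v + (n : ℝ)⁻¹ * ((A *ᵥ v) ⬝ b) =
        v ⬝ fun j => ξ j + (n : ℝ)⁻¹ * (Aᵀ *ᵥ b) j := by
      have e1 : (A *ᵥ v) ⬝ b = v ⬝ (Aᵀ *ᵥ b) := by
        rw [dotProduct_comm, dotProduct_mulVec, ← mulVec_transpose, dotProduct_comm]
      rw [e1, dotProduct_comm ξ v]
      simp only [dotProduct, mul_sum, ← sum_add_distrib]
      exact sum_congr rfl fun j _ => by ring
    rw [e]
    exact abs_dotProduct_le_of_forall_le h1
  set N := (n : ℝ)⁻¹ * nsq b / 2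
  have hexpand : ∀ v, (n : ℝ)⁻¹ * nsq (A *ᵥ v - b) =
      (n : ℝ)⁻¹ * nsq (A *ᵥ v) - 2 * ((n : ℝ)⁻¹ * ((A *ᵥ v) ⬝ b)) + 2 * N := by
    intro v
    simp only [sub_dotProduct, dotProduct_sub, dotProduct_comm b, N]; ring
  have hlow : ∀ v, lam / 2 * ∑ j, |v j| - N ≤ F v := by
    intro v
    have h2 := (abs_le.1 (hinner v)).1
    have h3 := hexpand v
    have h4 : 0 ≤ (n : ℝ)⁻¹ * nsq (A *ᵥ v - b) := mul_nonneg (by positivity) (nsq_nonneg _)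
    simp only [hF]; linarith
  have hcoer : Tendsto F (cocompact _) atTop := by
    have h2 : Tendsto (fun v : Fin p → ℝ => lam / 2 * ‖v‖ + -N) (cocompact _) atTop :=
      tendsto_atTop_add_const_right _ _ ((tendsto_norm_cocompact_atTop).const_mul_atTop
        (by positivity))
    refine tendsto_atTop_mono (fun v => ?_) h2
    have h3 : ‖v‖ ≤ ∑ j, |v j| := by
      rw [pi_norm_le_iff_of_nonneg (sum_nonneg fun j _ => abs_nonneg _)]
      exact fun j => single_le_sum (f := fun j => |v j|) (fun j _ => abs_nonneg _) (mem_univ j)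
    have := mul_le_mul_of_nonneg_left h3 (by positivity : 0 ≤ lam / 2)
    linarith [hlow v]
  obtain ⟨v, hv⟩ := hFc.exists_forall_le hcoer
  refine ⟨v, fun j => ?_, ?_⟩
  · set D := ξ j + (((n : ℝ)⁻¹ • (Aᵀ * A)) *ᵥ v) j with hD
    set q := (n : ℝ)⁻¹ * nsq (A *ᵥ Pi.single j 1) / 2
    have hstep : ∀ s : ℝ, 0 ≤ s ^ 2 * q + s * D + lam * |s| := by
      intro s
      have h2 := hv (v + s • Pi.single j 1)
      have e1 : nsq (A *ᵥ (v + s • Pi.single j 1)) = nsq (A *ᵥ v) + 2 * s * ((Aᵀ * A) *ᵥ v) j +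
            s ^ 2 * nsq (A *ᵥ Pi.single j 1) := by
        have e2 : (A *ᵥ Pi.single j 1) ⬝ (A *ᵥ v) = ((Aᵀ * A) *ᵥ v) j := by
          rw [Matrix.mulVec_single_one, ← mulVec_mulVec]
          rfl
        simp only [mulVec_add, Matrix.mulVec_smul, add_dotProduct, dotProduct_add,
          smul_dotProduct, dotProduct_smul, smul_eq_mul, e2,
          dotProduct_comm (A *ᵥ v) (A *ᵥ Pi.single j 1)]
        ring
      have e3 : ξ ⬝ (v + s • Pi.single j 1) = ξ ⬝ v + s * ξ j := by simp
      have e4 : ∑ l, |(v + s • (Pi.single j 1 : Fin p → ℝ)) l| ≤ ∑ l, |v l| + |s| := by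
        have : ∑ l, |s * (Pi.single j (1 : ℝ) : Fin p → ℝ) l| = |s| := by
          rw [sum_eq_single j]
          · simp
          · intro l _ hl; simp [Pi.single_eq_of_ne hl]
          · simp
        rw [← this, ← sum_add_distrib]
        exact sum_le_sum fun l _ => by
          simp only [Pi.add_apply, Pi.smul_apply, smul_eq_mul]; exact abs_add_le _ _
      have e5 := mul_le_mul_of_nonneg_left e4 hlam.le
      have e6 : (((n : ℝ)⁻¹ • (Aᵀ * A)) *ᵥ v) j = (n : ℝ)⁻¹ * ((Aᵀ * A) *ᵥ v) j := by
        rw [smul_mulVec]; rfl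
      simp only [hF] at h2
      rw [e1, e3] at h2
      rw [hD, e6]
      simp only [q]
      linarith
    have hq : 0 ≤ q := by
      have : 0 ≤ (A *ᵥ Pi.single j 1) ⬝ (A *ᵥ Pi.single j (1 : ℝ)) := nsq_nonneg _
      positivity
    by_contra hcon
    push Not at hcon
    set s := (|D| - lam) / (2 * (q + 1))
    have hs : 0 < s := by positivity
    have hsq : s * q < |D| - lam := by
      have : s * (2 * (q + 1)) = |D| - lam := by simp only [s]; field_simp
      nlinarith
    rcases le_total 0 D with h0 | h0
    · have := hstep (-s)
      rw [abs_neg, abs_of_pos hs] at this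
      rw [abs_of_nonneg h0] at hsq
      nlinarith
    · have := hstep s
      rw [abs_of_pos hs] at this
      rw [abs_of_nonpos h0] at hsq
      nlinarith
  · have h2 := hv w₀
    have h3 := hlow v
    have h4 := (abs_le.1 (hinner w₀)).2
    have h5 := hexpand w₀
    have h6 : lam / 2 * ∑ j, |v j| ≤ g / 2 + 3 / 2 * lam * ∑ j, |w₀ j| := by
      simp only [hF] at h2 h3
      linarith
    have : (∑ j, |v j|) ≤ (g + 3 * lam * ∑ j, |w₀ j|) / lam := by rw [le_div_iff₀ hlam]; linarith
    refine this.trans (le_of_eq ?_)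
    field_simp; ring

lemma dantzig_prediction_error (A : Matrix (Fin n) (Fin p) ℝ) (ξ w₀ w : Fin p → ℝ)
    (b : Fin n → ℝ) {lam g : ℝ}
    (h1 : ∀ j, |ξ j + (n : ℝ)⁻¹ * (Aᵀ *ᵥ b) j| ≤ lam / 2)
    (hg : (n : ℝ)⁻¹ * nsq (A *ᵥ w₀ - b) ≤ g)
    (hw : ∀ j, |ξ j + (((n : ℝ)⁻¹ • (Aᵀ * A)) *ᵥ w) j| ≤ lam) :
    (n : ℝ)⁻¹ * nsq (A *ᵥ (w - w₀)) ≤ g + 3 * lam * ∑ j, |(w - w₀) j| := by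
  set δ := w - w₀ with hδ
  have e1 := (abs_le.1 (abs_dotProduct_le_of_forall_le (v := δ) hw)).2
  have e2 := (abs_le.1 (abs_dotProduct_le_of_forall_le (v := δ) h1)).1
  have a1 : (δ ⬝ fun j => ξ j + (((n : ℝ)⁻¹ • (Aᵀ * A)) *ᵥ w) j) =
      δ ⬝ ξ + (n : ℝ)⁻¹ * ((A *ᵥ δ) ⬝ (A *ᵥ w)) := by
    have : (A *ᵥ δ) ⬝ (A *ᵥ w) = δ ⬝ ((Aᵀ * A) *ᵥ w) := by
      rw [dotProduct_mulVec, Matrix.vecMul_mulVec, ← dotProduct_mulVec]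
    rw [this, smul_mulVec, ← smul_eq_mul, ← dotProduct_smul, ← dotProduct_add]; rfl
  have a2 : (δ ⬝ fun j => ξ j + (n : ℝ)⁻¹ * (Aᵀ *ᵥ b) j) =
      δ ⬝ ξ + (n : ℝ)⁻¹ * ((A *ᵥ δ) ⬝ b) := by
    have : (A *ᵥ δ) ⬝ b = δ ⬝ (Aᵀ *ᵥ b) := by
      rw [dotProduct_comm, dotProduct_mulVec, ← mulVec_transpose, dotProduct_comm]
    rw [this, ← smul_eq_mul, ← dotProduct_smul, ← dotProduct_add]; rfl
  rw [a1] at e1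
  rw [a2] at e2
  have e3 := two_mul_dotProduct_le (-(A *ᵥ δ)) (A *ᵥ w₀ - b)
  have hw' : A *ᵥ w = A *ᵥ δ + A *ᵥ w₀ := by rw [hδ, mulVec_sub]; abel
  rw [hw', dotProduct_add] at e1
  simp only [neg_dotProduct, dotProduct_neg, neg_neg, dotProduct_sub (A *ᵥ δ)] at e3
  have hn0 : 0 ≤ (n : ℝ)⁻¹ := by positivity
  nlinarith

end Dantzig

section Lasso

variable {n k p : ℕ}

/-- The basic inequality for a penalized least squares estimator with a nuisance part that is
profiled out. -/
lemma lasso_basic {X : Matrix (Fin n) (Fin p) ℝ} {G : Matrix (Fin n) (Fin k) ℝ}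
    (hG : IsUnit (Gᵀ * G).det) {β β₀ : Fin p → ℝ} {γ γ₀ : Fin k → ℝ} {S u : Fin n → ℝ}
    (hS : S = X *ᵥ β₀ + G *ᵥ γ₀ + u) {lam : ℝ}
    (hmin : ∀ γ', (n : ℝ)⁻¹ * nsq (X *ᵥ β + G *ᵥ γ - S) + lam * ∑ j, |β j| ≤
      (n : ℝ)⁻¹ * nsq (X *ᵥ β₀ + G *ᵥ γ' - S) + lam * ∑ j, |β₀ j|) :
    (n : ℝ)⁻¹ * nsq (residM G (X *ᵥ (β - β₀))) + lam * ∑ j, |β j| ≤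
      lam * ∑ j, |β₀ j| + 2 * ((n : ℝ)⁻¹ * (residM G (X *ᵥ (β - β₀)) ⬝ u)) := by
  have hres : ∀ z, residM G (G *ᵥ z) = 0 := fun z => by
    rw [residM, mulVec_mulVec, projM_mul G hG, sub_self]
  have h := hmin (γ₀ + (Gᵀ * G)⁻¹ *ᵥ (Gᵀ *ᵥ u))
  have e1 : X *ᵥ β₀ + G *ᵥ (γ₀ + (Gᵀ * G)⁻¹ *ᵥ (Gᵀ *ᵥ u)) - S = -residM G u := by
    rw [mulVec_add, ← projM_mulVec_eq, hS, residM]; abel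
  rw [e1] at h
  have e2 : X *ᵥ β + G *ᵥ γ - S = X *ᵥ (β - β₀) - u + G *ᵥ (γ - γ₀) := by
    rw [hS, mulVec_sub, mulVec_sub]; abel
  have e3 : residM G (X *ᵥ β + G *ᵥ γ - S) = residM G (X *ᵥ (β - β₀)) - residM G u := by
    rw [e2, residM_add, hres, add_zero, residM_sub]
  have h2 := residM_dot_self_le G (X *ᵥ β + G *ᵥ γ - S)
  rw [e3] at h2
  have e4 : residM G (X *ᵥ (β - β₀)) ⬝ u = residM G (X *ᵥ (β - β₀)) ⬝ residM G u := by
    conv_lhs => rw [← residM_residM, residM_dot]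
  rw [e4]
  simp only [sub_dotProduct, dotProduct_sub, neg_dotProduct, dotProduct_neg, neg_neg,
    dotProduct_comm (residM G u)] at h2 h
  have hn0 : 0 ≤ (n : ℝ)⁻¹ := by positivity
  nlinarith

lemma sum_abs_sub_support (β β₀ : Fin p → ℝ) :
    ∑ j, |β₀ j| + ∑ j, |(β - β₀) j| - 2 * (√((Finset.univ.filter fun j => β₀ j ≠ 0).card : ℝ) *
      √(nsq (β - β₀))) ≤ ∑ j, |β j| := by
  set S := Finset.univ.filter fun j => β₀ j ≠ 0 with hS
  set δ := β - β₀ with hδ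
  have h1 : ∑ j ∈ S, |δ j| ≤ √(S.card : ℝ) * √(nsq δ) := by
    rw [← sqrt_mul (by positivity)]
    refine Real.le_sqrt_of_sq_le ?_
    calc (∑ j ∈ S, |δ j|) ^ 2 ≤ S.card * ∑ j ∈ S, |δ j| ^ 2 := sq_sum_le_card_mul_sum_sq
      _ ≤ S.card * nsq δ := by
          refine mul_le_mul_of_nonneg_left ?_ (by positivity)
          simp only [sq_abs, dotProduct, ← sq]
          exact Finset.sum_le_sum_of_subset_of_nonneg (Finset.subset_univ _)
            fun j _ _ => sq_nonneg _
  have h2 : ∑ j, |β₀ j| + ∑ j, |δ j| - 2 * ∑ j ∈ S, |δ j| ≤ ∑ j, |β j| := by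
    have : ∑ j ∈ S, |δ j| = ∑ j, if β₀ j ≠ 0 then |δ j| else 0 := by rw [hS, Finset.sum_filter]
    rw [this, mul_sum, ← sum_add_distrib, ← sum_sub_distrib]
    refine sum_le_sum fun j _ => ?_
    have hj : β j = β₀ j + δ j := by simp [hδ]
    grind
  linarith

/-- Rates of the penalized estimator from its basic inequality and a lower bound for the
quadratic form with an error of second order in the `ℓ¹` norm. -/
lemma lasso_rates {Q D t A ρ lam s rate a c C z : ℝ} (hQ : 0 ≤ Q) (hD : 0 ≤ D) (ht : 0 ≤ t)
    (hρ : 0 ≤ ρ) (hlam : 0 < lam) (ha : 0 ≤ a) (hc : 0 < c)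
    (hC : 1 ≤ C)
    (hbasic : Q / 2 + 3 / 4 * lam * t ≤ 2 * lam * √s * D + 2 * ρ + 2 * √(A * ρ))
    (hA : A ≤ C * (D ^ 2 + rate * t ^ 2)) (hlow : c * D ^ 2 - a * t ^ 2 ≤ Q)
    (hρr : 64 * C * ρ * rate ≤ lam ^ 2) (hz : z = lam * √s + √(C * ρ))
    (ha1 : 64 * a * z ^ 2 ≤ c * lam ^ 2) (ha2 : 32 * a * z ^ 2 ≤ lam ^ 2) :
    D ≤ (18 / c + 1) * z ∧ lam * t ≤ 4 * (18 / c + 2) * z ^ 2 := by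
  have hθ0 : 0 ≤ z := by rw [hz]; positivity
  have hsr : √(A * ρ) ≤ √(C * ρ) * D + lam * t / 8 := by
    refine Real.sqrt_le_iff.2 ⟨by positivity, ?_⟩
    have h1 : A * ρ ≤ C * ρ * D ^ 2 + C * ρ * rate * t ^ 2 := by
      linarith [mul_le_mul_of_nonneg_right hA hρ]
    have h2 : C * ρ * rate * t ^ 2 ≤ (lam * t / 8) ^ 2 := by
      linarith [mul_le_mul_of_nonneg_right hρr (sq_nonneg t)]
    have h3 : (√(C * ρ)) ^ 2 = C * ρ := sq_sqrt (by positivity)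
    have h4 : 0 ≤ √(C * ρ) * D * (lam * t / 8) := by positivity
    have h5 : (√(C * ρ) * D + lam * t / 8) ^ 2 =
        (√(C * ρ)) ^ 2 * D ^ 2 + 2 * (√(C * ρ) * D * (lam * t / 8)) + (lam * t / 8) ^ 2 := by ring
    rw [h5, h3]
    linarith
  have hρθ : ρ ≤ z ^ 2 := by
    have h3 : (√(C * ρ)) ^ 2 = C * ρ := sq_sqrt (by positivity)
    have h4 : √(C * ρ) ≤ z := by simp_all
    have h5 : (√(C * ρ)) ^ 2 ≤ z ^ 2 := by gcongr
    linarith [mul_le_mul_of_nonneg_right hC hρ]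
  have hmain : Q / 2 + lam * t / 2 ≤ 2 * z * D + 2 * z ^ 2 := by
    have : 2 * z * D = 2 * lam * √s * D + 2 * (√(C * ρ) * D) := by rw [hz]; ring
    linarith
  have ht1 : lam * t ≤ 4 * z * D + 4 * z ^ 2 := by linarith
  have hat : lam ^ 2 * (a * t ^ 2) ≤ lam ^ 2 * (c / 2 * D ^ 2 + z ^ 2) := by
    have h1 : (lam * t) ^ 2 ≤ (4 * z * D + 4 * z ^ 2) ^ 2 := by gcongr
    have h2 : (4 * z * D + 4 * z ^ 2) ^ 2 ≤ 32 * z ^ 2 * D ^ 2 + 32 * z ^ 2 * z ^ 2 := by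
      nlinarith [sq_nonneg (z * D - z ^ 2)]
    have h3 : a * (lam * t) ^ 2 ≤ a * (32 * z ^ 2 * D ^ 2 + 32 * z ^ 2 * z ^ 2) := by
      gcongr; exact h1.trans h2
    linarith [mul_le_mul_of_nonneg_right ha1 (sq_nonneg D),
      mul_le_mul_of_nonneg_right ha2 (sq_nonneg z)]
  have hat' := le_of_mul_le_mul_left hat (by positivity)
  have hquad : c / 2 * D ^ 2 ≤ 4 * z * D + 5 * z ^ 2 := by linarith [mul_nonneg hlam.le ht]
  have hDle : D ≤ (18 / c + 1) * z := by
    by_contra hcon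
    push Not at hcon
    have hK : (18 / c + 1) * z = 18 * z / c + z := by ring
    rw [hK] at hcon
    have h0 : 0 ≤ 18 * z / c := by positivity
    have hDpos : 0 < D := by linarith
    have h1 : c / 2 * D * D ≤ 9 * z * D := by
      have := mul_le_mul_of_nonneg_left (by linarith : z ≤ D) hθ0
      linarith
    have h2 := le_of_mul_le_mul_right h1 hDpos
    have h3 : D ≤ 18 * z / c := by rw [le_div_iff₀ hc]; linarith
    linarith
  refine ⟨hDle, ht1.trans ?_⟩
  have := mul_le_mul_of_nonneg_left hDle hθ0
  linarith

end Lasso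

section Family

variable {O : Type*} [MeasurableSpace O] {P : Measure O} [IsProbabilityMeasure P] {n k : ℕ}
  {ι : Type*} [Fintype ι] {c L M A : ℝ} {U : ι → O → ℝ} {f : O → Fin k → ℝ}

/-- Union bound in the form used below. -/
lemma measure_exists_le {α : Type*} [MeasurableSpace α] {μ : Measure α} {p : ι → α → Prop}
    {a : ℝ} {N : ℝ} (hN : (Fintype.card ι : ℝ) ≤ N) (ha : 0 ≤ a)
    (h : ∀ u, μ {r | p u r} ≤ ofReal a) :
    μ {r | ∃ u, p u r} ≤ ofReal (N * a) := by
  have e : {r | ∃ u, p u r} = ⋃ u, {r | p u r} := by ext; simp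
  rw [e]
  refine (measure_iUnion_fintype_le _ _).trans ((sum_le_sum fun u _ => h u).trans ?_)
  rw [sum_const, card_univ, nsmul_eq_mul, ← ofReal_natCast, ← ofReal_mul (by positivity)]
  gcongr

/-- Simultaneous control of the empirical moments of a family of sub-Gaussian variables and of
their empirical covariances with an orthonormal system. -/
structure FamGood (P : Measure O) (U : ι → O → ℝ) (f : O → Fin k → ℝ) (c L A : ℝ)
    (r : Fin n → O) : Prop where
  max : ∀ u i, U u (r i) ^ 2 ≤ 4 * L / c
  four : ∀ u, ∑ i, U u (r i) ^ 4 ≤ n * (32 / c ^ 2)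
  excess : ∀ u, ∑ i, excess (log n / c) (U u) (r i) ≤ (2 * L + 2) / c
  cov : ∀ u v, (∑ i, U u (r i) * U v (r i) - n * ∫ o, U u o * U v o ∂P) ^ 2 ≤
    8 * (n * (76 / c ^ 2)) * (3 * L)
  vec : ∀ u, ∑ a, (∑ i, f (r i) a * U u (r i) - n * ∫ o, f o a * U u o ∂P) ^ 2 ≤
    8 * (n * log n * ((7 + 20 * A) / c)) * (k + 2 * L)

lemma iid_not_famGood (hc : 0 < c) (hU : ∀ u, SG P c (U u)) (hf : OrthoSystem P f M)
    (hn : 1 ≤ log n) (hL : log n ≤ L) (hL2 : L ^ 2 ≤ n)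
    (hcard : (Fintype.card ι : ℝ) ≤ 4 * exp L) (hA : 0 ≤ A) (hΞL : M * L ≤ A * n) :
    iid P n {r | OrthoSystem.GramOK f 1 r ∧ ¬ FamGood P U f c L A r} ≤ ofReal (52 / n) := by
  have hn0 : 0 < n := by
    rcases Nat.eq_zero_or_pos n with h | h
    · subst h; norm_num at hn
    · exact h
  have hnR : (0 : ℝ) < n := by exact_mod_cast hn0
  have hL1 := hn.trans hL
  have hnL : (n : ℝ) ≤ exp L := by rw [← Real.log_le_iff_le_exp hnR]; exact hL
  have hE : exp (-L) ≤ 1 / n := by rw [exp_neg, inv_eq_one_div]; gcongr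
  have hΞ0 := (Nat.cast_nonneg k).trans hf.k_le
  have hexcL : exp (-(c * (log n / c))) = 1 / n := by
    rw [mul_div_cancel₀ _ hc.ne', exp_neg, exp_log hnR, one_div]
  have B1 : iid P n {r | ∃ u : ι, ∃ i, 4 * L / c < U u (r i) ^ 2} ≤ ofReal (8 / n) := by
    refine (measure_exists_le hcard (a := n * (2 * exp (-(4 * L)))) (by positivity)
      fun u => ?_).trans (ofReal_le_ofReal ?_)
    · refine (iid_exists_le (P := P) (p := fun o => 4 * L / c < U u o ^ 2)).trans ?_
      have ht := (hU u).tail (4 * L / c) hc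
      rw [mul_div_cancel₀ _ hc.ne'] at ht
      refine (mul_le_mul_right ht _).trans_eq ?_
      simp
    · have e : 4 * exp L * (n * (2 * exp (-(4 * L)))) =
          8 * (n * (exp (-L) * (exp (-L) * exp (-L)))) := by
        have : exp L * exp (-(4 * L)) =
            exp (-L) * (exp (-L) * exp (-L)) := by
          rw [← exp_add, ← exp_add, ← exp_add]; congr 1; ring
        linear_combination 8 * n * this
      rw [e]
      have h2 : (n : ℝ) * (exp (-L) * (exp (-L) * exp (-L))) ≤
          n * (1 / n * (1 / n * 1)) := by
        have : exp (-L) ≤ 1 := Real.exp_le_one_iff.2 (by linarith)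
        gcongr
      calc 8 * ((n : ℝ) * (exp (-L) * (exp (-L) * exp (-L)))) ≤
          8 * (n * (1 / n * (1 / n * 1))) := by gcongr
        _ = 8 / n := by field_simp
  have e2 : exp L * exp (-(2 * L)) = exp (-L) := by rw [← exp_add]; congr 1; ring
  have hfour : 4 * exp L * exp (-(2 * L)) ≤ 4 / n := by rw [mul_assoc, e2, ← mul_one_div]; gcongr
  have B2 : iid P n {r | ∃ u : ι, (∀ i, U u (r i) ^ 2 ≤ 4 * L / c) ∧
      n * (32 / c ^ 2) ≤ ∑ i, U u (r i) ^ 4} ≤ ofReal (4 / n) := by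
    refine (measure_exists_le hcard (a := exp (-(2 * L))) (by positivity)
      fun u => ?_).trans (ofReal_le_ofReal hfour)
    refine ((hU u).iid_pow_four hc (B := 4 * L / c) (by positivity)).trans
      (ofReal_le_ofReal (Real.exp_le_exp.2 (neg_le_neg ?_)))
    rw [mul_div_cancel₀ _ hc.ne', le_div_iff₀ (by positivity)]
    nlinarith
  have B3 : iid P n {r | ∃ u : ι, (2 * L + 2) / c ≤
      ∑ i, excess (log n / c) (U u) (r i)} ≤ ofReal (4 / n) := by
    refine (measure_exists_le hcard (a := exp (-(2 * L))) (by positivity)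
      fun u => ?_).trans (ofReal_le_ofReal hfour)
    refine ((hU u).iid_excess hc _ _).trans_eq ?_
    grind
  have B4 : iid P n {r | ∃ uv : ι × ι, ∑ i, U uv.1 (r i) ^ 4 ≤ n * (32 / c ^ 2) ∧
      ∑ i, U uv.2 (r i) ^ 4 ≤ n * (32 / c ^ 2) ∧ 8 * (n * (76 / c ^ 2)) * (3 * L) ≤
        (∑ i, U uv.1 (r i) * U uv.2 (r i) - n * ∫ o, U uv.1 o * U uv.2 o ∂P) ^ 2} ≤
      ofReal (32 / n) := by
    have hcard2 : (Fintype.card (ι × ι) : ℝ) ≤ 16 * (exp L * exp L) := by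
      rw [Fintype.card_prod, Nat.cast_mul]
      nlinarith
    refine (measure_exists_le hcard2 (a := 2 * exp (-(3 * L))) (by positivity)
      fun uv => (hU uv.1).iid_mul (hU uv.2) hc hn0 (3 * L)).trans (ofReal_le_ofReal ?_)
    have : exp L * exp L * exp (-(3 * L)) = exp (-L) := by rw [← exp_add, ← exp_add]; congr 1; ring
    grind
  set Λ := n * log n * ((7 + 20 * A) / c) with hΛ
  have hΛ0 : 0 < Λ := by positivity
  have B5 : iid P n {r | ∃ u : ι, OrthoSystem.GramOK f 1 r ∧ ∑ i, excess (log n / c) (U u) (r i) ≤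
      (2 * L + 2) / c ∧ 8 * Λ * (k + 2 * L) ≤
        ∑ a, (∑ i, f (r i) a * U u (r i) - n * ∫ o, f o a * U u o ∂P) ^ 2} ≤
      ofReal (4 / n) := by
    refine (measure_exists_le hcard (a := exp (-(2 * L))) (by positivity)
      fun u => ?_).trans (ofReal_le_ofReal hfour)
    refine (hf.iid_vec (hU u) hc (T := log n / c) (by positivity) hΛ0 ?_ _).trans
      (ofReal_le_ofReal ?_)
    · rw [hexcL, hΛ]
      have hM : M ≤ A * n := le_trans (by nlinarith) hΞL
      have h1 : 7 * n * (log n / c) + 2 * M * ((2 * L + 2) / c) + 3 * n * M * (2 * (1 / n) / c)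
          = (7 * n * log n + 4 * (M * L) + 10 * M) / c := by field_simp; ring
      rw [h1, ← mul_div_assoc]
      refine div_le_div_of_nonneg_right ?_ hc.le
      have : A * n ≤ A * n * log n := le_mul_of_one_le_right (by positivity) hn
      nlinarith
    · rw [show -((k : ℝ) + 2 * L) = k * (-1) + -(2 * L) by ring, exp_add, exp_nat_mul,
        ← mul_assoc, ← mul_pow]
      refine mul_le_of_le_one_left (exp_pos _).le (pow_le_one₀ (by positivity) ?_)
      rw [exp_neg, ← div_eq_mul_inv, div_le_one (exp_pos _)]
      have : √2 ≤ 2 := Real.sqrt_le_sqrt_iff' (by norm_num) |>.2 (by norm_num : (2 : ℝ) ≤ 4) |>.trans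
        (by rw [show (4 : ℝ) = 2 ^ 2 by norm_num, sqrt_sq (by norm_num)])
      linarith [add_one_le_exp (1 : ℝ)]
  have hsub : {r : Fin n → O | OrthoSystem.GramOK f 1 r ∧ ¬ FamGood P U f c L A r} ⊆
      {r | ∃ u : ι, ∃ i, 4 * L / c < U u (r i) ^ 2} ∪
      ({r | ∃ u : ι, (∀ i, U u (r i) ^ 2 ≤ 4 * L / c) ∧ n * (32 / c ^ 2) ≤ ∑ i, U u (r i) ^ 4} ∪
      ({r | ∃ u : ι, (2 * L + 2) / c ≤ ∑ i, excess (log n / c) (U u) (r i)} ∪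
      ({r | ∃ uv : ι × ι, ∑ i, U uv.1 (r i) ^ 4 ≤ n * (32 / c ^ 2) ∧
        ∑ i, U uv.2 (r i) ^ 4 ≤ n * (32 / c ^ 2) ∧ 8 * (n * (76 / c ^ 2)) * (3 * L) ≤
          (∑ i, U uv.1 (r i) * U uv.2 (r i) - n * ∫ o, U uv.1 o * U uv.2 o ∂P) ^ 2} ∪
      {r | ∃ u : ι, OrthoSystem.GramOK f 1 r ∧ ∑ i, excess (log n / c) (U u) (r i) ≤
        (2 * L + 2) / c ∧ 8 * Λ * (k + 2 * L) ≤
          ∑ a, (∑ i, f (r i) a * U u (r i) - n * ∫ o, f o a * U u o ∂P) ^ 2}))) := by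
    rintro r ⟨hG, hbad⟩
    by_contra hcon
    simp only [Set.mem_union, Set.mem_ofPred_eq, not_or, not_exists, not_lt, not_and, not_le]
      at hcon
    obtain ⟨h1, h2, h3, h4, h5⟩ := hcon
    refine hbad ⟨h1, fun u => (h2 u (h1 u)).le, fun u => (h3 u).le, fun u v => ?_, fun u => ?_⟩
    · exact (h4 (u, v) (h2 u (h1 u)).le (h2 v (h1 v)).le).le
    · exact (h5 u hG (h3 u).le).le
  refine (measure_mono hsub).trans ((measure_union_le _ _).trans ((add_le_add B1
    ((measure_union_le _ _).trans (add_le_add B2 ((measure_union_le _ _).trans (add_le_add B3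
    ((measure_union_le _ _).trans (add_le_add B4 B5))))))).trans ?_))
  rw [← ofReal_add (by positivity) (by positivity),
    ← ofReal_add (by positivity) (by positivity),
    ← ofReal_add (by positivity) (by positivity),
    ← ofReal_add (by positivity) (by positivity)]
  refine ofReal_le_ofReal (le_of_eq ?_)
  ring

end Family

section Measurability

variable {α : Type*} [MeasurableSpace α] {n k : ℕ}

lemma measurable_matrix_det {A : α → Matrix (Fin k) (Fin k) ℝ}
    (hA : ∀ i j, Measurable fun x => A x i j) : Measurable fun x => (A x).det := by
  simp only [Matrix.det_apply]
  fun_prop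

lemma measurable_matrix_inv {A : α → Matrix (Fin k) (Fin k) ℝ}
    (hA : ∀ i j, Measurable fun x => A x i j) (i j : Fin k) : Measurable fun x => (A x)⁻¹ i j := by
  have h1 : Measurable fun x => (A x).adjugate i j := by
    simp only [Matrix.adjugate_apply]
    refine measurable_matrix_det fun a b => ?_
    by_cases h : a = j
    · subst h; simp
    · simpa [Matrix.updateRow_ne h] using hA a b
  have h2 : ∀ x, (A x)⁻¹ i j = ((A x).det)⁻¹ * (A x).adjugate i j := fun x => by
    rw [Matrix.inv_def, Matrix.smul_apply, Ring.inverse_eq_inv', smul_eq_mul]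
  simp only [h2]
  exact (measurable_matrix_det hA).inv.mul h1

lemma measurable_projM {F : α → Matrix (Fin n) (Fin k) ℝ}
    (hF : ∀ i a, Measurable fun x => F x i a) (i j : Fin n) :
    Measurable fun x => projM (F x) i j := by
  have h1 : ∀ a b, Measurable fun x => ((F x)ᵀ * F x) a b := fun a b => by
    simp only [Matrix.mul_apply, transpose_apply]
    fun_prop
  have h2 := fun a b => measurable_matrix_inv h1 a b
  have e : ∀ x, projM (F x) i j = ∑ b, (∑ a, F x i a * ((F x)ᵀ * F x)⁻¹ a b) * F x j b :=
    fun x => by rw [projM, Matrix.mul_apply]; rfl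
  simp only [e]
  exact measurable_sum _ fun b _ => (measurable_sum _ fun a _ => (hF i a).mul (h2 a b)).mul (hF j b)

end Measurability

section Projection

variable {O J : Type*} [MeasurableSpace O] [MeasurableSpace J] {P : Measure O}
  [IsProbabilityMeasure P] {n k : ℕ} {T : O → J} {q : J → Fin k → ℝ} {u : O → ℝ} {c M : ℝ}

/-- The matrix with rows `q (t i)`. -/
def rowsM (q : J → Fin k → ℝ) (t : Fin n → J) : Matrix (Fin n) (Fin k) ℝ := of fun i a => q (t i) a

/-- The sieve design matrix of a sample. -/
local notation "Rows" r:max => rowsM q fun l => T (r l)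

lemma measurable_projM_rowsM (hq : Measurable q) (i j : Fin n) :
    Measurable fun t : Fin n → J => projM (rowsM q t) i j := by
  refine measurable_projM (fun i a => ?_) i j
  exact (measurable_pi_apply a).comp (hq.comp (measurable_pi_apply i))

lemma CondZero.integral_projM (hT : Measurable T) (hq : Measurable q) (hum : Measurable u)
    (hu : CondZero P T u) (hu2 : MemLp u 2 P) :
    ∫ r, nsq (projM (Rows r) *ᵥ fun l => u (r l)) ∂(iid P n) =
      ∫ r, ∑ i, projM (Rows r) i i * u (r i) ^ 2 ∂(iid P n) := by
  have hTT : Measurable fun (r : Fin n → O) (l : Fin n) => T (r l) := by fun_prop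
  have hb : ∀ i j : Fin n, Measurable fun t : Fin n → J => projM (rowsM q t) i j :=
    fun i j => measurable_projM_rowsM hq i j
  have hmem : ∀ i j : Fin n, MemLp (fun r : Fin n → O =>
      projM (Rows r) i j * u (r j)) 2 (iid P n) := fun i j => by
    refine (memLp_iid_eval hu2 j).mono
      (((hb i j).comp hTT).mul (hum.comp (measurable_pi_apply j))).aestronglyMeasurable
      (.of_forall fun r => ?_)
    rw [norm_mul]
    exact mul_le_of_le_one_left (norm_nonneg _) (abs_projM_le_one _ i j)
  have hint1 : ∀ i : Fin n, Integrable (fun r : Fin n → O =>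
      (∑ j, projM (Rows r) i j * u (r j)) ^ 2) (iid P n) := fun i =>
    (memLp_finsetSum _ fun j _ => hmem i j).integrable_sq
  have hint2 : ∀ i j : Fin n, Integrable (fun r : Fin n → O =>
      projM (Rows r) i j ^ 2 * u (r j) ^ 2) (iid P n) := fun i j => by
    refine (hmem i j).integrable_sq.congr (.of_forall fun r => ?_)
    simp only [mul_pow]
  simp only [dotProduct, mulVec, ← sq]
  rw [integral_finsetSum _ fun i _ => hint1 i]
  calc ∑ i, ∫ r, (∑ j, projM (Rows r) i j * u (r j)) ^ 2 ∂(iid P n)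
      = ∑ i, ∫ r, ∑ j, projM (Rows r) i j ^ 2 * u (r j) ^ 2 ∂(iid P n) :=
        sum_congr rfl fun i _ => hu.integral_sq_sum hT hum hu2
          (b := fun j t => projM (rowsM q t) i j) (hb i) (fun j t => abs_projM_le_one _ i j)
    _ = ∫ r, ∑ i, ∑ j, projM (Rows r) i j ^ 2 * u (r j) ^ 2 ∂(iid P n) :=
        (integral_finsetSum _ fun i _ => integrable_finsetSum _ fun j _ => hint2 i j).symm
    _ = _ := by
        refine integral_congr_ae (.of_forall fun r => ?_)
        show ∑ i, ∑ j, projM (Rows r) i j ^ 2 * u (r j) ^ 2 = _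
        rw [sum_comm]
        refine sum_congr rfl fun j _ => ?_
        rw [projM_diag, sum_mul]
        refine sum_congr rfl fun i _ => ?_
        congr 2
        conv_lhs => rw [← projM_transpose, transpose_apply]

lemma integrable_projM_diag (hT : Measurable T) (hq : Measurable q) (hu2 : MemLp u 2 P)
    (i : Fin n) :
    Integrable (fun r => projM (Rows r) i i * u (r i) ^ 2) (iid P n) := by
  have hTT : Measurable fun (r : Fin n → O) (l : Fin n) => T (r l) := by fun_prop
  have h1 := (memLp_iid_eval hu2 i).integrable_sq
  refine h1.mono (((measurable_projM_rowsM hq i i).comp hTT).aestronglyMeasurable.mul h1.1)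
    (.of_forall fun r => ?_)
  rw [norm_mul]
  exact mul_le_of_le_one_left (norm_nonneg _) (abs_projM_le_one _ i i)

lemma CondZero.integral_projM_le_of_sg (hT : Measurable T) (hq : Measurable q)
    (hu : CondZero P T u) (hsg : SG P c u) (hc : 0 < c) {B : ℝ} (hB : 0 ≤ B) :
    ∫ r, nsq (projM (Rows r) *ᵥ fun l => u (r l)) ∂(iid P n) ≤
      k * B + n * (2 * exp (-(c * B)) / c) := by
  rw [hu.integral_projM hT hq hsg.meas (hsg.memLp_two hc)]
  have hex := hsg.integral_excess hc B
  have hexi : ∀ i : Fin n, Integrable (fun r : Fin n → O => excess B u (r i)) (iid P n) :=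
    fun i => integrable_iid_eval i hex.1
  calc ∫ r, ∑ i, projM (Rows r) i i * u (r i) ^ 2 ∂(iid P n)
      ≤ ∫ r, (k * B + ∑ i, excess B u (r i)) ∂(iid P n) := by
        refine integral_mono (integrable_finsetSum _ fun i _ =>
          integrable_projM_diag hT hq (hsg.memLp_two hc) i)
          ((integrable_const _).add (integrable_finsetSum _ fun i _ => hexi i)) fun r => ?_
        calc ∑ i, projM (Rows r) i i * u (r i) ^ 2
            ≤ ∑ i, (projM (Rows r) i i * B + excess B u (r i)) := by
              refine sum_le_sum fun i _ => ?_
              have h1 := projM_diag_mem (Rows r) i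
              have h2 := sq_le_add_excess B u (r i)
              have h3 := excess_nonneg B u (r i)
              nlinarith
          _ = (∑ i, projM (Rows r) i i) * B + ∑ i, excess B u (r i) := by
              rw [sum_add_distrib, sum_mul]
          _ ≤ _ := by
              gcongr
              exact sum_projM_diag_le _
    _ = k * B + n * ∫ o, excess B u o ∂P := by
        rw [integral_add (integrable_const _) (integrable_finsetSum _ fun i _ => hexi i),
          integral_const, probReal_univ, one_smul, integral_finsetSum _ fun i _ => hexi i]
        simp [integral_iid_eval _ hex.1.1]
    _ ≤ _ := by gcongr; exact hex.2

lemma CondZero.integral_projM_le_of_condSqLE (hT : Measurable T) (hq : Measurable q)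
    (hum : Measurable u) (hu : CondZero P T u) (hu2 : MemLp u 2 P) {v : ℝ} (hv : 0 ≤ v)
    (hsq : CondSqLE P T u v) :
    ∫ r, nsq (projM (Rows r) *ᵥ fun l => u (r l)) ∂(iid P n) ≤ v * k := by
  have hTT : Measurable fun (r : Fin n → O) (l : Fin n) => T (r l) := by fun_prop
  rw [hu.integral_projM hT hq hum hu2]
  have hii : ∀ i : Fin n, Integrable (fun r : Fin n → O => projM (Rows r) i i) (iid P n) := fun i =>
    Integrable.of_bound (C := 1) ((measurable_projM_rowsM hq i i).comp hTT).aestronglyMeasurable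
      (.of_forall fun r => abs_projM_le_one _ i i)
  have hstep : ∀ i : Fin n, ∫ r, projM (Rows r) i i * u (r i) ^ 2 ∂(iid P n) ≤
      v * ∫ r, projM (Rows r) i i ∂(iid P n) := by
    intro i
    have h := hsq.lintegral_iid hT hum i (H := fun t => ofReal (projM (rowsM q t) i i))
      (measurable_projM_rowsM hq i i).ennreal_ofReal
    have h0 : ∀ r : Fin n → O, 0 ≤ projM (Rows r) i i := fun r => (projM_diag_mem _ i).1
    have hI : 0 ≤ ∫ r, projM (Rows r) i i ∂(iid P n) := integral_nonneg h0
    rw [← ofReal_integral_eq_lintegral_ofReal (hii i) (.of_forall h0), ← ofReal_mul hv] at h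
    rw [← ENNReal.ofReal_le_ofReal_iff (mul_nonneg hv hI),
      ofReal_integral_eq_lintegral_ofReal (integrable_projM_diag hT hq hu2 i)
        (.of_forall fun r => mul_nonneg (h0 r) (sq_nonneg _))]
    refine le_trans (lintegral_mono fun r => ?_) h
    rw [ofReal_mul (h0 r)]
  rw [integral_finsetSum _ fun i _ => integrable_projM_diag hT hq hu2 i]
  calc ∑ i, ∫ r, projM (Rows r) i i * u (r i) ^ 2 ∂(iid P n)
      ≤ ∑ i, v * ∫ r, projM (Rows r) i i ∂(iid P n) := sum_le_sum fun i _ => hstep i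
    _ = v * ∫ r, ∑ i, projM (Rows r) i i ∂(iid P n) := by
        rw [← mul_sum, integral_finsetSum _ fun i _ => hii i]
    _ ≤ v * ∫ _, (k : ℝ) ∂(iid P n) := by
        refine mul_le_mul_of_nonneg_left (integral_mono (integrable_finsetSum _ fun i _ => hii i)
          (integrable_const _) fun r => sum_projM_diag_le _) hv
    _ = v * k := by simp

lemma measurable_projM_mulVec (hT : Measurable T) (hq : Measurable q) (hum : Measurable u)
    (i : Fin n) : Measurable fun r : Fin n → O => (projM (Rows r) *ᵥ fun l => u (r l)) i := by
  have hTT : Measurable fun (r : Fin n → O) (l : Fin n) => T (r l) := by fun_prop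
  simp only [mulVec, dotProduct]
  exact measurable_sum _ fun j _ => ((measurable_projM_rowsM hq i j).comp hTT).mul
    (hum.comp (measurable_pi_apply j))

lemma measurable_residM (hT : Measurable T) (hq : Measurable q) (hum : Measurable u)
    (i : Fin n) : Measurable fun r : Fin n → O => residM (Rows r) (fun l => u (r l)) i := by
  simp only [residM, Pi.sub_apply]
  exact (hum.comp (measurable_pi_apply i)).sub (measurable_projM_mulVec hT hq hum i)

lemma memLp_residM (hT : Measurable T) (hq : Measurable q) (hum : Measurable u)
    (hu2 : MemLp u 2 P) (i : Fin n) : MemLp (fun r : Fin n → O =>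
      residM (Rows r) (fun l => u (r l)) i) 2 (iid P n) := by
  have h1 : MemLp (fun r : Fin n → O => ∑ l, |u (r l)|) 2 (iid P n) :=
    memLp_finsetSum _ fun l _ => (memLp_iid_eval hu2 l).abs
  refine ((memLp_iid_eval hu2 i).abs.add h1).mono
    (measurable_residM hT hq hum i).aestronglyMeasurable (.of_forall fun r => ?_)
  simp only [residM, Pi.sub_apply, Pi.add_apply, mulVec, dotProduct, norm_eq_abs]
  refine (abs_sub _ _).trans (le_trans (add_le_add_right ?_ _) (le_abs_self _))
  refine (abs_sum_le_sum_abs _ _).trans (sum_le_sum fun l _ => ?_)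
  rw [abs_mul]
  exact mul_le_of_le_one_left (abs_nonneg _) (abs_projM_le_one _ i l)

lemma integrable_residM_dot (hT : Measurable T) (hq : Measurable q) {v : O → ℝ}
    (hum : Measurable u) (hu2 : MemLp u 2 P) (hvm : Measurable v) (hv2 : MemLp v 2 P) :
    Integrable (fun r : Fin n → O => residM (Rows r) (fun l => u (r l)) ⬝
      residM (Rows r) (fun l => v (r l))) (iid P n) :=
  integrable_finsetSum _ fun i _ =>
    (memLp_residM hT hq hum hu2 i).integrable_mul (memLp_residM hT hq hvm hv2 i)

/-- The mean squared residual of a function of `T`, in terms of that of its sum with a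
conditionally centered variable. -/
lemma CondZero.integral_residM_le (hT : Measurable T) (hq : Measurable q)
    (hu : CondZero P T u) (hsg : SG P c u) (hc : 0 < c) {B : ℝ} (hB : 0 ≤ B)
    {h : J → ℝ} (hh : Measurable h) (hh2 : MemLp (fun o => h (T o)) 2 P) :
    ∫ r, nsq (residM (Rows r) (fun l => h (T (r l)))) ∂(iid P n) ≤
      ∫ r, nsq (residM (Rows r) (fun l => h (T (r l)) + u (r l))) ∂(iid P n)
      - n * ∫ o, u o ^ 2 ∂P + k * B + n * (2 * exp (-(c * B)) / c) := by
  have hu2 := hsg.memLp_two hc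
  have hum := hsg.meas
  have hTT : Measurable fun (r : Fin n → O) (l : Fin n) => T (r l) := by fun_prop
  set R := fun (v : O → ℝ) (r : Fin n → O) => residM (Rows r) (fun l => v (r l)) with hR
  set V : O → ℝ := fun o => h (T o)
  have hVm := hh.comp hT
  set Q := fun r : Fin n → O => nsq (projM (Rows r) *ᵥ fun l => u (r l)) with hQ
  have hpt : ∀ r : Fin n → O, R (fun o => V o + u o) r ⬝ R (fun o => V o + u o) r =
      R V r ⬝ R V r + 2 * (∑ i, R V r i * u (r i)) + ∑ i, u (r i) ^ 2 - Q r := by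
    intro r
    have e1 : R (fun o => V o + u o) r = R V r + R u r := residM_add _ _ _
    have e2 : R V r ⬝ R u r = ∑ i, R V r i * u (r i) := by
      simp only [hR]
      rw [← residM_dot, residM_residM]; rfl
    have e3 : R u r ⬝ R u r = ∑ i, u (r i) ^ 2 - Q r := by
      have := dot_self_eq_projM_add (Rows r) (fun l => u (r l))
      simp only [hR, hQ]
      have e4 : nsq (fun l => u (r l)) = ∑ i, u (r i) ^ 2 := by simp [dotProduct, sq]
      linarith
    rw [e1, add_dotProduct, dotProduct_add, dotProduct_add, dotProduct_comm (R u r) (R V r), e2, e3]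
    ring
  have iRR : Integrable (fun r => R V r ⬝ R V r) (iid P n) :=
    integrable_residM_dot hT hq hVm hh2 hVm hh2
  have iC : ∀ i, Integrable (fun r => R V r i * u (r i)) (iid P n) := fun i =>
    (memLp_residM hT hq hVm hh2 i).integrable_mul (memLp_iid_eval hu2 i)
  have iS : ∀ i : Fin n, Integrable (fun r : Fin n → O => u (r i) ^ 2) (iid P n) := fun i =>
    (memLp_iid_eval hu2 i).integrable_sq
  have iQ : Integrable Q (iid P n) := by
    refine integrable_finsetSum _ fun i _ => ?_
    have : MemLp (fun r : Fin n → O => (projM (Rows r) *ᵥ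
        fun l => u (r l)) i) 2 (iid P n) := by
      have := (memLp_iid_eval hu2 i).sub (memLp_residM (n := n) hT hq hum hu2 i)
      refine this.congr_norm (measurable_projM_mulVec hT hq hum i).aestronglyMeasurable
        (.of_forall fun r => ?_)
      simp [residM]
    exact this.integrable_mul this
  have hcross := fun i => by
    refine hu.integral_iid hT i (H := fun t => residM (rowsM q t) (fun l => h (t l)) i) ?_ (iC i)
    exact measurable_residM (T := id) (u := h) measurable_id hq hh i
  have hQle := hu.integral_projM_le_of_sg (n := n) hT hq hsg hc hB
  have hI : ∫ r, R (fun o => V o + u o) r ⬝ R (fun o => V o + u o) r ∂(iid P n) =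
      ∫ r, R V r ⬝ R V r ∂(iid P n) + n * ∫ o, u o ^ 2 ∂P - ∫ r, Q r ∂(iid P n) := by
    simp_rw [hpt]
    have i1 : Integrable (fun r => R V r ⬝ R V r + 2 * (∑ i, R V r i * u (r i))) (iid P n) :=
      iRR.add ((integrable_finsetSum _ fun i _ => iC i).const_mul 2)
    have i2 : Integrable (fun r : Fin n → O => ∑ i, u (r i) ^ 2) (iid P n) :=
      integrable_finsetSum _ fun i _ => iS i
    have i3 : Integrable (fun r => R V r ⬝ R V r + 2 * (∑ i, R V r i * u (r i)) +
      ∑ i, u (r i) ^ 2) (iid P n) := i1.add i2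
    rw [integral_sub i3 iQ, integral_add i1 i2,
      integral_add iRR ((integrable_finsetSum _ fun i _ => iC i).const_mul 2), integral_const_mul,
      integral_finsetSum _ fun i _ => iC i, sum_eq_zero fun i _ => hcross i,
      integral_finsetSum _ fun i _ => iS i]
    have : ∀ i : Fin n, ∫ r, u (r i) ^ 2 ∂(iid P n) = ∫ o, u o ^ 2 ∂P := fun i =>
      integral_iid_eval (f := fun o => u o ^ 2) i hu2.integrable_sq.1
    simp [this]
  linarith

end Projection

section SieveResidual

variable {O J : Type*} [MeasurableSpace O] [MeasurableSpace J] {P : Measure O}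
  [IsProbabilityMeasure P] {n k : ℕ} {T : O → J} {q : J → Fin k → ℝ} {c M : ℝ}

/-- The sieve design matrix of a sample. -/
local notation "Rows" r:max => DiD.rowsM q fun l => T (r l)

lemma OrthoSystem.GramOK.rowsM {τ : ℝ} {r : Fin n → O}
    (h : OrthoSystem.GramOK (fun o => q (T o)) τ r) (hn : 0 < n) (p : Fin k → ℝ) :
    (1 - τ) * n * nsq p ≤ nsq (Rows r *ᵥ p) := by
  have hnR : (0 : ℝ) < n := by exact_mod_cast hn
  have h1 := (abs_le.1 (h p)).1
  have e : nsq (Rows r *ᵥ p) =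
      ∑ i, (p ⬝ q (T (r i))) ^ 2 := by
    simp only [dotProduct, sq]
    refine sum_congr rfl fun i _ => ?_
    simp only [mulVec, dotProduct, DiD.rowsM, of_apply, mul_comm]
  rw [e]
  have h2 : (1 - τ) * nsq p ≤ (n : ℝ)⁻¹ * ∑ i, (p ⬝ q (T (r i))) ^ 2 := by linarith
  rw [inv_mul_eq_div, le_div_iff₀ hnR] at h2
  linarith

lemma transpose_rowsM_mulVec (t : Fin n → J) (v : Fin n → ℝ) (a : Fin k) :
    ((rowsM q t)ᵀ *ᵥ v) a = ∑ i, q (t i) a * v i := rfl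

/-- The mean of a product of a function of one draw and the indicator of an event that concerns
the other draws. -/
lemma integral_iid_indicator_removeNth {f : O → ℝ} (hf : Integrable f P) {m : ℕ}
    {B : Set (Fin m → O)} (hB : MeasurableSet B) (i : Fin (m + 1)) :
    Integrable (fun r : Fin (m + 1) → O => f (r i) * B.indicator 1 (i.removeNth r))
        (iid P (m + 1)) ∧
      ∫ r, f (r i) * B.indicator 1 (i.removeNth r) ∂(iid P (m + 1)) =
        (∫ o, f o ∂P) * (iid P m).real B := by
  have hmp := measurePreserving_piFinSuccAbove (fun _ : Fin (m + 1) => P) i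
  set e := MeasurableEquiv.piFinSuccAbove (fun _ : Fin (m + 1) => O) i
  set F : O × (Fin m → O) → ℝ := fun z => f z.1 * B.indicator (1 : (Fin m → O) → ℝ) z.2 with hF
  have hcomp : (fun r : Fin (m + 1) → O => f (r i) * B.indicator 1 (i.removeNth r)) = F ∘ e := by
    ext r; rfl
  have hi : Integrable (B.indicator (1 : (Fin m → O) → ℝ)) (iid P m) :=
    (integrable_const 1).indicator hB
  have hFi := hf.mul_prod hi
  rw [hcomp]
  refine ⟨(hmp.integrable_comp_emb e.measurableEmbedding).2 hFi, ?_⟩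
  calc ∫ r, (F ∘ e) r ∂(iid P (m + 1)) = ∫ z, F z ∂(P.prod (iid P m)) :=
        hmp.integral_comp e.measurableEmbedding F
    _ = (∫ o, f o ∂P) * ∫ y, B.indicator (1 : (Fin m → O) → ℝ) y ∂(iid P m) := integral_prod_mul f _
    _ = _ := by simp_all

lemma OrthoSystem.gramOK_of_removeNth {q : O → Fin k → ℝ} {m : ℕ} {r : Fin (m + 1) → O}
    (i : Fin (m + 1)) (hb : q (r i) ⬝ q (r i) ≤ M) (hM : 4 * (M + 1) ≤ m + 1)
    (h : OrthoSystem.GramOK q (1 / 4) (i.removeNth r)) : OrthoSystem.GramOK q (1 / 2) r := by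
  intro p
  have h1 := h p
  have hm : (0 : ℝ) ≤ m := by positivity
  set N := nsq p with hN
  have hN0 := nsq_nonneg p
  set S := ∑ l, (p ⬝ q (i.removeNth r l)) ^ 2 with hS
  have e : ∑ l, (p ⬝ q (r l)) ^ 2 = (p ⬝ q (r i)) ^ 2 + S := by rw [Fin.sum_univ_succAbove _ i]; rfl
  have h2 : |S - m * N| ≤ 1 / 4 * (m * N) := by
    rcases hm.eq_or_lt with h0 | h0
    · obtain rfl : m = 0 := by exact_mod_cast h0.symm
      simp [hS]
    · have : S - m * N = m * ((m : ℝ)⁻¹ * S - N) := by field_simp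
      rw [this, abs_mul, abs_of_pos h0]
      nlinarith
  have h3 : (p ⬝ q (r i)) ^ 2 ≤ M * N := by
    have := sq_dotProduct_le p (q (r i))
    nlinarith
  have hm1 : (0 : ℝ) < m + 1 := by positivity
  rw [e]
  push_cast
  have : ((m : ℝ) + 1)⁻¹ * ((p ⬝ q (r i)) ^ 2 + S) - N =
      ((p ⬝ q (r i)) ^ 2 + (S - m * N) - N) / (m + 1) := by field_simp; ring
  rw [this, abs_div, abs_of_pos hm1, div_le_iff₀ hm1, abs_le]
  obtain ⟨h5, h6⟩ := abs_le.1 h2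
  constructor <;> nlinarith

lemma condZero_unit {u : O → ℝ} (h0 : ∫ o, u o ∂P = 0) : CondZero P (fun _ : O => ()) u := by
  intro h _ _
  rw [integral_const_mul, h0, mul_zero]

lemma OrthoSystem.integral_sq_sum_le (h : OrthoSystem P (fun o => q (T o)) M) {η : O → ℝ}
    (hηm : Measurable η) (hη : MemLp η 2 P) (h0 : ∀ a, ∫ o, q (T o) a * η o ∂P = 0) :
    Integrable (fun r : Fin n → O => ∑ a, (∑ i, q (T (r i)) a * η (r i)) ^ 2) (iid P n) ∧
    ∫ r, ∑ a, (∑ i, q (T (r i)) a * η (r i)) ^ 2 ∂(iid P n) =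
      n * ∫ o, (q (T o) ⬝ q (T o)) * η o ^ 2 ∂P := by
  have hmem := fun a => h.memLp_mul hη a
  have hm : ∀ a, Measurable fun o => q (T o) a * η o := fun a =>
    ((measurable_pi_apply a).comp h.meas).mul hηm
  have hi : ∀ a, Integrable (fun r : Fin n → O => (∑ i, q (T (r i)) a * η (r i)) ^ 2)
      (iid P n) := fun a =>
    (memLp_finsetSum _ fun i _ => memLp_iid_eval (hmem a) i).integrable_sq
  refine ⟨integrable_finsetSum _ fun a _ => hi a, ?_⟩
  rw [integral_finsetSum _ fun a _ => hi a]
  have h1 : ∀ a, ∫ r, (∑ i, q (T (r i)) a * η (r i)) ^ 2 ∂(iid P n) =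
      n * ∫ o, (q (T o) a * η o) ^ 2 ∂P := fun a => by
    have := (condZero_unit (h0 a)).integral_sq_sum (n := n) measurable_const (hm a) (hmem a)
      (b := fun _ _ => 1) (fun _ => measurable_const) (B := 1) (fun _ _ => by simp)
    simp only [one_mul, one_pow] at this
    rw [this, integral_finsetSum _ fun i _ => (memLp_iid_eval (hmem a) i).integrable_sq]
    have e : ∀ i : Fin n, ∫ r, (q (T (r i)) a * η (r i)) ^ 2 ∂(iid P n) =
        ∫ o, (q (T o) a * η o) ^ 2 ∂P := fun i =>
      integral_iid_eval (f := fun o => (q (T o) a * η o) ^ 2) i (hmem a).integrable_sq.1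
    simp [e]
  simp_rw [h1]
  rw [← mul_sum, ← integral_finsetSum _ fun a _ => (hmem a).integrable_sq]
  congr 1
  refine integral_congr_ae (.of_forall fun o => ?_)
  simp only [dotProduct, sum_mul]
  exact sum_congr rfl fun a _ => by ring

lemma OrthoSystem.integral_mul_sq_le (h : OrthoSystem P (fun o => q (T o)) M) {η : O → ℝ}
    (hη : MemLp η 2 P) : ∫ o, (q (T o) ⬝ q (T o)) * η o ^ 2 ∂P ≤ M * ∫ o, η o ^ 2 ∂P := by
  rw [← integral_const_mul]
  refine integral_mono_of_nonneg (.of_forall fun o => mul_nonneg (nsq_nonneg _)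
    (sq_nonneg _)) (hη.integrable_sq.const_mul _) ?_
  filter_upwards [h.bound] with o ho
  gcongr

set_option maxHeartbeats 1000000 in
/-- The mean squared in-sample residual is at least half the population residual. -/
lemma OrthoSystem.integral_residM_ge (hT : Measurable T) (hq : Measurable q)
    (h : OrthoSystem P (fun o => q (T o)) M) {V : J → ℝ} (hV : Measurable V)
    (hV2 : MemLp (fun o => V (T o)) 2 P) {γ : Fin k → ℝ}
    (hγ : ∀ a, ∫ o, q (T o) a * (V (T o) - q (T o) ⬝ γ) ∂P = 0) (hk : 0 < k)
    (hn : 256 * (k * M) ≤ n) :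
    n / 2 * ∫ o, (V (T o) - q (T o) ⬝ γ) ^ 2 ∂P ≤
      ∫ r, nsq (residM (Rows r) (fun l => V (T (r l)))) ∂(iid P n) := by
  have hk1 : (1 : ℝ) ≤ k := by exact_mod_cast hk
  have hΞk := h.k_le
  have hΞ1 : 1 ≤ M := hk1.trans hΞk
  have hΞn : 256 * M ≤ n := le_trans (by nlinarith) hn
  set η : O → ℝ := fun o => V (T o) - q (T o) ⬝ γ with hη
  have hφγ : MemLp (fun o => q (T o) ⬝ γ) 2 P := by
    have := memLp_dotProduct (fun a => h.memLp a) γ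
    simpa only [dotProduct_comm γ] using this
  have hηm : Measurable η := (hV.comp hT).sub (measurable_dotProduct h.meas measurable_const)
  have hη2 : MemLp η 2 P := hV2.sub hφγ
  obtain ⟨m, rfl⟩ : ∃ m, n = m + 1 := by
    refine ⟨n - 1, ?_⟩
    have : 0 < n := by
      rcases Nat.eq_zero_or_pos n with h0 | h0
      · subst h0; norm_num at hΞn; linarith
      · exact h0
    omega
  push_cast at hn hΞn ⊢
  have hm255 : (255 : ℝ) ≤ m := by linarith
  have hm0 : 0 < m := by
    have : (0 : ℝ) < m := by linarith
    exact_mod_cast this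
  set Bad : Set (Fin m → O) := {y | ¬ OrthoSystem.GramOK (fun o => q (T o)) (1 / 4) y}
  set B := toMeasurable (iid P m) Bad
  have hBm : MeasurableSet B := measurableSet_toMeasurable _ _
  have hBP : (iid P m).real B ≤ 1 / 8 := by
    have h1 : iid P m B ≤ ofReal (1 / 8) := by
      rw [measure_toMeasurable]
      refine (h.iid_gram hm0 (by norm_num : (0 : ℝ) < 1 / 4)).trans (ofReal_le_ofReal ?_)
      rw [div_le_iff₀ (by positivity)]
      nlinarith
    exact ENNReal.toReal_le_of_le_ofReal (by norm_num) h1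
  set S := fun r : Fin (m + 1) → O => ∑ a, (∑ i, q (T (r i)) a * η (r i)) ^ 2
  obtain ⟨hSi, hSe⟩ := h.integral_sq_sum_le (n := m + 1) hηm hη2 hγ
  have hSle := (hSe.le.trans (mul_le_mul_of_nonneg_left (h.integral_mul_sq_le hη2) (by positivity)))
  have hη2i := hη2.integrable_sq
  have hloo := fun i => integral_iid_indicator_removeNth (P := P) hη2i hBm i
  set I := ∫ o, η o ^ 2 ∂P
  have hI0 : 0 ≤ I := integral_nonneg fun o => sq_nonneg _
  set lower := fun r : Fin (m + 1) → O => ∑ i, η (r i) ^ 2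
    - ∑ i, η (r i) ^ 2 * B.indicator 1 (i.removeNth r) - 2 / (m + 1) * S r with hlower
  have iη : ∀ i : Fin (m + 1), Integrable (fun r : Fin (m + 1) → O => η (r i) ^ 2)
      (iid P (m + 1)) := fun i => (memLp_iid_eval hη2 i).integrable_sq
  have i1 : Integrable (fun r : Fin (m + 1) → O => ∑ i, η (r i) ^ 2) (iid P (m + 1)) :=
    integrable_finsetSum _ fun i _ => iη i
  have i2 : Integrable (fun r : Fin (m + 1) → O => ∑ i, η (r i) ^ 2 *
      B.indicator 1 (i.removeNth r)) (iid P (m + 1)) :=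
    integrable_finsetSum _ fun i _ => (hloo i).1
  have hlowI : (m + 1) / 2 * I ≤ ∫ r, lower r ∂(iid P (m + 1)) := by
    have i12 : Integrable (fun r : Fin (m + 1) → O => ∑ i, η (r i) ^ 2 - ∑ i, η (r i) ^ 2 *
      B.indicator 1 (i.removeNth r)) (iid P (m + 1)) := i1.sub i2
    simp only [hlower]
    rw [integral_sub i12 (hSi.const_mul _), integral_sub i1 i2,
      integral_const_mul, integral_finsetSum _ fun i _ => iη i,
      integral_finsetSum _ fun i _ => (hloo i).1]
    have e1 : ∀ i : Fin (m + 1), ∫ r, η (r i) ^ 2 ∂(iid P (m + 1)) = I := fun i =>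
      integral_iid_eval (f := fun o => η o ^ 2) i hη2i.1
    have e2 : ∀ i : Fin (m + 1), ∫ r, η (r i) ^ 2 * B.indicator 1 (i.removeNth r) ∂(iid P (m + 1))
        ≤ I * (1 / 8) := fun i => by
      rw [(hloo i).2]; exact mul_le_mul_of_nonneg_left hBP hI0
    have e3 := sum_le_sum fun i (_ : i ∈ univ) => e2 i
    simp only [e1]
    simp only [sum_const, card_univ, Fintype.card_fin, nsmul_eq_mul] at e3 ⊢
    push_cast at e3 hSle ⊢
    have e4 : 2 / ((m : ℝ) + 1) * ∫ r, S r ∂(iid P (m + 1)) ≤ 2 * (M * I) := by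
      calc 2 / ((m : ℝ) + 1) * ∫ r, S r ∂(iid P (m + 1))
          ≤ 2 / ((m : ℝ) + 1) * ((m + 1) * (M * I)) :=
            mul_le_mul_of_nonneg_left hSle (by positivity)
        _ = _ := by field_simp
    nlinarith
  refine hlowI.trans (integral_mono_ae ((i1.sub i2).sub (hSi.const_mul _))
    (integrable_residM_dot hT hq (hV.comp hT) hV2 (hV.comp hT) hV2) ?_)
  filter_upwards [ae_iid_of_ae h.bound] with r hr
  have hS0 : 0 ≤ S r := sum_nonneg fun a _ => sq_nonneg _
  have hR0 : 0 ≤ nsq (residM (Rows r) (fun l => V (T (r l)))) := nsq_nonneg _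
  show lower r ≤ _
  by_cases hG : OrthoSystem.GramOK (fun o => q (T o)) (1 / 2) r
  · have hgram := hG.rowsM (Nat.succ_pos m)
    norm_num at hgram
    set D := Rows r with hD
    have hpos : (0 : ℝ) < 1 / 2 * (m + 1) := by positivity
    have hU := isUnit_gram hpos hgram
    have e1 : (fun l => V (T (r l))) = (fun l => η (r l)) + D *ᵥ γ := by
      ext l
      simp only [hη, Pi.add_apply, hD]
      have : (Rows r *ᵥ γ) l = q (T (r l)) ⬝ γ := rfl
      rw [this]; ring
    have e2 : residM D (fun l => V (T (r l))) = residM D fun l => η (r l) := by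
      rw [e1, residM_add]
      have : residM D (D *ᵥ γ) = 0 := by rw [residM, mulVec_mulVec, projM_mul D hU, sub_self]
      rw [this, add_zero]
    have h3 := projM_dot_self_le_of_gram hpos hgram fun l => η (r l)
    have h4 := dot_self_eq_projM_add D fun l => η (r l)
    have h5 : nsq (Dᵀ *ᵥ fun l => η (r l)) = S r := by
      simp only [dotProduct, ← sq, S]
      rfl
    have h6 : nsq (fun l => η (r l)) = ∑ i, η (r i) ^ 2 := by simp [dotProduct, sq]
    rw [h5] at h3
    rw [h6] at h4
    rw [e2]
    have h7 : S r / (1 / 2 * ((m : ℝ) + 1)) = 2 / (m + 1) * S r := by field_simp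
    rw [h7] at h3
    have h8 : 0 ≤ ∑ i, η (r i) ^ 2 * B.indicator (1 : (Fin m → O) → ℝ) (i.removeNth r) :=
      sum_nonneg fun i _ => mul_nonneg (sq_nonneg _)
        (Set.indicator_nonneg (fun _ _ => zero_le_one) _)
    simp only [hlower]
    linarith
  · have hbad : ∀ i : Fin (m + 1), B.indicator (1 : (Fin m → O) → ℝ) (i.removeNth r) = 1 := by
      intro i
      refine Set.indicator_of_mem (subset_toMeasurable _ _ ?_) _
      intro hok
      exact hG (OrthoSystem.gramOK_of_removeNth i (hr i) (by linarith) hok)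
    simp only [hlower, hbad, mul_one, sub_self]
    have : 0 ≤ 2 / ((m : ℝ) + 1) * S r := by positivity
    linarith

end SieveResidual

/-- Relations between the sample size `n`, the sieve dimension `k`, `L = log p`, and the bound `R`
on the squared norm of the sieve functions. -/
structure Scal (A : ℝ) (n k : ℕ) (L R : ℝ) : Prop where
  one_le : 1 ≤ A
  log_n : 1 ≤ log n
  L_ge : log n ≤ L
  L_sq : L ^ 2 ≤ n
  L_log : L * log n ^ 2 ≤ n
  k_pos : 0 < k
  k_le : (k : ℝ) ≤ R
  grow : k * R * L ≤ A * n

namespace Scal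

variable {A L R : ℝ} {n k : ℕ}

lemma n_pos (h : Scal A n k L R) : 0 < n := by
  rcases Nat.eq_zero_or_pos n with h0 | h0
  · have := h.log_n; subst h0; norm_num at this
  · exact h0

lemma nR_pos (h : Scal A n k L R) : (0 : ℝ) < n := by exact_mod_cast h.n_pos

lemma one_le_L (h : Scal A n k L R) : 1 ≤ L := h.log_n.trans h.L_ge

lemma one_le_k (h : Scal A n k L R) : (1 : ℝ) ≤ k := by exact_mod_cast h.k_pos

lemma one_le_Ξ (h : Scal A n k L R) : 1 ≤ R := h.one_le_k.trans h.k_le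

lemma ΞL_le (h : Scal A n k L R) : R * L ≤ A * n := by
  refine le_trans ?_ h.grow
  have := h.one_le_k
  have := mul_nonneg (zero_le_one.trans h.one_le_Ξ) (zero_le_one.trans h.one_le_L)
  nlinarith

lemma Ξ_le (h : Scal A n k L R) : R ≤ A * n :=
  (le_mul_of_one_le_right (zero_le_one.trans h.one_le_Ξ) h.one_le_L).trans h.ΞL_le

lemma kk_le (h : Scal A n k L R) : (k : ℝ) ^ 2 * L ≤ A * n := by
  refine le_trans ?_ h.grow
  rw [sq]
  have := h.one_le_L
  have := h.k_le
  gcongr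

lemma exp_ge (h : Scal A n k L R) : (n : ℝ) ≤ exp L := by
  rw [← Real.log_le_iff_le_exp h.nR_pos]; exact h.L_ge

lemma rate_pos (h : Scal A n k L R) : 0 < √(L / n) :=
  Real.sqrt_pos.2 (div_pos (zero_lt_one.trans_le h.one_le_L) h.nR_pos)

lemma rate_sq (h : Scal A n k L R) : √(L / n) ^ 2 = L / n :=
  sq_sqrt (div_nonneg (zero_le_one.trans h.one_le_L) h.nR_pos.le)

lemma le_rate_of_sq_le (h : Scal A n k L R) {x B : ℝ} (hB : 0 ≤ B) (hx : x ^ 2 * n ≤ B ^ 2 * L) :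
    x ≤ B * √(L / n) := by
  refine le_of_sq_le_sq ?_ (mul_nonneg hB h.rate_pos.le)
  rw [mul_pow, h.rate_sq, ← mul_div_assoc, le_div_iff₀ h.nR_pos]
  exact hx

lemma rate_mul_k (h : Scal A n k L R) : √(L / n) * k ≤ A := by
  have hA := h.one_le
  refine le_of_sq_le_sq ?_ (by linarith)
  rw [mul_pow, h.rate_sq, div_mul_eq_mul_div, div_le_iff₀ h.nR_pos]
  have := h.kk_le
  have := mul_le_mul_of_nonneg_right (le_self_pow₀ hA two_ne_zero) h.nR_pos.le
  linarith

lemma rate_mul_log (h : Scal A n k L R) : √(L / n) * log n ≤ 1 := by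
  refine le_of_sq_le_sq ?_ zero_le_one
  rw [mul_pow, h.rate_sq, div_mul_eq_mul_div, div_le_iff₀ h.nR_pos]
  linarith [h.L_log]

lemma k_log_le (h : Scal A n k L R) : k * log n / n ≤ A * √(L / n) := by
  have hA := h.one_le
  refine h.le_rate_of_sq_le (by linarith) ?_
  have hn := h.nR_pos
  have hL := h.one_le_L
  rw [div_pow, div_mul_eq_mul_div, div_le_iff₀ (by positivity)]
  have h1 : (k * log n) ^ 2 * L ≤ A * n * L ^ 2 := by
    have h2 : log n ^ 2 ≤ L ^ 2 := by have := h.log_n; have := h.L_ge; gcongr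
    calc (k * log n) ^ 2 * L = (k ^ 2 * L) * log n ^ 2 := by ring
      _ ≤ (A * n) * L ^ 2 := mul_le_mul h.kk_le h2 (sq_nonneg _) (by positivity)
  have h3 : (k * log n) ^ 2 ≤ A * n * L := by nlinarith
  calc (k * log n) ^ 2 * n ≤ A * n * L * n := by gcongr
    _ ≤ A ^ 2 * L * n ^ 2 := by
        have : 0 ≤ n * L * (n : ℝ) := by positivity
        have := mul_le_mul_of_nonneg_right (le_self_pow₀ hA two_ne_zero) this
        linarith

lemma L_log_le (h : Scal A n k L R) : L * log n / n ≤ 1 * √(L / n) := by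
  refine h.le_rate_of_sq_le zero_le_one ?_
  have hn := h.nR_pos
  have hL := h.one_le_L
  rw [div_pow, div_mul_eq_mul_div, div_le_iff₀ (by positivity)]
  have := h.L_log
  calc (L * log n) ^ 2 * n = L * n * (L * log n ^ 2) := by ring
    _ ≤ L * n * n := by gcongr
    _ = _ := by ring

lemma kL_log_le (h : Scal A n k L R) : (k + 2 * L) * log n / n ≤ (A + 2) * √(L / n) := by
  have h1 := h.k_log_le
  have h2 := h.L_log_le
  grind

lemma k_L_log_le (h : Scal A n k L R) : k * L * log n ≤ A * n := by
  have hA := h.one_le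
  have hL := h.one_le_L
  refine le_of_sq_le_sq ?_ (by positivity)
  calc (k * L * log n) ^ 2 = (k ^ 2 * L) * (L * log n ^ 2) := by ring
    _ ≤ (A * n) * n := mul_le_mul h.kk_le h.L_log (by positivity) (by positivity)
    _ ≤ (A * n) ^ 2 := by nlinarith

end Scal

section SieveErrors

variable {O : Type*} [MeasurableSpace O] {P : Measure O} [IsProbabilityMeasure P] {n k : ℕ}
  {ι : Type*} [Fintype ι] {c L R A G Cg : ℝ} {V η : ι → O → ℝ} {f : O → Fin k → ℝ}
  {γ : ι → Fin k → ℝ}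

/-- Constant in the bound for the empirical mean square of the sieve approximation errors. -/
def etaConst (A c G Cg : ℝ) : ℝ := 16 * (2 * (8 * A / c + 2 * G * A) + 3 * Cg * A)

/-- Uniform bound for the empirical mean squares of the sieve approximation errors `η_j`. -/
lemma iid_eta (h : Scal A n k L R) (hc : 0 < c) (hG : 0 < G) (hCg : 0 < Cg)
    (hφb : ∀ᵐ o ∂P, f o ⬝ f o ≤ R)
    (hη : ∀ j o, η j o = V j o - f o ⬝ γ j) (hηm : ∀ j, Measurable (η j))
    (hη2 : ∀ j, MemLp (η j) 2 P) (hγ : ∀ j, γ j ⬝ γ j ≤ G)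
    (hg : ∀ j, ∫ o, η j o ^ 2 ∂P ≤ Cg * √(L / n))
    (hcard : (Fintype.card ι : ℝ) ≤ 4 * exp L) :
    iid P n {q | ∃ j, (∀ i, V j (q i) ^ 2 ≤ 4 * L / c) ∧
      etaConst A c G Cg * (n * L / ((k + L) * log n)) ≤ ∑ i, η j (q i) ^ 2} ≤
      ofReal (4 / n) := by
  have hn := h.nR_pos
  have hL := h.one_le_L
  have hk := h.one_le_k
  have hA := h.one_le
  have hlog := h.log_n
  have hr := h.rate_pos
  have hR := h.one_le_Ξ
  set K := etaConst A c G Cg with hK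
  set D := 8 * A / c + 2 * G * A with hD
  have hD0 : 0 < D := by positivity
  have hKe : K = 16 * (2 * D + 3 * Cg * A) := rfl
  have hK0 : 0 < K := by rw [hKe]; positivity
  have hΞL := h.ΞL_le
  set x := K * (n * L / ((k + L) * log n)) with hx
  have key : ∃ M s : ℝ, 0 < M ∧ 0 ≤ s ∧ 8 * L / c + 2 * (R * G) ≤ M ∧
      n * (Cg * √(L / n) * exp s / M) - s * x / M ≤ -(2 * L) := by
    rcases lt_or_ge (k : ℝ) L with hkL | hkL
    · refine ⟨D * n / L, log (1 / √(L / n)), by positivity, ?_, ?_, ?_⟩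
      · refine Real.log_nonneg ?_
        rw [le_div_iff₀ hr, one_mul]
        refine Real.sqrt_le_one.2 ?_
        rw [div_le_one hn]; nlinarith [h.L_sq]
      · rw [le_div_iff₀ (by positivity)]
        have e : (8 * L / c + 2 * (R * G)) * L = 8 / c * L ^ 2 + 2 * G * (R * L) := by field_simp
        rw [e]
        have h1 : 8 / c * L ^ 2 ≤ 8 / c * (A * n) := by
          have := h.L_sq.trans (le_mul_of_one_le_left hn.le hA)
          gcongr
        have h2 : 2 * G * (R * L) ≤ 2 * G * (A * n) := by gcongr
        grind
      · have hes : exp (log (1 / √(L / n))) = 1 / √(L / n) :=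
          exp_log (by positivity)
        rw [hes]
        have e1 : n * (Cg * √(L / n) * (1 / √(L / n)) / (D * n / L)) = Cg * L / D := by field_simp
        rw [e1]
        have hs : log n / 4 ≤ log (1 / √(L / n)) := by
          rw [one_div, Real.log_inv, Real.log_sqrt (by positivity), Real.log_div (by positivity)
            (by positivity)]
          have : 2 * log L ≤ log n := by
            have := Real.log_le_log (by positivity) h.L_sq
            rwa [Real.log_pow] at this
          linarith
        have e2 : K * L / (8 * D) ≤ log (1 / √(L / n)) * x / (D * n / L) := by
          have h1 : log n / 4 * x / (D * n / L) ≤ log (1 / √(L / n)) * x / (D * n / L) := by gcongr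
          refine le_trans ?_ h1
          have e3 : log n / 4 * x / (D * n / L) = K * L * L / (4 * D * (k + L)) := by
            rw [hx]; field_simp
          rw [e3, div_le_div_iff₀ (by positivity) (by positivity)]
          have : 0 ≤ K * L * D := by positivity
          nlinarith
        have e4 : 2 * L + Cg * L / D ≤ K * L / (8 * D) := by
          rw [← sub_nonneg]
          have : K * L / (8 * D) - (2 * L + Cg * L / D) =
              (2 * D + (6 * A - 1) * Cg) * L / D := by
            rw [hKe]; field_simp; ring
          rw [this]
          have : 0 ≤ (6 * A - 1) * Cg := mul_nonneg (by linarith) hCg.le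
          positivity
        linarith
    · refine ⟨D * n / (k * log n), 1, by positivity, zero_le_one, ?_, ?_⟩
      · rw [le_div_iff₀ (by positivity)]
        have e : (8 * L / c + 2 * (R * G)) * (k * log n) =
            8 / c * (k * L * log n) + 2 * G * (k * R * log n) := by
          field_simp
        rw [e]
        have h1 : 8 / c * (k * L * log n) ≤ 8 / c * (A * n) := by
          exact mul_le_mul_of_nonneg_left h.k_L_log_le (by positivity)
        have h2 : 2 * G * (k * R * log n) ≤ 2 * G * (A * n) := by
          have := le_trans (mul_le_mul_of_nonneg_left h.L_ge (by positivity)) h.grow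
          gcongr
        grind
      · have e1 : n * (Cg * √(L / n) * exp 1 / (D * n / (k * log n))) =
            Cg * (√(L / n) * k) * exp 1 * log n / D := by
          field_simp
        rw [e1]
        have h1 : Cg * (√(L / n) * k) * exp 1 * log n / D ≤ Cg * A * 3 * L / D := by
          have := h.rate_mul_k
          have h3 : exp 1 ≤ 3 := by linarith [Real.exp_one_lt_d9]
          have := h.L_ge
          gcongr
        have e2 : K * L / (2 * D) ≤ 1 * x / (D * n / (k * log n)) := by
          have e3 : 1 * x / (D * n / (k * log n)) = K * L * k / (D * (k + L)) := by
            rw [hx]; field_simp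
          rw [e3, div_le_div_iff₀ (by positivity) (by positivity)]
          have : 0 ≤ K * L * D := by positivity
          nlinarith
        have e4 : 2 * L + Cg * A * 3 * L / D ≤ K * L / (2 * D) := by
          rw [← sub_nonneg]
          have : K * L / (2 * D) - (2 * L + Cg * A * 3 * L / D) =
              (14 * D + 21 * Cg * A) * L / D := by
            rw [hKe]; field_simp; ring
          rw [this]
          positivity
        linarith
  obtain ⟨M, s, hM, hs, hMle, hexp⟩ := key
  have hb : ∀ j, iid P n {q | (∀ i, V j (q i) ^ 2 ≤ 4 * L / c) ∧ x ≤ ∑ i, η j (q i) ^ 2} ≤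
      ofReal (exp (-(2 * L))) := by
    intro j
    refine (iid_le_of_ae (B := {q | (∀ i, η j (q i) ^ 2 ≤ M) ∧ x ≤ ∑ i, η j (q i) ^ 2}) hφb
      ?_).trans ((iid_sum_nonneg_ge_le (Y := fun o => η j o ^ 2) ((hηm j).pow_const 2)
        (fun o => sq_nonneg _) (hη2 j).integrable_sq (hg j) hM hs).trans
        (ofReal_le_ofReal (Real.exp_le_exp.2 hexp)))
    rintro q hq ⟨hV, hxω⟩
    refine ⟨fun i => ?_, hxω⟩
    rw [hη j]
    have h1 := (sq_dotProduct_le _ _).trans (mul_le_mul (hq i) (hγ j) (nsq_nonneg _)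
        (by positivity))
    have h2 := hV i
    have e : 8 * L / c = 2 * (4 * L / c) := by ring
    nlinarith [sq_nonneg (V j (q i) + f (q i) ⬝ γ j)]
  refine (measure_exists_le hcard (by positivity) hb).trans (ofReal_le_ofReal ?_)
  have e2 : exp L * exp (-(2 * L)) = exp (-L) := by rw [← exp_add]; congr 1; ring
  rw [mul_assoc, e2, exp_neg, ← div_eq_mul_inv]
  gcongr
  exact h.exp_ge

/-- Constant in the bound for the empirical covariances of sieve errors. -/
def etaCovConst (A c G Cg : ℝ) : ℝ :=
  2 / c * etaConst A c G Cg + (Cg / c + 8 / c ^ 2 + 4 * G * A / c)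

lemma iid_eta_mul (h : Scal A n k L R) (hc : 0 < c) (hG : 0 < G) (hCg : 0 < Cg)
    (hφb : ∀ᵐ o ∂P, f o ⬝ f o ≤ R)
    (hη : ∀ j o, η j o = V j o - f o ⬝ γ j) (hηm : ∀ j, Measurable (η j))
    (hη2 : ∀ j, MemLp (η j) 2 P) (hγ : ∀ j, γ j ⬝ γ j ≤ G) (hV : ∀ j, SG P c (V j))
    (hg : ∀ j, ∫ o, η j o ^ 2 ∂P ≤ Cg * √(L / n)) {b : O → ℝ} (hb : SG P c b)
    (h0 : ∀ j, ∫ o, η j o * b o ∂P = 0)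
    (hcard : (Fintype.card ι : ℝ) ≤ 4 * exp L) :
    iid P n {q | ∃ j, (∀ i, b (q i) ^ 2 ≤ 2 * log n / c) ∧
      ∑ i, η j (q i) ^ 2 ≤ etaConst A c G Cg * (n * L / ((k + L) * log n)) ∧
      8 * (n * etaCovConst A c G Cg) * (2 * L) ≤ (∑ i, η j (q i) * b (q i)) ^ 2} ≤
      ofReal (8 / n) := by
  have hn := h.nR_pos
  have hL := h.one_le_L
  have hk := h.one_le_k
  have hA := h.one_le
  have hlog := h.log_n
  have hR := h.one_le_Ξ
  have hK0 : 0 < etaConst A c G Cg := by unfold etaConst; positivity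
  have hbm := hb.meas
  set t := log n / c with ht
  have ht0 : 0 ≤ t := by positivity
  have hex := hb.integral_excess hc t
  have hexp : exp (-(c * t)) = 1 / n := by
    rw [ht, mul_div_cancel₀ _ hc.ne', exp_neg, exp_log hn, one_div]
  rw [hexp] at hex
  have hsq : ∀ j, Integrable (fun o => η j o ^ 2 * b o ^ 2) P ∧
      ∫ o, η j o ^ 2 * b o ^ 2 ∂P ≤ Cg / c + 8 / c ^ 2 + 4 * G * A / c := by
    intro j
    have hVb := (hV j).mul_sq hb hc
    have hbound : ∀ᵐ o ∂P, η j o ^ 2 * b o ^ 2 ≤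
        t * η j o ^ 2 + 2 * (V j o ^ 2 * b o ^ 2) + 2 * R * G * excess t b o := by
      filter_upwards [hφb] with o ho
      have h1 := (sq_dotProduct_le _ _).trans (mul_le_mul ho (hγ j) (nsq_nonneg _) (by positivity))
      have h2 : η j o ^ 2 ≤ 2 * V j o ^ 2 + 2 * (R * G) := by
        rw [hη]; nlinarith [sq_nonneg (V j o + f o ⬝ γ j)]
      have h3 := sq_le_add_excess t b o
      have h4 := excess_nonneg t b o
      have h5 : excess t b o ≤ b o ^ 2 := max_le (by linarith) (sq_nonneg _)
      calc η j o ^ 2 * b o ^ 2 ≤ η j o ^ 2 * (t + excess t b o) :=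
            mul_le_mul_of_nonneg_left h3 (sq_nonneg _)
        _ = t * η j o ^ 2 + η j o ^ 2 * excess t b o := by ring
        _ ≤ t * η j o ^ 2 + (2 * V j o ^ 2 + 2 * (R * G)) * excess t b o := by gcongr
        _ ≤ _ := by nlinarith [mul_le_mul_of_nonneg_left h5 (sq_nonneg (V j o))]
    have hin : Integrable (fun o => t * η j o ^ 2 + 2 * (V j o ^ 2 * b o ^ 2) +
        2 * R * G * excess t b o) P :=
      (((hη2 j).integrable_sq.const_mul t).add (hVb.1.const_mul 2)).add (hex.1.const_mul _)
    have hi : Integrable (fun o => η j o ^ 2 * b o ^ 2) P := by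
      refine hin.mono' (((hηm j).pow_const 2).mul (hbm.pow_const 2)).aestronglyMeasurable ?_
      filter_upwards [hbound] with o ho
      rw [norm_of_nonneg (by positivity)]; exact ho
    refine ⟨hi, (integral_mono_ae hi hin hbound).trans ?_⟩
    have i1 : Integrable (fun o => t * η j o ^ 2 + 2 * (V j o ^ 2 * b o ^ 2)) P :=
      ((hη2 j).integrable_sq.const_mul t).add (hVb.1.const_mul 2)
    rw [integral_add i1 (hex.1.const_mul _), integral_add ((hη2 j).integrable_sq.const_mul t)
      (hVb.1.const_mul 2), integral_const_mul, integral_const_mul, integral_const_mul]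
    have a1 : t * ∫ o, η j o ^ 2 ∂P ≤ Cg / c := by
      calc t * ∫ o, η j o ^ 2 ∂P ≤ t * (Cg * √(L / n)) := mul_le_mul_of_nonneg_left (hg j) ht0
        _ = Cg / c * (√(L / n) * log n) := by rw [ht]; ring
        _ ≤ Cg / c * 1 := by gcongr; exact h.rate_mul_log
        _ = _ := mul_one _
    have a2 : 2 * ∫ o, V j o ^ 2 * b o ^ 2 ∂P ≤ 8 / c ^ 2 := by grind
    have a3 : 2 * R * G * ∫ o, excess t b o ∂P ≤ 4 * G * A / c := by
      calc 2 * R * G * ∫ o, excess t b o ∂P ≤ 2 * R * G * (2 * (1 / n) / c) :=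
            mul_le_mul_of_nonneg_left hex.2 (by positivity)
        _ = 4 * G / c * (R / n) := by field_simp; ring
        _ ≤ 4 * G / c * A := by
            have : R / n ≤ A := by rw [div_le_iff₀ hn]; exact h.Ξ_le
            gcongr
        _ = _ := by ring
    linarith
  have hΛ : 0 < etaCovConst A c G Cg := by unfold etaCovConst; positivity
  have hbj : ∀ j, iid P n {q | (∀ i, b (q i) ^ 2 ≤ 2 * log n / c) ∧
      ∑ i, η j (q i) ^ 2 ≤ etaConst A c G Cg * (n * L / ((k + L) * log n)) ∧
      8 * (n * etaCovConst A c G Cg) * (2 * L) ≤ (∑ i, η j (q i) * b (q i)) ^ 2} ≤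
      ofReal (2 * exp (-(2 * L))) := by
    intro j
    have hmem := memLp_two_mul_of_sq (hηm j) hbm (hsq j).1
    refine (measure_mono ?_).trans (iid_sq_sum_ge_le ((hηm j).mul hbm) hmem (h0 j)
      (Λ := n * etaCovConst A c G Cg) (by positivity) (2 * L))
    rintro q ⟨h1, h2, h3⟩
    refine ⟨?_, h3⟩
    have e1 : ∑ i, ((η j * b) (q i)) ^ 2 ≤ n * (2 / c * etaConst A c G Cg) := by
      calc ∑ i, ((η j * b) (q i)) ^ 2 ≤ ∑ i, 2 * log n / c * η j (q i) ^ 2 := by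
            refine sum_le_sum fun i _ => ?_
            simp only [Pi.mul_apply]
            nlinarith [mul_le_mul_of_nonneg_right (h1 i) (sq_nonneg (η j (q i)))]
        _ = 2 * log n / c * ∑ i, η j (q i) ^ 2 := by rw [mul_sum]
        _ ≤ 2 * log n / c * (etaConst A c G Cg * (n * L / ((k + L) * log n))) := by gcongr
        _ = n * (2 / c * etaConst A c G Cg) * (L / (k + L)) := by field_simp
        _ ≤ n * (2 / c * etaConst A c G Cg) * 1 := by
            gcongr
            rw [div_le_one (by positivity)]; linarith
        _ = _ := mul_one _
    have e2 : ∫ o, (η j * b) o ^ 2 ∂P ≤ Cg / c + 8 / c ^ 2 + 4 * G * A / c := by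
      refine le_trans (le_of_eq ?_) (hsq j).2
      refine integral_congr_ae (.of_forall fun o => ?_)
      simp only [Pi.mul_apply]; ring
    have e3 := mul_le_mul_of_nonneg_left e2 hn.le
    have e4 : n * etaCovConst A c G Cg = n * (2 / c * etaConst A c G Cg) +
        n * (Cg / c + 8 / c ^ 2 + 4 * G * A / c) := by unfold etaCovConst; ring
    rw [e4]
    linarith
  refine (measure_exists_le hcard (by positivity) hbj).trans (ofReal_le_ofReal ?_)
  have e2 : exp L * exp (-(2 * L)) = exp (-L) := by rw [← exp_add]; congr 1; ring
  have e3 : 4 * exp L * (2 * exp (-(2 * L))) = 8 * exp (-L) := by linear_combination 8 * e2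
  rw [e3, exp_neg, ← div_eq_mul_inv]
  gcongr
  exact h.exp_ge

end SieveErrors

section RecordMeasurability

variable {p d : ℕ}

lemma measurable_cov : Measurable (cov : Rec p d → Cov p d) := measurable_snd.comp measurable_snd
lemma measurable_xx : Measurable (xx : Rec p d → Fin p → ℝ) := measurable_fst.comp measurable_cov
lemma measurable_zz : Measurable (zz : Rec p d → EZ d) := measurable_snd.comp measurable_cov
lemma measurable_xx_apply (j : Fin p) : Measurable fun o : Rec p d => xx o j :=
  (measurable_pi_apply j).comp measurable_xx
lemma measurable_y11 : Measurable (y11 : Rec p d → ℝ) := measurable_fst.comp measurable_fst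
lemma measurable_y01 : Measurable (y01 : Rec p d → ℝ) :=
  measurable_fst.comp (measurable_snd.comp (measurable_snd.comp measurable_fst))
lemma measurable_y00 : Measurable (y00 : Rec p d → ℝ) :=
  measurable_snd.comp (measurable_snd.comp (measurable_snd.comp measurable_fst))
lemma measurableSet_treated : MeasurableSet (treated : Set (Rec p d)) :=
  (measurable_fst.comp measurable_snd) (measurableSet_singleton true)
lemma measurableSet_untreated : MeasurableSet (untreated : Set (Rec p d)) :=
  (measurable_fst.comp measurable_snd) (measurableSet_singleton false)
lemma measurable_dd : Measurable (dd : Rec p d → ℝ) :=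
  Measurable.ite measurableSet_treated measurable_const measurable_const
lemma measurable_dY1 : Measurable (dY1 : Rec p d → ℝ) := measurable_y11.sub measurable_y00
lemma measurable_dY0 : Measurable (dY0 : Rec p d → ℝ) := measurable_y01.sub measurable_y00

end RecordMeasurability

variable {d n : ℕ} {E : Experiment d n} {K : Consts} {Z : Set (EZ d)}

namespace Experiment

/-- `𝔼[X | Z]`. -/
def XPi (E : Experiment d n) (o : Rec E.p d) : Fin E.p → ℝ :=
  fun j => (condExp (sigZ E.p d) E.P (fun o' => xx o' j)) o

lemma Xbar_eq (E : Experiment d n) (o : Rec E.p d) : E.Xbar o = xx o - E.XPi o := rfl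

lemma sigZ_le (p d : ℕ) : sigZ p d ≤ (inferInstance : MeasurableSpace (Rec p d)) :=
  measurable_zz.comap_le

lemma sigW_le (p d : ℕ) : sigW p d ≤ (inferInstance : MeasurableSpace (Rec p d)) :=
  measurable_cov.comap_le

/-- `𝔼[X_j | Z]` as a function of `Z`. -/
lemma exists_piZ (E : Experiment d n) : ∃ f : EZ d → Fin E.p → ℝ, Measurable f ∧
    ∀ o, E.XPi o = f (zz o) := by
  have h : ∀ j, ∃ g : EZ d → ℝ, StronglyMeasurable g ∧
      condExp (sigZ E.p d) E.P (fun o' => xx o' j) = g ∘ zz := fun j =>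
    stronglyMeasurable_condExp.exists_eq_measurable_comp
  choose g hg using h
  refine ⟨fun z j => g j z, measurable_pi_lambda _ fun j => (hg j).1.measurable, fun o => ?_⟩
  ext j
  exact congrFun (hg j).2 o

def piZ (E : Experiment d n) : EZ d → Fin E.p → ℝ := Classical.choose E.exists_piZ

lemma measurable_piZ (E : Experiment d n) : Measurable E.piZ :=
  (Classical.choose_spec E.exists_piZ).1

lemma XPi_eq (E : Experiment d n) (o : Rec E.p d) : E.XPi o = E.piZ (zz o) :=
  (Classical.choose_spec E.exists_piZ).2 o

lemma measurable_XPi (E : Experiment d n) : Measurable E.XPi := by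
  have := funext E.XPi_eq
  rw [this]
  exact E.measurable_piZ.comp measurable_zz

lemma measurable_Xbar (E : Experiment d n) : Measurable E.Xbar := by
  have := funext E.Xbar_eq
  rw [this]
  exact measurable_xx.sub E.measurable_XPi

lemma xx_eq (E : Experiment d n) (o : Rec E.p d) : xx o = E.XPi o + E.Xbar o := by
  rw [Xbar_eq]; abel

/-- Bound on the `L^q` norms of linear forms in `X`. -/
lemma Regular.eLpNorm_le (hE : E.Regular K Z) {W : ℝ} (hW : 0 < W) (hKX : 0 < K.KX)
    {v : Fin E.p → ℝ} (hv : nsq v ≤ W ^ 2) {q : ℝ} (hq : 1 ≤ q) :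
    eLpNorm (fun o => v ⬝ xx o) (ofReal q) E.P ≤ ofReal (W * K.KX * √q) := by
  rcases (nsq_nonneg v).eq_or_lt with h0 | h0
  · have hv0 := dotProduct_self_eq_zero.1 h0.symm
    subst hv0
    simp
  · set s := √(nsq v) with hs
    have hs0 : 0 < s := Real.sqrt_pos.2 h0
    have hs2 : s ^ 2 = nsq v := sq_sqrt h0.le
    have hsW := le_of_sq_le_sq (by rw [hs2]; exact hv) hW.le
    have hunit : nsq (s⁻¹ • v) = 1 := by
      rw [smul_dotProduct, dotProduct_smul, smul_eq_mul, smul_eq_mul, ← hs2]; field_simp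
    have h1 := hE.subGaussian (s⁻¹ • v) hunit q hq
    set f : Rec E.p d → ℝ := fun o => (s⁻¹ • v) ⬝ xx o with hf
    have e : (fun o : Rec E.p d => v ⬝ xx o) = s • f := by
      ext o
      simp only [Pi.smul_apply, hf]
      rw [smul_dotProduct, smul_eq_mul, smul_eq_mul]; field_simp
    rw [e, eLpNorm_const_smul s f]
    calc ‖s‖ₑ * eLpNorm f (ofReal q) E.P
        ≤ ofReal s * ofReal (K.KX * √q) := by
          rw [Real.enorm_of_nonneg hs0.le]
          gcongr
      _ = ofReal (s * (K.KX * √q)) := (ofReal_mul hs0.le).symm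
      _ ≤ _ := by
          refine ofReal_le_ofReal ?_
          rw [mul_assoc]
          gcongr

lemma Regular.memLp_xx (hE : E.Regular K Z) (j : Fin E.p) :
    MemLp (fun o => xx o j) 2 E.P := by
  refine ⟨(measurable_xx_apply j).aestronglyMeasurable, ?_⟩
  have h := hE.subGaussian (Pi.single j 1) (by simp) 2 (by norm_num)
  simp only [single_one_dotProduct] at h
  rw [show ofReal 2 = 2 by norm_num] at h
  exact h.trans_lt ofReal_lt_top

lemma Regular.integrable_xx (hE : E.Regular K Z) (j : Fin E.p) :
    Integrable (fun o => xx o j) E.P := (hE.memLp_xx j).integrable one_le_two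

lemma Regular.dotProduct_XPi_ae (hE : E.Regular K Z) (v : Fin E.p → ℝ) :
    (fun o => v ⬝ E.XPi o) =ᵐ[E.P] E.P[fun o => v ⬝ xx o | sigZ E.p d] := by
  have e : (fun o : Rec E.p d => v ⬝ xx o) = ∑ j, fun o => v j * xx o j := by
    ext o; simp [dotProduct]
  rw [e]
  have h1 := condExp_finsetSum (μ := E.P) (m := sigZ E.p d) (s := univ)
    (f := fun j (o : Rec E.p d) => v j * xx o j) (fun j _ => (hE.integrable_xx j).const_mul (v j))
  have h2 : ∀ᵐ o ∂E.P, ∀ j, (E.P[fun o => v j * xx o j | sigZ E.p d]) o = v j * E.XPi o j := by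
    rw [ae_all_iff]
    intro j
    exact condExp_smul (v j) (fun o => xx o j) (sigZ E.p d)
  filter_upwards [h1, h2] with o h1 h2
  rw [h1, Finset.sum_apply]
  simp only [dotProduct]
  exact sum_congr rfl fun j _ => (h2 j).symm

/-- The bound on `‖Σ_X̄⁻¹ ξ‖₂`. -/
def _root_.DiD.Consts.wMax (K : Consts) : ℝ := 1 + K.Cξ / K.cSig

/-- A sub-Gaussian constant that serves for all linear forms in `X`, `𝔼[X | Z]` and `X̄` with
coefficients of norm at most `wMax`. -/
def _root_.DiD.Consts.cX (K : Consts) : ℝ := 1 / (4 * exp 1 * (2 * (K.wMax * K.KX)) ^ 2)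

lemma _root_.DiD.Consts.Valid.wMax_pos (hK : K.Valid d) : 1 ≤ K.wMax := by
  have := hK.Cξ; have := hK.cSig
  unfold Consts.wMax
  have : 0 < K.Cξ / K.cSig := by positivity
  linarith

lemma _root_.DiD.Consts.Valid.cX_pos (hK : K.Valid d) : 0 < K.cX := by
  have := hK.wMax_pos; have := hK.KX
  unfold Consts.cX
  positivity

lemma Regular.sg (hE : E.Regular K Z) (hK : K.Valid d) {v : Fin E.p → ℝ} (hv : nsq v ≤ K.wMax ^ 2) :
    SG E.P K.cX (fun o => v ⬝ xx o) ∧ SG E.P K.cX (fun o => v ⬝ E.XPi o) ∧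
      SG E.P K.cX (fun o => v ⬝ E.Xbar o) := by
  have hW := hK.wMax_pos
  have hKX := hK.KX
  have hX : ∀ q : ℝ, 1 ≤ q → eLpNorm (fun o => v ⬝ xx o) (ofReal q) E.P ≤
      ofReal (K.wMax * K.KX * √q) := fun q hq => hE.eLpNorm_le (by linarith) hKX hv hq
  have hPi : ∀ q : ℝ, 1 ≤ q → eLpNorm (fun o => v ⬝ E.XPi o) (ofReal q) E.P ≤
      ofReal (K.wMax * K.KX * √q) := fun q hq => by
    rw [eLpNorm_congr_ae (hE.dotProduct_XPi_ae v)]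
    refine (eLpNorm_condExp_le_eLpNorm _ ?_).trans (hX q hq)
    simp_all
  have mX : Measurable fun o : Rec E.p d => v ⬝ xx o :=
    measurable_dotProduct measurable_const measurable_xx
  have mPi : Measurable fun o : Rec E.p d => v ⬝ E.XPi o :=
    measurable_dotProduct measurable_const E.measurable_XPi
  have mB : Measurable fun o : Rec E.p d => v ⬝ E.Xbar o :=
    measurable_dotProduct measurable_const E.measurable_Xbar
  have hle : ∀ q : ℝ, K.wMax * K.KX * √q ≤ 2 * (K.wMax * K.KX) * √q := fun q => by
    have : 0 ≤ K.wMax * K.KX * √q := by positivity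
    linarith
  have hpos : 0 < 2 * (K.wMax * K.KX) := by positivity
  refine ⟨sg_of_eLpNorm_le hpos mX fun q hq => (hX q hq).trans (ofReal_le_ofReal (hle q)),
    sg_of_eLpNorm_le hpos mPi fun q hq => (hPi q hq).trans (ofReal_le_ofReal (hle q)),
    sg_of_eLpNorm_le hpos mB fun q hq => ?_⟩
  have e : (fun o => v ⬝ E.Xbar o) = (fun o => v ⬝ xx o) - fun o => v ⬝ E.XPi o := by
    ext o; rw [Pi.sub_apply, Xbar_eq, dotProduct_sub]
  rw [e]
  have hq1 : (1 : ℝ≥0∞) ≤ ofReal q := by simp_all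
  refine (eLpNorm_sub_le mX.aestronglyMeasurable mPi.aestronglyMeasurable hq1).trans
    ((add_le_add (hX q hq) (hPi q hq)).trans_eq ?_)
  rw [← ofReal_add (by positivity) (by positivity)]
  congr 1; ring

lemma Regular.sg_apply (hE : E.Regular K Z) (hK : K.Valid d) (j : Fin E.p) :
    SG E.P K.cX (fun o => xx o j) ∧ SG E.P K.cX (fun o => E.XPi o j) ∧
      SG E.P K.cX (fun o => E.Xbar o j) := by
  have h := hE.sg hK (v := Pi.single j 1) (by
    rw [single_one_dotProduct, Pi.single_eq_same]
    exact one_le_pow₀ hK.wMax_pos)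
  simpa only [single_one_dotProduct] using h

lemma Regular.memLp_XPi (hE : E.Regular K Z) (j : Fin E.p) :
    MemLp (fun o => E.XPi o j) 2 E.P := (hE.memLp_xx j).condExp one_le_two

lemma Regular.memLp_Xbar (hE : E.Regular K Z) (j : Fin E.p) :
    MemLp (fun o => E.Xbar o j) 2 E.P := (hE.memLp_xx j).sub (hE.memLp_XPi j)

lemma Regular.condZero_Xbar (hE : E.Regular K Z) (v : Fin E.p → ℝ) :
    CondZero E.P (zz : Rec E.p d → EZ d) (fun o => v ⬝ E.Xbar o) := by
  have hi := (memLp_dotProduct (fun j => hE.memLp_xx j) v).integrable one_le_two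
  have hiP := (memLp_dotProduct (fun j => hE.memLp_XPi j) v).integrable one_le_two
  have e : (fun o => v ⬝ E.Xbar o) = (fun o => v ⬝ xx o) - fun o => v ⬝ E.XPi o := by
    ext o; rw [Pi.sub_apply, Xbar_eq, dotProduct_sub]
  rw [e]
  refine condZero_of_condExp measurable_zz (hi.sub hiP) ?_
  have h1 := condExp_sub hi hiP (sigZ E.p d)
  have h2 := (condExp_congr_ae (hE.dotProduct_XPi_ae v)).trans
      (condExp_condExp_of_le le_rfl (sigZ_le E.p d))
  filter_upwards [h1, h2] with o h1 h2
  rw [h1, Pi.sub_apply, h2, sub_self]; rfl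

lemma sq_integral_mul_le {O : Type*} [MeasurableSpace O] {P : Measure O} {f g : O → ℝ}
    (hf : MemLp f 2 P) (hg : MemLp g 2 P) :
    (∫ o, f o * g o ∂P) ^ 2 ≤ (∫ o, f o ^ 2 ∂P) * ∫ o, g o ^ 2 ∂P := by
  have i1 := hf.integrable_sq
  have i3 := hg.integrable_sq
  have i2 : Integrable (fun o => f o * g o) P := hf.integrable_mul hg
  have h : ∀ s : ℝ, 0 ≤ (∫ o, g o ^ 2 ∂P) * (s * s) + 2 * (∫ o, f o * g o ∂P) * s +
      ∫ o, f o ^ 2 ∂P := by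
    intro s
    have h0 : 0 ≤ ∫ o, (f o + s * g o) ^ 2 ∂P := integral_nonneg fun o => sq_nonneg _
    have e : ∀ o, (f o + s * g o) ^ 2 = f o ^ 2 + 2 * s * (f o * g o) + s ^ 2 * g o ^ 2 :=
      fun o => by ring
    simp_rw [e] at h0
    have i12 : Integrable (fun o => f o ^ 2 + 2 * s * (f o * g o)) P := i1.add (i2.const_mul _)
    rw [integral_add i12 (i3.const_mul _), integral_add i1 (i2.const_mul _), integral_const_mul,
      integral_const_mul] at h0
    linarith
  have := discrim_le_zero h
  rw [discrim] at this
  linarith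

lemma integral_dotProduct_sq {O : Type*} [MeasurableSpace O] {P : Measure O} {p : ℕ}
    {U : O → Fin p → ℝ} (hU : ∀ j, MemLp (fun o => U o j) 2 P) (v : Fin p → ℝ) :
    ∫ o, (v ⬝ U o) ^ 2 ∂P = v ⬝ ((of fun j l => ∫ o, U o j * U o l ∂P) *ᵥ v) := by
  have hi : ∀ j l, Integrable (fun o => U o j * U o l) P := fun j l => (hU j).integrable_mul (hU l)
  have e : ∀ o, (v ⬝ U o) ^ 2 = ∑ j, ∑ l, v j * v l * (U o j * U o l) := fun o => by
    rw [sq, dotProduct, sum_mul_sum]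
    grind
  simp_rw [e]
  rw [integral_finsetSum _ fun j _ => integrable_finsetSum _ fun l _ => (hi j l).const_mul _]
  simp_rw [integral_finsetSum _ fun l _ => (hi _ l).const_mul _, integral_const_mul]
  simp only [dotProduct, mulVec, of_apply, mul_sum]
  grind

lemma Regular.integral_Xbar_sq (hE : E.Regular K Z) (v : Fin E.p → ℝ) :
    ∫ o, (v ⬝ E.Xbar o) ^ 2 ∂E.P = v ⬝ (E.SigBar *ᵥ v) :=
  integral_dotProduct_sq hE.memLp_Xbar v

lemma Regular.integral_XPi_sq (hE : E.Regular K Z) (v : Fin E.p → ℝ) :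
    ∫ o, (v ⬝ E.XPi o) ^ 2 ∂E.P = v ⬝ (E.SigPi *ᵥ v) :=
  integral_dotProduct_sq hE.memLp_XPi v

/-- `X̄` is orthogonal to all functions of `Z`. -/
lemma Regular.integral_add_Xbar_sq (hE : E.Regular K Z) {h : EZ d → ℝ} (hm : Measurable h)
    (h2 : MemLp (fun o : Rec E.p d => h (zz o)) 2 E.P) (v : Fin E.p → ℝ) :
    ∫ o, (h (zz o) + v ⬝ E.Xbar o) ^ 2 ∂E.P = ∫ o, h (zz o) ^ 2 ∂E.P + v ⬝ (E.SigBar *ᵥ v) := by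
  have hb := memLp_dotProduct (fun j => hE.memLp_Xbar j) v
  have hi : Integrable (fun o : Rec E.p d => h (zz o) * (v ⬝ E.Xbar o)) E.P := h2.integrable_mul hb
  have h0 := hE.condZero_Xbar v h hm hi
  have e : ∀ o : Rec E.p d, (h (zz o) + v ⬝ E.Xbar o) ^ 2 =
      h (zz o) ^ 2 + 2 * (h (zz o) * (v ⬝ E.Xbar o)) + (v ⬝ E.Xbar o) ^ 2 := fun o => by ring
  simp_rw [e]
  have i1 : Integrable (fun o : Rec E.p d => h (zz o) ^ 2 + 2 * (h (zz o) * (v ⬝ E.Xbar o))) E.P :=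
    h2.integrable_sq.add (hi.const_mul 2)
  rw [integral_add i1 hb.integrable_sq, integral_add h2.integrable_sq (hi.const_mul 2),
    integral_const_mul, h0, hE.integral_Xbar_sq]
  ring

lemma Regular.integral_xx_sq_le (hE : E.Regular K Z) (v : Fin E.p → ℝ) :
    ∫ o, (v ⬝ xx o) ^ 2 ∂E.P ≤ (1 / K.cPi + 1 / K.cSig) * nsq v := by
  have h := hE.integral_add_Xbar_sq (h := fun z => v ⬝ E.piZ z)
    (measurable_dotProduct measurable_const E.measurable_piZ)
    (by simpa only [← XPi_eq] using memLp_dotProduct (fun j => hE.memLp_XPi j) v) v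
  simp only [← XPi_eq, ← dotProduct_add, ← xx_eq] at h
  rw [h, hE.integral_XPi_sq, add_mul]
  exact add_le_add (hE.SigPi_le v) (hE.SigBar_le v)

/-- `w₀ = -Σ_X̄⁻¹ ξ`. -/
def w0 (E : Experiment d n) : Fin E.p → ℝ := -(E.SigBar⁻¹ *ᵥ E.ξ)

lemma SigBar_transpose (E : Experiment d n) : E.SigBarᵀ = E.SigBar := by
  ext j l
  simp only [SigBar, transpose_apply, of_apply, mul_comm]

lemma isUnit_det_of_eigGE {ι : Type*} [Fintype ι] [DecidableEq ι] {S : Matrix ι ι ℝ} {c : ℝ}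
    (hc : 0 < c) (h : EigGE S c) : IsUnit S.det := by
  rw [← Matrix.isUnit_iff_isUnit_det, ← Matrix.mulVec_injective_iff_isUnit]
  intro u v huv
  rw [← sub_eq_zero, ← mulVec_sub] at huv
  have h3 := h (u - v)
  rw [huv, dotProduct_zero] at h3
  have h4 := le_antisymm (by nlinarith) (nsq_nonneg _)
  exact sub_eq_zero.1 (dotProduct_self_eq_zero.1 h4)

lemma Regular.SigBar_mulVec_w0 (hE : E.Regular K Z) (hK : K.Valid d) :
    E.SigBar *ᵥ E.w0 = -E.ξ := by
  rw [w0, mulVec_neg, mulVec_mulVec,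
    mul_nonsing_inv _ (isUnit_det_of_eigGE hK.cSig hE.SigBar_ge), one_mulVec]

lemma Regular.w0_le (hE : E.Regular K Z) (hK : K.Valid d) :
    √(nsq E.w0) ≤ K.Cξ / K.cSig := by
  have h1 := hE.SigBar_ge E.w0
  rw [hE.SigBar_mulVec_w0 hK, dotProduct_neg] at h1
  have h2 := abs_dotProduct_le_sqrt E.w0 E.ξ
  have h3 : √(nsq E.ξ) ≤ K.Cξ := by
    have := hE.ξ_le
    simpa only [dotProduct, sq] using this
  set s := √(nsq E.w0)
  have hs0 : 0 ≤ s := sqrt_nonneg _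
  have hs2 : s ^ 2 = nsq E.w0 := sq_sqrt (nsq_nonneg _)
  have h4 := (abs_le.1 h2).1
  have hc := hK.cSig
  rw [le_div_iff₀ hc]
  rcases hs0.eq_or_lt with h0 | h0
  · rw [← h0, zero_mul]; exact hK.Cξ.le
  · nlinarith

lemma Regular.w0_sq_le (hE : E.Regular K Z) (hK : K.Valid d) :
    nsq E.w0 ≤ K.wMax ^ 2 := by
  have h := hE.w0_le hK
  have hs2 : √(nsq E.w0) ^ 2 = nsq E.w0 := sq_sqrt (nsq_nonneg _)
  rw [← hs2]
  unfold Consts.wMax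
  gcongr
  linarith

lemma Regular.w0_ge (hE : E.Regular K Z) (hK : K.Valid d) :
    (K.cξ * K.cSig) ^ 2 ≤ nsq E.w0 := by
  have hc := hK.cSig
  have hcξ := hK.cξ
  set b := nsq E.ξ with hb
  have hb1 : K.cξ ^ 2 ≤ b := by
    have h1 := hE.ξ_ge
    have h2 : √b ^ 2 = b := sq_sqrt (nsq_nonneg _)
    have h3 : K.cξ ≤ √b := by simpa only [hb, dotProduct, sq] using h1
    rw [← h2]; gcongr
  have hbpos := lt_of_lt_of_le (by positivity) hb1
  have hmem := fun v => memLp_dotProduct (fun j => hE.memLp_Xbar j) v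
  have hwξ : ∫ o, (E.w0 ⬝ E.Xbar o) * (E.ξ ⬝ E.Xbar o) ∂E.P = -b := by
    have h1 := hE.integral_Xbar_sq (E.w0 + E.ξ)
    have h2 := hE.integral_Xbar_sq E.w0
    have h3 := hE.integral_Xbar_sq E.ξ
    have i1 := (hmem E.w0).integrable_sq
    have i3 := (hmem E.ξ).integrable_sq
    have i2 : Integrable (fun o => (E.w0 ⬝ E.Xbar o) * (E.ξ ⬝ E.Xbar o)) E.P :=
      (hmem E.w0).integrable_mul (hmem E.ξ)
    have e : ∀ o, ((E.w0 + E.ξ) ⬝ E.Xbar o) ^ 2 = (E.w0 ⬝ E.Xbar o) ^ 2 +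
        2 * ((E.w0 ⬝ E.Xbar o) * (E.ξ ⬝ E.Xbar o)) + (E.ξ ⬝ E.Xbar o) ^ 2 := fun o => by
      rw [add_dotProduct]; ring
    simp_rw [e] at h1
    have i12 : Integrable (fun o => (E.w0 ⬝ E.Xbar o) ^ 2 +
        2 * ((E.w0 ⬝ E.Xbar o) * (E.ξ ⬝ E.Xbar o))) E.P := i1.add (i2.const_mul 2)
    rw [integral_add i12 i3, integral_add i1 (i2.const_mul 2), integral_const_mul, h2, h3,
      mulVec_add, add_dotProduct, dotProduct_add, dotProduct_add] at h1
    have e2 : E.w0 ⬝ (E.SigBar *ᵥ E.ξ) = E.ξ ⬝ (E.SigBar *ᵥ E.w0) := by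
      rw [dotProduct_mulVec, ← mulVec_transpose, SigBar_transpose, dotProduct_comm]
    rw [e2, hE.SigBar_mulVec_w0 hK, dotProduct_neg, dotProduct_neg] at h1
    linarith
  have hcs : b ^ 2 ≤ (1 / K.cSig * nsq E.w0) * (1 / K.cSig * b) := by
    have h1 := sq_integral_mul_le (hmem E.w0) (hmem E.ξ)
    rw [hwξ, neg_sq, hE.integral_Xbar_sq, hE.integral_Xbar_sq] at h1
    refine h1.trans (mul_le_mul (hE.SigBar_le _) (hE.SigBar_le _) ?_ ?_)
    · rw [← hE.integral_Xbar_sq]; exact integral_nonneg fun o => sq_nonneg _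
    · exact mul_nonneg (by positivity) (nsq_nonneg _)
  have h5 : b * K.cSig ^ 2 ≤ nsq E.w0 := by
    have e : (1 / K.cSig * nsq E.w0) * (1 / K.cSig * b) = nsq E.w0 / K.cSig ^ 2 * b := by field_simp
    rw [e, sq b] at hcs
    have := le_of_mul_le_mul_right hcs hbpos
    rwa [le_div_iff₀ (by positivity)] at this
  nlinarith

lemma Regular.w0_l1_le (hE : E.Regular K Z) (hK : K.Valid d) :
    ∑ j, |E.w0 j| ≤ √(E.sw : ℝ) * K.wMax := by
  set S := Finset.univ.filter fun j => (E.SigBar⁻¹ *ᵥ E.ξ) j ≠ 0 with hS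
  have hsw : E.sw = S.card := rfl
  have e : ∑ j, |E.w0 j| = ∑ j ∈ S, |E.w0 j| := by
    rw [hS, Finset.sum_filter]
    refine sum_congr rfl fun j _ => ?_
    split_ifs with h
    · rfl
    · have : E.w0 j = 0 := by simp only [w0, Pi.neg_apply]; push Not at h; rw [h, neg_zero]
      rw [this, abs_zero]
  rw [e, hsw]
  have h1 : (∑ j ∈ S, |E.w0 j|) ^ 2 ≤ S.card * K.wMax ^ 2 := by
    calc (∑ j ∈ S, |E.w0 j|) ^ 2 ≤ S.card * ∑ j ∈ S, |E.w0 j| ^ 2 := sq_sum_le_card_mul_sum_sq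
      _ ≤ S.card * K.wMax ^ 2 := by
          refine mul_le_mul_of_nonneg_left ?_ (by positivity)
          refine le_trans ?_ (hE.w0_sq_le hK)
          simp only [sq_abs, dotProduct, ← sq]
          exact Finset.sum_le_sum_of_subset_of_nonneg (Finset.subset_univ _)
            fun j _ _ => sq_nonneg _
  have hW := hK.wMax_pos
  refine le_of_sq_le_sq ?_ (by positivity)
  rw [mul_pow, sq_sqrt (by positivity)]
  exact h1

lemma Regular.sw_pos (hE : E.Regular K Z) (hK : K.Valid d) : 0 < E.sw := by
  rw [sw, Finset.card_pos]
  by_contra hne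
  rw [Finset.not_nonempty_iff_eq_empty, Finset.filter_eq_empty_iff] at hne
  have h0 : E.w0 = 0 := by
    ext j
    have := hne (mem_univ j)
    push Not at this
    simp only [w0, Pi.neg_apply, this, neg_zero, Pi.zero_apply]
  have := hE.w0_ge hK
  rw [h0, zero_dotProduct] at this
  have := hK.cξ; have := hK.cSig
  have : 0 < (K.cξ * K.cSig) ^ 2 := by positivity
  linarith

end Experiment

section ConditionalMoments

variable {O J : Type*} [MeasurableSpace O] [MeasurableSpace J] {P : Measure O}
  [IsProbabilityMeasure P] {T : O → J} {u : O → ℝ}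

lemma CondZero.mul_left (hu : CondZero P T u) {g : J → ℝ} (hg : Measurable g) :
    CondZero P T fun o => g (T o) * u o := by
  intro h hh hi
  have := hu (fun t => h t * g t) (hh.mul hg) (hi.congr (.of_forall fun o => by ring))
  rw [← this]
  exact integral_congr_ae (.of_forall fun o => by ring)

lemma CondZero.congr (hu : CondZero P T u) {v : O → ℝ} (h : u =ᵐ[P] v) : CondZero P T v := by
  intro g hg hi
  have e : (fun o => g (T o) * v o) =ᵐ[P] fun o => g (T o) * u o := by
    filter_upwards [h] with o ho; rw [ho]
  rw [integral_congr_ae e]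
  exact hu g hg (hi.congr e)

/-- A bound for the conditional mean of a nonnegative variable, in terms of integrals. -/
lemma lintegral_mul_le_of_condExp_le (hT : Measurable T) {y : O → ℝ} (hy : Measurable y)
    (h0 : ∀ o, 0 ≤ y o) (hi : Integrable y P) {C : ℝ} (hC : 0 ≤ C)
    (h : ∀ᵐ o ∂P, (P[y | MeasurableSpace.comap T inferInstance]) o ≤ C) {g : J → ℝ≥0∞}
    (hg : Measurable g) :
    ∫⁻ o, g (T o) * ofReal (y o) ∂P ≤ ofReal C * ∫⁻ o, g (T o) ∂P := by
  set ν := (P.withDensity fun o => ofReal (y o)).map T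
  have hle : ν ≤ ofReal C • P.map T := by
    refine Measure.le_iff.2 fun s hs => ?_
    have hTs := hT hs
    rw [Measure.map_apply hT hs, withDensity_apply _ hTs, Measure.smul_apply,
      Measure.map_apply hT hs, smul_eq_mul,
      ← ofReal_integral_eq_lintegral_ofReal hi.integrableOn (.of_forall h0)]
    have hm := hT.comap_le
    rw [← setIntegral_condExp hm hi ⟨s, hs, rfl⟩]
    have h1 : ∫ o in T ⁻¹' s, (P[y | MeasurableSpace.comap T inferInstance]) o ∂P ≤
        ∫ _ in T ⁻¹' s, C ∂P :=
      setIntegral_mono_ae integrable_condExp.integrableOn (integrable_const C).integrableOn h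
    refine (ofReal_le_ofReal h1).trans ?_
    rw [setIntegral_const, smul_eq_mul, mul_comm, ofReal_mul hC, ofReal_measureReal]
  have hgT : Measurable fun o => g (T o) := hg.comp hT
  calc ∫⁻ o, g (T o) * ofReal (y o) ∂P = ∫⁻ t, g t ∂ν := by
        rw [lintegral_map hg hT, lintegral_withDensity_eq_lintegral_mul _ hy.ennreal_ofReal hgT]
        refine lintegral_congr fun o => ?_
        simp only [Pi.mul_apply, mul_comm]
    _ ≤ ∫⁻ t, g t ∂(ofReal C • P.map T) := lintegral_mono' hle le_rfl
    _ = _ := by rw [lintegral_smul_measure, lintegral_map hg hT, smul_eq_mul]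

lemma CondSqLE.integrable_mul {v : ℝ} (hu : CondSqLE P T u v) (hum : Measurable u)
    (hT : Measurable T) {g : J → ℝ} (hg : Measurable g) (h0 : ∀ t, 0 ≤ g t)
    (hi : Integrable (fun o => g (T o)) P) (hv : 0 ≤ v) :
    Integrable (fun o => g (T o) * u o ^ 2) P ∧
      ∫ o, g (T o) * u o ^ 2 ∂P ≤ v * ∫ o, g (T o) ∂P := by
  have h1 := hu (fun t => ofReal (g t)) hg.ennreal_ofReal
  rw [← ofReal_integral_eq_lintegral_ofReal hi (.of_forall fun o => h0 _), ← ofReal_mul hv] at h1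
  have e : ∀ o, ofReal (g (T o)) * ofReal (u o ^ 2) =
      ofReal (g (T o) * u o ^ 2) := fun o => (ofReal_mul (h0 _)).symm
  simp_rw [e] at h1
  have hm := (hg.comp hT).mul (hum.pow_const 2)
  have hnn : ∀ o, 0 ≤ g (T o) * u o ^ 2 := fun o => mul_nonneg (h0 _) (sq_nonneg _)
  have hI : Integrable (fun o => g (T o) * u o ^ 2) P := by
    refine ⟨hm.aestronglyMeasurable, ?_⟩
    rw [hasFiniteIntegral_iff_ofReal (.of_forall hnn)]
    exact h1.trans_lt ofReal_lt_top
  refine ⟨hI, ?_⟩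
  rw [← ofReal_integral_eq_lintegral_ofReal hI (.of_forall hnn)] at h1
  exact (ENNReal.ofReal_le_ofReal_iff (mul_nonneg hv (integral_nonneg fun o => h0 _))).1 h1

end ConditionalMoments

namespace Experiment

lemma dd_eq_zero_or_one {p : ℕ} (o : Rec p d) : dd o = 0 ∨ dd o = 1 := by
  unfold dd; split_ifs <;> simp

lemma measurable_eps1 (E : Experiment d n) : Measurable E.eps1 :=
  measurable_dY1.sub (E.meas_Φ1.comp measurable_cov)

lemma measurable_eps0 (E : Experiment d n) : Measurable E.eps0 :=
  measurable_dY0.sub (E.meas_Φ0.comp measurable_cov)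

lemma measurable_eps (E : Experiment d n) : Measurable E.eps := by
  have h1 := E.measurable_eps1
  have h2 := E.measurable_eps0
  have h3 := measurable_dd (p := E.p) (d := d)
  have h4 := E.meas_pr.comp measurable_cov
  unfold eps
  fun_prop

lemma Regular.zz_mem (hE : E.Regular K Z) : ∀ᵐ o ∂E.P, zz o ∈ Z := by
  filter_upwards [hE.W_mem] with o ho
  exact hE.W_sub _ ho

/-! ### Errors -/

lemma integral_cond {O : Type*} [MeasurableSpace O] (P : Measure O) (s : Set O) (f : O → ℝ) :
    ∫ o, f o ∂(ProbabilityTheory.cond P s) = (P s)⁻¹.toReal * ∫ o in s, f o ∂P := by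
  rw [ProbabilityTheory.cond, integral_smul_measure, smul_eq_mul]

lemma condZero_of_cond {O J : Type*} [MeasurableSpace O] [MeasurableSpace J] {P : Measure O}
    [IsProbabilityMeasure P] {T : O → J} (hT : Measurable T) {s : Set O} (hs : MeasurableSet s)
    (hP : P s ≠ 0) {y : O → ℝ} {m : J → ℝ} (hy : Integrable y P)
    (hi : Integrable (fun o => y o - m (T o)) P)
    (h : condExp (MeasurableSpace.comap T inferInstance) (ProbabilityTheory.cond P s) y
      =ᵐ[P] fun o => m (T o)) (hm : Measurable m) :
    CondZero P T (s.indicator fun o => y o - m (T o)) := by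
  set Q := ProbabilityTheory.cond P s
  have := cond_isProbabilityMeasure hP
  have hac : Q ≪ P := cond_absolutelyContinuous
  have hQ : ∀ {f : O → ℝ}, Integrable f P → Integrable f Q := fun hf =>
    (hf.restrict).smul_measure (ENNReal.inv_ne_top.2 hP)
  have hcz : CondZero Q T fun o => y o - m (T o) := by
    refine condZero_of_condExp hT (hQ hi) ?_
    have him : Integrable (fun o => m (T o)) Q :=
      ((hQ hy).sub (hQ hi)).congr (.of_forall fun o => by simp)
    have h1 := condExp_sub (hQ hy) him (MeasurableSpace.comap T inferInstance)
    have h2 : Q[fun o => m (T o) | MeasurableSpace.comap T inferInstance] = fun o => m (T o) :=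
      condExp_of_stronglyMeasurable hT.comap_le
        (hm.comp (comap_measurable T)).stronglyMeasurable him
    filter_upwards [h1, hac.ae_le h] with o h1 h3
    have h1' : (Q[fun o => y o - m (T o) | MeasurableSpace.comap T inferInstance]) o = _ := h1
    rw [h1', Pi.sub_apply, h3, h2]; simp
  intro g hg hgi
  have e : (fun o => g (T o) * s.indicator (fun o => y o - m (T o)) o) =
      s.indicator fun o => g (T o) * (y o - m (T o)) := by
    ext o
    by_cases ho : o ∈ s <;> simp [ho]
  rw [e] at hgi ⊢
  rw [integrable_indicator_iff hs] at hgi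
  rw [integral_indicator hs]
  have hgQ := Integrable.smul_measure hgi (ENNReal.inv_ne_top.2 hP)
  have h0 := hcz g hg hgQ
  rw [integral_cond] at h0
  rcases mul_eq_zero.1 h0 with h | h
  · exfalso
    rw [ENNReal.toReal_eq_zero_iff] at h
    simp_all
  · exact h

lemma Regular.integral_dd (hE : E.Regular K Z) {h : Cov E.p d → ℝ} (hm : Measurable h)
    {C : ℝ} (hC : ∀ w, |h w| ≤ C) :
    ∫ o, h (cov o) * dd o ∂E.P = ∫ o, h (cov o) * E.pr (cov o) ∂E.P := by
  have hdi : Integrable (dd : Rec E.p d → ℝ) E.P :=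
    Integrable.of_bound measurable_dd.aestronglyMeasurable 1 (.of_forall fun o => by
      rcases dd_eq_zero_or_one o with h | h <;> simp [h])
  have hi := hdi.bdd_mul (hm.comp measurable_cov).aestronglyMeasurable (c := C)
      (.of_forall fun o => hC _)
  have hsm : StronglyMeasurable[sigW E.p d] fun o => h (cov o) :=
    (hm.comp (comap_measurable cov)).stronglyMeasurable
  rw [← integral_condExp (sigW_le E.p d)]
  refine integral_congr_ae ?_
  filter_upwards [condExp_mul_of_stronglyMeasurable_left hsm hi hdi, hE.pr_eq] with o h1 h2
  have h1' : (E.P[fun o => h (cov o) * dd o | sigW E.p d]) o = _ := h1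
  rw [h1', Pi.mul_apply, h2]

lemma Regular.integrable_pr (hE : E.Regular K Z) :
    Integrable (fun o => E.pr (cov o)) E.P := integrable_condExp.congr hE.pr_eq

lemma Regular.condZero_dd_sub (hE : E.Regular K Z) :
    CondZero E.P (cov : Rec E.p d → Cov E.p d) (fun o => dd o - E.pr (cov o)) := by
  have hdi : Integrable (dd : Rec E.p d → ℝ) E.P :=
    Integrable.of_bound measurable_dd.aestronglyMeasurable 1 (.of_forall fun o => by
      rcases dd_eq_zero_or_one o with h | h <;> simp [h])
  refine condZero_of_condExp measurable_cov (hdi.sub hE.integrable_pr) ?_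
  have h1 := condExp_sub hdi hE.integrable_pr (sigW E.p d)
  have h2 : E.P[fun o => E.pr (cov o) | sigW E.p d] = fun o => E.pr (cov o) :=
    condExp_of_stronglyMeasurable (sigW_le E.p d)
      (E.meas_pr.comp (comap_measurable cov)).stronglyMeasurable hE.integrable_pr
  filter_upwards [h1, hE.pr_eq] with o h1 h3
  have h1' : (E.P[fun o => dd o - E.pr (cov o) | sigW E.p d]) o = _ := h1
  rw [h1', Pi.sub_apply, h3, h2]; simp

/-- A set of covariate values that is null for the treated, or for the untreated, is null. -/
lemma Regular.ae_of_ae_treated (hE : E.Regular K Z) (hK : K.Valid d) {A : Set (Cov E.p d)}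
    (hA : MeasurableSet A) (h : ∀ᵐ o ∂E.P, o ∈ treated → cov o ∉ A) :
    ∀ᵐ o ∂E.P, cov o ∉ A := by
  have h1 := hE.integral_dd (h := A.indicator 1) (measurable_one.indicator hA) (C := 1) (fun w => by
    by_cases hw : w ∈ A <;> simp [hw])
  have h2 : ∫ o, A.indicator 1 (cov o) * dd o ∂E.P = 0 := by
    rw [integral_eq_zero_of_ae]
    filter_upwards [h] with o ho
    by_cases ht : o.2.1 = true
    · simp [ho ht]
    · simp [dd, ht]
  rw [h2] at h1
  have hnn : 0 ≤ᵐ[E.P] fun o => A.indicator (1 : Cov E.p d → ℝ) (cov o) * E.pr (cov o) := by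
    filter_upwards [hE.overlap] with o ho
    have := (hK.cπ.trans ho.1).le
    exact mul_nonneg (Set.indicator_nonneg (fun _ _ => zero_le_one) _) this
  have hi := hE.integrable_pr.bdd_mul (c := 1)
      ((measurable_one.indicator hA).comp measurable_cov).aestronglyMeasurable
      (.of_forall fun o => by by_cases hw : cov o ∈ A <;> simp [hw])
  have h3 := (integral_eq_zero_iff_of_nonneg_ae hnn hi).1 h1.symm
  filter_upwards [h3, hE.overlap] with o h3 ho hmem
  have := hK.cπ.trans ho.1
  simp [hmem] at h3
  linarith

lemma Regular.measure_treated_ne_zero (hE : E.Regular K Z) (hK : K.Valid d) :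
    E.P treated ≠ 0 := by
  intro h0
  have h1 : ∀ᵐ o ∂E.P, o ∈ treated → cov o ∉ (Set.univ : Set (Cov E.p d)) := by
    have := measure_eq_zero_iff_ae_notMem.1 h0
    simp_all
  have h2 := hE.ae_of_ae_treated hK MeasurableSet.univ h1
  simp at h2
  exact IsProbabilityMeasure.ne_zero E.P h2

lemma Regular.measure_untreated_ne_zero (hE : E.Regular K Z) (hK : K.Valid d) :
    E.P untreated ≠ 0 := by
  intro h0
  have h1 := hE.integral_dd (h := 1) measurable_one (C := 1) (fun w => by simp)
  simp only [Pi.one_apply, one_mul] at h1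
  have h2 : ∫ o, dd o ∂E.P = 1 := by
    have : (dd : Rec E.p d → ℝ) =ᵐ[E.P] fun _ => 1 := by
      filter_upwards [measure_eq_zero_iff_ae_notMem.1 h0] with o ho
      have : o.2.1 = true := by
        by_contra h
        exact ho (by simpa [untreated] using h)
      simp [dd, this]
    rw [integral_congr_ae this]; simp
  have h3 : ∫ o, E.pr (cov o) ∂E.P ≤ ∫ _, (1 - K.cπ) ∂E.P := by
    refine integral_mono_ae hE.integrable_pr (integrable_const _) ?_
    filter_upwards [hE.overlap] with o ho using ho.2.le
  rw [integral_const, probReal_univ, one_smul] at h3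
  linarith [hK.cπ]

lemma Regular.condZero_dd_eps1 (hE : E.Regular K Z) (hK : K.Valid d) :
    CondZero E.P (cov : Rec E.p d → Cov E.p d) (fun o => dd o * E.eps1 o) := by
  have h := condZero_of_cond measurable_cov measurableSet_treated (hE.measure_treated_ne_zero hK)
    (y := dY1) (m := E.Φ1) (hE.int_y11.sub hE.int_y00) hE.int_eps1 hE.Φ1_eq E.meas_Φ1
  refine h.congr (.of_forall fun o => ?_)
  by_cases ht : o.2.1 = true
  · simp [Set.indicator, treated, ht, dd, eps1]
  · simp [Set.indicator, treated, ht, dd]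

lemma Regular.condZero_sub_dd_eps0 (hE : E.Regular K Z) (hK : K.Valid d) :
    CondZero E.P (cov : Rec E.p d → Cov E.p d) (fun o => (1 - dd o) * E.eps0 o) := by
  have h := condZero_of_cond measurable_cov measurableSet_untreated
    (hE.measure_untreated_ne_zero hK)
    (y := dY0) (m := E.Φ0) (hE.int_y01.sub hE.int_y00) hE.int_eps0 hE.Φ0_eq E.meas_Φ0
  refine h.congr (.of_forall fun o => ?_)
  by_cases ht : o.2.1 = true
  · simp [Set.indicator, untreated, ht, dd]
  · simp [Set.indicator, untreated, ht, dd, eps0]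

lemma dd_mul_eps (E : Experiment d n) (o : Rec E.p d) :
    dd o * E.eps o = 1 / E.pr (cov o) * (dd o * E.eps1 o) := by
  unfold eps
  rcases dd_eq_zero_or_one o with h | h <;> rw [h] <;> ring

lemma sub_dd_mul_eps (E : Experiment d n) (o : Rec E.p d) :
    (1 - dd o) * E.eps o = -(1 / (1 - E.pr (cov o))) * ((1 - dd o) * E.eps0 o) := by
  unfold eps
  rcases dd_eq_zero_or_one o with h | h <;> rw [h] <;> ring

lemma Regular.condZero_dd_eps (hE : E.Regular K Z) (hK : K.Valid d) :
    CondZero E.P (cov : Rec E.p d → Cov E.p d) (fun o => dd o * E.eps o) := by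
  have := (hE.condZero_dd_eps1 hK).mul_left (g := fun w => 1 / E.pr w)
    (measurable_const.div E.meas_pr)
  refine this.congr (.of_forall fun o => (E.dd_mul_eps o).symm)

lemma Regular.condZero_sub_dd_eps (hE : E.Regular K Z) (hK : K.Valid d) :
    CondZero E.P (cov : Rec E.p d → Cov E.p d) (fun o => (1 - dd o) * E.eps o) := by
  have := (hE.condZero_sub_dd_eps0 hK).mul_left (g := fun w => -(1 / (1 - E.pr w)))
    (measurable_const.div (measurable_const.sub E.meas_pr)).neg
  refine this.congr (.of_forall fun o => (E.sub_dd_mul_eps o).symm)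

/-- Bound for the conditional moments of `ε` of order two and four. -/
def _root_.DiD.Consts.vε (K : Consts) : ℝ := 1 + K.Cε

lemma abs_pow_le_one_add_rpow {x r : ℝ} {m : ℕ} (hm : (m : ℝ) ≤ r) : |x| ^ m ≤ 1 + |x| ^ r := by
  rcases le_total |x| 1 with h | h
  · have h1 : |x| ^ m ≤ 1 := pow_le_one₀ (abs_nonneg x) h
    have h2 := rpow_nonneg (abs_nonneg x) r
    linarith
  · have := Real.rpow_le_rpow_of_exponent_le h hm
    rw [Real.rpow_natCast] at this
    linarith

lemma Regular.lintegral_eps_le (hE : E.Regular K Z) (hK : K.Valid d) {g : Cov E.p d → ℝ≥0∞}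
    (hg : Measurable g) :
    ∫⁻ o, g (cov o) * ofReal (1 + |E.eps o| ^ K.rε) ∂E.P ≤ ofReal K.vε * ∫⁻ o, g (cov o) ∂E.P := by
  have hm : Measurable fun o => |E.eps o| ^ K.rε := by have := E.measurable_eps; fun_prop
  have hnn : ∀ o, 0 ≤ |E.eps o| ^ K.rε := fun o => rpow_nonneg (abs_nonneg _) _
  have h1 := lintegral_mul_le_of_condExp_le measurable_cov hm hnn hE.int_eps hK.Cε.le hE.eps_moment
    hg
  have e : ∀ o, g (cov o) * ofReal (1 + |E.eps o| ^ K.rε) =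
      g (cov o) + g (cov o) * ofReal (|E.eps o| ^ K.rε) := fun o => by
    rw [ofReal_add zero_le_one (hnn o), mul_add, ofReal_one, mul_one]
  simp_rw [e]
  have hgc : Measurable fun o : Rec E.p d => g (cov o) := hg.comp measurable_cov
  rw [lintegral_add_left hgc, Consts.vε,
    ofReal_add zero_le_one hK.Cε.le, add_mul, ofReal_one, one_mul]
  gcongr

lemma Regular.condSqLE_eps (hE : E.Regular K Z) (hK : K.Valid d) :
    CondSqLE E.P (cov : Rec E.p d → Cov E.p d) E.eps K.vε := by
  intro h hh
  refine le_trans (lintegral_mono fun o => ?_) (hE.lintegral_eps_le hK hh)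
  gcongr
  rw [← sq_abs]
  exact abs_pow_le_one_add_rpow (by have := hK.rε; push_cast; linarith)

lemma Regular.condSqLE_eps_sq (hE : E.Regular K Z) (hK : K.Valid d) :
    CondSqLE E.P (cov : Rec E.p d → Cov E.p d) (fun o => E.eps o ^ 2) K.vε := by
  intro h hh
  refine le_trans (lintegral_mono fun o => ?_) (hE.lintegral_eps_le hK hh)
  gcongr
  have e : (E.eps o ^ 2) ^ 2 = |E.eps o| ^ 4 := by grind
  rw [e]
  exact abs_pow_le_one_add_rpow (by have := hK.rε; push_cast; linarith)

lemma _root_.DiD.Consts.Valid.vε_pos (hK : K.Valid d) : 0 < K.vε := by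
  have := hK.Cε; unfold Consts.vε; linarith

lemma Regular.eps_sq (hE : E.Regular K Z) (hK : K.Valid d) :
    Integrable (fun o => E.eps o ^ 2) E.P ∧ ∫ o, E.eps o ^ 2 ∂E.P ≤ K.vε := by
  have := (hE.condSqLE_eps hK).integrable_mul E.measurable_eps measurable_cov
    (g := fun _ => 1) measurable_const (fun _ => zero_le_one) (integrable_const _) hK.vε_pos.le
  simpa using this

lemma Regular.eps_four (hE : E.Regular K Z) (hK : K.Valid d) :
    Integrable (fun o => E.eps o ^ 4) E.P ∧ ∫ o, E.eps o ^ 4 ∂E.P ≤ K.vε := by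
  have := (hE.condSqLE_eps_sq hK).integrable_mul (E.measurable_eps.pow_const 2) measurable_cov
    (g := fun _ => 1) measurable_const (fun _ => zero_le_one) (integrable_const _) hK.vε_pos.le
  simp only [one_mul, ← pow_mul] at this
  simpa using this

lemma Regular.memLp_eps (hE : E.Regular K Z) (hK : K.Valid d) : MemLp E.eps 2 E.P :=
  (memLp_two_iff_integrable_sq E.measurable_eps.aestronglyMeasurable).2 (hE.eps_sq hK).1

lemma Regular.condZero_eps (hE : E.Regular K Z) (hK : K.Valid d) :
    CondZero E.P (cov : Rec E.p d → Cov E.p d) E.eps := by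
  intro h hh hi
  have hm : Measurable (dd : Rec E.p d → ℝ) := measurable_dd
  have hm' : Measurable fun o : Rec E.p d => 1 - dd o := measurable_const.sub hm
  have hb : ∀ o : Rec E.p d, ‖dd o‖ ≤ 1 := fun o => by
    rcases dd_eq_zero_or_one o with h | h <;> simp [h]
  have hb' : ∀ o : Rec E.p d, ‖1 - dd o‖ ≤ 1 := fun o => by
    rcases dd_eq_zero_or_one o with h | h <;> simp [h]
  have i1 : Integrable (fun o => h (cov o) * (dd o * E.eps o)) E.P :=
    (hi.bdd_mul hm.aestronglyMeasurable (.of_forall hb)).congr (.of_forall fun o => by ring)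
  have i2 : Integrable (fun o => h (cov o) * ((1 - dd o) * E.eps o)) E.P :=
    (hi.bdd_mul hm'.aestronglyMeasurable (.of_forall hb')).congr (.of_forall fun o => by ring)
  have e : (fun o => h (cov o) * E.eps o) = fun o => h (cov o) * (dd o * E.eps o) +
      h (cov o) * ((1 - dd o) * E.eps o) := by ext o; ring
  rw [e, integral_add i1 i2, hE.condZero_dd_eps hK h hh i1, hE.condZero_sub_dd_eps hK h hh i2,
    add_zero]

end Experiment

open scoped MatrixOrder Matrix.Norms.L2Operator in
lemma exists_whitening {k : ℕ} {S : Matrix (Fin k) (Fin k) ℝ} {c : ℝ} (hc : 0 < c)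
    (hS : Sᵀ = S) (h : EigGE S c) :
    ∃ B : Matrix (Fin k) (Fin k) ℝ, IsUnit B.det ∧ B * S * Bᵀ = 1 := by
  have hpos : S.PosSemidef := by
    refine Matrix.PosSemidef.of_dotProduct_mulVec_nonneg ?_ fun v => ?_
    · rw [Matrix.IsHermitian, Matrix.conjTranspose_eq_transpose_of_trivial, hS]
    · simp only [star_trivial]
      exact (mul_nonneg hc.le (nsq_nonneg v)).trans (h v)
  obtain ⟨C, hC⟩ := CStarAlgebra.nonneg_iff_eq_star_mul_self.1 hpos.nonneg
  rw [Matrix.star_eq_conjTranspose, Matrix.conjTranspose_eq_transpose_of_trivial] at hC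
  have hdet : IsUnit C.det := by
    have := Experiment.isUnit_det_of_eigGE hc h
    simp_all
  have hdetT : IsUnit Cᵀ.det := by rwa [det_transpose]
  refine ⟨Cᵀ⁻¹, (Matrix.isUnit_nonsing_inv_det _ hdetT), ?_⟩
  rw [hC, Matrix.transpose_nonsing_inv, Matrix.transpose_transpose, ← Matrix.mul_assoc,
    nonsing_inv_mul _ hdetT, Matrix.one_mul, mul_nonsing_inv _ hdet]

/-- Whitened vectors are no longer than `|v| / √c`. -/
lemma whitening_le {k : ℕ} {S B : Matrix (Fin k) (Fin k) ℝ} {c : ℝ} (hc : 0 < c)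
    (h : EigGE S c) (hB : B * S * Bᵀ = 1) (v : Fin k → ℝ) :
    nsq (B *ᵥ v) ≤ nsq v / c := by
  set u := B *ᵥ v
  set y := Bᵀ *ᵥ u
  have h1 : y ⬝ (S *ᵥ y) = nsq u := by
    have e1 : y ⬝ (S *ᵥ y) = u ⬝ (B *ᵥ (S *ᵥ y)) := by
      rw [dotProduct_mulVec u B, ← mulVec_transpose]
    rw [e1, mulVec_mulVec, mulVec_mulVec, hB, one_mulVec]
  have h2 : nsq u = y ⬝ v := by
    change u ⬝ (B *ᵥ v) = _
    rw [dotProduct_mulVec, ← mulVec_transpose]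
  have h3 := h y
  rw [h1] at h3
  have h4 := sq_dotProduct_le y v
  rw [← h2] at h4
  have hu := nsq_nonneg u
  have hv := nsq_nonneg v
  rw [le_div_iff₀ hc]
  rcases hu.eq_or_lt with h0 | h0
  · rw [← h0]; simpa using hv
  · nlinarith

namespace Experiment

/-- `g` is an orthonormal basis of the sieve space, with `|g|² ≤ M`. -/
structure SieveBasis (E : Experiment d n) (g : EZ d → Fin E.k → ℝ) (M : ℝ) : Prop where
  meas : Measurable g
  ortho : OrthoSystem E.P (fun o => g (zz o)) M
  PZ_eq : ∀ w, E.PZ w = projM (rowsM g fun i => (w i).2)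
  of_ψ : ∀ γ : Fin E.k → ℝ, ∃ t : Fin E.k → ℝ, ∀ z, E.ψ z ⬝ γ = g z ⬝ t
  to_ψ : ∀ t : Fin E.k → ℝ, ∃ γ : Fin E.k → ℝ, ∀ z, g z ⬝ t = E.ψ z ⬝ γ
  ortho_rn : ∀ a, ∫ o, g (zz o) a * E.rn (zz o) ∂E.P = 0

/-- A measurable version of the sieve approximation error. -/
def rnI (E : Experiment d n) (Z : Set (EZ d)) : EZ d → ℝ := Z.indicator E.rn

lemma Regular.f0_continuousOn (hE : E.Regular K Z) : ContinuousOn E.f0 Z := (hE.F_sub hE.f0_mem).1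

lemma Regular.measurable_f0I (hE : E.Regular K Z) (hZ : IsCompact Z) :
    Measurable (Z.indicator E.f0) := by
  classical
  rw [← Set.piecewise_eq_indicator]
  exact hE.f0_continuousOn.measurable_piecewise continuousOn_const hZ.measurableSet

lemma Regular.measurable_rnI (hE : E.Regular K Z) (hZ : IsCompact Z) :
    Measurable (E.rnI Z) := by
  have e : E.rnI Z = Z.indicator fun z => Z.indicator E.f0 z - E.ψ z ⬝ E.γ0 := by
    ext z
    by_cases h : z ∈ Z <;> simp [rnI, rn, h]
  rw [e]
  exact ((hE.measurable_f0I hZ).sub (measurable_dotProduct E.meas_ψ measurable_const)).indicator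
    hZ.measurableSet

lemma Regular.rnI_ae (hE : E.Regular K Z) : ∀ᵐ o ∂E.P, E.rn (zz o) = E.rnI Z (zz o) := by
  filter_upwards [hE.zz_mem] with o ho
  simp [rnI, ho]

lemma Regular.abs_rn_le (hE : E.Regular K Z) {z : EZ d} (hz : z ∈ Z) :
    |E.rn z| ≤ E.lk * E.ck :=
  hE.approx_sup _ hE.f0_mem _ hE.γ0_proj z hz

lemma Regular.memLp_rnI (hE : E.Regular K Z) (hZ : IsCompact Z) :
    MemLp (fun o => E.rnI Z (zz o)) 2 E.P :=
  (MemLp.of_bound (((hE.measurable_rnI hZ).comp measurable_zz).aestronglyMeasurable) (E.lk * E.ck)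
    (by
      filter_upwards [hE.zz_mem, hE.rnI_ae] with o ho h
      rw [Function.comp_apply, ← h, norm_eq_abs]
      exact hE.abs_rn_le ho) : MemLp (E.rnI Z ∘ zz) 2 E.P)

lemma Regular.memLp_ψ (hE : E.Regular K Z) (a : Fin E.k) :
    MemLp (fun o => E.ψ (zz o) a) 2 E.P := by
  refine (MemLp.of_bound (C := E.ξ0)
    ((measurable_pi_apply a).comp (E.meas_ψ.comp measurable_zz)).aestronglyMeasurable ?_ :
      MemLp ((fun v : Fin E.k → ℝ => v a) ∘ (E.ψ ∘ zz)) 2 E.P)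
  filter_upwards [hE.zz_mem] with o ho
  refine le_trans ?_ (hE.ψ_sup _ ho)
  rw [norm_eq_abs, ← Real.sqrt_sq_eq_abs]
  exact Real.sqrt_le_sqrt (single_le_sum (f := fun a => E.ψ (zz o) a ^ 2)
    (fun _ _ => sq_nonneg _) (mem_univ a))

lemma Regular.exists_sieveBasis (hE : E.Regular K Z) (hK : K.Valid d) (hZ : IsCompact Z) :
    ∃ g : EZ d → Fin E.k → ℝ, E.SieveBasis g (E.ξ0 ^ 2 / K.cψ) := by
  have hsym : E.gramψᵀ = E.gramψ := by
    ext a b; simp only [gramψ, transpose_apply, of_apply, mul_comm]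
  obtain ⟨B, hBu, hB⟩ := exists_whitening hK.cψ hsym hE.gram_ge
  have hmeas : Measurable fun z => B *ᵥ E.ψ z :=
    measurable_pi_lambda _ fun a => measurable_dotProduct measurable_const E.meas_ψ
  have hBT : IsUnit Bᵀ.det := by rwa [det_transpose]
  have key : ∀ t z, (B *ᵥ E.ψ z) ⬝ t = E.ψ z ⬝ (Bᵀ *ᵥ t) := fun t z => by
    rw [dotProduct_mulVec, Matrix.vecMul_transpose]
  refine ⟨fun z => B *ᵥ E.ψ z, hmeas, ⟨hmeas.comp measurable_zz, ?_, fun a b => ?_⟩,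
    fun w => ?_, fun γ => ⟨Bᵀ⁻¹ *ᵥ γ, fun z => ?_⟩, fun t => ⟨Bᵀ *ᵥ t, key t⟩, fun a => ?_⟩
  · filter_upwards [hE.zz_mem] with o ho
    refine (whitening_le hK.cψ hE.gram_ge hB _).trans ?_
    have h1 := hE.ψ_sup _ ho
    have h2 : E.ψ (zz o) ⬝ E.ψ (zz o) ≤ E.ξ0 ^ 2 := by
      have e : E.ψ (zz o) ⬝ E.ψ (zz o) = ∑ a, E.ψ (zz o) a ^ 2 := by simp [dotProduct, sq]
      rw [e]
      exact (sqrt_le_left hE.ξ0_nonneg).1 h1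
    exact div_le_div_of_nonneg_right h2 hK.cψ.le
  · have hi : ∀ x y, Integrable (fun o => B a x * E.ψ (zz o) x * (B b y * E.ψ (zz o) y)) E.P :=
      fun x y => ((hE.memLp_ψ x).const_mul (B a x)).integrable_mul
        ((hE.memLp_ψ y).const_mul (B b y))
    have e : ∀ o : Rec E.p d, (B *ᵥ E.ψ (zz o)) a * (B *ᵥ E.ψ (zz o)) b =
        ∑ x, ∑ y, B a x * E.ψ (zz o) x * (B b y * E.ψ (zz o) y) := fun o => by
      simp only [mulVec, dotProduct]
      rw [sum_mul_sum]
    have e2 : (B * E.gramψ * Bᵀ) a b = (1 : Matrix (Fin E.k) (Fin E.k) ℝ) a b := by rw [hB]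
    rw [Matrix.one_apply] at e2
    rw [← e2]
    simp_rw [e]
    rw [integral_finsetSum _ fun x _ => integrable_finsetSum _ fun y _ => hi x y]
    simp_rw [integral_finsetSum _ fun y _ => hi _ y]
    rw [Matrix.mul_assoc, Matrix.mul_apply]
    refine sum_congr rfl fun x _ => ?_
    rw [Matrix.mul_apply, mul_sum]
    refine sum_congr rfl fun y _ => ?_
    rw [gramψ, of_apply, transpose_apply, ← integral_mul_const, ← integral_const_mul]
    grind
  · have e : rowsM (fun z => B *ᵥ E.ψ z) (fun i => (w i).2) = E.Psi w * Bᵀ := by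
      ext i a
      simp only [rowsM, Psi, of_apply, Matrix.mul_apply, transpose_apply, mulVec, dotProduct]
      exact sum_congr rfl fun _ _ => mul_comm _ _
    rw [e, projM_mul_right _ hBT]
    rfl
  · simp_all
  · have hi : ∀ x, Integrable (fun o => B a x * (E.ψ (zz o) x * E.rn (zz o))) E.P := fun x => by
      refine Integrable.const_mul ?_ _
      refine ((hE.memLp_ψ x).integrable_mul (hE.memLp_rnI hZ)).congr ?_
      filter_upwards [hE.rnI_ae] with o ho
      simp [ho]
    have e : ∀ o : Rec E.p d, (B *ᵥ E.ψ (zz o)) a * E.rn (zz o) =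
        ∑ x, B a x * (E.ψ (zz o) x * E.rn (zz o)) := fun o => by
      simp only [mulVec, dotProduct, sum_mul, mul_assoc]
    simp_rw [e]
    rw [integral_finsetSum _ fun x _ => hi x]
    refine sum_eq_zero fun x _ => ?_
    rw [integral_const_mul]
    have := hE.γ0_proj x
    rw [show ∫ o, E.ψ (zz o) x * E.rn (zz o) ∂E.P = 0 from this, mul_zero]

lemma Regular.Phi_sub_eq (hE : E.Regular K Z) (hK : K.Valid d) (hZ : IsCompact Z) :
    ∀ᵐ o ∂E.P, E.Φ1 (cov o) - E.Φ0 (cov o) = xx o ⬝ E.β0 + E.f0 (zz o) := by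
  set Pt := ProbabilityTheory.cond E.P treated with hPt
  have hac : Pt ≪ E.P := ProbabilityTheory.cond_absolutelyContinuous
  have hcond : ∀ {f : Rec E.p d → ℝ}, Integrable f E.P → Integrable f Pt := fun hf =>
    hf.restrict.smul_measure (ENNReal.inv_ne_top.2 (hE.measure_treated_ne_zero hK))
  have i1 : Integrable dY1 Pt := hcond (hE.int_y11.sub hE.int_y00)
  have i0 : Integrable dY0 Pt := hcond (hE.int_y01.sub hE.int_y00)
  have e : (fun o : Rec E.p d => y11 o - y01 o) = dY1 - dY0 := by ext o; simp [dY1, dY0]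
  have hm : Pt[fun o : Rec E.p d => y11 o - y01 o | sigW E.p d] =ᵐ[Pt]
      fun o => xx o ⬝ E.β0 + E.f0 (zz o) := hE.model
  rw [e] at hm
  have h1 := condExp_sub i1 i0 (sigW E.p d)
  have hae : ∀ᵐ o ∂Pt, E.Φ1 (cov o) - E.Φ0 (cov o) = xx o ⬝ E.β0 + E.f0 (zz o) := by
    filter_upwards [hm, h1, hac.ae_le hE.Φ1_eq, hac.ae_le hE.Φ0_eq, hac.ae_le hE.parallel]
      with o a1 a2 a3 a4 a5
    rw [← a1, a2, Pi.sub_apply, a3, a5, a4]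
  have hae' : ∀ᵐ o ∂E.P, o ∈ treated →
      E.Φ1 (cov o) - E.Φ0 (cov o) = xx o ⬝ E.β0 + E.f0 (zz o) := by
    have h2 : ∀ᵐ o ∂(E.P.restrict treated), E.Φ1 (cov o) - E.Φ0 (cov o) =
        xx o ⬝ E.β0 + E.f0 (zz o) := by
      rw [hPt, ProbabilityTheory.cond] at hae
      simp_all
    exact (ae_restrict_iff' measurableSet_treated).1 h2
  have hA : MeasurableSet {w : Cov E.p d | ¬ (E.Φ1 w - E.Φ0 w =
      w.1 ⬝ E.β0 + Z.indicator E.f0 w.2)} :=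
    (measurableSet_eq_fun (E.meas_Φ1.sub E.meas_Φ0)
      ((measurable_dotProduct measurable_fst measurable_const).add
        ((hE.measurable_f0I hZ).comp measurable_snd))).compl
  have h3 := hE.ae_of_ae_treated hK hA (by
    filter_upwards [hae', hE.zz_mem] with o ho hz ht hn
    refine hn ?_
    have : (cov o).2 ∈ Z := hz
    rw [Set.indicator_of_mem this]
    exact ho ht)
  filter_upwards [h3, hE.zz_mem] with o ho hz
  simp only [not_not] at ho
  have hz' : (cov o).2 ∈ Z := hz
  rw [ho, Set.indicator_of_mem hz']
  rfl

/-- The infeasible score obeys the partially linear model with error `ε`. -/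
lemma Regular.score_eq (hE : E.Regular K Z) (hK : K.Valid d) (hZ : IsCompact Z) :
    ∀ᵐ o ∂E.P, score E.pr E.Φ1 E.Φ0 o = xx o ⬝ E.β0 + E.f0 (zz o) + E.eps o := by
  filter_upwards [hE.Phi_sub_eq hK hZ, hE.overlap, hE.no_anticipation] with o h1 h2 h3
  rw [← h1]
  have hc := hK.cπ
  have hp : E.pr (cov o) ≠ 0 := by linarith [h2.1]
  have hq : 1 - E.pr (cov o) ≠ 0 := by linarith [h2.2]
  rcases hd : o.2.1 with _ | _
  · have e : dd o = 0 := by simp [dd, hd]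
    simp only [score, eps, eps1, eps0, dY, dY0, e]
    field_simp
    ring
  · have e : dd o = 1 := by simp [dd, hd]
    have := h3 hd
    simp only [score, eps, eps1, eps0, dY, dY1, e, this]
    field_simp
    ring

/-- The innovation of the debiasing direction, `w₀ᵀX̄`. -/
def bb (E : Experiment d n) (o : Rec E.p d) : ℝ := E.w0 ⬝ E.Xbar o

lemma measurable_bb (E : Experiment d n) : Measurable E.bb :=
  measurable_dotProduct measurable_const E.measurable_Xbar

lemma Xbar_eq_cov (E : Experiment d n) (o : Rec E.p d) :
    E.Xbar o = (cov o).1 - E.piZ (cov o).2 := by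
  rw [Xbar_eq, XPi_eq]; rfl

lemma Regular.eps_mul_Xbar_memLp (hE : E.Regular K Z) (hK : K.Valid d) (j : Fin E.p) :
    MemLp (fun o => E.eps o * E.Xbar o j) 2 E.P := by
  have hm : Measurable fun w : Cov E.p d => (w.1 j - E.piZ w.2 j) ^ 2 := by
    have := E.measurable_piZ
    fun_prop
  have hx := (measurable_pi_apply j).comp E.measurable_Xbar
  have h1 := ((hE.condSqLE_eps hK).integrable_mul E.measurable_eps measurable_cov hm
    (fun _ => sq_nonneg _) (by
      refine ((hE.memLp_Xbar j).integrable_sq).congr (.of_forall fun o => ?_)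
      simp [Xbar_eq_cov]) hK.vε_pos.le).1
  refine memLp_two_mul_of_sq E.measurable_eps hx (h1.congr (.of_forall fun o => ?_))
  simp [Xbar_eq_cov, mul_comm]

lemma Regular.Omega_eq (hE : E.Regular K Z) (hK : K.Valid d) :
    E.Omega = of fun j l => ∫ o, E.eps o * E.Xbar o j * (E.eps o * E.Xbar o l) ∂E.P := by
  ext j l
  simp only [Omega, of_apply]
  have hi : Integrable (fun o => E.eps o ^ 2 * (E.Xbar o j * E.Xbar o l)) E.P :=
    ((hE.eps_mul_Xbar_memLp hK j).integrable_mul (hE.eps_mul_Xbar_memLp hK l)).congr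
      (.of_forall fun o => by simp only [Pi.mul_apply]; ring)
  have hsm : StronglyMeasurable[sigW E.p d] fun o => E.Xbar o j * E.Xbar o l := by
    have hm : Measurable fun w : Cov E.p d => (w.1 j - E.piZ w.2 j) * (w.1 l - E.piZ w.2 l) := by
      have := E.measurable_piZ
      fun_prop
    have : (fun o => E.Xbar o j * E.Xbar o l) =
        (fun w : Cov E.p d => (w.1 j - E.piZ w.2 j) * (w.1 l - E.piZ w.2 l)) ∘ cov := by
      ext o; simp [Xbar_eq_cov]
    rw [this]
    exact (hm.comp (comap_measurable cov)).stronglyMeasurable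
  have h1 := condExp_mul_of_stronglyMeasurable_right hsm hi (hE.eps_sq hK).1
  have h2 : ∫ o, E.sig2 o * (E.Xbar o j * E.Xbar o l) ∂E.P =
      ∫ o, (E.P[(fun o => E.eps o ^ 2 * (E.Xbar o j * E.Xbar o l)) | sigW E.p d]) o ∂E.P :=
    integral_congr_ae h1.symm
  rw [h2, integral_condExp (sigW_le _ _)]
  exact integral_congr_ae (.of_forall fun o => by ring)

lemma avar_eq_w0 (E : Experiment d n) : E.avar = E.w0 ⬝ (E.Omega *ᵥ E.w0) := by
  have h : E.SigBar⁻¹ᵀ = E.SigBar⁻¹ := by rw [Matrix.transpose_nonsing_inv, SigBar_transpose]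
  rw [avar, Vbeta, w0, ← mulVec_mulVec, ← mulVec_mulVec, dotProduct_mulVec,
    ← mulVec_transpose, h, mulVec_neg, neg_dotProduct_neg]

lemma Regular.avar_eq (hE : E.Regular K Z) (hK : K.Valid d) :
    E.avar = ∫ o, (E.bb o * E.eps o) ^ 2 ∂E.P := by
  rw [avar_eq_w0, hE.Omega_eq hK,
    ← integral_dotProduct_sq (U := fun o j => E.eps o * E.Xbar o j) (hE.eps_mul_Xbar_memLp hK)]
  refine integral_congr_ae (.of_forall fun o => ?_)
  have : (E.w0 ⬝ fun j => E.eps o * E.Xbar o j) = E.bb o * E.eps o := by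
    simp only [bb, dotProduct, sum_mul]
    exact sum_congr rfl fun _ _ => by ring
  simp only [this]

lemma Regular.avar_ge (hE : E.Regular K Z) (hK : K.Valid d) :
    K.cOm * (K.cξ * K.cSig) ^ 2 ≤ E.avar := by
  rw [avar_eq_w0]
  exact (mul_le_mul_of_nonneg_left (hE.w0_ge hK) hK.cOm.le).trans (hE.Omega_ge _)

lemma Regular.avar_le (hE : E.Regular K Z) (hK : K.Valid d) :
    E.avar ≤ K.COm * K.wMax ^ 2 := by
  rw [avar_eq_w0]
  exact (hE.Omega_le _).trans (mul_le_mul_of_nonneg_left (hE.w0_sq_le hK) hK.COm.le)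

lemma Regular.LamBar2_le (hE : E.Regular K Z) (hK : K.Valid d) (h : 0 < E.s0) :
    E.LamBar2 ≤ 1 / K.cSig := by
  obtain ⟨j, hj⟩ := Finset.card_pos.1 h
  have h1 : ∑ l ∈ E.S0, (Pi.single j 1 : Fin E.p → ℝ) l ^ 2 = 1 := by
    rw [Finset.sum_eq_single_of_mem j hj fun l _ hl => by simp [hl]]
    simp
  have hv : (Pi.single j 1 : Fin E.p → ℝ) ⬝ Pi.single j 1 = 1 := by simp
  have h2 := hE.SigBar_le (Pi.single j 1)
  rw [hv, mul_one] at h2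
  refine le_trans (csInf_le ⟨0, ?_⟩ ⟨Pi.single j 1, ?_, ?_, rfl⟩) ?_
  · rintro q ⟨δ, -, -, rfl⟩
    exact div_nonneg ((mul_nonneg hK.cSig.le (nsq_nonneg δ)).trans (hE.SigBar_ge δ))
      (sum_nonneg fun _ _ => sq_nonneg _)
  · simp
  · rw [sum_eq_zero fun l hl => ?_]
    · positivity
    · have : l ≠ j := by rintro rfl; exact (Finset.mem_compl.1 hl) hj
      simp [this]
  · rw [h1, div_one]
    exact h2

variable {q : EZ d → Fin E.k → ℝ} {A M : ℝ}

/-- The sieve design matrix of a sample in the basis `q`. -/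
abbrev Zm {p k : ℕ} (q : EZ d → Fin k → ℝ) (r : Fin n → Rec p d) : Matrix (Fin n) (Fin k) ℝ :=
  rowsM q fun l => zz (r l)

lemma SieveBasis.PZ_covs (hb : E.SieveBasis q M) (r : E.Smp) :
    E.PZ (E.covs r) = projM (Zm q r.1) := hb.PZ_eq _

lemma SieveBasis.Xtil_apply (hb : E.SieveBasis q M) (r : E.Smp) (i : Fin n) (j : Fin E.p) :
    E.Xtil (E.covs r) i j = residM (Zm q r.1) (fun l => xx (r.1 l) j) i := by
  rw [Xtil, hb.PZ_covs]
  rfl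

lemma SieveBasis.Xtil_mulVec (hb : E.SieveBasis q M) (r : E.Smp) (v : Fin E.p → ℝ) :
    E.Xtil (E.covs r) *ᵥ v = residM (Zm q r.1) (fun l => v ⬝ xx (r.1 l)) := by
  have e : ((of fun i j => (E.covs r i).1 j) : Matrix (Fin n) (Fin E.p) ℝ) *ᵥ v =
      fun l => v ⬝ xx (r.1 l) := by
    ext l
    rw [mulVec, dotProduct_comm]
    rfl
  rw [Xtil, hb.PZ_covs, Matrix.sub_mulVec, ← mulVec_mulVec, e]
  rfl

lemma Regular.integral_iid_residM_xx (hE : E.Regular K Z) (hb : E.SieveBasis q M)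
    (v : Fin E.p → ℝ) :
    ∫ r, nsq (residM (Zm q r) (fun l => v ⬝ xx (r l)))
        ∂(iid E.P n) - n * ∫ o, (v ⬝ E.Xbar o) ^ 2 ∂E.P ≤
      n * ((∑ j, |v j|) ^ 2 * (K.Cproj * E.rate)) := by
  set Xt : (Fin n → Rec E.p d) → Fin n → Fin E.p → ℝ := fun r i j =>
    residM (Zm q r) (fun l => xx (r l) j) i with hXt
  obtain ⟨y⟩ : Nonempty E.Aux := nonempty_of_isProbabilityMeasure E.ν
  have hmem : ∀ i j, MemLp (fun r => Xt r i j) 2 (iid E.P n) := fun i j =>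
    memLp_residM measurable_zz hb.meas (measurable_xx_apply j) (hE.memLp_xx j) i
  have hi1 : ∀ i j l, Integrable (fun r => Xt r i j * Xt r i l) (iid E.P n) := fun i j l =>
    (hmem i j).integrable_mul (hmem i l)
  have hiX : ∀ j l, Integrable (fun o => E.Xbar o j * E.Xbar o l) E.P := fun j l =>
    (hE.memLp_Xbar j).integrable_mul (hE.memLp_Xbar l)
  have hi2 : ∀ (i : Fin n) j l, Integrable (fun r : Fin n → Rec E.p d =>
      E.Xbar (r i) j * E.Xbar (r i) l) (iid E.P n) := fun i j l =>
    integrable_iid_eval i (hiX j l)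
  have hpe : ∀ i j l, |∫ r, (Xt r i j * Xt r i l - E.Xbar (r i) j * E.Xbar (r i) l) ∂(iid E.P n)|
      ≤ K.Cproj * E.rate := fun i j l => by
    have h1 := hE.proj_error i j l
    simp_rw [hb.Xtil_apply] at h1
    have h2 : ∫ r, (Xt r.1 i j * Xt r.1 i l - E.Xbar (r.1 i) j * E.Xbar (r.1 i) l) ∂E.μ =
        ∫ r, (Xt r i j * Xt r i l - E.Xbar (r i) j * E.Xbar (r i) l) ∂(iid E.P n) := by
      rw [μ, integral_fun_fst (f := fun r => Xt r i j * Xt r i l - E.Xbar (r i) j * E.Xbar (r i) l)]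
      simp
    rwa [← h2]
  have hexp : ∀ x : Fin E.p → ℝ, (v ⬝ x) ^ 2 = ∑ j, ∑ l, v j * v l * (x j * x l) := fun x => by
    rw [sq, dotProduct, sum_mul_sum]
    grind
  have e1 : ∀ r : Fin n → Rec E.p d, nsq (residM (Zm q r) (fun l => v ⬝ xx (r l))) =
      ∑ i, ∑ j, ∑ l, v j * v l * (Xt r i j * Xt r i l) := fun r => by
    rw [dotProduct]
    refine sum_congr rfl fun i _ => ?_
    rw [← sq, ← hexp]
    have := congrFun (hb.Xtil_mulVec (r, y) v) i
    simp only at this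
    rw [← this, mulVec, dotProduct_comm]
    congr 2
    ext j
    exact hb.Xtil_apply (r, y) i j
  simp_rw [e1, hexp]
  rw [integral_finsetSum _ fun i _ => integrable_finsetSum _ fun j _ =>
    integrable_finsetSum _ fun l _ => (hi1 i j l).const_mul _]
  have e2 : (n : ℝ) * ∫ o, ∑ j, ∑ l, v j * v l * (E.Xbar o j * E.Xbar o l) ∂E.P =
      ∑ _i : Fin n, ∫ o, ∑ j, ∑ l, v j * v l * (E.Xbar o j * E.Xbar o l) ∂E.P := by simp
  rw [e2, ← sum_sub_distrib]
  have e3 : ∀ i, ∫ r, ∑ j, ∑ l, v j * v l * (Xt r i j * Xt r i l) ∂(iid E.P n) -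
      ∫ o, ∑ j, ∑ l, v j * v l * (E.Xbar o j * E.Xbar o l) ∂E.P ≤
      (∑ j, |v j|) ^ 2 * (K.Cproj * E.rate) := fun i => by
    rw [integral_finsetSum _ fun j _ => integrable_finsetSum _ fun l _ => (hi1 i j l).const_mul _,
      integral_finsetSum _ fun j _ => integrable_finsetSum _ fun l _ => (hiX j l).const_mul _,
      ← sum_sub_distrib, sq, sum_mul_sum, sum_mul]
    refine sum_le_sum fun j _ => ?_
    rw [integral_finsetSum _ fun l _ => (hi1 i j l).const_mul _,
      integral_finsetSum _ fun l _ => (hiX j l).const_mul _, ← sum_sub_distrib,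
      sum_mul]
    refine sum_le_sum fun l _ => ?_
    rw [integral_const_mul, integral_const_mul, ← mul_sub,
      ← integral_iid_eval (n := n) (f := fun o => E.Xbar o j * E.Xbar o l) i (hiX j l).1,
      ← integral_sub (hi1 i j l) (hi2 i j l), ← abs_mul]
    refine (le_abs_self _).trans ?_
    rw [abs_mul]
    exact mul_le_mul_of_nonneg_left (hpe i j l) (abs_nonneg _)
  refine (sum_le_sum fun i _ => e3 i).trans ?_
  simp

lemma Regular.integral_iid_residM_XPi (hE : E.Regular K Z) (hK : K.Valid d)
    (hb : E.SieveBasis q M) (hn : 0 < n) {v : Fin E.p → ℝ} (hv : nsq v ≤ K.wMax ^ 2) :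
    ∫ r, nsq (residM (Zm q r) (fun l => v ⬝ E.XPi (r l))) ∂(iid E.P n) ≤
      n * ((∑ j, |v j|) ^ 2 * (K.Cproj * E.rate)) + (E.k * log n + 2) / K.cX := by
  have hc := hK.cX_pos
  have hnR : (0 : ℝ) < n := by exact_mod_cast hn
  have hlog := Real.log_natCast_nonneg n
  have hh : Measurable fun z => v ⬝ E.piZ z :=
    measurable_dotProduct measurable_const E.measurable_piZ
  have h1 := (hE.condZero_Xbar v).integral_residM_le (n := n) measurable_zz hb.meas
    (hE.sg hK hv).2.2 hc (div_nonneg hlog hc.le) hh (by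
      have := (hE.sg hK hv).2.1.memLp_two hc
      simpa only [E.XPi_eq] using this)
  have h2 := hE.integral_iid_residM_xx hb v
  have e : ∀ o, v ⬝ E.piZ (zz o) + v ⬝ E.Xbar o = v ⬝ xx o := fun o => by
    rw [E.xx_eq, dotProduct_add, E.XPi_eq]
  simp_rw [e, ← E.XPi_eq] at h1
  have h3 : (n : ℝ) * (2 * exp (-(K.cX * (log n / K.cX))) / K.cX) = 2 / K.cX := by
    rw [mul_div_cancel₀ _ hc.ne', exp_neg, exp_log hnR]
    field_simp
  have h4 : (E.k * log n + 2) / K.cX = E.k * (log n / K.cX) + 2 / K.cX := by ring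
  rw [h3] at h1
  rw [h4]
  linarith

/-- Sieve coefficients of the coordinates of `X`. -/
def gam (E : Experiment d n) (q : EZ d → Fin E.k → ℝ) (j : Fin E.p) : Fin E.k → ℝ :=
  fun a => ∫ o, q (zz o) a * xx o j ∂E.P

/-- Sieve approximation error of `E[X_j | Z]`. -/
def eta (E : Experiment d n) (q : EZ d → Fin E.k → ℝ) (j : Fin E.p) (o : Rec E.p d) : ℝ :=
  E.XPi o j - q (zz o) ⬝ E.gam q j

lemma SieveBasis.measurable_eta (hb : E.SieveBasis q M) (j : Fin E.p) : Measurable (E.eta q j) :=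
  ((measurable_pi_apply j).comp E.measurable_XPi).sub
    (measurable_dotProduct hb.ortho.meas measurable_const)

lemma SieveBasis.memLp_φ_dot (hb : E.SieveBasis q M) (t : Fin E.k → ℝ) :
    MemLp (fun o => q (zz o) ⬝ t) 2 E.P := by
  simp_rw [dotProduct_comm _ t]
  exact memLp_dotProduct hb.ortho.memLp t

lemma Regular.memLp_eta (hE : E.Regular K Z) (hb : E.SieveBasis q M) (j : Fin E.p) :
    MemLp (E.eta q j) 2 E.P := (hE.memLp_XPi j).sub (hb.memLp_φ_dot _)

lemma Regular.condZero_Xbar_apply (hE : E.Regular K Z) (j : Fin E.p) :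
    CondZero E.P (zz : Rec E.p d → EZ d) (fun o => E.Xbar o j) := by
  have := hE.condZero_Xbar (Pi.single j 1)
  simpa using this

lemma SieveBasis.integral_φ_mul_dot (hb : E.SieveBasis q M) (t : Fin E.k → ℝ) (a : Fin E.k) :
    ∫ o, q (zz o) a * (q (zz o) ⬝ t) ∂E.P = t a := by
  have e : ∀ o : Rec E.p d, q (zz o) a * (q (zz o) ⬝ t) =
      ∑ b, t b * (q (zz o) a * q (zz o) b) := fun o => by
    rw [dotProduct, mul_sum]
    exact sum_congr rfl fun _ _ => by ring
  have hi : ∀ b, Integrable (fun o => t b * (q (zz o) a * q (zz o) b)) E.P := fun b =>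
    ((hb.ortho.memLp a).integrable_mul (hb.ortho.memLp b)).const_mul _
  simp_rw [e]
  rw [integral_finsetSum _ fun b _ => hi b]
  simp_rw [integral_const_mul]
  simp only [hb.ortho.ortho]
  simp

lemma Regular.integral_φ_mul_XPi (hE : E.Regular K Z) (hb : E.SieveBasis q M) (j : Fin E.p)
    (a : Fin E.k) : ∫ o, q (zz o) a * E.XPi o j ∂E.P = E.gam q j a := by
  have i1 : Integrable (fun o => q (zz o) a * xx o j) E.P :=
    (hb.ortho.memLp a).integrable_mul (hE.memLp_xx j)
  have i2 : Integrable (fun o => q (zz o) a * E.Xbar o j) E.P :=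
    (hb.ortho.memLp a).integrable_mul (hE.memLp_Xbar j)
  have h0 := hE.condZero_Xbar_apply j (fun z => q z a) ((measurable_pi_apply a).comp hb.meas) i2
  have e : ∀ o, q (zz o) a * E.XPi o j = q (zz o) a * xx o j - q (zz o) a * E.Xbar o j :=
    fun o => by rw [E.xx_eq, Pi.add_apply]; ring
  simp_rw [e]
  rw [integral_sub i1 i2, h0, sub_zero]
  rfl

lemma Regular.integral_φ_mul_eta (hE : E.Regular K Z) (hb : E.SieveBasis q M) (j : Fin E.p)
    (a : Fin E.k) : ∫ o, q (zz o) a * E.eta q j o ∂E.P = 0 := by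
  have i1 : Integrable (fun o => q (zz o) a * E.XPi o j) E.P :=
    (hb.ortho.memLp a).integrable_mul (hE.memLp_XPi j)
  have i2 : Integrable (fun o => q (zz o) a * (q (zz o) ⬝ E.gam q j)) E.P :=
    (hb.ortho.memLp a).integrable_mul (hb.memLp_φ_dot _)
  have e : ∀ o, q (zz o) a * E.eta q j o =
      q (zz o) a * E.XPi o j - q (zz o) a * (q (zz o) ⬝ E.gam q j) := fun o => by
    rw [eta]; ring
  simp_rw [e]
  rw [integral_sub i1 i2, hE.integral_φ_mul_XPi hb, hb.integral_φ_mul_dot, sub_self]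

lemma Regular.gam_sq_le (hE : E.Regular K Z) (hK : K.Valid d) (hb : E.SieveBasis q M)
    (j : Fin E.p) : E.gam q j ⬝ E.gam q j ≤ 2 / K.cX := by
  have h1 := ((hE.sg_apply hK j).2.1.sq hK.cX_pos).2
  set G := E.gam q j
  have hG : ∫ o, (q (zz o) ⬝ G) * E.XPi o j ∂E.P = nsq G := by
    have e : ∀ o, (q (zz o) ⬝ G) * E.XPi o j = ∑ a, G a * (q (zz o) a * E.XPi o j) := fun o => by
      rw [dotProduct, sum_mul]
      exact sum_congr rfl fun _ _ => by ring
    have hi : ∀ a, Integrable (fun o => G a * (q (zz o) a * E.XPi o j)) E.P := fun a =>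
      ((hb.ortho.memLp a).integrable_mul (hE.memLp_XPi j)).const_mul _
    simp_rw [e]
    rw [integral_finsetSum _ fun a _ => hi a]
    simp_rw [integral_const_mul, hE.integral_φ_mul_XPi hb]
    rfl
  have h2 := sq_integral_mul_le (hb.memLp_φ_dot G) (hE.memLp_XPi j)
  have h3 := hb.ortho.integral_sq G
  simp_rw [dotProduct_comm G (q _)] at h3
  rw [hG, h3, sq] at h2
  rcases (nsq_nonneg G).eq_or_lt with h0 | h0
  · rw [← h0]; have := hK.cX_pos; positivity
  · exact (le_of_mul_le_mul_left h2 h0).trans h1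

/-- Constant in the bound for the sieve approximation error of `E[X | Z]`. -/
def _root_.DiD.Consts.Cg (K : Consts) (A : ℝ) : ℝ := 2 * (K.Cproj + 3 * A / K.cX)

lemma Regular.eta_sq_le (hE : E.Regular K Z) (hK : K.Valid d) (hb : E.SieveBasis q M)
    (hs : Scal A n E.k (log E.p) M) (hM : 256 * (E.k * M) ≤ n) (j : Fin E.p) :
    ∫ o, E.eta q j o ^ 2 ∂E.P ≤ K.Cg A * E.rate := by
  have hc := hK.cX_pos
  have hn := hs.nR_pos
  have hv : (Pi.single j 1 : Fin E.p → ℝ) ⬝ Pi.single j 1 ≤ K.wMax ^ 2 := by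
    have := hK.wMax_pos
    simp only [dotProduct_single, Pi.single_eq_same, mul_one]
    nlinarith
  have h1 := hE.integral_iid_residM_XPi hK hb hs.n_pos hv
  have hs1 : ∑ l, |(Pi.single j 1 : Fin E.p → ℝ) l| = 1 := by
    rw [sum_eq_single j (fun l _ hl => by simp [hl]) (by simp)]; simp
  simp only [single_dotProduct, one_mul, hs1, one_pow] at h1
  have hV := (measurable_pi_apply j).comp E.measurable_piZ
  have h2 := OrthoSystem.integral_residM_ge (n := n) measurable_zz hb.meas hb.ortho
    (V := fun z => E.piZ z j) hV
    (by simpa only [E.XPi_eq] using hE.memLp_XPi j) (γ := E.gam q j) (fun a => by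
      have := hE.integral_φ_mul_eta hb j a
      simpa only [eta, E.XPi_eq] using this) hs.k_pos hM
  simp only [← E.XPi_eq] at h2
  have h3 : (n : ℝ) / 2 * ∫ o, E.eta q j o ^ 2 ∂E.P ≤
      n * (K.Cproj * E.rate) + (E.k * log n + 2) / K.cX := h2.trans h1
  have h4 : (E.k * log n + 2) / K.cX ≤ n * (3 * A / K.cX * E.rate) := by
    have h5 := hs.k_log_le
    rw [div_le_iff₀ hn] at h5
    have h6 := one_le_mul_of_one_le_of_one_le hs.one_le_k hs.log_n
    rw [div_le_iff₀ hc]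
    have : (n : ℝ) * (3 * A / K.cX * E.rate) * K.cX = 3 * (A * √(log E.p / n) * n) := by
      rw [rate]; field_simp
    rw [this]
    linarith
  have h5 : (n : ℝ) * ∫ o, E.eta q j o ^ 2 ∂E.P ≤ n * (K.Cg A * E.rate) := by
    rw [Consts.Cg]; linarith
  exact le_of_mul_le_mul_left h5 hn

variable {f : EZ d → Fin E.k → ℝ} {M : ℝ} {r : Fin n → Rec E.p d}

/-- The family of sub-Gaussian variables: coordinates of `X`, `E[X | Z]`, `X̄`, and `w₀ᵀX̄`. -/
def famU (E : Experiment d n) : (Fin E.p ⊕ Fin E.p) ⊕ (Fin E.p ⊕ Unit) → Rec E.p d → ℝ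
  | .inl (.inl j) => fun o => xx o j
  | .inl (.inr j) => fun o => E.XPi o j
  | .inr (.inl j) => fun o => E.Xbar o j
  | .inr (.inr _) => E.bb

lemma Regular.sg_bb (hE : E.Regular K Z) (hK : K.Valid d) : SG E.P K.cX E.bb :=
  (hE.sg hK (hE.w0_sq_le hK)).2.2

lemma Regular.sg_famU (hE : E.Regular K Z) (hK : K.Valid d) (u) : SG E.P K.cX (E.famU u) := by
  rcases u with (j | j) | (j | j)
  · exact (hE.sg_apply hK j).1
  · exact (hE.sg_apply hK j).2.1
  · exact (hE.sg_apply hK j).2.2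
  · exact hE.sg_bb hK

end Experiment

namespace Consts

variable (K : Consts)

/-- Constants derived from the fixed ones: growth of the sieve, eigenvalue bound for `E[XXᵀ]`,
tolerance for the sieve Gram matrix, and the constants of the concentration bounds. -/
def A : ℝ := 1 + K.Cψ / K.cψ
def CS : ℝ := 1 / K.cPi + 1 / K.cSig
def τ : ℝ := K.cSig / (16 * (K.CS + K.cSig))
def e₁ : ℝ := 43 / K.cX
def e₂ : ℝ := 8 * ((7 + 20 * K.A) / K.cX) * (K.A + 2)
def Eη : ℝ := etaConst K.A K.cX (2 / K.cX) (K.Cg K.A)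
def Eηb : ℝ := etaCovConst K.A K.cX (2 / K.cX) (K.Cg K.A)
def aQ : ℝ := K.e₁ + K.e₂ / K.τ
def CD : ℝ := K.e₁ + 2 * K.e₂ + 4 * (1 + K.Eηb) + (1 + 32 * K.Eη * ((7 + 20 * K.A) / K.cX))

namespace Valid

variable {K} {d : ℕ}

lemma one_le_A (h : K.Valid d) : 1 ≤ K.A := by
  have := h.Cψ; have := h.cψ; unfold A; have : 0 < K.Cψ / K.cψ := by positivity
  linarith
lemma CS_pos (h : K.Valid d) : 0 < K.CS := by have := h.cPi; have := h.cSig; unfold CS; positivity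
lemma τ_pos (h : K.Valid d) : 0 < K.τ := by have := h.CS_pos; have := h.cSig; unfold τ; positivity
lemma τ_le (h : K.Valid d) : K.τ ≤ 1 / 16 := by
  have h1 := h.CS_pos; have h2 := h.cSig
  unfold τ
  rw [div_le_iff₀ (by positivity)]
  linarith
lemma τ_CS_le (h : K.Valid d) : 4 * K.τ * K.CS ≤ K.cSig / 4 := by
  have h1 := h.CS_pos; have h2 := h.cSig
  unfold τ
  have : 4 * (K.cSig / (16 * (K.CS + K.cSig))) * K.CS =
      K.cSig / 4 * (K.CS / (K.CS + K.cSig)) := by field_simp; norm_num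
  rw [this]
  exact mul_le_of_le_one_right (by positivity) ((div_le_one (by positivity)).2 (by linarith))
lemma e₁_pos (h : K.Valid d) : 0 < K.e₁ := by have := h.cX_pos; unfold e₁; positivity
lemma e₂_pos (h : K.Valid d) : 0 < K.e₂ := by have := h.cX_pos; have := h.one_le_A; unfold e₂; positivity
lemma Cg_pos (h : K.Valid d) : 0 < K.Cg K.A := by
  have := h.cX_pos; have := h.one_le_A; have := h.Cproj; unfold Cg; positivity
lemma Eη_pos (h : K.Valid d) : 0 < K.Eη := by
  have := h.cX_pos; have := h.one_le_A; have := h.Cg_pos; unfold Eη etaConst; positivity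
lemma Eηb_pos (h : K.Valid d) : 0 < K.Eηb := by
  have h1 := h.cX_pos; have h2 := h.one_le_A; have h3 := h.Cg_pos; have h4 := h.Eη_pos
  unfold Eηb etaCovConst; unfold Eη at h4; positivity
lemma aQ_pos (h : K.Valid d) : 0 < K.aQ := by
  have := h.e₁_pos; have := h.e₂_pos; have := h.τ_pos; unfold aQ; positivity
lemma CD_pos (h : K.Valid d) : 0 < K.CD := by
  have := h.e₁_pos; have := h.e₂_pos; have := h.Eηb_pos; have := h.Eη_pos
  have := h.cX_pos; have := h.one_le_A
  unfold CD; positivity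

end Valid

end Consts

namespace Experiment

variable {f : EZ d → Fin E.k → ℝ} {M : ℝ} {r : Fin n → Rec E.p d}

/-- The event on which all concentration bounds for the covariates hold. -/
structure CovGood (E : Experiment d n) (K : Consts) (f : EZ d → Fin E.k → ℝ)
    (r : Fin n → Rec E.p d) : Prop where
  gram : OrthoSystem.GramOK (fun o : Rec E.p d => f (zz o)) K.τ r
  fam : FamGood E.P E.famU (fun o : Rec E.p d => f (zz o)) K.cX (log E.p) K.A r
  bmax : ∀ i, E.bb (r i) ^ 2 ≤ 2 * log n / K.cX
  eta : ∀ j, ∑ i, E.eta f j (r i) ^ 2 ≤ K.Eη * (n * log E.p / ((E.k + log E.p) * log n))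
  etab : ∀ j, (∑ i, E.eta f j (r i) * E.bb (r i)) ^ 2 ≤ 8 * (n * K.Eηb) * (2 * log E.p)

lemma Regular.integral_eta_mul_bb (hE : E.Regular K Z) (hK : K.Valid d)
    (hb : E.SieveBasis f M) (j : Fin E.p) : ∫ o, E.eta f j o * E.bb o ∂E.P = 0 := by
  have hi : Integrable (fun o => E.eta f j o * E.bb o) E.P :=
    (hE.memLp_eta hb j).integrable_mul ((hE.sg_bb hK).memLp_two hK.cX_pos)
  have hm : Measurable fun z => E.piZ z j - f z ⬝ E.gam f j :=
    ((measurable_pi_apply j).comp E.measurable_piZ).sub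
      (measurable_dotProduct hb.meas measurable_const)
  simp only [Experiment.eta, E.XPi_eq] at hi ⊢
  exact hE.condZero_Xbar E.w0 _ hm hi

lemma Regular.measure_not_covGood (hE : E.Regular K Z) (hK : K.Valid d)
    (hb : E.SieveBasis f M) (hs : Scal K.A n E.k (log E.p) M) (hM : 256 * (E.k * M) ≤ n) :
    iid E.P n {r | ¬ E.CovGood K f r} ≤ ofReal (E.k * M / (n * K.τ ^ 2) + 66 / n) := by
  have hc := hK.cX_pos
  have hn := hs.nR_pos
  have hp : (0 : ℝ) < E.p := by
    have := hE.p_gt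
    exact_mod_cast (Nat.zero_le n).trans_lt this
  have hp1 : (1 : ℝ) ≤ E.p := by exact_mod_cast (Nat.zero_le n).trans_lt hE.p_gt
  have hcard : (Fintype.card ((Fin E.p ⊕ Fin E.p) ⊕ (Fin E.p ⊕ Unit)) : ℝ) ≤
      4 * exp (log E.p) := by
    rw [exp_log hp]
    simp only [Fintype.card_sum, Fintype.card_fin, Fintype.card_unit]
    push_cast
    linarith
  have hcard' : (Fintype.card (Fin E.p) : ℝ) ≤ 4 * exp (log E.p) := by
    rw [exp_log hp, Fintype.card_fin]; linarith
  have hG : 0 < 2 / K.cX := by positivity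
  have hA0 := zero_le_one.trans hK.one_le_A
  have b1 := hb.ortho.iid_gram hs.n_pos hK.τ_pos
  have b2 := iid_not_famGood hc (hE.sg_famU hK) hb.ortho hs.log_n hs.L_ge hs.L_sq hcard hA0 hs.ΞL_le
  have b3 : iid E.P n {r | ∃ i, 2 * log n / K.cX < E.bb (r i) ^ 2} ≤
      ofReal (2 / n) := by
    refine iid_exists_le.trans ((mul_le_mul_right ((hE.sg_bb hK).tail _ hc) _).trans ?_)
    rw [mul_div_cancel₀ _ hc.ne', two_mul (log n), neg_add, exp_add, exp_neg,
      exp_log hn, ← ofReal_natCast, ← ofReal_mul hn.le]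
    grind
  have b4 := iid_eta hs hc hG hK.Cg_pos hb.ortho.bound (fun j o => rfl) hb.measurable_eta
    (hE.memLp_eta hb) (hE.gam_sq_le hK hb) (hE.eta_sq_le hK hb hs hM) hcard'
  have b5 := iid_eta_mul hs hc hG hK.Cg_pos hb.ortho.bound (fun j o => rfl) hb.measurable_eta
    (hE.memLp_eta hb) (hE.gam_sq_le hK hb) (fun j => (hE.sg_apply hK j).2.1)
    (hE.eta_sq_le hK hb hs hM) (hE.sg_bb hK) (hE.integral_eta_mul_bb hK hb) hcard'
  have hsub : {r | ¬ E.CovGood K f r} ⊆ ((({r | ¬ OrthoSystem.GramOK (fun o => f (zz o)) K.τ r} ∪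
      {r | OrthoSystem.GramOK (fun o => f (zz o)) 1 r ∧
        ¬ FamGood E.P E.famU (fun o => f (zz o)) K.cX (log E.p) K.A r}) ∪
      {r | ∃ i, 2 * log n / K.cX < E.bb (r i) ^ 2}) ∪
      {r | ∃ j, (∀ i, E.XPi (r i) j ^ 2 ≤ 4 * log E.p / K.cX) ∧
        K.Eη * (n * log E.p / ((E.k + log E.p) * log n)) ≤ ∑ i, E.eta f j (r i) ^ 2}) ∪
      {r | ∃ j, (∀ i, E.bb (r i) ^ 2 ≤ 2 * log n / K.cX) ∧ ∑ i, E.eta f j (r i) ^ 2 ≤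
          K.Eη * (n * log E.p / ((E.k + log E.p) * log n)) ∧
        8 * (n * K.Eηb) * (2 * log E.p) ≤ (∑ i, E.eta f j (r i) * E.bb (r i)) ^ 2} := by
    intro r hr
    by_contra hcon
    simp only [Set.mem_union, Set.mem_ofPred_eq, not_or, not_not, not_exists, not_and, not_le,
      not_lt] at hcon
    obtain ⟨⟨⟨⟨h1, h2⟩, h3⟩, h4⟩, h5⟩ := hcon
    have hf := h2 fun t => (h1 t).trans (mul_le_mul_of_nonneg_right
      (hK.τ_le.trans (by norm_num)) (nsq_nonneg t))
    have h4' := fun j => (h4 j fun i => hf.max (.inl (.inr j)) i).le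
    exact hr ⟨h1, hf, h3, h4', fun j => (h5 j h3 (h4' j)).le⟩
  refine (measure_mono hsub).trans ?_
  have hkΞ : 0 ≤ E.k * M / (n * K.τ ^ 2) := by have := hs.one_le_Ξ; have := hK.τ_pos; positivity
  have e : ofReal (E.k * M / (n * K.τ ^ 2) + 66 / n) =
      (((ofReal (E.k * M / (n * K.τ ^ 2)) + ofReal (52 / n)) +
        ofReal (2 / n)) + ofReal (4 / n)) + ofReal (8 / n) := by
    rw [← ofReal_add hkΞ (by positivity), ← ofReal_add (by positivity)
      (by positivity), ← ofReal_add (by positivity) (by positivity),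
      ← ofReal_add (by positivity) (by positivity)]
    congr 1
    ring
  rw [e]
  refine (measure_union_le _ _).trans (add_le_add ?_ b5)
  refine (measure_union_le _ _).trans (add_le_add ?_ b4)
  refine (measure_union_le _ _).trans (add_le_add ?_ b3)
  exact (measure_union_le _ _).trans (by gcongr)

end Experiment

lemma two_mul_le_add_of_sq_le {x a b : ℝ} (ha : 0 ≤ a) (hb : 0 ≤ b) (h : x ^ 2 ≤ a * b) :
    2 * x ≤ a + b := by
  have : (2 * x) ^ 2 ≤ (a + b) ^ 2 := by nlinarith [sq_nonneg (a - b)]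
  nlinarith

lemma abs_quadratic_le {p : ℕ} {M : Matrix (Fin p) (Fin p) ℝ} {e : ℝ} (h : ∀ j l, |M j l| ≤ e)
    (v : Fin p → ℝ) : |v ⬝ (M *ᵥ v)| ≤ e * (∑ j, |v j|) ^ 2 := by
  have h1 : ∀ j, |(M *ᵥ v) j| ≤ e * ∑ l, |v l| := fun j => by
    rw [mulVec, dotProduct_comm]
    exact abs_dotProduct_le_of_forall_le (h j)
  refine (abs_dotProduct_le_of_forall_le h1).trans (le_of_eq (by ring))

lemma avg_dotProduct_sq {p n : ℕ} (x : Fin n → Fin p → ℝ) (v : Fin p → ℝ) :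
    (n : ℝ)⁻¹ * ∑ i, (v ⬝ x i) ^ 2 = v ⬝ ((of fun j l => (n : ℝ)⁻¹ * ∑ i, x i j * x i l) *ᵥ v) := by
  have e : ∀ i, (v ⬝ x i) ^ 2 = ∑ j, ∑ l, v j * (x i j * x i l * v l) := fun i => by
    rw [sq, dotProduct, sum_mul_sum]
    grind
  simp_rw [e]
  rw [sum_comm, dotProduct, mul_sum]
  refine sum_congr rfl fun j _ => ?_
  rw [sum_comm, mulVec, dotProduct, mul_sum, mul_sum]
  refine sum_congr rfl fun l _ => ?_
  rw [of_apply, ← mul_sum, ← sum_mul]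
  ring

lemma residM_mulVec {n k : ℕ} {F : Matrix (Fin n) (Fin k) ℝ} (h : IsUnit (Fᵀ * F).det)
    (s : Fin k → ℝ) : residM F (F *ᵥ s) = 0 := by
  rw [residM, mulVec_mulVec, projM_mul _ h, sub_self]

namespace Experiment

variable {f : EZ d → Fin E.k → ℝ} {R : ℝ} {r : Fin n → Rec E.p d}

lemma CovGood.cov_le (hg : E.CovGood K f r) (hK : K.Valid d)
    (hs : Scal K.A n E.k (log E.p) R) (u v) :
    |(n : ℝ)⁻¹ * ∑ i, E.famU u (r i) * E.famU v (r i) - ∫ o, E.famU u o * E.famU v o ∂E.P| ≤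
      K.e₁ * E.rate := by
  have hn := hs.nR_pos
  have h1 := hg.fam.cov u v
  refine hs.le_rate_of_sq_le hK.e₁_pos.le ?_
  rw [sq_abs]
  set S := ∑ i, E.famU u (r i) * E.famU v (r i)
  set I := ∫ o, E.famU u o * E.famU v o ∂E.P
  have e : ((n : ℝ)⁻¹ * S - I) ^ 2 * n = (S - n * I) ^ 2 / n := by field_simp
  rw [e, div_le_iff₀ hn, Consts.e₁]
  refine h1.trans ?_
  have : 0 ≤ n * log E.p / K.cX ^ 2 := by positivity
  calc 8 * (n * (76 / K.cX ^ 2)) * (3 * log E.p)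
      = 1824 * (n * log E.p / K.cX ^ 2) := by ring
    _ ≤ 1849 * (n * log E.p / K.cX ^ 2) := by linarith
    _ = _ := by ring

lemma CovGood.vec_le (hg : E.CovGood K f r) (hK : K.Valid d) (hs : Scal K.A n E.k (log E.p) R) (u) :
    ∑ a, ((n : ℝ)⁻¹ * ∑ i, f (zz (r i)) a * E.famU u (r i) -
      ∫ o, f (zz o) a * E.famU u o ∂E.P) ^ 2 ≤ K.e₂ * E.rate := by
  have hn := hs.nR_pos
  have hc := hK.cX_pos
  have hA := hK.one_le_A
  have h1 := hg.fam.vec u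
  have e : ∀ a, ((n : ℝ)⁻¹ * ∑ i, f (zz (r i)) a * E.famU u (r i) -
      ∫ o, f (zz o) a * E.famU u o ∂E.P) ^ 2 = (n : ℝ)⁻¹ ^ 2 * (∑ i, f (zz (r i)) a *
        E.famU u (r i) - n * ∫ o, f (zz o) a * E.famU u o ∂E.P) ^ 2 := fun a => by
    field_simp
  simp_rw [e]
  rw [← mul_sum]
  refine (mul_le_mul_of_nonneg_left h1 (by positivity)).trans ?_
  have h2 := mul_le_mul_of_nonneg_left hs.kL_log_le
    (by positivity : 0 ≤ 8 * ((7 + 20 * K.A) / K.cX))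
  rw [Consts.e₂, rate]
  refine le_trans (le_of_eq ?_) (h2.trans (le_of_eq (by ring)))
  field_simp

lemma CovGood.gram_ge (hg : E.CovGood K f r) (hK : K.Valid d) (hn : 0 < n) (s : Fin E.k → ℝ) :
    n / 2 * nsq s ≤ nsq (Zm f r *ᵥ s) := by
  refine le_trans ?_ (OrthoSystem.GramOK.rowsM (T := zz) hg.gram hn s)
  refine mul_le_mul_of_nonneg_right ?_ (nsq_nonneg s)
  have := hK.τ_le
  nlinarith

lemma CovGood.isUnit (hg : E.CovGood K f r) (hK : K.Valid d) (hn : 0 < n) :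
    IsUnit ((Zm f r)ᵀ * Zm f r).det :=
  isUnit_gram (c := n / 2) (by have : (0 : ℝ) < n := by exact_mod_cast hn
                               positivity) (hg.gram_ge hK hn)

lemma CovGood.projM_le (hg : E.CovGood K f r) (hK : K.Valid d) (hn : 0 < n) (v : Fin n → ℝ) :
    nsq (projM (Zm f r) *ᵥ v) ≤ 2 / n * ∑ a, (∑ i, f (zz (r i)) a * v i) ^ 2 := by
  have h := projM_dot_self_le_of_gram (c := n / 2) (by positivity) (hg.gram_ge hK hn) v
  refine h.trans (le_of_eq ?_)
  rw [dotProduct]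
  simp only [transpose_rowsM_mulVec, ← sq]
  field_simp

lemma CovGood.projM_famU_le (hg : E.CovGood K f r) (hK : K.Valid d)
    (hs : Scal K.A n E.k (log E.p) R) {u} (h0 : ∀ a, ∫ o, f (zz o) a * E.famU u o ∂E.P = 0) :
    nsq (projM (Zm f r) *ᵥ fun l => E.famU u (r l)) ≤
      16 * (log n * ((7 + 20 * K.A) / K.cX)) * (E.k + 2 * log E.p) ∧
    (n : ℝ)⁻¹ * nsq (projM (Zm f r) *ᵥ fun l => E.famU u (r l)) ≤ 2 * K.e₂ * E.rate := by
  have hn := hs.nR_pos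
  have h1 := hg.projM_le hK hs.n_pos fun l => E.famU u (r l)
  have h2 := hg.fam.vec u
  have h3 := hg.vec_le hK hs u
  simp only [h0, mul_zero, sub_zero] at h2 h3
  constructor
  · refine h1.trans ((mul_le_mul_of_nonneg_left h2 (by positivity)).trans (le_of_eq ?_))
    field_simp
    ring
  · simp_rw [mul_pow] at h3
    rw [← mul_sum] at h3
    have h4 := mul_le_mul_of_nonneg_left h1 (by positivity : 0 ≤ (n : ℝ)⁻¹)
    grind

lemma CovGood.avg_xx_sq (hg : E.CovGood K f r) (hE : E.Regular K Z) (hK : K.Valid d)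
    (hs : Scal K.A n E.k (log E.p) R) (v : Fin E.p → ℝ) :
    |(n : ℝ)⁻¹ * ∑ i, (v ⬝ xx (r i)) ^ 2 - ∫ o, (v ⬝ xx o) ^ 2 ∂E.P| ≤
      K.e₁ * E.rate * (∑ j, |v j|) ^ 2 := by
  rw [avg_dotProduct_sq, integral_dotProduct_sq hE.memLp_xx, ← dotProduct_sub, ← Matrix.sub_mulVec]
  exact abs_quadratic_le (fun j l => hg.cov_le hK hs (.inl (.inl j)) (.inl (.inl l))) v

lemma CovGood.avg_xx_sq_le (hg : E.CovGood K f r) (hE : E.Regular K Z) (hK : K.Valid d)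
    (hs : Scal K.A n E.k (log E.p) R) (v : Fin E.p → ℝ) :
    (n : ℝ)⁻¹ * ∑ i, (v ⬝ xx (r i)) ^ 2 ≤ K.CS * nsq v + K.e₁ * E.rate * (∑ j, |v j|) ^ 2 := by
  have h1 := (abs_le.1 (hg.avg_xx_sq hE hK hs v)).2
  have h2 := hE.integral_xx_sq_le v
  rw [Consts.CS]
  linarith

lemma CovGood.avg_cross (hg : E.CovGood K f r) (hE : E.Regular K Z) (hK : K.Valid d)
    (hb : E.SieveBasis f R) (hs : Scal K.A n E.k (log E.p) R) (v : Fin E.p → ℝ)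
    (s : Fin E.k → ℝ) :
    ((n : ℝ)⁻¹ * ∑ i, (v ⬝ xx (r i)) * (f (zz (r i)) ⬝ s) -
      ∫ o, (v ⬝ xx o) * (f (zz o) ⬝ s) ∂E.P) ^ 2 ≤
      nsq s * (K.e₂ * E.rate) * (∑ j, |v j|) ^ 2 := by
  set g : Fin E.p → Fin E.k → ℝ := fun j a => (n : ℝ)⁻¹ * ∑ i, f (zz (r i)) a * xx (r i) j -
      ∫ o, f (zz o) a * xx o j ∂E.P with hgdef
  have hexp : ∀ o : Rec E.p d, (v ⬝ xx o) * (f (zz o) ⬝ s) =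
      ∑ j, ∑ a, v j * (s a * (f (zz o) a * xx o j)) := fun o => by
    rw [dotProduct, dotProduct, sum_mul_sum]
    grind
  have hi : ∀ j a, Integrable (fun o => v j * (s a * (f (zz o) a * xx o j))) E.P := fun j a =>
    (((hb.ortho.memLp a).integrable_mul (hE.memLp_xx j)).const_mul (s a)).const_mul (v j)
  have e : (n : ℝ)⁻¹ * ∑ i, (v ⬝ xx (r i)) * (f (zz (r i)) ⬝ s) -
      ∫ o, (v ⬝ xx o) * (f (zz o) ⬝ s) ∂E.P = v ⬝ fun j => s ⬝ g j := by
    simp_rw [hexp]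
    rw [integral_finsetSum _ fun j _ => integrable_finsetSum _ fun a _ => hi j a,
      sum_comm, mul_sum, ← sum_sub_distrib, dotProduct]
    refine sum_congr rfl fun j _ => ?_
    rw [integral_finsetSum _ fun a _ => hi j a, sum_comm, mul_sum,
      ← sum_sub_distrib, dotProduct, mul_sum]
    refine sum_congr rfl fun a _ => ?_
    rw [integral_const_mul, integral_const_mul, ← mul_sum, ← mul_sum, hgdef]
    ring
  have h0 : 0 ≤ nsq s * (K.e₂ * E.rate) :=
    mul_nonneg (nsq_nonneg s) (mul_nonneg hK.e₂_pos.le (sqrt_nonneg _))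
  have h1 : ∀ j, |s ⬝ g j| ≤ √(nsq s * (K.e₂ * E.rate)) := fun j => by
    refine abs_le_sqrt ((sq_dotProduct_le s (g j)).trans ?_)
    refine mul_le_mul_of_nonneg_left ?_ (nsq_nonneg s)
    have := hg.vec_le hK hs (.inl (.inl j))
    rw [dotProduct]
    simp only [← sq]
    exact this
  have h2 := abs_dotProduct_le_of_forall_le (v := v) h1
  rw [e, ← sq_abs]
  refine (pow_le_pow_left₀ (abs_nonneg _) h2 2).trans (le_of_eq ?_)
  rw [mul_pow, sq_sqrt h0]

/-- Restricted eigenvalue bound for the partialled-out design. -/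
lemma CovGood.residM_ge (hg : E.CovGood K f r) (hE : E.Regular K Z) (hK : K.Valid d)
    (hb : E.SieveBasis f R) (hs : Scal K.A n E.k (log E.p) R) (v : Fin E.p → ℝ) :
    K.cSig / 2 * nsq v - K.aQ * E.rate * (∑ j, |v j|) ^ 2 ≤
      (n : ℝ)⁻¹ * nsq (residM (Zm f r) (fun l => v ⬝ xx (r l))) := by
  set s := ((Zm f r)ᵀ * Zm f r)⁻¹ *ᵥ ((Zm f r)ᵀ *ᵥ fun l => v ⬝ xx (r l))
  have hr : residM (Zm f r) (fun l => v ⬝ xx (r l)) =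
      fun l => v ⬝ xx (r l) - f (zz (r l)) ⬝ s := by
    rw [residM, projM_mulVec_eq]
    rfl
  have e0 : (n : ℝ)⁻¹ * nsq (residM (Zm f r) (fun l => v ⬝ xx (r l))) = (n : ℝ)⁻¹ * ∑ i, (v ⬝ xx (r i)) ^ 2 -
      2 * ((n : ℝ)⁻¹ * ∑ i, (v ⬝ xx (r i)) * (f (zz (r i)) ⬝ s)) +
      (n : ℝ)⁻¹ * ∑ i, (f (zz (r i)) ⬝ s) ^ 2 := by
    have e : ∀ i, (v ⬝ xx (r i) - f (zz (r i)) ⬝ s) * (v ⬝ xx (r i) - f (zz (r i)) ⬝ s) =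
        (v ⬝ xx (r i)) ^ 2 - 2 * ((v ⬝ xx (r i)) * (f (zz (r i)) ⬝ s)) +
          (f (zz (r i)) ⬝ s) ^ 2 := fun i => by ring
    rw [hr, dotProduct]
    simp_rw [e]
    rw [sum_add_distrib, sum_sub_distrib, ← mul_sum]
    ring
  have mV := memLp_dotProduct hE.memLp_xx v
  have mφ := hb.memLp_φ_dot s
  set S2 := (n : ℝ)⁻¹ * ∑ i, (v ⬝ xx (r i)) ^ 2
  set C := (n : ℝ)⁻¹ * ∑ i, (v ⬝ xx (r i)) * (f (zz (r i)) ⬝ s)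
  set Gm := (n : ℝ)⁻¹ * ∑ i, (f (zz (r i)) ⬝ s) ^ 2
  set t := ∑ j, |v j|
  set V2 := ∫ o, (v ⬝ xx o) ^ 2 ∂E.P
  set B := ∫ o, (v ⬝ xx o) * (f (zz o) ⬝ s) ∂E.P
  set G := nsq s
  have hG : ∫ o, (f (zz o) ⬝ s) ^ 2 ∂E.P = G := by
    have := hb.ortho.integral_sq s
    simpa only [dotProduct_comm s] using this
  have hG0 := nsq_nonneg s
  have h1 := (abs_le.1 (hg.avg_xx_sq hE hK hs v)).1
  have h2 : (C - B) ^ 2 ≤ G * (K.e₂ * E.rate) * t ^ 2 := hg.avg_cross hE hK hb hs v s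
  have h3 : (1 - K.τ) * G ≤ Gm := by
    have := (abs_le.1 (hg.gram s)).1
    simp only [dotProduct_comm s (f _)] at this
    linarith
  have hτ := hK.τ_pos
  have h4 : 2 * (C - B) ≤ K.τ * G + K.e₂ / K.τ * E.rate * t ^ 2 := by
    refine two_mul_le_add_of_sq_le (by positivity) ?_ (h2.trans (le_of_eq (by field_simp)))
    exact mul_nonneg (mul_nonneg (div_nonneg hK.e₂_pos.le hτ.le) (sqrt_nonneg _)) (sq_nonneg _)
  set W := ∫ o, (v ⬝ xx o - f (zz o) ⬝ s) ^ 2 ∂E.P with hW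
  have i1 := mV.integrable_sq
  have i2 : Integrable (fun o => 2 * ((v ⬝ xx o) * (f (zz o) ⬝ s))) E.P :=
    (mV.integrable_mul mφ).const_mul 2
  have i3 := mφ.integrable_sq
  have i12 : Integrable (fun o => (v ⬝ xx o) ^ 2 - 2 * ((v ⬝ xx o) * (f (zz o) ⬝ s))) E.P :=
    i1.sub i2
  have h5 : W = V2 - 2 * B + G := by
    have e : ∀ o : Rec E.p d, (v ⬝ xx o - f (zz o) ⬝ s) ^ 2 = (v ⬝ xx o) ^ 2 -
        2 * ((v ⬝ xx o) * (f (zz o) ⬝ s)) + (f (zz o) ⬝ s) ^ 2 := fun o => by ring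
    rw [hW]
    simp_rw [e]
    rw [integral_add i12 i3, integral_sub i1 i2, hG, integral_const_mul]
  have h6 : K.cSig * nsq v ≤ W := by
    have hm : Measurable fun z => v ⬝ E.piZ z - f z ⬝ s :=
      (measurable_dotProduct measurable_const E.measurable_piZ).sub
        (measurable_dotProduct hb.meas measurable_const)
    have := hE.integral_add_Xbar_sq hm (by
      have := (memLp_dotProduct hE.memLp_XPi v).sub mφ
      simp only [E.XPi_eq] at this
      exact this) v
    have e : ∀ o : Rec E.p d, v ⬝ E.piZ (zz o) - f (zz o) ⬝ s + v ⬝ E.Xbar o =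
        v ⬝ xx o - f (zz o) ⬝ s := fun o => by
      rw [E.xx_eq, dotProduct_add, E.XPi_eq]; ring
    simp_rw [e] at this
    rw [hW, this]
    have h0 : 0 ≤ ∫ o : Rec E.p d, (v ⬝ E.piZ (zz o) - f (zz o) ⬝ s) ^ 2 ∂E.P :=
      integral_nonneg fun _ => sq_nonneg _
    linarith [hE.SigBar_ge v]
  have h7 : G ≤ 2 * W + 2 * V2 := by
    have i4 : Integrable (fun o => 2 * (v ⬝ xx o - f (zz o) ⬝ s) ^ 2) E.P :=
      (mV.sub mφ).integrable_sq.const_mul 2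
    have i5 := i1.const_mul 2
    rw [← hG, hW, ← integral_const_mul, ← integral_const_mul, ← integral_add i4 i5]
    refine integral_mono i3 (i4.add i5) fun o => ?_
    dsimp only
    nlinarith [sq_nonneg (2 * (v ⬝ xx o) - f (zz o) ⬝ s)]
  have h8 : V2 ≤ K.CS * nsq v := hE.integral_xx_sq_le v
  have h9 := mul_le_mul_of_nonneg_left h8 (by positivity : 0 ≤ 4 * K.τ)
  have h10 := mul_le_mul_of_nonneg_right hK.τ_CS_le (nsq_nonneg v)
  have h11 := mul_le_mul_of_nonneg_left h7 (by positivity : 0 ≤ 2 * K.τ)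
  have h12 : 0 ≤ W := integral_nonneg fun _ => sq_nonneg _
  have h13 := mul_le_mul_of_nonneg_right hK.τ_le h12
  rw [e0, Consts.aQ]
  linarith

variable {f : EZ d → Fin E.k → ℝ} {M : ℝ}

lemma Regular.integral_φ_mul_famU (hE : E.Regular K Z) (hK : K.Valid d) (hb : E.SieveBasis f M)
    (u : Fin E.p ⊕ Unit) (a : Fin E.k) : ∫ o, f (zz o) a * E.famU (.inr u) o ∂E.P = 0 := by
  have hm := (measurable_pi_apply a).comp hb.meas
  have hi := (hb.ortho.memLp a).integrable_mul ((hE.sg_famU hK (.inr u)).memLp_two hK.cX_pos)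
  rcases u with j | _
  · exact hE.condZero_Xbar_apply j _ hm hi
  · exact hE.condZero_Xbar E.w0 _ hm hi

lemma Regular.integral_Xbar_mul_bb (hE : E.Regular K Z) (hK : K.Valid d) (j : Fin E.p) :
    ∫ o, E.Xbar o j * E.bb o ∂E.P = -E.ξ j := by
  have h := congrFun (hE.SigBar_mulVec_w0 hK) j
  rw [Pi.neg_apply] at h
  rw [← h]
  have e : ∀ o, E.Xbar o j * E.bb o = ∑ l, E.Xbar o j * E.Xbar o l * E.w0 l := fun o => by
    rw [bb, dotProduct, mul_sum]
    exact sum_congr rfl fun _ _ => by ring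
  simp_rw [e]
  have hi : ∀ l, Integrable (fun o => E.Xbar o j * E.Xbar o l * E.w0 l) E.P := fun l =>
    ((hE.memLp_Xbar j).integrable_mul (hE.memLp_Xbar l)).mul_const _
  rw [integral_finsetSum _ fun l _ => hi l]
  simp_rw [integral_mul_const]
  rfl

lemma CovGood.abs_xi_add_le {r : E.Smp} (hg : E.CovGood K f r.1) (hE : E.Regular K Z)
    (hK : K.Valid d) (hb : E.SieveBasis f M) (hs : Scal K.A n E.k (log E.p) M)
    (j : Fin E.p) :
    |E.ξ j + (n : ℝ)⁻¹ * ((E.Xtil (E.covs r))ᵀ *ᵥ fun l => E.bb (r.1 l)) j| ≤ K.CD * E.rate := by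
  have hn := hs.nR_pos
  have hc := hK.cX_pos
  have hA := hK.one_le_A
  have hk := hs.one_le_k
  set F := Zm f r.1
  set b : Fin n → ℝ := fun l => E.bb (r.1 l)
  set xb : Fin n → ℝ := fun l => E.Xbar (r.1 l) j
  set h : Fin n → ℝ := fun l => E.eta f j (r.1 l)
  have hx : (fun l => xx (r.1 l) j) = (xb + h) + F *ᵥ E.gam f j := by
    ext l
    have : (F *ᵥ E.gam f j) l = f (zz (r.1 l)) ⬝ E.gam f j := rfl
    simp only [Pi.add_apply, this, xb, h, Experiment.eta]
    rw [E.xx_eq, Pi.add_apply]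
    ring
  have e1 : ((E.Xtil (E.covs r))ᵀ *ᵥ b) j = residM F (fun l => xx (r.1 l) j) ⬝ b := by
    simp only [mulVec, dotProduct, transpose_apply, hb.Xtil_apply]
    rfl
  have e2 : residM F (fun l => xx (r.1 l) j) ⬝ b = xb ⬝ b -
      (projM F *ᵥ xb) ⬝ (projM F *ᵥ b) + h ⬝ b - h ⬝ (projM F *ᵥ b) := by
    rw [hx, residM_add, residM_mulVec (hg.isUnit hK hs.n_pos), add_zero, residM_dot, residM,
      dotProduct_sub, add_dotProduct, add_dotProduct, projM_dot_projM]
    ring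
  rw [e1, e2]
  have P1 := (hg.projM_famU_le hK hs (u := .inr (.inl j)) (hE.integral_φ_mul_famU hK hb (.inl j))).2
  have P2 := hg.projM_famU_le hK hs (u := .inr (.inr ())) (hE.integral_φ_mul_famU hK hb (.inr ()))
  have t1 : |(n : ℝ)⁻¹ * (xb ⬝ b) - -E.ξ j| ≤ K.e₁ * E.rate := by
    rw [← hE.integral_Xbar_mul_bb hK j]
    exact hg.cov_le hK hs (.inr (.inl j)) (.inr (.inr ()))
  have t2 : |(n : ℝ)⁻¹ * ((projM F *ᵥ xb) ⬝ (projM F *ᵥ b))| ≤ 2 * K.e₂ * E.rate := by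
    rw [abs_mul, abs_of_nonneg (inv_nonneg.2 hn.le)]
    have q1 := two_mul_dotProduct_le (projM F *ᵥ xb) (projM F *ᵥ b)
    have q2 := two_mul_dotProduct_le (-(projM F *ᵥ xb)) (projM F *ᵥ b)
    rw [neg_dotProduct, neg_dotProduct_neg] at q2
    have q3 : |(projM F *ᵥ xb) ⬝ (projM F *ᵥ b)| ≤ (nsq (projM F *ᵥ xb) +
        nsq (projM F *ᵥ b)) / 2 := abs_le.2 ⟨by linarith, by linarith⟩
    refine (mul_le_mul_of_nonneg_left q3 (inv_nonneg.2 hn.le)).trans ?_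
    have r1 : (n : ℝ)⁻¹ * nsq (projM F *ᵥ xb) ≤ 2 * K.e₂ * E.rate := P1
    have r2 : (n : ℝ)⁻¹ * nsq (projM F *ᵥ b) ≤ 2 * K.e₂ * E.rate := P2.2
    linarith
  have t3 : |(n : ℝ)⁻¹ * (h ⬝ b)| ≤ 4 * (1 + K.Eηb) * E.rate := by
    have hp := hK.Eηb_pos
    refine hs.le_rate_of_sq_le (by positivity) ?_
    have := hg.etab j
    have e : |(n : ℝ)⁻¹ * (h ⬝ b)| ^ 2 * n = (h ⬝ b) ^ 2 / n := by rw [sq_abs]; field_simp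
    rw [e, div_le_iff₀ hn]
    refine this.trans ?_
    have h1 : K.Eηb ≤ (1 + K.Eηb) ^ 2 := by nlinarith
    have h2 := mul_le_mul_of_nonneg_right h1 (by positivity : 0 ≤ 16 * (n * log E.p))
    linarith
  have t4 : |(n : ℝ)⁻¹ * (h ⬝ (projM F *ᵥ b))| ≤
      (1 + 32 * K.Eη * ((7 + 20 * K.A) / K.cX)) * E.rate := by
    have hp := hK.Eη_pos
    set Y := (7 + 20 * K.A) / K.cX
    have hY : 0 ≤ Y := by positivity
    refine hs.le_rate_of_sq_le (by positivity) ?_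
    have e : |(n : ℝ)⁻¹ * (h ⬝ (projM F *ᵥ b))| ^ 2 * n = (h ⬝ (projM F *ᵥ b)) ^ 2 / n := by
      rw [sq_abs]; field_simp
    rw [e, div_le_iff₀ hn]
    refine (sq_dotProduct_le _ _).trans ?_
    have q1 : nsq h ≤ K.Eη * (n * log E.p / ((E.k + log E.p) * log n)) := by
      refine le_trans (le_of_eq ?_) (hg.eta j)
      simp only [dotProduct, sq, h]
    refine (mul_le_mul q1 P2.1 (nsq_nonneg _) ?_).trans ?_
    · have := hs.log_n; positivity
    have hl := hs.log_n
    have e2 : K.Eη * (n * log E.p / ((E.k + log E.p) * log n)) *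
        (16 * (log n * Y) * (E.k + 2 * log E.p)) =
        16 * (K.Eη * Y) * (n * log E.p) * ((E.k + 2 * log E.p) / (E.k + log E.p)) := by
      field_simp
    rw [e2]
    have h3 : (E.k + 2 * log E.p) / (E.k + log E.p) ≤ 2 := by
      rw [div_le_iff₀ (by positivity)]; linarith
    have h4 := mul_le_mul_of_nonneg_left h3 (by positivity : 0 ≤ 16 * (K.Eη * Y) * (n * log E.p))
    have h5 : 32 * K.Eη * Y ≤ (1 + 32 * K.Eη * Y) ^ 2 := by
      have : 0 ≤ 32 * K.Eη * Y := by positivity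
      nlinarith
    have h6 := mul_le_mul_of_nonneg_right h5 (by positivity : 0 ≤ (n * log E.p))
    linarith
  have e3 : E.ξ j + (n : ℝ)⁻¹ * (xb ⬝ b - (projM F *ᵥ xb) ⬝ (projM F *ᵥ b) + h ⬝ b -
      h ⬝ (projM F *ᵥ b)) = ((n : ℝ)⁻¹ * (xb ⬝ b) - -E.ξ j) -
      (n : ℝ)⁻¹ * ((projM F *ᵥ xb) ⬝ (projM F *ᵥ b)) + (n : ℝ)⁻¹ * (h ⬝ b) -
      (n : ℝ)⁻¹ * (h ⬝ (projM F *ᵥ b)) := by ring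
  rw [e3, Consts.CD]
  have a1 := abs_le.1 t1; have a2 := abs_le.1 t2; have a3 := abs_le.1 t3; have a4 := abs_le.1 t4
  grind

/-- Properties of the debiasing direction on the good event. -/
lemma CovGood.dantzig {r : E.Smp} (hg : E.CovGood K f r.1) (hE : E.Regular K Z)
    (hK : K.Valid d) (hb : E.SieveBasis f M) (hs : Scal K.A n E.k (log E.p) M)
    (hest : E.IsEstimated) {G : ℝ}
    (hG : (n : ℝ)⁻¹ * nsq (residM (Zm f r.1) (fun l => E.w0 ⬝ E.XPi (r.1 l))) ≤ G)
    (hlam : 0 < E.lam') (hlam' : 2 * K.CD * E.rate ≤ E.lam') :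
    E.Feasible (E.covs r) (E.wHat (E.covs r)) ∧
    ∑ j, |E.wHat (E.covs r) j| ≤ 3 * ∑ j, |E.w0 j| + (2 * G + 4 * K.e₂ * E.rate) / E.lam' ∧
    (n : ℝ)⁻¹ * ∑ i, ((E.Xtil (E.covs r) *ᵥ E.wHat (E.covs r)) i - E.bb (r.1 i)) ^ 2 ≤
      10 * (2 * G + 4 * K.e₂ * E.rate) + 24 * E.lam' * ∑ j, |E.w0 j| := by
  have hn := hs.nR_pos
  set X := E.Xtil (E.covs r)
  set b : Fin n → ℝ := fun l => E.bb (r.1 l)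
  set g := 2 * G + 4 * K.e₂ * E.rate with hgdef
  have h1 : ∀ j, |E.ξ j + (n : ℝ)⁻¹ * (Xᵀ *ᵥ b) j| ≤ E.lam' / 2 := fun j =>
    (hg.abs_xi_add_le hE hK hb hs j).trans (by linarith)
  have e : X *ᵥ E.w0 - b = residM (Zm f r.1) (fun l => E.w0 ⬝ E.XPi (r.1 l)) +
      -(projM (Zm f r.1) *ᵥ b) := by
    have : (fun l => E.w0 ⬝ xx (r.1 l)) = (fun l => E.w0 ⬝ E.XPi (r.1 l)) + b := by
      ext l
      rw [E.xx_eq, dotProduct_add]; rfl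
    rw [hb.Xtil_mulVec, this, residM_add, residM.eq_1 _ b]
    abel
  have hPb := (hg.projM_famU_le hK hs (u := .inr (.inr ()))
    (hE.integral_φ_mul_famU hK hb (.inr ()))).2
  have h2 : (n : ℝ)⁻¹ * nsq (X *ᵥ E.w0 - b) ≤ g := by
    rw [e]
    refine (mul_le_mul_of_nonneg_left (add_dotProduct_self_le _ _) (inv_nonneg.2 hn.le)).trans ?_
    rw [neg_dotProduct_neg]
    have : (n : ℝ)⁻¹ * nsq (projM (Zm f r.1) *ᵥ b) ≤ 2 * K.e₂ * E.rate := hPb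
    linarith
  obtain ⟨v, hv, hvn⟩ := exists_dantzig_feasible X E.ξ E.w0 b hlam h1 h2
  obtain ⟨hf, hmin⟩ := hest.dantzig (E.covs r) ⟨v, hv⟩
  set w := E.wHat (E.covs r)
  have hw := (hmin v hv).trans hvn
  refine ⟨hf, hw, ?_⟩
  have h3 := dantzig_prediction_error X E.ξ E.w0 w b h1 h2 hf
  have h4 : ∑ j, |(w - E.w0) j| ≤ 4 * ∑ j, |E.w0 j| + g / E.lam' := by
    have : ∑ j, |(w - E.w0) j| ≤ ∑ j, |w j| + ∑ j, |E.w0 j| := by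
      rw [← sum_add_distrib]
      exact sum_le_sum fun j _ => abs_sub _ _
    linarith
  have h5 := mul_le_mul_of_nonneg_left h4 (by positivity : 0 ≤ 3 * E.lam')
  have h6 : 3 * E.lam' * (4 * ∑ j, |E.w0 j| + g / E.lam') =
      12 * E.lam' * ∑ j, |E.w0 j| + 3 * g := by
    field_simp; ring
  have e2 : ∑ i, ((X *ᵥ w) i - E.bb (r.1 i)) ^ 2 =
      nsq (X *ᵥ (w - E.w0) + (X *ᵥ E.w0 - b)) := by
    rw [mulVec_sub, sub_add_sub_cancel, dotProduct]
    exact sum_congr rfl fun i _ => sq _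
  rw [e2]
  refine (mul_le_mul_of_nonneg_left (add_dotProduct_self_le _ _) (inv_nonneg.2 hn.le)).trans ?_
  linarith

end Experiment

section Weighted

variable {O J : Type*} [MeasurableSpace O] [MeasurableSpace J] {P : Measure O}
  [IsProbabilityMeasure P] {T : O → J} {u u' : O → ℝ} {n : ℕ}

lemma CondZero.add (hT : Measurable T) (hu : CondZero P T u) (hu' : CondZero P T u')
    (hi : Integrable u P) (hi' : Integrable u' P) : CondZero P T (fun o => u o + u' o) := by
  intro h hh hin
  set hN : ℕ → J → ℝ := fun N t => {t | |h t| ≤ N}.indicator h t with hNdef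
  have hm : ∀ N, Measurable (hN N) := fun N =>
    hh.indicator (measurableSet_le hh.abs measurable_const)
  have hbd : ∀ N t, ‖hN N t‖ ≤ N := fun N t => by
    by_cases ht : |h t| ≤ N
    · simp [hNdef, ht]
    · simp [hNdef, ht]
  have hz : ∀ N, ∫ o, hN N (T o) * (u o + u' o) ∂P = 0 := fun N => by
    have hmT : AEStronglyMeasurable (fun o => hN N (T o)) P := ((hm N).comp hT).aestronglyMeasurable
    have i1 := hi.bdd_mul hmT (.of_forall fun o => hbd N _)
    have i2 := hi'.bdd_mul hmT (.of_forall fun o => hbd N _)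
    simp_rw [mul_add]
    rw [integral_add i1 i2, hu _ (hm N) i1, hu' _ (hm N) i2, add_zero]
  have hlim : Tendsto (fun N => ∫ o, hN N (T o) * (u o + u' o) ∂P) atTop
      (𝓝 (∫ o, h (T o) * (u o + u' o) ∂P)) := by
    refine tendsto_integral_of_dominated_convergence (fun o => |h (T o) * (u o + u' o)|)
      (fun N => ?_) hin.abs (fun N => .of_forall fun o => ?_) (.of_forall fun o => ?_)
    · exact ((hm N).comp hT).aestronglyMeasurable.mul (hi.add hi').1
    · rw [norm_eq_abs, abs_mul, abs_mul]
      refine mul_le_mul_of_nonneg_right ?_ (abs_nonneg _)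
      by_cases ht : |h (T o)| ≤ N <;> simp [hNdef, ht]
    · refine tendsto_const_nhds.congr' ?_
      obtain ⟨M, hM⟩ := exists_nat_ge |h (T o)|
      filter_upwards [eventually_ge_atTop M] with N hN'
      have : |h (T o)| ≤ N := hM.trans (by exact_mod_cast hN')
      simp [hNdef, this]
  simp_rw [hz] at hlim
  exact tendsto_nhds_unique hlim tendsto_const_nhds

/-- Weights truncated on the event that their sum of squares exceeds `s`. -/
def truncW (s : ℝ) (a : (Fin n → J) → Fin n → ℝ) (i : Fin n) (t : Fin n → J) : ℝ :=
  {t | ∑ l, a t l ^ 2 ≤ s}.indicator (fun t => a t i) t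

lemma truncW_of_le {s : ℝ} {a : (Fin n → J) → Fin n → ℝ} {t : Fin n → J}
    (h : ∑ l, a t l ^ 2 ≤ s) (i : Fin n) : truncW s a i t = a t i := by
  simp [truncW, h]

lemma sum_truncW_sq_le {s : ℝ} (hs : 0 ≤ s) (a : (Fin n → J) → Fin n → ℝ) (t : Fin n → J) :
    ∑ i, truncW s a i t ^ 2 ≤ s := by
  by_cases h : ∑ l, a t l ^ 2 ≤ s
  · simpa [truncW_of_le h] using h
  · simpa [truncW, h] using hs

lemma measurable_truncW {s : ℝ} {a : (Fin n → J) → Fin n → ℝ}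
    (ha : ∀ i, Measurable fun t => a t i) (i : Fin n) : Measurable (truncW s a i) :=
  (ha i).indicator (measurableSet_le (measurable_sum _ fun l _ => (ha l).pow_const 2)
    measurable_const)

lemma CondSqLE.lintegral_weighted_le (hT : Measurable T) (hum : Measurable u) {v s : ℝ}
    (hv : 0 ≤ v) (hs : 0 ≤ s) (hsq : CondSqLE P T u v) {a : (Fin n → J) → Fin n → ℝ}
    (ha : ∀ i, Measurable fun t => a t i) :
    ∫⁻ r, ofReal (∑ i, truncW s a i (fun l => T (r l)) ^ 2 * u (r i) ^ 2) ∂(iid P n) ≤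
      ofReal (v * s) := by
  have hTn : Measurable fun r : Fin n → O => fun l => T (r l) :=
    measurable_pi_lambda _ fun l => hT.comp (measurable_pi_apply l)
  have e : ∀ r : Fin n → O, ofReal (∑ i, truncW s a i (fun l => T (r l)) ^ 2 * u (r i) ^ 2) =
      ∑ i, ofReal (truncW s a i (fun l => T (r l)) ^ 2) * ofReal (u (r i) ^ 2) :=
    fun r => by
      rw [ENNReal.ofReal_sum_of_nonneg fun i _ => by positivity]
      exact sum_congr rfl fun i _ => ofReal_mul (sq_nonneg _)
  have hw : ∀ i, Measurable fun t => ofReal (truncW s a i t ^ 2) := fun i =>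
    ((measurable_truncW ha i).pow_const 2).ennreal_ofReal
  have hwT : ∀ i, Measurable fun r : Fin n → O =>
      ofReal (truncW s a i (fun l => T (r l)) ^ 2) := fun i => (hw i).comp hTn
  have hwu : ∀ i, Measurable fun r : Fin n → O => ofReal
      (truncW s a i (fun l => T (r l)) ^ 2) * ofReal (u (r i) ^ 2) := fun i =>
    (hwT i).mul ((hum.comp (measurable_pi_apply i)).pow_const 2).ennreal_ofReal
  simp_rw [e]
  rw [lintegral_finsetSum _ fun i _ => hwu i]
  calc _ ≤ ∑ i, ofReal v *
        ∫⁻ r, ofReal (truncW s a i (fun l => T (r l)) ^ 2) ∂(iid P n) :=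
        sum_le_sum fun i _ => hsq.lintegral_iid hT hum i (hw i)
    _ = ofReal v *
        ∫⁻ r, ∑ i, ofReal (truncW s a i (fun l => T (r l)) ^ 2) ∂(iid P n) := by
        rw [← mul_sum, lintegral_finsetSum _ fun i _ => hwT i]
    _ ≤ ofReal v * ∫⁻ _, ofReal s ∂(iid P n) := by
        refine mul_le_mul_right (lintegral_mono fun r => ?_) _
        rw [← ENNReal.ofReal_sum_of_nonneg fun i _ => sq_nonneg _]
        exact ofReal_le_ofReal (sum_truncW_sq_le hs a _)
    _ = _ := by simp_all

lemma meas_ge_le_of_lintegral {α : Type*} [MeasurableSpace α] {μ : Measure α} {f : α → ℝ}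
    (hf : Measurable f) {C x : ℝ} (hx : 0 < x)
    (h : ∫⁻ a, ofReal (f a) ∂μ ≤ ofReal C) :
    μ {a | x ≤ f a} ≤ ofReal (C / x) := by
  rw [ENNReal.ofReal_div_of_pos hx]
  refine le_trans (measure_mono fun a ha => ?_) (le_trans (meas_ge_le_lintegral_div
    hf.ennreal_ofReal.aemeasurable (ENNReal.ofReal_pos.2 hx).ne' ofReal_ne_top)
    (div_le_div_right h _))
  exact ofReal_le_ofReal ha

lemma CondSqLE.iid_weighted_le (hT : Measurable T) (hum : Measurable u) {v s x : ℝ}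
    (hv : 0 ≤ v) (hs : 0 ≤ s) (hx : 0 < x) (hsq : CondSqLE P T u v)
    {a : (Fin n → J) → Fin n → ℝ} (ha : ∀ i, Measurable fun t => a t i) :
    iid P n {r | ∑ i, a (fun l => T (r l)) i ^ 2 ≤ s ∧
      x ≤ ∑ i, a (fun l => T (r l)) i ^ 2 * u (r i) ^ 2} ≤ ofReal (v * s / x) := by
  have hTn : Measurable fun r : Fin n → O => fun l => T (r l) :=
    measurable_pi_lambda _ fun l => hT.comp (measurable_pi_apply l)
  refine le_trans (measure_mono fun r hr => ?_) (meas_ge_le_of_lintegral ?_ hx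
    (hsq.lintegral_weighted_le hT hum hv hs ha))
  · simpa only [Set.mem_ofPred_eq, truncW_of_le hr.1] using hr.2
  · exact measurable_sum _ fun i _ => (((measurable_truncW ha i).comp hTn).pow_const 2).mul
      ((hum.comp (measurable_pi_apply i)).pow_const 2)

/-- Chebyshev's inequality given the conditioning variables. -/
lemma CondZero.iid_weighted_le (hT : Measurable T) (hum : Measurable u) (hu : CondZero P T u)
    (hu2 : MemLp u 2 P) {v s x : ℝ} (hv : 0 ≤ v) (hs : 0 ≤ s) (hx : 0 < x)
    (hsq : CondSqLE P T u v) {a : (Fin n → J) → Fin n → ℝ} (ha : ∀ i, Measurable fun t => a t i) :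
    iid P n {r | ∑ i, a (fun l => T (r l)) i ^ 2 ≤ s ∧
      x ≤ (∑ i, a (fun l => T (r l)) i * u (r i)) ^ 2} ≤ ofReal (v * s / x) := by
  have hTn : Measurable fun r : Fin n → O => fun l => T (r l) :=
    measurable_pi_lambda _ fun l => hT.comp (measurable_pi_apply l)
  have hB := fun i t => abs_le_sqrt
    ((single_le_sum (f := fun i => truncW s a i t ^ 2) (fun _ _ => sq_nonneg _)
      (mem_univ i)).trans (sum_truncW_sq_le hs a t))
  have hmw : ∀ i, Measurable fun r : Fin n → O => truncW s a i (fun l => T (r l)) := fun i =>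
    (measurable_truncW ha i).comp hTn
  have hmem : ∀ i, MemLp (fun r : Fin n → O => truncW s a i (fun l => T (r l)) * u (r i)) 2
      (iid P n) := fun i => by
    refine MemLp.mono ((memLp_iid_eval hu2 i).const_mul (√s))
      ((hmw i).mul (hum.comp (measurable_pi_apply i))).aestronglyMeasurable
      (.of_forall fun r => ?_)
    rw [norm_eq_abs, norm_eq_abs, abs_mul, abs_mul, abs_of_nonneg (sqrt_nonneg s)]
    exact mul_le_mul_of_nonneg_right (hB i _) (abs_nonneg _)
  have h1 := hu.integral_sq_sum hT hum hu2 (measurable_truncW ha) hB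
  have i1 : Integrable (fun r : Fin n → O =>
      (∑ i, truncW s a i (fun l => T (r l)) * u (r i)) ^ 2) (iid P n) :=
    (memLp_finsetSum _ fun i _ => hmem i).integrable_sq
  have i2 : Integrable (fun r : Fin n → O =>
      ∑ i, truncW s a i (fun l => T (r l)) ^ 2 * u (r i) ^ 2) (iid P n) :=
    integrable_finsetSum _ fun i _ => (hmem i).integrable_sq.congr (.of_forall fun r => by ring)
  refine le_trans (measure_mono fun r hr => ?_) (meas_ge_le_of_lintegral
    (f := fun r : Fin n → O => (∑ i, truncW s a i (fun l => T (r l)) * u (r i)) ^ 2)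
    ?_ hx ?_)
  · simpa only [Set.mem_ofPred_eq, truncW_of_le hr.1] using hr.2
  · fun_prop
  · rw [← ofReal_integral_eq_lintegral_ofReal i1 (.of_forall fun _ => sq_nonneg _), h1,
      ofReal_integral_eq_lintegral_ofReal i2 (.of_forall fun _ =>
        sum_nonneg fun _ _ => by positivity)]
    exact hsq.lintegral_weighted_le hT hum hv hs ha

end Weighted

lemma one_div_one_sub_sub_le {π πh c : ℝ} (hc : 0 < c) (h1 : c < π) (h2 : π < 1 - c)
    (h : |1 / πh - 1 / π| ≤ c / 2) :
    πh ≠ 0 ∧ 1 - πh ≠ 0 ∧ |1 / (1 - πh) - 1 / (1 - π)| ≤ 2 / c ^ 2 * |1 / πh - 1 / π| := by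
  have hπ := hc.trans h1
  have hz : 1 + c ≤ 1 / π := by rw [le_div_iff₀ hπ]; nlinarith
  have hx : 1 + c / 2 ≤ 1 / πh := by linarith [(abs_le.1 h).1]
  have hπh : πh ≠ 0 := by grind
  have hx1 : 0 < 1 / πh - 1 := by linarith
  have hz1 : 0 < 1 / π - 1 := by linarith
  have e : 1 - πh = πh * (1 / πh - 1) := by field_simp
  have hne : 1 - πh ≠ 0 := by nlinarith
  refine ⟨hπh, hne, ?_⟩
  have e2 : 1 / (1 - πh) - 1 / (1 - π) =
      -(1 / πh - 1 / π) / ((1 / πh - 1) * (1 / π - 1)) := by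
    grind
  rw [e2, abs_div, abs_neg, abs_of_pos (mul_pos hx1 hz1), div_le_iff₀ (mul_pos hx1 hz1)]
  have h3 : c ^ 2 / 2 ≤ (1 / πh - 1) * (1 / π - 1) := by nlinarith
  have h4 := mul_le_mul_of_nonneg_left h3
    (mul_nonneg (by positivity : 0 ≤ 2 / c ^ 2) (abs_nonneg (1 / πh - 1 / π)))
  refine le_trans (le_of_eq ?_) h4
  field_simp

namespace Experiment

variable {y : E.Aux} {δ : ℝ}

/-- Errors of the first stage as functions of the auxiliary sample: `1/π̂ - 1/π`,
`1/(1-π̂) - 1/(1-π)`, `Φ̂₁ - Φ₁` and `Φ̂₀ - Φ₀`. -/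
def dP (E : Experiment d n) (y : E.Aux) (w : Cov E.p d) : ℝ := 1 / E.prHat y w - 1 / E.pr w
def dP' (E : Experiment d n) (y : E.Aux) (w : Cov E.p d) : ℝ :=
  1 / (1 - E.prHat y w) - 1 / (1 - E.pr w)
def dF1 (E : Experiment d n) (y : E.Aux) (w : Cov E.p d) : ℝ := E.Φ1Hat y w - E.Φ1 w
def dF0 (E : Experiment d n) (y : E.Aux) (w : Cov E.p d) : ℝ := E.Φ0Hat y w - E.Φ0 w

/-- The part of the first-stage error `Ŝ - S` with conditional mean zero given the covariates. -/
def mErr (E : Experiment d n) (y : E.Aux) (o : Rec E.p d) : ℝ :=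
  E.pr (cov o) * E.dP y (cov o) * (dd o * E.eps o) +
    (1 - E.pr (cov o)) * E.dP' y (cov o) * ((1 - dd o) * E.eps o) +
    -(E.dF1 y (cov o) / E.pr (cov o) + E.dF0 y (cov o) / (1 - E.pr (cov o))) * (dd o - E.pr (cov o))

/-- The second-order part of the first-stage error. -/
def qErr (E : Experiment d n) (y : E.Aux) (o : Rec E.p d) : ℝ :=
  -(dd o * (E.dP y (cov o) * E.dF1 y (cov o))) + (1 - dd o) * (E.dP' y (cov o) * E.dF0 y (cov o))

/-- The auxiliary sample is such that all first-stage errors are at most `δ`. -/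
def AuxGood (E : Experiment d n) (δ : ℝ) (y : E.Aux) : Prop :=
  ∀ w ∈ E.𝒲, |E.dP y w| ≤ δ ∧ |E.dF1 y w| ≤ δ ∧ |E.dF0 y w| ≤ δ

def _root_.DiD.Consts.Km (K : Consts) : ℝ := 1 + 2 / K.cπ ^ 2 + 2 / K.cπ

lemma _root_.DiD.Consts.Valid.one_le_Km (hK : K.Valid d) : 1 ≤ K.Km := by
  have := hK.cπ
  have h1 : 0 < 2 / K.cπ ^ 2 := by positivity
  have h2 : 0 < 2 / K.cπ := by positivity
  unfold Consts.Km; linarith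

lemma measurable_dP (E : Experiment d n) : Measurable fun z : E.Aux × Cov E.p d => E.dP z.1 z.2 :=
  (measurable_const.div E.meas_prHat).sub (measurable_const.div (E.meas_pr.comp measurable_snd))

lemma measurable_dP' (E : Experiment d n) : Measurable fun z : E.Aux × Cov E.p d => E.dP' z.1 z.2 :=
  (measurable_const.div (measurable_const.sub E.meas_prHat)).sub
    (measurable_const.div (measurable_const.sub (E.meas_pr.comp measurable_snd)))

lemma measurable_dF1 (E : Experiment d n) : Measurable fun z : E.Aux × Cov E.p d => E.dF1 z.1 z.2 :=
  E.meas_Φ1Hat.sub (E.meas_Φ1.comp measurable_snd)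

lemma measurable_dF0 (E : Experiment d n) : Measurable fun z : E.Aux × Cov E.p d => E.dF0 z.1 z.2 :=
  E.meas_Φ0Hat.sub (E.meas_Φ0.comp measurable_snd)

lemma measurable_mErr (E : Experiment d n) :
    Measurable fun z : E.Aux × Rec E.p d => E.mErr z.1 z.2 := by
  have hc : Measurable fun z : E.Aux × Rec E.p d => cov z.2 := measurable_cov.comp measurable_snd
  have hp := E.meas_pr.comp hc
  have hd : Measurable fun z : E.Aux × Rec E.p d => dd z.2 := measurable_dd.comp measurable_snd
  have he : Measurable fun z : E.Aux × Rec E.p d => E.eps z.2 :=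
    E.measurable_eps.comp measurable_snd
  have hpair := measurable_fst.prodMk hc
  have h1 := E.measurable_dP.comp hpair
  have h2 := E.measurable_dP'.comp hpair
  have h3 := E.measurable_dF1.comp hpair
  have h4 := E.measurable_dF0.comp hpair
  unfold mErr
  fun_prop

variable (K) in
/-- Pointwise consequences of small first-stage errors at one individual. -/
structure ErrGood (E : Experiment d n) (δ : ℝ) (y : E.Aux) (o : Rec E.p d) : Prop where
  score_eq : score (E.prHat y) (E.Φ1Hat y) (E.Φ0Hat y) o =
    score E.pr E.Φ1 E.Φ0 o + E.mErr y o + E.qErr y o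
  abs_m : |E.mErr y o| ≤ K.Km * δ * (1 + |E.eps o|)
  abs_q : |E.qErr y o| ≤ K.Km * δ ^ 2
  sq_q : E.qErr y o ^ 2 ≤ K.Km ^ 2 * ((E.dP y (cov o) * E.dF1 y (cov o)) ^ 2 +
    (E.dP y (cov o) * E.dF0 y (cov o)) ^ 2)

lemma Regular.errGood_ae (hE : E.Regular K Z) (hK : K.Valid d) (hδ : δ ≤ K.cπ / 2) :
    ∀ᵐ o ∂E.P, ∀ y, E.AuxGood δ y → E.ErrGood K δ y o := by
  filter_upwards [hE.W_mem, hE.overlap, hE.no_anticipation] with o hW ⟨hp1, hp2⟩ hna y hy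
  obtain ⟨ha, h1, h0⟩ := hy _ hW
  have hc := hK.cπ
  have hδ0 := (abs_nonneg _).trans ha
  obtain ⟨hne, hne1, ha'⟩ := one_div_one_sub_sub_le hc hp1 hp2 (ha.trans hδ)
  set π := E.pr (cov o) with hπ
  set a := E.dP y (cov o) with hadef
  set a' := E.dP' y (cov o) with ha'def
  set D1 := E.dF1 y (cov o) with hD1
  set D0 := E.dF0 y (cov o) with hD0
  have ha2 := ha'
  have hKm := hK.one_le_Km
  have hπ0 := hc.trans hp1
  have hπ1 : 0 < 1 - π := by linarith
  have hK0 : 0 < 2 / K.cπ ^ 2 := by positivity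
  have hK2 : 0 < 2 / K.cπ := by positivity
  have hKa : 2 / K.cπ ^ 2 ≤ K.Km := by unfold Consts.Km; linarith
  have ha'δ := ha2.trans (mul_le_mul_of_nonneg_left ha hK0.le)
  have g3 : |D1 / π + D0 / (1 - π)| ≤ 2 / K.cπ * δ := by
    have q1 : |D1 / π| ≤ δ / K.cπ := by
      rw [abs_div, abs_of_pos hπ0]; exact div_le_div₀ hδ0 h1 hc hp1.le
    have q2 : |D0 / (1 - π)| ≤ δ / K.cπ := by
      rw [abs_div, abs_of_pos hπ1]; exact div_le_div₀ hδ0 h0 hc (by linarith)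
    refine (abs_add_le _ _).trans ((add_le_add q1 q2).trans (le_of_eq (by ring)))
  have hε := abs_nonneg (E.eps o)
  have em : E.mErr y o = π * a * (dd o * E.eps o) + (1 - π) * a' * ((1 - dd o) * E.eps o) +
    -(D1 / π + D0 / (1 - π)) * (dd o - π) := rfl
  have eq : E.qErr y o = -(dd o * (a * D1)) + (1 - dd o) * (a' * D0) := rfl
  have hKexp : K.Km * δ * (1 + |E.eps o|) = δ * |E.eps o| + 2 / K.cπ ^ 2 * δ * |E.eps o| +
      2 / K.cπ * δ + (δ + 2 / K.cπ ^ 2 * δ + 2 / K.cπ * δ * |E.eps o|) := by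
    unfold Consts.Km; ring
  have hrest : 0 ≤ δ + 2 / K.cπ ^ 2 * δ + 2 / K.cπ * δ * |E.eps o| := by positivity
  rcases hd : o.2.1 with _ | _
  · have e : dd o = 0 := by simp [dd, hd]
    have em0 : E.mErr y o = (1 - π) * a' * E.eps o + (D1 / π + D0 / (1 - π)) * π := by
      rw [em, e]; ring
    have eq0 : E.qErr y o = a' * D0 := by rw [eq, e]; ring
    have hpa : |a' * D0| ≤ K.Km * |a * D0| := by
      rw [abs_mul, abs_mul, ← mul_assoc]
      exact mul_le_mul_of_nonneg_right
        (ha2.trans (mul_le_mul_of_nonneg_right hKa (abs_nonneg a))) (abs_nonneg _)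
    refine ⟨?_, ?_, ?_, ?_⟩
    · rw [em0, eq0]
      simp only [score, eps, eps1, eps0, dY, dY0, e, ha'def, hD1, hD0, dP', dF1, dF0, ← hπ]
      field_simp
      ring
    · rw [em0, hKexp]
      have q1 : |(1 - π) * a' * E.eps o| ≤ 2 / K.cπ ^ 2 * δ * |E.eps o| := by
        rw [abs_mul, abs_mul, abs_of_pos hπ1]
        refine mul_le_mul_of_nonneg_right ?_ hε
        exact (mul_le_of_le_one_left (abs_nonneg _) (by linarith)).trans ha'δ
      have q2 : |(D1 / π + D0 / (1 - π)) * π| ≤ 2 / K.cπ * δ := by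
        rw [abs_mul, abs_of_pos hπ0]
        exact (mul_le_of_le_one_right (abs_nonneg _) (by linarith)).trans g3
      have := abs_add_le ((1 - π) * a' * E.eps o) ((D1 / π + D0 / (1 - π)) * π)
      have : 0 ≤ δ * |E.eps o| := by positivity
      linarith
    · rw [eq0]
      refine hpa.trans (mul_le_mul_of_nonneg_left ?_ (by linarith))
      rw [abs_mul, sq]
      gcongr
    · rw [eq0, ← sq_abs, ← sq_abs (a * D1), ← sq_abs (a * D0)]
      have := pow_le_pow_left₀ (abs_nonneg _) hpa 2
      rw [mul_pow] at this
      have h2 : 0 ≤ K.Km ^ 2 * |a * D1| ^ 2 := by positivity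
      linarith
  · have e : dd o = 1 := by simp [dd, hd]
    have hna' := hna hd
    have em1 : E.mErr y o = π * a * E.eps o + -((D1 / π + D0 / (1 - π)) * (1 - π)) := by
      rw [em, e]; ring
    have eq1 : E.qErr y o = -(a * D1) := by rw [eq, e]; ring
    refine ⟨?_, ?_, ?_, ?_⟩
    · rw [em1, eq1]
      simp only [score, eps, eps1, eps0, dY, dY1, e, hadef, hD1, hD0, dP, dF1, dF0, hna', ← hπ]
      field_simp
      ring
    · rw [em1, hKexp]
      have q1 : |π * a * E.eps o| ≤ δ * |E.eps o| := by
        rw [abs_mul, abs_mul, abs_of_pos hπ0]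
        refine mul_le_mul_of_nonneg_right ?_ hε
        exact (mul_le_of_le_one_left (abs_nonneg _) (by linarith)).trans ha
      have q2 : |-((D1 / π + D0 / (1 - π)) * (1 - π))| ≤ 2 / K.cπ * δ := by
        rw [abs_neg, abs_mul, abs_of_pos hπ1]
        exact (mul_le_of_le_one_right (abs_nonneg _) (by linarith)).trans g3
      have := abs_add_le (π * a * E.eps o) (-((D1 / π + D0 / (1 - π)) * (1 - π)))
      have : 0 ≤ 2 / K.cπ ^ 2 * δ * |E.eps o| := by positivity
      linarith
    · rw [eq1, abs_neg, abs_mul]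
      have := mul_le_mul ha h1 (abs_nonneg _) hδ0
      nlinarith
    · rw [eq1, neg_sq]
      have q1 : 1 ≤ K.Km ^ 2 := one_le_pow₀ hKm
      have q2 := mul_le_mul_of_nonneg_right q1 (by positivity : 0 ≤ (a * D1) ^ 2 + (a * D0) ^ 2)
      have q3 := sq_nonneg (a * D0)
      linarith

lemma AuxGood.errGood (hE : E.Regular K Z) (hK : K.Valid d) (hy : E.AuxGood δ y)
    (hδ : δ ≤ K.cπ / 2) : ∀ᵐ o ∂E.P, E.ErrGood K δ y o :=
  (hE.errGood_ae hK hδ).mono fun _ h => h y hy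

end Experiment

lemma one_add_pow_four_le (x : ℝ) : (1 + x) ^ 4 ≤ 8 * (1 + x ^ 4) := by
  nlinarith [sq_nonneg (x - 1), sq_nonneg (x ^ 2 - 1), mul_nonneg (sq_nonneg x) (sq_nonneg (x - 1))]

namespace Experiment

variable {y : E.Aux}
  {δ Y : ℝ} {u : Rec E.p d → ℝ}

lemma Regular.memLp_of_le (hE : E.Regular K Z) (hK : K.Valid d) (hum : Measurable u)
    (hu : ∀ᵐ o ∂E.P, |u o| ≤ Y * (1 + |E.eps o|)) : MemLp u 2 E.P := by
  have h0 := (hE.memLp_eps hK).abs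
  have h1 := MemLp.const_mul ((memLp_const (1 : ℝ)).add h0) Y
  refine h1.mono hum.aestronglyMeasurable ?_
  filter_upwards [hu] with o ho
  rw [norm_eq_abs]
  exact ho.trans (le_abs_self _)

lemma Regular.condSqLE_of_le (hE : E.Regular K Z) (hK : K.Valid d)
    (hu : ∀ᵐ o ∂E.P, |u o| ≤ Y * (1 + |E.eps o|)) :
    CondSqLE E.P (cov : Rec E.p d → Cov E.p d) u (2 * Y ^ 2 * (1 + K.vε)) := by
  intro h hh
  have hv := hK.vε_pos
  have hhc : Measurable fun o : Rec E.p d => h (cov o) := hh.comp measurable_cov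
  have h1 := hE.condSqLE_eps hK h hh
  calc ∫⁻ o, h (cov o) * ofReal (u o ^ 2) ∂E.P
      ≤ ∫⁻ o, ofReal (2 * Y ^ 2) * (h (cov o) +
          h (cov o) * ofReal (E.eps o ^ 2)) ∂E.P := by
        refine lintegral_mono_ae ?_
        filter_upwards [hu] with o ho
        have e : ofReal (2 * Y ^ 2) * (h (cov o) + h (cov o) * ofReal (E.eps o ^ 2)) =
            h (cov o) * ofReal (2 * Y ^ 2 * (1 + E.eps o ^ 2)) := by
          rw [ofReal_mul (by positivity : 0 ≤ 2 * Y ^ 2),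
            ofReal_add zero_le_one (sq_nonneg _), ofReal_one]
          ring
        rw [e]
        refine mul_le_mul_right (ofReal_le_ofReal ?_) _
        have h2 := pow_le_pow_left₀ (abs_nonneg _) ho 2
        rw [sq_abs, mul_pow] at h2
        have h3 : (1 + |E.eps o|) ^ 2 ≤ 2 * (1 + E.eps o ^ 2) := by
          rw [← sq_abs (E.eps o)]; nlinarith [sq_nonneg (1 - |E.eps o|)]
        nlinarith
    _ = ofReal (2 * Y ^ 2) * (∫⁻ o, h (cov o) ∂E.P +
          ∫⁻ o, h (cov o) * ofReal (E.eps o ^ 2) ∂E.P) := by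
        rw [lintegral_const_mul' _ _ ofReal_ne_top, lintegral_add_left hhc]
    _ ≤ ofReal (2 * Y ^ 2) * (∫⁻ o, h (cov o) ∂E.P +
          ofReal K.vε * ∫⁻ o, h (cov o) ∂E.P) := by gcongr
    _ = _ := by
        rw [ofReal_mul (by positivity : 0 ≤ 2 * Y ^ 2), ofReal_add zero_le_one hv.le, ofReal_one]
        ring

lemma measurable_mErr_right (E : Experiment d n) (y : E.Aux) : Measurable (E.mErr y) :=
  E.measurable_mErr.comp measurable_prodMk_left

lemma AuxGood.condZero_mErr (hE : E.Regular K Z) (hK : K.Valid d) (hy : E.AuxGood δ y)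
    (hδ : δ ≤ K.cπ / 2) : CondZero E.P (cov : Rec E.p d → Cov E.p d) (E.mErr y) := by
  have hp := E.meas_pr
  have m1 : Measurable fun w => E.pr w * E.dP y w := hp.mul (E.measurable_dP.comp measurable_prodMk_left)
  have m2 : Measurable fun w => (1 - E.pr w) * E.dP' y w :=
    (measurable_const.sub hp).mul (E.measurable_dP'.comp measurable_prodMk_left)
  have m3 : Measurable fun w => -(E.dF1 y w / E.pr w + E.dF0 y w / (1 - E.pr w)) :=
    (((E.measurable_dF1.comp measurable_prodMk_left).div hp).add
      ((E.measurable_dF0.comp measurable_prodMk_left).div (measurable_const.sub hp))).neg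
  have c1 := (hE.condZero_dd_eps hK).mul_left m1
  have c2 := (hE.condZero_sub_dd_eps hK).mul_left m2
  have c3 := hE.condZero_dd_sub.mul_left m3
  have hdm : Measurable (dd : Rec E.p d → ℝ) := measurable_dd
  have hem := E.measurable_eps
  have hI : Integrable (fun o => 2 / K.cπ ^ 2 * δ * |E.eps o| + δ * |E.eps o| + 2 / K.cπ * δ) E.P :=
    ((((hE.memLp_eps hK).integrable one_le_two).abs.const_mul _).add
      (((hE.memLp_eps hK).integrable one_le_two).abs.const_mul _)).add (integrable_const _)
  have hc := hK.cπ
  have hbd : ∀ᵐ o ∂E.P, 0 ≤ δ ∧ |E.pr (cov o) * E.dP y (cov o)| ≤ δ ∧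
      |(1 - E.pr (cov o)) * E.dP' y (cov o)| ≤ 2 / K.cπ ^ 2 * δ ∧
      |-(E.dF1 y (cov o) / E.pr (cov o) + E.dF0 y (cov o) / (1 - E.pr (cov o)))| ≤
        2 / K.cπ * δ ∧ 0 ≤ E.pr (cov o) ∧ E.pr (cov o) ≤ 1 := by
    filter_upwards [hE.W_mem, hE.overlap] with o hW ⟨hp1, hp2⟩
    obtain ⟨ha, h1, h0⟩ := hy _ hW
    have hδ0 := (abs_nonneg _).trans ha
    obtain ⟨-, -, ha'⟩ := one_div_one_sub_sub_le hc hp1 hp2 (ha.trans hδ)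
    have hπ0 := hc.trans hp1
    have hπ1 : 0 < 1 - E.pr (cov o) := by linarith
    refine ⟨hδ0, ?_, ?_, ?_, hπ0.le, by linarith⟩
    · rw [abs_mul, abs_of_pos hπ0]
      nlinarith
    · rw [abs_mul, abs_of_pos hπ1]
      exact (mul_le_of_le_one_left (abs_nonneg _) (by linarith)).trans
        (ha'.trans (mul_le_mul_of_nonneg_left ha (by positivity)))
    · rw [abs_neg]
      have q1 : |E.dF1 y (cov o) / E.pr (cov o)| ≤ δ / K.cπ := by
        rw [abs_div, abs_of_pos hπ0]; exact div_le_div₀ hδ0 h1 hc hp1.le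
      have q2 : |E.dF0 y (cov o) / (1 - E.pr (cov o))| ≤ δ / K.cπ := by
        rw [abs_div, abs_of_pos hπ1]; exact div_le_div₀ hδ0 h0 hc (by linarith)
      exact (abs_add_le _ _).trans ((add_le_add q1 q2).trans (le_of_eq (by ring)))
  have hd1 : ∀ o : Rec E.p d, |dd o| ≤ 1 := fun o => by
    rcases dd_eq_zero_or_one o with h | h <;> simp [h]
  have hd2 : ∀ o : Rec E.p d, |1 - dd o| ≤ 1 := fun o => by
    rcases dd_eq_zero_or_one o with h | h <;> simp [h]
  have i1 : Integrable (fun o => E.pr (cov o) * E.dP y (cov o) * (dd o * E.eps o)) E.P := by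
    refine hI.mono' (((m1.comp measurable_cov).mul (hdm.mul hem)).aestronglyMeasurable) ?_
    filter_upwards [hbd] with o ⟨h0, h1, h2, h3, _, _⟩
    rw [norm_eq_abs, abs_mul, abs_mul (dd o)]
    have q := mul_le_mul h1 (mul_le_of_le_one_left (abs_nonneg (E.eps o)) (hd1 o))
      (by positivity) h0
    have : 0 ≤ 2 / K.cπ ^ 2 * δ * |E.eps o| + 2 / K.cπ * δ := by positivity
    linarith
  have i2 : Integrable (fun o => (1 - E.pr (cov o)) * E.dP' y (cov o) *
      ((1 - dd o) * E.eps o)) E.P := by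
    refine hI.mono' (((m2.comp measurable_cov).mul
      ((measurable_const.sub hdm).mul hem)).aestronglyMeasurable) ?_
    filter_upwards [hbd] with o ⟨h0, h1, h2, h3, _, _⟩
    rw [norm_eq_abs, abs_mul, abs_mul (1 - dd o)]
    have q := mul_le_mul h2 (mul_le_of_le_one_left (abs_nonneg (E.eps o)) (hd2 o))
      (by positivity) (by positivity)
    have : 0 ≤ δ * |E.eps o| + 2 / K.cπ * δ := by positivity
    linarith
  have i3 : Integrable (fun o => -(E.dF1 y (cov o) / E.pr (cov o) + E.dF0 y (cov o) /
      (1 - E.pr (cov o))) * (dd o - E.pr (cov o))) E.P := by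
    refine hI.mono' (((m3.comp measurable_cov).mul
      (hdm.sub (hp.comp measurable_cov))).aestronglyMeasurable) ?_
    filter_upwards [hbd] with o ⟨h0, h1, h2, h3, h4, h5⟩
    rw [norm_eq_abs, abs_mul]
    have h6 : |dd o - E.pr (cov o)| ≤ 1 := by grind
    have q := mul_le_mul h3 h6 (abs_nonneg _) (by positivity)
    have : 0 ≤ 2 / K.cπ ^ 2 * δ * |E.eps o| + δ * |E.eps o| := by positivity
    linarith
  exact (c1.add measurable_cov c2 i1 i2).add measurable_cov c3 (i1.add i2) i3

/-- The error of the regression of the estimated score, up to second-order terms. -/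
def zeta (E : Experiment d n) (y : E.Aux) (o : Rec E.p d) : ℝ := E.eps o + E.mErr y o

lemma measurable_zeta (E : Experiment d n) (y : E.Aux) : Measurable (E.zeta y) :=
  E.measurable_eps.add (E.measurable_mErr_right y)

lemma AuxGood.abs_zeta_le (hE : E.Regular K Z) (hK : K.Valid d) (hy : E.AuxGood δ y)
    (hδ : δ ≤ K.cπ / 2) (hδ1 : K.Km * δ ≤ 1) :
    ∀ᵐ o ∂E.P, |E.zeta y o| ≤ 2 * (1 + |E.eps o|) := by
  filter_upwards [hy.errGood hE hK hδ] with o ho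
  have h1 := ho.abs_m
  have h2 := mul_le_mul_of_nonneg_right hδ1 (by positivity : 0 ≤ 1 + |E.eps o|)
  have h3 := abs_add_le (E.eps o) (E.mErr y o)
  unfold zeta
  linarith

lemma AuxGood.condZero_zeta (hE : E.Regular K Z) (hK : K.Valid d) (hy : E.AuxGood δ y)
    (hδ : δ ≤ K.cπ / 2) : CondZero E.P (cov : Rec E.p d → Cov E.p d) (E.zeta y) :=
  (hE.condZero_eps hK).add measurable_cov (hy.condZero_mErr hE hK hδ)
    ((hE.memLp_eps hK).integrable one_le_two)
    ((hE.memLp_of_le hK (E.measurable_mErr_right y)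
      ((hy.errGood hE hK hδ).mono fun _ h => h.abs_m)).integrable one_le_two)

/-- Bounds for the empirical fourth moment of `ε` and for the noise level of the score. -/
def _root_.DiD.Consts.C₄ (K : Consts) : ℝ := K.vε + 2
def _root_.DiD.Consts.Lz (K : Consts) : ℝ := 18 / K.cX ^ 2 + 64 * (2 + K.C₄ + K.vε)

lemma Regular.iid_eps_four (hE : E.Regular K Z) (hK : K.Valid d) (hn : 0 < n) :
    iid E.P n {c | n * K.C₄ ≤ ∑ i, E.eps (c i) ^ 4} ≤
      ofReal (2 * K.vε * (n : ℝ) ^ (1 - min (K.rε / 4) 2)) := by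
  have hr := hK.rε
  set s := min (K.rε / 4) 2
  have hs : s ≤ K.rε / 4 := min_le_left _ _
  have hs1 : 1 < s := lt_min (by linarith) one_lt_two
  have e : ∀ o, (E.eps o ^ 4) ^ s = |E.eps o| ^ (4 * s) := fun o => by
    rw [Real.rpow_mul (abs_nonneg _)]
    congr 1
    rw [show (4 : ℝ) = ((4 : ℕ) : ℝ) by norm_num, Real.rpow_natCast, Even.pow_abs (by decide)]
  have hle : ∀ o, (E.eps o ^ 4) ^ s ≤ 1 + |E.eps o| ^ K.rε := fun o => by
    rw [e]
    rcases le_total |E.eps o| 1 with h | h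
    · have := Real.rpow_le_one (abs_nonneg _) h (by linarith : 0 ≤ 4 * s)
      have := rpow_nonneg (abs_nonneg (E.eps o)) K.rε
      linarith
    · have := Real.rpow_le_rpow_of_exponent_le h (by linarith : 4 * s ≤ K.rε)
      linarith
  have hm : Measurable fun o => (E.eps o ^ 4) ^ s := by have := E.measurable_eps; fun_prop
  have h0 : ∀ o, 0 ≤ (E.eps o ^ 4) ^ s := fun o => rpow_nonneg (by positivity) _
  have hi1 : Integrable (fun o => 1 + |E.eps o| ^ K.rε) E.P := (integrable_const _).add hE.int_eps
  have hi := hi1.mono' hm.aestronglyMeasurable (.of_forall fun o => by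
      rw [norm_eq_abs, abs_of_nonneg (h0 o)]; exact hle o)
  have hC : ∫ o, (E.eps o ^ 4) ^ s ∂E.P ≤ K.vε := by
    refine (integral_mono hi hi1 hle).trans ?_
    have h1 : ∫ o, |E.eps o| ^ K.rε ∂E.P ≤ K.Cε := by
      rw [← integral_condExp (sigW_le E.p d)]
      refine (integral_mono_ae integrable_condExp (integrable_const K.Cε) hE.eps_moment).trans ?_
      simp
    rw [integral_add (integrable_const _) hE.int_eps]
    simp only [integral_const, probReal_univ, smul_eq_mul, Consts.vε]
    linarith
  exact iid_avg_ge_le (E.measurable_eps.pow_const 4) (fun o => by positivity) hs1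
    (min_le_right _ _) hi hC hn

lemma Regular.iid_xx_mul (hE : E.Regular K Z) (hK : K.Valid d) (hn : 0 < n)
    (hum : Measurable u) (hu0 : CondZero E.P (cov : Rec E.p d → Cov E.p d) u)
    (hu : ∀ᵐ o ∂E.P, |u o| ≤ 2 * (1 + |E.eps o|)) :
    iid E.P n {c | (∀ j, ∑ i, xx (c i) j ^ 4 ≤ n * (32 / K.cX ^ 2)) ∧
      ∑ i, E.eps (c i) ^ 4 ≤ n * K.C₄ ∧
      ∃ j, 8 * (n * K.Lz) * (2 * log E.p) ≤ (∑ i, xx (c i) j * u (c i)) ^ 2} ≤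
      ofReal (2 / n) := by
  have hc := hK.cX_pos
  have hv := hK.vε_pos
  have hnR : (0 : ℝ) < n := by exact_mod_cast hn
  have hp : (n : ℝ) < E.p := by exact_mod_cast hE.p_gt
  have hp0 := hnR.trans hp
  have hu4 : ∀ᵐ o ∂E.P, u o ^ 4 ≤ 128 * (1 + E.eps o ^ 4) := by
    filter_upwards [hu] with o ho
    have h1 := pow_le_pow_left₀ (abs_nonneg _) ho 4
    rw [Even.pow_abs (by decide), mul_pow] at h1
    have h2 := one_add_pow_four_le |E.eps o|
    rw [Even.pow_abs (by decide)] at h2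
    linarith
  have hprod : ∀ a b : ℝ, a ^ 2 * b ^ 2 ≤ (a ^ 4 + b ^ 4) / 2 := fun a b => by
    nlinarith [sq_nonneg (a ^ 2 - b ^ 2)]
  have hone : ∀ j, iid E.P n {c | (∀ j, ∑ i, xx (c i) j ^ 4 ≤ n * (32 / K.cX ^ 2)) ∧
      ∑ i, E.eps (c i) ^ 4 ≤ n * K.C₄ ∧
      8 * (n * K.Lz) * (2 * log E.p) ≤ (∑ i, xx (c i) j * u (c i)) ^ 2} ≤
      ofReal (2 * exp (-(2 * log E.p))) := fun j => by
    have hsg := (hE.sg_apply hK j).1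
    have hmx := measurable_xx_apply (p := E.p) (d := d) j
    have hi4 : Integrable (fun o => (xx o j ^ 4 + 128 * (1 + E.eps o ^ 4)) / 2) E.P :=
      ((hsg.pow_four hc).1.add (((integrable_const _).add (hE.eps_four hK).1).const_mul _)).div_const _
    have hle : ∀ᵐ o ∂E.P, xx o j ^ 2 * u o ^ 2 ≤ (xx o j ^ 4 + 128 * (1 + E.eps o ^ 4)) / 2 := by
      filter_upwards [hu4] with o ho
      linarith [hprod (xx o j) (u o)]
    have hi2 : Integrable (fun o => xx o j ^ 2 * u o ^ 2) E.P :=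
      hi4.mono' ((hmx.pow_const 2).mul (hum.pow_const 2)).aestronglyMeasurable (by
        filter_upwards [hle] with o ho
        rwa [norm_eq_abs, abs_of_nonneg (by positivity)])
    have hmem : MemLp (fun o => xx o j * u o) 2 E.P := memLp_two_mul_of_sq hmx hum hi2
    have h0 : ∫ o, xx o j * u o ∂E.P = 0 :=
      hu0 (fun w => w.1 j) ((measurable_pi_apply j).comp measurable_fst)
        (hmem.integrable one_le_two)
    have hE2 : ∫ o, (xx o j * u o) ^ 2 ∂E.P ≤ 2 / K.cX ^ 2 + 64 * (1 + K.vε) := by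
      simp_rw [mul_pow]
      refine (integral_mono_ae hi2 hi4 hle).trans ?_
      have j1 := (hsg.pow_four hc)
      have j2 := (hE.eps_four hK)
      have j3 : Integrable (fun o => 128 * (1 + E.eps o ^ 4)) E.P :=
        ((integrable_const _).add j2.1).const_mul _
      rw [integral_div, integral_add j1.1 j3, integral_const_mul,
        integral_add (integrable_const _) j2.1]
      simp only [integral_const, probReal_univ, smul_eq_mul]
      have := j1.2; have := j2.2
      have e : (4 : ℝ) / K.cX ^ 2 = 2 * (2 / K.cX ^ 2) := by ring
      linarith
    have hLz : 0 < K.Lz := by unfold Consts.Lz Consts.C₄; positivity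
    refine le_trans (iid_le_of_ae hu4 fun c hc hA => ?_)
      (iid_sq_sum_ge_le (hmx.mul hum) hmem h0 (mul_pos hnR hLz) (2 * log E.p))
    refine ⟨?_, hA.2.2⟩
    have h1 : ∑ i, (xx (c i) j * u (c i)) ^ 2 ≤
        (∑ i, xx (c i) j ^ 4 + 128 * (n + ∑ i, E.eps (c i) ^ 4)) / 2 := by
      have : ∑ i, (xx (c i) j ^ 4 + 128 * (1 + E.eps (c i) ^ 4)) / 2 =
          (∑ i, xx (c i) j ^ 4 + 128 * (n + ∑ i, E.eps (c i) ^ 4)) / 2 := by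
        rw [← sum_div, sum_add_distrib, ← mul_sum, sum_add_distrib]
        simp
      rw [← this]
      refine sum_le_sum fun i _ => ?_
      rw [mul_pow]
      linarith [hprod (xx (c i) j) (u (c i)), hc i]
    have h2 := hA.1 j
    have h3 := hA.2.1
    have h4 := mul_le_mul_of_nonneg_left hE2 hnR.le
    have e : (n : ℝ) * K.Lz = n * (32 / K.cX ^ 2) / 2 + 64 * (n + n * K.C₄) +
        n * (2 / K.cX ^ 2 + 64 * (1 + K.vε)) := by unfold Consts.Lz; ring
    rw [e]
    change ∑ i, (xx (c i) j * u (c i)) ^ 2 + n * ∫ o, (xx o j * u o) ^ 2 ∂E.P ≤ _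
    linarith
  refine le_trans (measure_mono ?_) ((measure_exists_le (ι := Fin E.p) (N := E.p)
    (by simp) (by positivity) hone).trans (ofReal_le_ofReal ?_))
  · rintro c ⟨h1, h2, j, h3⟩
    exact ⟨j, h1, h2, h3⟩
  · rw [two_mul (log _), neg_add, exp_add, exp_neg, exp_log hp0]
    have : (E.p : ℝ) * (2 * ((E.p : ℝ)⁻¹ * (E.p : ℝ)⁻¹)) = 2 / E.p := by field_simp
    rw [this]
    exact div_le_div_of_nonneg_left zero_le_two hnR hp.le

variable {f : EZ d → Fin E.k → ℝ} {M : ℝ} {r : E.Smp}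

/-- The design matrix of a sample. -/
def Xm (r : E.Smp) : Matrix (Fin n) (Fin E.p) ℝ := of fun i j => xx (r.1 i) j

lemma Xm_mulVec (r : E.Smp) (v : Fin E.p → ℝ) :
    Xm r *ᵥ v = fun l => v ⬝ xx (r.1 l) := by
  ext l
  rw [mulVec, dotProduct_comm]
  rfl

lemma crit_eq {β : Fin E.p → ℝ} {γ θ : Fin E.k → ℝ} (h : ∀ z, E.ψ z ⬝ γ = f z ⬝ θ) :
    E.crit r β γ = (n : ℝ)⁻¹ * nsq (Xm r *ᵥ β + Zm f r.1 *ᵥ θ - E.SHat r) + E.lam * ∑ j, |β j| := by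
  rw [crit, dotProduct]
  simp only [h, sq]
  rfl

lemma SieveBasis.residM_xx_dot (hb : E.SieveBasis f M) (v : Fin E.p → ℝ) (u : Fin n → ℝ) :
    residM (Zm f r.1) (Xm r *ᵥ v) ⬝ u = v ⬝ fun j => ∑ i, E.Xtil (E.covs r) i j * u i := by
  rw [Xm_mulVec, ← hb.Xtil_mulVec]
  simp only [dotProduct, mulVec, sum_mul, mul_sum]
  rw [sum_comm]
  grind

lemma abs_avg_dot_le {p : ℕ} {N e : ℝ} {v g : Fin p → ℝ} (h : ∀ j, |N * g j| ≤ e) :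
    |N * (v ⬝ g)| ≤ e * ∑ j, |v j| := by
  rw [← smul_eq_mul, ← dotProduct_smul]
  exact abs_dotProduct_le_of_forall_le h

def _root_.DiD.Consts.Cl (K : Consts) : ℝ := 1 + K.CS + K.e₁

/-- Rates of the penalized estimator on the good event. -/
lemma CovGood.lasso_bound (hg : E.CovGood K f r.1) (hE : E.Regular K Z) (hK : K.Valid d)
    (hb : E.SieveBasis f M) (hs : Scal K.A n E.k (log E.p) M)
    (hmin : ∀ β ∈ E.ℬ, ∀ γ, E.crit r (E.βHat r) (E.γHat r) ≤ E.crit r β γ)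
    {ζ q : Fin n → ℝ} (hS : ∀ i, E.SHat r i =
      xx (r.1 i) ⬝ E.β0 + E.f0 (zz (r.1 i)) + ζ i + q i) {ρ θ : ℝ} (hρ : 0 ≤ ρ)
    (hlam : 0 < E.lam) (hζ : ∀ j, |(n : ℝ)⁻¹ * ∑ i, xx (r.1 i) j * ζ i| ≤ E.lam / 16)
    (hr : ∀ j, |(n : ℝ)⁻¹ * ∑ i, E.Xtil (E.covs r) i j * E.rn (zz (r.1 i))| ≤ E.lam / 16)
    (hP : (n : ℝ)⁻¹ * nsq (projM (Zm f r.1) *ᵥ ζ) ≤ ρ)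
    (hq : (n : ℝ)⁻¹ * nsq q ≤ ρ) (hρr : 64 * K.Cl * ρ * E.rate ≤ E.lam ^ 2)
    (hθ : θ = E.lam * √E.s0 + √(K.Cl * ρ))
    (ha1 : 64 * (K.aQ * E.rate) * θ ^ 2 ≤ K.cSig / 2 * E.lam ^ 2)
    (ha2 : 32 * (K.aQ * E.rate) * θ ^ 2 ≤ E.lam ^ 2) :
    √(nsq (E.βHat r - E.β0)) ≤ (18 / (K.cSig / 2) + 1) * θ ∧
      E.lam * ∑ j, |(E.βHat r - E.β0) j| ≤ 4 * (18 / (K.cSig / 2) + 2) * θ ^ 2 := by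
  have hn := hs.nR_pos
  have hn' := inv_nonneg.2 hn.le
  set δ := E.βHat r - E.β0
  set F := Zm f r.1
  obtain ⟨θh, hθh⟩ := hb.of_ψ (E.γHat r)
  obtain ⟨θ0, hθ0⟩ := hb.of_ψ E.γ0
  set y : Fin n → ℝ := fun i => E.rn (zz (r.1 i))
  have hSv : E.SHat r = Xm r *ᵥ E.β0 + F *ᵥ θ0 + (y + ζ + q) := by
    ext i
    have e : (F *ᵥ θ0) i = E.ψ (zz (r.1 i)) ⬝ E.γ0 := (hθ0 _).symm
    simp only [Pi.add_apply, e, hS i, Xm_mulVec, dotProduct_comm E.β0, y, rn]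
    ring
  have hbas := lasso_basic (X := Xm r) (hg.isUnit hK hs.n_pos) hSv (β := E.βHat r) (γ := θh)
    (lam := E.lam) fun γ' => by
      obtain ⟨γ'', h''⟩ := hb.to_ψ γ'
      rw [← crit_eq hθh, ← crit_eq fun z => (h'' z).symm]
      exact hmin _ hE.β0_mem _
  set Q := (n : ℝ)⁻¹ * nsq (residM F (Xm r *ᵥ δ))
  set t := ∑ j, |δ j|
  set Dn := √(nsq δ)
  have hD2 := sq_sqrt (nsq_nonneg δ)
  have ht : 0 ≤ t := sum_nonneg fun _ _ => abs_nonneg _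
  set A := (n : ℝ)⁻¹ * nsq (Xm r *ᵥ δ) with hAdef
  have hA0 : 0 ≤ A := mul_nonneg hn' (nsq_nonneg _)
  have hQ0 : 0 ≤ Q := mul_nonneg hn' (nsq_nonneg _)
  have hsup := sum_abs_sub_support (E.βHat r) E.β0
  have e1 : (n : ℝ)⁻¹ * (residM F (Xm r *ᵥ δ) ⬝ (y + ζ + q)) =
      (n : ℝ)⁻¹ * (residM F (Xm r *ᵥ δ) ⬝ y) + (n : ℝ)⁻¹ * ((Xm r *ᵥ δ) ⬝ ζ) -
      (n : ℝ)⁻¹ * ((Xm r *ᵥ δ) ⬝ (projM F *ᵥ ζ)) +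
      (n : ℝ)⁻¹ * (residM F (Xm r *ᵥ δ) ⬝ q) := by
    rw [dotProduct_add, dotProduct_add, residM_dot F _ ζ, residM.eq_1 F ζ, dotProduct_sub]
    ring
  have b1 : |(n : ℝ)⁻¹ * (residM F (Xm r *ᵥ δ) ⬝ y)| ≤ E.lam / 16 * t := by
    rw [hb.residM_xx_dot]
    exact abs_avg_dot_le hr
  have b2 : |(n : ℝ)⁻¹ * ((Xm r *ᵥ δ) ⬝ ζ)| ≤ E.lam / 16 * t := by
    have : (Xm r *ᵥ δ) ⬝ ζ = δ ⬝ fun j => ∑ i, xx (r.1 i) j * ζ i := by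
      simp only [dotProduct, mulVec, sum_mul, mul_sum, Xm, of_apply]
      rw [sum_comm]
      exact sum_congr rfl fun _ _ => sum_congr rfl fun _ _ => by ring
    rw [this]
    exact abs_avg_dot_le hζ
  have b3 : |(n : ℝ)⁻¹ * ((Xm r *ᵥ δ) ⬝ (projM F *ᵥ ζ))| ≤ √(A * ρ) := by
    refine abs_le_sqrt ?_
    have h1 := sq_dotProduct_le (Xm r *ᵥ δ) (projM F *ᵥ ζ)
    calc _ = (n : ℝ)⁻¹ ^ 2 * ((Xm r *ᵥ δ) ⬝ (projM F *ᵥ ζ)) ^ 2 := by ring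
      _ ≤ (n : ℝ)⁻¹ ^ 2 * (nsq (Xm r *ᵥ δ) *
          nsq (projM F *ᵥ ζ)) := mul_le_mul_of_nonneg_left h1 (sq_nonneg _)
      _ = A * ((n : ℝ)⁻¹ * nsq (projM F *ᵥ ζ)) := by rw [hAdef]; ring
      _ ≤ A * ρ := mul_le_mul_of_nonneg_left hP hA0
  have b4 : 2 * ((n : ℝ)⁻¹ * (residM F (Xm r *ᵥ δ) ⬝ q)) ≤ Q / 2 + 2 * ρ := by
    have h1 := two_mul_dotProduct_le (residM F (Xm r *ᵥ δ)) ((2 : ℝ) • q)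
    rw [dotProduct_smul, smul_dotProduct, dotProduct_smul, smul_eq_mul, smul_eq_mul,
      smul_eq_mul] at h1
    have h2 := mul_le_mul_of_nonneg_left h1 hn'
    linarith
  rw [e1] at hbas
  have hsup' : E.lam * t - 2 * E.lam * √E.s0 * Dn ≤
      E.lam * ∑ j, |E.βHat r j| - E.lam * ∑ j, |E.β0 j| := by
    have : E.lam * (∑ j, |E.β0 j| + t - 2 * (√E.s0 * Dn)) ≤
        E.lam * ∑ j, |E.βHat r j| := mul_le_mul_of_nonneg_left hsup hlam.le
    linarith
  have hr0 : 0 ≤ E.rate := sqrt_nonneg _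
  have hCS := hK.CS_pos
  have he₁ := hK.e₁_pos
  refine lasso_rates hQ0 (sqrt_nonneg _) ht hρ hlam (mul_nonneg hK.aQ_pos.le hr0)
    (half_pos hK.cSig) (by unfold Consts.Cl; linarith) ?_ (A := A) (rate := E.rate) ?_ ?_ hρr hθ
    ha1 ha2
  · have c1 := abs_le.1 b1; have c2 := abs_le.1 b2; have c3 := abs_le.1 b3
    linarith
  · have h1 := hg.avg_xx_sq_le hE hK hs δ
    have e : A = (n : ℝ)⁻¹ * ∑ i, (δ ⬝ xx (r.1 i)) ^ 2 := by
      rw [hAdef, Xm_mulVec, dotProduct]; simp only [sq]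
    rw [e, hD2]
    refine h1.trans ?_
    have h2 : 0 ≤ (1 + K.e₁) * nsq δ := mul_nonneg (by positivity) (nsq_nonneg δ)
    have h3 : 0 ≤ (1 + K.CS) * (E.rate * t ^ 2) := by positivity
    have e2 : K.Cl * (nsq δ + E.rate * t ^ 2) = K.CS * nsq δ + K.e₁ * E.rate * t ^ 2 +
        ((1 + K.e₁) * nsq δ + (1 + K.CS) * (E.rate * t ^ 2)) := by unfold Consts.Cl; ring
    rw [e2]
    linarith
  · have h1 := hg.residM_ge hE hK hb hs δ
    rw [hD2]
    change _ ≤ (n : ℝ)⁻¹ * nsq (residM F (Xm r *ᵥ δ))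
    rw [Xm_mulVec]
    exact h1

variable {q : EZ d → Fin E.k → ℝ} {M : ℝ} {r : E.Smp} {v : Fin n → ℝ}

lemma measurable_Xtil (E : Experiment d n) (i : Fin n) (j : Fin E.p) :
    Measurable fun w : Fin n → Cov E.p d => E.Xtil w i j := by
  have h2 : ∀ l, Measurable fun w : Fin n → Cov E.p d => E.PZ w i l := fun l =>
    measurable_projM (fun l a => (measurable_pi_apply a).comp
      (E.meas_ψ.comp (measurable_snd.comp (measurable_pi_apply l)))) i l
  simp only [Xtil, Matrix.sub_apply, Matrix.mul_apply, of_apply]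
  fun_prop

lemma measurable_covs (E : Experiment d n) : Measurable E.covs :=
  measurable_pi_lambda _ fun i => measurable_cov.comp ((measurable_pi_apply i).comp measurable_fst)

/-- The weights `X̃ ŵ` of the debiasing step. -/
def wts (E : Experiment d n) (w : Fin n → Cov E.p d) : Fin n → ℝ := E.Xtil w *ᵥ E.wHat w

lemma measurable_wts (E : Experiment d n) (i : Fin n) : Measurable fun w => E.wts w i := by
  simp only [wts, mulVec, dotProduct]
  exact measurable_sum _ fun j _ =>
    (E.measurable_Xtil i j).mul ((measurable_pi_apply j).comp E.meas_wHat)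

lemma measurable_uncurry_score {α : Type*} [MeasurableSpace α] {p : ℕ}
    {f g h : α → Cov p d → ℝ} (hf : Measurable (Function.uncurry f))
    (hg : Measurable (Function.uncurry g)) (hh : Measurable (Function.uncurry h)) :
    Measurable fun z : Rec p d × α => score (f z.2) (g z.2) (h z.2) z.1 := by
  have hc : Measurable fun z : Rec p d × α => (z.2, cov z.1) :=
    measurable_snd.prodMk (measurable_cov.comp measurable_fst)
  have hd : Measurable fun z : Rec p d × α => dd z.1 := by
    refine Measurable.ite ?_ measurable_const measurable_const
    exact (measurable_fst.comp (measurable_snd.comp measurable_fst)) (measurableSet_singleton true)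
  have hf' := hf.comp hc
  have hg' := hg.comp hc
  have hh' := hh.comp hc
  have hy : Measurable fun z : Rec p d × α => dY z.1 := by
    unfold dY y11 y01 y10 y00
    fun_prop
  simp only [Function.comp_def, Function.uncurry] at hf' hg' hh'
  unfold score
  fun_prop

lemma measurable_resid (E : Experiment d n) (i : Fin n) :
    Measurable fun r => E.resid r i := by
  have h0 : Measurable fun r : E.Smp => r.1 i := (measurable_pi_apply i).comp measurable_fst
  exact (((measurable_uncurry_score E.meas_prHat E.meas_Φ1Hat E.meas_Φ0Hat).comp
    (h0.prodMk measurable_snd)).sub (measurable_dotProduct (measurable_xx.comp h0)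
      E.meas_βHat)).sub (measurable_dotProduct (E.meas_ψ.comp (measurable_zz.comp h0)) E.meas_γHat)

lemma THat_eq (E : Experiment d n) (r : E.Smp) :
    E.THat r = E.ξ ⬝ E.βHat r - (n : ℝ)⁻¹ * (E.wts (E.covs r) ⬝ E.resid r) := by
  rw [THat]
  congr 1
  simp only [wts, dotProduct, mulVec, sum_mul, mul_sum]
  rw [sum_comm]
  grind

lemma measurable_stat (E : Experiment d n) : Measurable E.stat := by
  have h := fun i => (E.measurable_wts i).comp E.measurable_covs
  have h' := fun i => E.measurable_resid i
  unfold stat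
  simp_rw [THat_eq]
  exact ((((measurable_dotProduct measurable_const E.meas_βHat).sub
    ((measurable_sum _ fun i _ => (h i).mul (h' i)).const_mul _)).sub measurable_const).const_mul _)

lemma VHat_eq (E : Experiment d n) (r : E.Smp) :
    E.VHat r = (n : ℝ)⁻¹ * ∑ i, (E.resid r i * E.wts (E.covs r) i) ^ 2 := by
  have h := avg_dotProduct_sq (fun i j => E.resid r i * E.Xtil (E.covs r) i j) (E.wHat (E.covs r))
  rw [VHat, OmegaHat]
  convert h.symm using 4
  · grind
  · simp only [wts, dotProduct, mulVec, mul_sum]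
    exact sum_congr rfl fun i _ => by ring

lemma SieveBasis.wts_eq (hb : E.SieveBasis q M) (r : E.Smp) :
    E.wts (E.covs r) = residM (Zm q r.1) (Xm r *ᵥ E.wHat (E.covs r)) := by
  rw [wts, hb.Xtil_mulVec, Xm_mulVec]

lemma SieveBasis.exists_resid_eq (hb : E.SieveBasis q M)
    (hS : ∀ i, E.SHat r i = xx (r.1 i) ⬝ E.β0 + E.f0 (zz (r.1 i)) + v i) :
    ∃ t, E.resid r = (fun i => E.rn (zz (r.1 i)) + v i) - Xm r *ᵥ (E.βHat r - E.β0)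
      + Zm q r.1 *ᵥ t := by
  obtain ⟨t, ht⟩ := hb.of_ψ (E.γ0 - E.γHat r)
  refine ⟨t, funext fun i => ?_⟩
  have h := ht (zz (r.1 i))
  simp only [dotProduct_sub] at h
  have e : (Zm q r.1 *ᵥ t) i = q (zz (r.1 i)) ⬝ t := rfl
  simp only [Pi.add_apply, Pi.sub_apply, e, ← h, Xm_mulVec, resid, hS, rn,
    dotProduct_comm _ (xx (r.1 i)), dotProduct_sub]
  ring

lemma SieveBasis.THat_sub_eq (hb : E.SieveBasis q M) (hF : IsUnit ((Zm q r.1)ᵀ * Zm q r.1).det)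
    (hS : ∀ i, E.SHat r i = xx (r.1 i) ⬝ E.β0 + E.f0 (zz (r.1 i)) + v i) :
    E.THat r - E.ξ ⬝ E.β0 = (E.ξ + E.SigTil (E.covs r) *ᵥ E.wHat (E.covs r)) ⬝ (E.βHat r - E.β0)
        - (n : ℝ)⁻¹ * (E.wts (E.covs r) ⬝ fun i => E.rn (zz (r.1 i)) + v i) := by
  obtain ⟨t, ht⟩ := hb.exists_resid_eq hS
  have h1 : E.wts (E.covs r) ⬝ (Zm q r.1 *ᵥ t) = 0 := by
    rw [hb.wts_eq, residM_dot, residM_mulVec hF, dotProduct_zero]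
  have h2 : (E.SigTil (E.covs r) *ᵥ E.wHat (E.covs r)) ⬝ (E.βHat r - E.β0)
      = (n : ℝ)⁻¹ * (E.wts (E.covs r) ⬝ (Xm r *ᵥ (E.βHat r - E.β0))) := by
    have e : E.wts (E.covs r) ⬝ (Xm r *ᵥ (E.βHat r - E.β0))
        = E.wts (E.covs r) ⬝ (E.Xtil (E.covs r) *ᵥ (E.βHat r - E.β0)) := by
      rw [hb.Xtil_mulVec, ← Xm_mulVec, hb.wts_eq, ← residM_dot, residM_residM]
    rw [e, SigTil, smul_mulVec, smul_dotProduct, ← mulVec_mulVec,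
      mulVec_transpose, ← dotProduct_mulVec, wts, smul_eq_mul]
  rw [THat_eq, ht, dotProduct_add, dotProduct_sub, h1, add_dotProduct, h2, dotProduct_sub E.ξ]
  ring

/-- The least squares fit in the sieve coefficients makes the residuals orthogonal to the sieve. -/
lemma SieveBasis.projM_resid (hb : E.SieveBasis q M) (hn : 0 < n)
    (hmin : ∀ γ, E.crit r (E.βHat r) (E.γHat r) ≤ E.crit r (E.βHat r) γ) :
    projM (Zm q r.1) *ᵥ E.resid r = 0 := by
  set F := Zm q r.1
  obtain ⟨t, ht⟩ := hb.of_ψ (E.γHat r)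
  set c : Fin E.k → ℝ := (Fᵀ * F)⁻¹ *ᵥ (Fᵀ *ᵥ E.resid r)
  obtain ⟨γ, hγ⟩ := hb.to_ψ (t + c)
  have hc : F *ᵥ c = projM F *ᵥ E.resid r := (projM_mulVec_eq F _).symm
  have hr : Xm r *ᵥ E.βHat r + F *ᵥ t - E.SHat r = -E.resid r := by
    funext i
    have e : (F *ᵥ t) i = q (zz (r.1 i)) ⬝ t := rfl
    simp only [Pi.add_apply, Pi.sub_apply, Pi.neg_apply, e, ← ht, Xm_mulVec, resid,
      dotProduct_comm _ (xx (r.1 i))]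
    ring
  have hr' : Xm r *ᵥ E.βHat r + F *ᵥ (t + c) - E.SHat r = -residM F (E.resid r) := by
    rw [mulVec_add, hc, ← add_assoc, add_sub_right_comm, hr, residM]
    abel
  have h := hmin γ
  rw [crit_eq ht, crit_eq fun z => (hγ z).symm, hr, hr', add_le_add_iff_right,
    neg_dotProduct_neg, neg_dotProduct_neg] at h
  have h' := le_of_mul_le_mul_left h (inv_pos.2 (by exact_mod_cast hn))
  rw [dot_self_eq_projM_add F] at h'
  exact dotProduct_self_eq_zero.1 (le_antisymm (by linarith) (nsq_nonneg _))

end Experiment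

namespace Consts

variable (K : Consts) (C₁ : ℝ)

/-- The lower constant for the tuning parameters. -/
def C₀ : ℝ := 2 * K.CD + 64 * (1 + K.Lz) + 16
def ρ₀ : ℝ := 8 * (1 + K.vε) + 2 * K.Km ^ 2
def CG : ℝ := K.wMax ^ 2 * K.Cproj + (K.A + 2) / K.cX
def Cw : ℝ := 3 * K.wMax + 2 * K.CG + 4 * K.e₂
def CB : ℝ := 10 * (2 * K.CG + 4 * K.e₂) + 24 * C₁ * K.wMax
def CA : ℝ := 4 + 64 / K.cX ^ 2
def Cθ : ℝ := 2 + 2 * K.Cl * K.ρ₀ * K.A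
def Ct : ℝ := 4 * (18 / (K.cSig / 2) + 2) * (2 * C₁ + 2 * K.Cl * K.ρ₀ * K.A)
def CX : ℝ := K.CS * (18 / (K.cSig / 2) + 1) ^ 2 + K.e₁ * (4 * (18 / (K.cSig / 2) + 2)) ^ 2 * K.Cθ

variable {K} {d : ℕ}

lemma Valid.Lz_pos (h : K.Valid d) : 0 < K.Lz := by
  have := h.cX_pos; have := h.vε_pos
  unfold Consts.Lz Consts.C₄; positivity
lemma Valid.Cl_pos (h : K.Valid d) : 0 < K.Cl := by
  have := h.CS_pos; have := h.e₁_pos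
  unfold Consts.Cl; positivity
lemma Valid.ρ₀_pos (h : K.Valid d) : 0 < K.ρ₀ := by
  have := h.vε_pos
  unfold ρ₀; positivity
lemma Valid.CG_pos (h : K.Valid d) : 0 < K.CG := by
  have := h.wMax_pos; have := h.Cproj; have := h.cX_pos; have := h.one_le_A
  unfold CG; positivity
lemma Valid.CA_pos (_ : K.Valid d) : 0 < K.CA := by unfold CA; positivity
lemma Valid.Cw_pos (h : K.Valid d) : 0 < K.Cw := by
  have := h.wMax_pos; have := h.CG_pos; have := h.e₂_pos
  unfold Cw; positivity
lemma Valid.Cθ_pos (h : K.Valid d) : 0 < K.Cθ := by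
  have := h.Cl_pos; have := h.ρ₀_pos; have := h.one_le_A
  unfold Cθ; positivity
lemma Valid.CX_pos (h : K.Valid d) : 0 < K.CX := by
  have := h.CS_pos; have := h.cSig; have := h.Cθ_pos; have := h.e₁_pos
  unfold CX; positivity
lemma Valid.C₀_ge (h : K.Valid d) : 1 ≤ K.C₀ ∧ 2 * K.CD ≤ K.C₀ ∧ 64 * (1 + K.Lz) ≤ K.C₀ := by
  have := h.CD_pos; have := h.Lz_pos
  unfold C₀
  grind

end Consts

namespace Experiment

variable {f : EZ d → Fin E.k → ℝ} {M h C₁ : ℝ} {r : E.Smp}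

/-- Smallness of the deterministic quantities at level `h`. -/
structure Small (E : Experiment d n) (K : Consts) (M h C₁ : ℝ) : Prop where
  pos : 0 < h
  le_one : h ≤ 1
  scal : Scal K.A n E.k (log E.p) M
  inv_L : 1 ≤ h ^ 4 * log E.p
  sw_pos : 0 < E.sw
  sw_le : (E.sw : ℝ) ^ 2 * E.rate ≤ h ^ 4
  s0_le : E.s0 * log E.p ≤ h ^ 4 * √n
  lam_ge : K.C₀ * E.rate ≤ E.lam
  lam_le : E.lam ≤ C₁ * E.rate
  lam'_ge : K.C₀ * E.rate ≤ E.lam'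
  lam'_le : E.lam' ≤ C₁ * E.rate
  small_B : K.CB C₁ * h ≤ 1
  small_ρ : 64 * K.Cl * K.ρ₀ * K.A * h ≤ 1
  small_a : 64 * K.aQ * K.Cθ * h ≤ min (K.cSig / 2) 1

namespace Small

lemma sqrt_pos (hh : E.Small K M h C₁) : 0 < √n := Real.sqrt_pos.2 hh.scal.nR_pos

lemma rate_pos (hh : E.Small K M h C₁) : 0 < E.rate := hh.scal.rate_pos

lemma sqrt_mul_rate (hh : E.Small K M h C₁) : √n * E.rate = √(log E.p) := by
  rw [rate, Real.sqrt_div (by linarith [hh.scal.one_le_L]), mul_div_cancel₀ _ hh.sqrt_pos.ne']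

lemma one_le_sqrt_mul_rate (hh : E.Small K M h C₁) : 1 ≤ √n * E.rate := by
  rw [hh.sqrt_mul_rate]
  exact Real.one_le_sqrt.2 hh.scal.one_le_L

lemma rate_le_lam (hh : E.Small K M h C₁) (hK : K.Valid d) : E.rate ≤ E.lam :=
  (le_mul_of_one_le_left hh.rate_pos.le hK.C₀_ge.1).trans hh.lam_ge

lemma rate_le_lam' (hh : E.Small K M h C₁) (hK : K.Valid d) : E.rate ≤ E.lam' :=
  (le_mul_of_one_le_left hh.rate_pos.le hK.C₀_ge.1).trans hh.lam'_ge

lemma C₁_pos (hh : E.Small K M h C₁) (hK : K.Valid d) : 0 < C₁ :=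
  pos_of_mul_pos_left (hh.rate_pos.trans_le ((hh.rate_le_lam hK).trans hh.lam_le)) hh.rate_pos.le

lemma one_le_n (hh : E.Small K M h C₁) : 1 ≤ h ^ 4 * n := by
  refine hh.inv_L.trans (mul_le_mul_of_nonneg_left ?_ (by have := hh.pos; positivity))
  nlinarith [hh.scal.one_le_L, hh.scal.L_sq]

lemma k_le (hh : E.Small K M h C₁) : (E.k : ℝ) ≤ K.A * h ^ 2 * √n := by
  have hA := hh.scal.one_le
  refine le_of_sq_le_sq ?_ (by positivity)
  have h1 : (E.k : ℝ) ^ 2 ≤ h ^ 4 * (E.k ^ 2 * log E.p) := by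
    nlinarith [mul_le_mul_of_nonneg_left hh.inv_L (sq_nonneg (E.k : ℝ))]
  have h2 : h ^ 4 * (E.k ^ 2 * log E.p) ≤ h ^ 4 * (K.A ^ 2 * n) :=
    mul_le_mul_of_nonneg_left (hh.scal.kk_le.trans (mul_le_mul_of_nonneg_right
      (le_self_pow₀ hA two_ne_zero) (Nat.cast_nonneg _))) (by positivity)
  grind

lemma kΞ_le (hh : E.Small K M h C₁) : E.k * M ≤ K.A * h ^ 4 * n := by
  have h0 : 0 ≤ E.k * M := mul_nonneg (Nat.cast_nonneg _) (by linarith [hh.scal.one_le_Ξ])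
  have h1 : 0 ≤ h ^ 4 := by have := hh.pos; positivity
  nlinarith [mul_le_mul_of_nonneg_left hh.inv_L h0, mul_le_mul_of_nonneg_left hh.scal.grow h1]

/-- The squared noise level of the lasso step. -/
lemma ρ_le (hh : E.Small K M h C₁) (hK : K.Valid d) :
    √n * (K.ρ₀ * E.k / (n * h)) ≤ K.ρ₀ * K.A * h := by
  have hn := hh.scal.nR_pos
  have h0 := hh.pos
  rw [← mul_div_assoc, div_le_iff₀ (by positivity)]
  calc √n * (K.ρ₀ * E.k) ≤ √n * (K.ρ₀ * (K.A * h ^ 2 * √n)) := by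
        have := hK.ρ₀_pos; have := hh.k_le; gcongr
    _ = K.ρ₀ * K.A * h * (√n ^ 2 * h) := by ring
    _ = _ := by rw [sq_sqrt hn.le]

end Small

/-- The covariates and the errors of the sample behave as expected at level `h`. -/
structure GoodFst (E : Experiment d n) (K : Consts) (Z : Set (EZ d))
    (f : EZ d → Fin E.k → ℝ) (h : ℝ) (r : Fin n → Rec E.p d) : Prop where
  cov : E.CovGood K f r
  four : ∑ i, E.eps (r i) ^ 4 ≤ n * K.C₄
  pi : nsq (residM (Zm f r) (fun l => E.w0 ⬝ E.XPi (r l)))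
      ≤ (n * ((∑ j, |E.w0 j|) ^ 2 * (K.Cproj * E.rate)) + (E.k * log n + 2) / K.cX) / h
  we : ∑ i, (E.wts (fun l => DiD.cov (r l)) i - E.bb (r i)) ^ 2 ≤ n * h ^ 2 →
    (∑ i, (E.wts (fun l => DiD.cov (r l)) i - E.bb (r i)) * E.eps (r i)) ^ 2 ≤ n * h
  wv : ∑ i, (E.wts (fun l => DiD.cov (r l)) i - E.bb (r i)) ^ 2 ≤ n * h ^ 2 →
    ∑ i, (E.wts (fun l => DiD.cov (r l)) i - E.bb (r i)) ^ 2 * E.eps (r i) ^ 2 ≤ n * h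
  rv : ∑ a, (∑ i, f (zz (r i)) a * E.rnI Z (zz (r i))) ^ 2 ≤ n * (E.k * ((E.lk * E.ck) ^ 2 + 1)) / h
  av : |(n : ℝ)⁻¹ * ∑ i, (E.bb (r i) * E.eps (r i)) ^ 2 - E.avar| ≤ h

/-- The sample behaves as expected at level `h`. -/
structure Good (E : Experiment d n) (K : Consts) (Z : Set (EZ d)) (f : EZ d → Fin E.k → ℝ)
    (M h : ℝ) (r : E.Smp) : Prop extends E.GoodFst K Z f h r.1 where
  err : ∀ i, E.ErrGood K h r.2 (r.1 i)
  score : ∀ i, score E.pr E.Φ1 E.Φ0 (r.1 i) = xx (r.1 i) ⬝ E.β0 + E.f0 (zz (r.1 i)) + E.eps (r.1 i)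
  mem : ∀ i, zz (r.1 i) ∈ Z
  bound : ∀ i, f (zz (r.1 i)) ⬝ f (zz (r.1 i)) ≤ M
  lasso : E.βHat r ∈ E.ℬ ∧ ∀ β ∈ E.ℬ, ∀ γ, E.crit r (E.βHat r) (E.γHat r) ≤ E.crit r β γ
  xz : ∀ j, (∑ i, xx (r.1 i) j * E.zeta r.2 (r.1 i)) ^ 2 ≤ 8 * (n * K.Lz) * (2 * log E.p)
  pz : nsq (projM (Zm f r.1) *ᵥ fun l => E.zeta r.2 (r.1 l)) ≤ 8 * (1 + K.vε) * E.k / h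
  wm : ∑ i, E.wts (E.covs r) i ^ 2 ≤ n * K.CA →
    (∑ i, E.wts (E.covs r) i * E.mErr r.2 (r.1 i)) ^ 2 ≤ n * h
  rem : ∀ ij : Fin n × Fin E.p,
    |√n * E.sw * (E.Xtil (E.covs r) ij.1 ij.2 * E.rn (zz (r.1 ij.1)))| ≤ h ^ 4
  prod1 : |min ((E.sw : ℝ) ^ 2 * n) (E.k * n) *
    empSq E r (fun w => errPr E r w * errΦ1 E r w)| ≤ h ^ 4
  prod0 : |min ((E.sw : ℝ) ^ 2 * n) (E.k * n) *
    empSq E r (fun w => errPr E r w * errΦ0 E r w)| ≤ h ^ 4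

namespace Good

lemma SHat_eq (hg : E.Good K Z f M h r) (i : Fin n) : E.SHat r i = xx (r.1 i) ⬝ E.β0
    + E.f0 (zz (r.1 i)) + E.zeta r.2 (r.1 i) + E.qErr r.2 (r.1 i) := by
  rw [SHat, (hg.err i).score_eq, hg.score i, zeta]
  ring

lemma pi_le (hg : E.Good K Z f M h r) (hE : E.Regular K Z) (hK : K.Valid d)
    (hh : E.Small K M h C₁) :
    2 * ((n : ℝ)⁻¹ * nsq (residM (Zm f r.1) (fun l => E.w0 ⬝ E.XPi (r.1 l)))) + 4 * K.e₂ * E.rate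
      ≤ (2 * K.CG + 4 * K.e₂) * (E.sw * E.rate / h) := by
  have h0 := hh.pos
  have hr := hh.rate_pos
  have hn := hh.scal.nR_pos
  have hsw : (1 : ℝ) ≤ E.sw := by exact_mod_cast hh.sw_pos
  have hcX := hK.cX_pos
  have hA := hK.one_le_A
  have hw : (∑ j, |E.w0 j|) ^ 2 ≤ E.sw * K.wMax ^ 2 := by
    refine (pow_le_pow_left₀ (sum_nonneg fun _ _ => abs_nonneg _) (hE.w0_l1_le hK) 2).trans_eq ?_
    rw [mul_pow, sq_sqrt (Nat.cast_nonneg _)]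
  have h1n : 1 ≤ n * E.rate := by
    have h1 := hh.one_le_sqrt_mul_rate
    have hn1 : (1 : ℝ) ≤ n := by exact_mod_cast hh.scal.n_pos
    exact h1.trans (mul_le_mul_of_nonneg_right ((sqrt_le_left hn.le).2 (by nlinarith)) hr.le)
  have hk : E.k * log n ≤ n * (K.A * E.rate) := by
    have := hh.scal.k_log_le
    rwa [div_le_iff₀' hn] at this
  have h1 : n * ((∑ j, |E.w0 j|) ^ 2 * (K.Cproj * E.rate)) + (E.k * log n + 2) / K.cX
      ≤ n * (K.CG * (E.sw * E.rate)) := by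
    have e : n * (K.CG * (E.sw * E.rate)) = n * (E.sw * K.wMax ^ 2 * (K.Cproj * E.rate))
        + (n * (K.A * E.rate) * E.sw + 2 * (n * E.rate) * E.sw) / K.cX := by
      unfold Consts.CG; field_simp
    rw [e]
    have hp := hK.Cproj
    have e1 := hk.trans (le_mul_of_one_le_right (by positivity) hsw)
    have e2 : 2 ≤ 2 * (n * E.rate) * E.sw := by nlinarith
    gcongr
  have h2 : (n : ℝ)⁻¹ * nsq (residM (Zm f r.1) (fun l => E.w0 ⬝ E.XPi (r.1 l))) ≤ K.CG * (E.sw * E.rate / h) := by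
    refine (mul_le_mul_of_nonneg_left (hg.pi.trans (div_le_div_of_nonneg_right h1 h0.le))
      (by positivity)).trans_eq ?_
    field_simp
  have h3 : E.rate ≤ E.sw * E.rate / h := by
    rw [le_div_iff₀ h0]
    nlinarith [hh.le_one]
  have := mul_le_mul_of_nonneg_left h3 hK.e₂_pos.le
  linarith

lemma wts_le (hg : E.Good K Z f M h r) (hE : E.Regular K Z) (hK : K.Valid d)
    (hb : E.SieveBasis f M) (hest : E.IsEstimated) (hh : E.Small K M h C₁) :
    E.Feasible (E.covs r) (E.wHat (E.covs r)) ∧ ∑ j, |E.wHat (E.covs r) j| ≤ K.Cw * (E.sw / h) ∧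
      ∑ i, (E.wts (E.covs r) i - E.bb (r.1 i)) ^ 2 ≤ n * h ^ 2 ∧
      ∑ i, E.wts (E.covs r) i ^ 2 ≤ n * K.CA := by
  have h0 := hh.pos
  have hr := hh.rate_pos
  have hn := hh.scal.nR_pos
  have hsw : (1 : ℝ) ≤ E.sw := by exact_mod_cast hh.sw_pos
  have hlam' := hr.trans_le (hh.rate_le_lam' hK)
  obtain ⟨d1, d2, d3⟩ := hg.cov.dantzig hE hK hb hh.scal hest le_rfl hlam'
    ((mul_le_mul_of_nonneg_right hK.C₀_ge.2.1 hr.le).trans hh.lam'_ge)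
  have hG := hg.pi_le hE hK hh
  have hw := (hE.w0_l1_le hK).trans (mul_le_mul_of_nonneg_right
      ((sqrt_le_left (Nat.cast_nonneg _)).2 (by nlinarith)) (by linarith [hK.wMax_pos]))
  have hsh : (E.sw : ℝ) ≤ E.sw / h := le_div_self (by positivity) h0 hh.le_one
  have hc : 0 ≤ 2 * K.CG + 4 * K.e₂ := by have := hK.CG_pos; have := hK.e₂_pos; positivity
  have hwm := hK.wMax_pos
  have hC₁ := hh.C₁_pos hK
  have h3 : ∑ i, (E.wts (E.covs r) i - E.bb (r.1 i)) ^ 2 ≤ n * h ^ 2 := by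
    rw [← inv_mul_le_iff₀ hn]
    have e1 : E.lam' * ∑ j, |E.w0 j| ≤ (C₁ * E.rate) * (E.sw / h * K.wMax) :=
      mul_le_mul hh.lam'_le (hw.trans (by gcongr)) (sum_nonneg fun _ _ => abs_nonneg _)
        (by positivity)
    have e2 : E.sw * E.rate / h ≤ h ^ 3 := by
      rw [div_le_iff₀ h0]
      have := hh.sw_le
      nlinarith [mul_le_mul_of_nonneg_right hsw (mul_nonneg (Nat.cast_nonneg E.sw) hr.le)]
    have hCB : 0 ≤ K.CB C₁ := by unfold Consts.CB; positivity
    calc _ ≤ _ := d3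
      _ ≤ K.CB C₁ * (E.sw * E.rate / h) := by
          unfold Consts.CB
          linear_combination 10 * hG + 24 * e1
      _ ≤ K.CB C₁ * h ^ 3 := mul_le_mul_of_nonneg_left e2 hCB
      _ = K.CB C₁ * h * h ^ 2 := by ring
      _ ≤ h ^ 2 := mul_le_of_le_one_left (by positivity) hh.small_B
  refine ⟨d1, d2.trans ?_, h3, ?_⟩
  · have e1 := (div_le_div_of_nonneg_right hG hlam'.le).trans (div_le_div_of_nonneg_left
      (by positivity) hr (hh.rate_le_lam' hK))
    rw [mul_div_assoc, div_div, mul_comm h, ← div_div, mul_div_cancel_right₀ _ hr.ne'] at e1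
    unfold Consts.Cw
    nlinarith [hw.trans (by gcongr)]
  · have hf := hg.cov.fam.four (.inr (.inr ()))
    have e : ∀ i, E.wts (E.covs r) i ^ 2 ≤ 2 * (E.wts (E.covs r) i - E.bb (r.1 i)) ^ 2
        + (1 + 2 * E.bb (r.1 i) ^ 4) := fun i => by
      nlinarith [sq_nonneg (E.wts (E.covs r) i - 2 * E.bb (r.1 i)),
        sq_nonneg (2 * E.bb (r.1 i) ^ 2 - 1), sq_nonneg (E.bb (r.1 i) ^ 2 - 1)]
    refine (sum_le_sum fun i _ => e i).trans ?_
    simp only [sum_add_distrib, ← mul_sum, sum_const, card_univ,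
      Fintype.card_fin, nsmul_eq_mul, mul_one]
    have : ∑ i, E.bb (r.1 i) ^ 4 ≤ n * (32 / K.cX ^ 2) := hf
    have e4 : n * h ^ 2 ≤ n * 1 := by gcongr; exact pow_le_one₀ h0.le hh.le_one
    unfold Consts.CA
    grind

end Good

lemma sum_sq_le_of_min_empSq {g : Cov E.p d → ℝ} {x : ℝ} (hn : 0 < n) (hsw : 0 < E.sw)
    (hk : 0 < E.k)
    (hx : |min ((E.sw : ℝ) ^ 2 * n) (E.k * n) * empSq E r g| ≤ x) :
    ∑ i, g (cov (r.1 i)) ^ 2 ≤ x := by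
  have hn' : (0 : ℝ) < n := by exact_mod_cast hn
  have h1 : (n : ℝ) ≤ min ((E.sw : ℝ) ^ 2 * n) (E.k * n) := by
    have h1 : (1 : ℝ) ≤ E.sw := by exact_mod_cast hsw
    have h2 : (1 : ℝ) ≤ E.k := by exact_mod_cast hk
    simp_all
  have h0 : 0 ≤ empSq E r g := by unfold empSq; positivity
  calc ∑ i, g (cov (r.1 i)) ^ 2 = n * empSq E r g := by
        rw [empSq, mul_inv_cancel_left₀ hn'.ne']; rfl
    _ ≤ _ := (mul_le_mul_of_nonneg_right h1 h0).trans ((le_abs_self _).trans hx)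

namespace Good

lemma q_le (hg : E.Good K Z f M h r) (hh : E.Small K M h C₁) :
    ∑ i, E.qErr r.2 (r.1 i) ^ 2 ≤ 2 * K.Km ^ 2 * h ^ 4 := by
  have h1 := sum_sq_le_of_min_empSq hh.scal.n_pos hh.sw_pos hh.scal.k_pos hg.prod1
  have h0 := sum_sq_le_of_min_empSq hh.scal.n_pos hh.sw_pos hh.scal.k_pos hg.prod0
  refine (sum_le_sum fun i _ => (hg.err i).sq_q).trans ?_
  rw [← mul_sum, sum_add_distrib]
  have := mul_le_mul_of_nonneg_left (add_le_add h1 h0) (sq_nonneg K.Km)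
  calc _ ≤ _ := this
    _ = _ := by ring

lemma noise_le (hg : E.Good K Z f M h r) (hK : K.Valid d) (hh : E.Small K M h C₁) :
    (n : ℝ)⁻¹ * nsq (projM (Zm f r.1) *ᵥ fun l => E.zeta r.2 (r.1 l)) ≤ K.ρ₀ * E.k / (n * h) ∧
      (n : ℝ)⁻¹ * ((fun i => E.qErr r.2 (r.1 i)) ⬝ fun i => E.qErr r.2 (r.1 i))
        ≤ K.ρ₀ * E.k / (n * h) := by
  have h0 := hh.pos
  have hv := hK.vε_pos
  have hk := hh.scal.one_le_k
  have e : K.ρ₀ * E.k / (n * h) = (n : ℝ)⁻¹ * (K.ρ₀ * E.k / h) := by field_simp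
  rw [e]
  refine ⟨mul_le_mul_of_nonneg_left (hg.pz.trans ?_) (by positivity),
    mul_le_mul_of_nonneg_left ?_ (by positivity)⟩
  · gcongr
    unfold Consts.ρ₀
    linarith [sq_nonneg K.Km]
  · have h1 := hg.q_le hh
    simp only [dotProduct, ← sq]
    rw [le_div_iff₀ h0]
    have h4 : h ^ 4 * h ≤ 1 := mul_le_one₀ (pow_le_one₀ h0.le hh.le_one) h0.le hh.le_one
    calc (∑ i, E.qErr r.2 (r.1 i) ^ 2) * h ≤ 2 * K.Km ^ 2 * h ^ 4 * h := by gcongr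
      _ ≤ 2 * K.Km ^ 2 := by nlinarith [sq_nonneg K.Km]
      _ ≤ K.ρ₀ * 1 := by unfold Consts.ρ₀; linarith
      _ ≤ K.ρ₀ * E.k := mul_le_mul_of_nonneg_left hk hK.ρ₀_pos.le

/-- Rates of the penalized least squares estimator. -/
lemma lasso_le (hg : E.Good K Z f M h r) (hE : E.Regular K Z) (hK : K.Valid d)
    (hb : E.SieveBasis f M) (hh : E.Small K M h C₁) :
    √(log E.p) * ∑ j, |(E.βHat r - E.β0) j| ≤ K.Ct C₁ * h ∧
      (n : ℝ)⁻¹ * ∑ i, ((E.βHat r - E.β0) ⬝ xx (r.1 i)) ^ 2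
        ≤ K.CX * (2 * E.lam ^ 2 * E.s0 + 2 * K.Cl * (K.ρ₀ * E.k / (n * h))) := by
  set ρ := K.ρ₀ * E.k / (n * h)
  set t := ∑ j, |(E.βHat r - E.β0) j|
  have h0 := hh.pos
  have hn := hh.scal.nR_pos
  have hr := hh.rate_pos
  have hrl := hh.rate_le_lam hK
  have hlam := hr.trans_le hrl
  have hCl := hK.Cl_pos
  have hρ₀ := hK.ρ₀_pos
  have hA := hK.one_le_A
  have haQ := hK.aQ_pos
  have hcS := hK.cSig
  have hs := hh.sqrt_pos
  have hρ : 0 ≤ ρ := by positivity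
  have hsr := hh.one_le_sqrt_mul_rate
  have hρs := hh.ρ_le hK
  have hρr := calc ρ ≤ (√n * E.rate) * ρ := le_mul_of_one_le_left hρ hsr
      _ = √n * ρ * E.rate := by ring
      _ ≤ _ := mul_le_mul_of_nonneg_right hρs hr.le
  have hlr : E.rate * E.rate ≤ E.lam ^ 2 := by nlinarith
  have hs0 : √(log E.p) * E.rate * E.s0 ≤ h ^ 4 := by
    have e : √(log E.p) * E.rate * √n = log E.p := by
      rw [mul_assoc, mul_comm E.rate, hh.sqrt_mul_rate,
        Real.mul_self_sqrt (by linarith [hh.scal.one_le_L])]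
    refine le_of_mul_le_mul_right ?_ hs
    calc √(log E.p) * E.rate * E.s0 * √n
        = E.s0 * (√(log E.p) * E.rate * √n) := by ring
      _ ≤ _ := by rw [e]; exact hh.s0_le
  have hh4 : h ^ 4 ≤ h := pow_le_of_le_one h0.le hh.le_one (by norm_num)
  have hL1 := Real.one_le_sqrt.2 hh.scal.one_le_L
  set u := E.lam * √E.s0 + √(K.Cl * ρ) with hu
  have hθ2 : u ^ 2 ≤ 2 * E.lam ^ 2 * E.s0 + 2 * K.Cl * ρ := by
    have e1 : (E.lam * √E.s0) ^ 2 = E.lam ^ 2 * E.s0 := by rw [mul_pow, sq_sqrt (Nat.cast_nonneg _)]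
    have e2 : √(K.Cl * ρ) ^ 2 = K.Cl * ρ := sq_sqrt (by positivity)
    rw [hu]
    linarith [add_sq_le (a := E.lam * √E.s0) (b := √(K.Cl * ρ))]
  have hrθ : E.rate * u ^ 2 ≤ K.Cθ * h * E.lam ^ 2 := by
    have e1 : E.rate * E.s0 ≤ h := by
      have : E.rate * E.s0 ≤ √(log E.p) * (E.rate * E.s0) :=
        le_mul_of_one_le_left (by positivity) hL1
      linarith
    have e2 : E.rate * ρ ≤ K.ρ₀ * K.A * h * E.lam ^ 2 :=
      calc E.rate * ρ ≤ E.rate * (K.ρ₀ * K.A * h * E.rate) := by gcongr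
        _ = K.ρ₀ * K.A * h * (E.rate * E.rate) := by ring
        _ ≤ _ := by gcongr
    calc E.rate * u ^ 2 ≤ E.rate * (2 * E.lam ^ 2 * E.s0 + 2 * K.Cl * ρ) := by gcongr
      _ = 2 * E.lam ^ 2 * (E.rate * E.s0) + 2 * K.Cl * (E.rate * ρ) := by ring
      _ ≤ 2 * E.lam ^ 2 * h + 2 * K.Cl * (K.ρ₀ * K.A * h * E.lam ^ 2) := by gcongr
      _ = _ := by unfold Consts.Cθ; ring
  have hsm := calc 64 * (K.aQ * E.rate) * u ^ 2 = 64 * K.aQ * (E.rate * u ^ 2) := by ring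
      _ ≤ 64 * K.aQ * (K.Cθ * h * E.lam ^ 2) := by gcongr
      _ = 64 * K.aQ * K.Cθ * h * E.lam ^ 2 := by ring
      _ ≤ _ := mul_le_mul_of_nonneg_right hh.small_a (sq_nonneg _)
  obtain ⟨hD, hT⟩ := hg.cov.lasso_bound hE hK hb hh.scal hg.lasso.2 hg.SHat_eq hρ hlam
    (fun j => by
      rw [abs_mul, abs_of_pos (inv_pos.2 hn), inv_mul_le_iff₀ hn]
      refine abs_le_of_sq_le_sq ((hg.xz j).trans ?_) (by positivity)
      have hz := hK.Lz_pos
      have e1 : 4 * (1 + K.Lz) * E.rate ≤ E.lam / 16 := by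
        have := (mul_le_mul_of_nonneg_right hK.C₀_ge.2.2 hr.le).trans hh.lam_ge
        linarith
      have e2 : E.rate ^ 2 * n = log E.p := by rw [rate, hh.scal.rate_sq, div_mul_cancel₀ _ hn.ne']
      calc 8 * (n * K.Lz) * (2 * log E.p) = 16 * K.Lz * (E.rate ^ 2 * n) * n := by
            rw [e2]; ring
        _ ≤ 16 * (1 + K.Lz) ^ 2 * (E.rate ^ 2 * n) * n := by gcongr; nlinarith
        _ = (n * (4 * (1 + K.Lz) * E.rate)) ^ 2 := by ring
        _ ≤ _ := by gcongr)
    (fun j => by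
      have e1 := fun i => by
        have h1 := hg.rem (i, j)
        have hsw : (1 : ℝ) ≤ E.sw := by exact_mod_cast hh.sw_pos
        rw [abs_mul, abs_of_nonneg (by positivity)] at h1
        have h2 : 1 ≤ √n * E.sw * E.rate := by nlinarith
        have h3 : 16 * E.rate ≤ E.lam := le_trans (mul_le_mul_of_nonneg_right
          (by linarith [hK.C₀_ge.2.2, hK.Lz_pos]) hr.le) hh.lam_ge
        refine (le_of_mul_le_mul_left (h1.trans (le_trans ?_ h2))
          (by positivity : 0 < √n * E.sw)).trans (by linarith : E.rate ≤ E.lam / 16)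
        linarith [hh.le_one]
      rw [abs_mul, abs_of_pos (inv_pos.2 hn), inv_mul_le_iff₀ hn]
      refine (abs_sum_le_sum_abs _ _).trans ((sum_le_sum fun i _ => e1 i).trans ?_)
      simp)
    (hg.noise_le hK hh).1 (hg.noise_le hK hh).2
    (calc 64 * K.Cl * ρ * E.rate ≤ 64 * K.Cl * (K.ρ₀ * K.A * h * E.rate) * E.rate := by gcongr
      _ = 64 * K.Cl * K.ρ₀ * K.A * h * (E.rate * E.rate) := by ring
      _ ≤ 1 * E.lam ^ 2 := by gcongr; exact hh.small_ρ
      _ = _ := one_mul _)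
    hu (hsm.trans (mul_le_mul_of_nonneg_right (min_le_left _ _) (sq_nonneg _)))
    (by
      have := hsm.trans (mul_le_mul_of_nonneg_right (min_le_right _ _) (sq_nonneg _))
      have : 0 ≤ (K.aQ * E.rate) * u ^ 2 := by positivity
      linarith)
  set c := 18 / (K.cSig / 2)
  constructor
  · refine le_of_mul_le_mul_left ?_ hlam
    have e1 : √(log E.p) * (E.lam ^ 2 * E.s0) ≤ C₁ * h * E.lam :=
      calc _ = E.lam * (√(log E.p) * E.lam * E.s0) := by ring
        _ ≤ E.lam * (√(log E.p) * (C₁ * E.rate) * E.s0) := by gcongr; exact hh.lam_le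
        _ = E.lam * C₁ * (√(log E.p) * E.rate * E.s0) := by ring
        _ ≤ E.lam * C₁ * h := by have := hh.C₁_pos hK; gcongr; exact hs0.trans hh4
        _ = _ := by ring
    have e2 : √(log E.p) * ρ ≤ K.ρ₀ * K.A * h * E.lam := by
      rw [← hh.sqrt_mul_rate]
      calc _ = √n * ρ * E.rate := by ring
        _ ≤ _ := by gcongr
    calc E.lam * (√(log E.p) * t) = √(log E.p) * (E.lam * t) := by ring
      _ ≤ √(log E.p) * (4 * (c + 2) * (2 * E.lam ^ 2 * E.s0 + 2 * K.Cl * ρ)) := by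
          exact mul_le_mul_of_nonneg_left (hT.trans (by gcongr)) (by linarith)
      _ = 4 * (c + 2) * (2 * (√(log E.p) * (E.lam ^ 2 * E.s0))
          + 2 * K.Cl * (√(log E.p) * ρ)) := by ring
      _ ≤ 4 * (c + 2) * (2 * (C₁ * h * E.lam) + 2 * K.Cl * (K.ρ₀ * K.A * h * E.lam)) := by gcongr
      _ = _ := by unfold Consts.Ct; ring
  · have hδ : nsq (E.βHat r - E.β0) ≤ ((c + 1) * u) ^ 2 := by
      rw [← sq_sqrt (nsq_nonneg (E.βHat r - E.β0))]
      gcongr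
    have hrt : E.rate * t ^ 2 ≤ (4 * (c + 2)) ^ 2 * K.Cθ * u ^ 2 := by
      refine le_of_mul_le_mul_left ?_ (by positivity : 0 < E.lam ^ 2)
      have hCθ := hK.Cθ_pos
      calc E.lam ^ 2 * (E.rate * t ^ 2) = E.rate * (E.lam * t) ^ 2 := by ring
        _ ≤ E.rate * (4 * (c + 2) * u ^ 2) ^ 2 := by gcongr
        _ = (4 * (c + 2)) ^ 2 * u ^ 2 * (E.rate * u ^ 2) := by ring
        _ ≤ (4 * (c + 2)) ^ 2 * u ^ 2 * (K.Cθ * 1 * E.lam ^ 2) := by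
            exact mul_le_mul_of_nonneg_left (hrθ.trans (by gcongr; exact hh.le_one)) (by positivity)
        _ = _ := by ring
    have hCS := hK.CS_pos
    have he := hK.e₁_pos
    calc _ ≤ _ := hg.cov.avg_xx_sq_le hE hK hh.scal _
      _ = K.CS * nsq (E.βHat r - E.β0) + K.e₁ * (E.rate * t ^ 2) := by ring
      _ ≤ K.CS * ((c + 1) * u) ^ 2 + K.e₁ * ((4 * (c + 2)) ^ 2 * K.Cθ * u ^ 2) := by gcongr
      _ = K.CX * u ^ 2 := by unfold Consts.CX; ring
      _ ≤ _ := mul_le_mul_of_nonneg_left hθ2 hK.CX_pos.le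

end Good

end Experiment

namespace Consts

variable (K : Consts) (C₁ CR : ℝ)

def Cst : ℝ := C₁ * K.Ct C₁ + K.Cw + 2 + √(2 * K.CA * K.Km ^ 2)
def Kφ : ℝ := 2 * (2 * K.CX * (2 * (|CR| / K.cSig) + 2 * K.Cl * K.ρ₀) + 16 + 16 * K.ρ₀) * K.A
def Ke : ℝ := 1 + √(4 / K.cX) * K.Ct C₁ + √(K.Kφ CR) + 2 * K.Km
def Kd : ℝ := 2 * K.Ke C₁ CR ^ 2 * (2 * K.CA + 8 + 4 * (K.COm * K.wMax ^ 2)) + 2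
def Kv : ℝ := K.Kd C₁ CR + 2 * √(K.Kd C₁ CR * (K.COm * K.wMax ^ 2 + 1)) + 1

end Consts

lemma abs_sum_sq_sub_le {n : ℕ} (u v : Fin n → ℝ) : |∑ i, u i ^ 2 - ∑ i, v i ^ 2|
    ≤ ∑ i, (u i - v i) ^ 2 + 2 * √((∑ i, (u i - v i) ^ 2) * ∑ i, v i ^ 2) := by
  have h := abs_dotProduct_le_sqrt (fun i => u i - v i) v
  simp only [dotProduct, ← sq] at h
  rw [← sqrt_mul (sum_nonneg fun _ _ => sq_nonneg _)] at h
  have e : ∑ i, u i ^ 2 - ∑ i, v i ^ 2 = ∑ i, (u i - v i) ^ 2 + 2 * ∑ i, (u i - v i) * v i := by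
    rw [mul_sum, ← sum_add_distrib, ← sum_sub_distrib]
    exact sum_congr rfl fun i _ => by ring
  have h0 : 0 ≤ ∑ i, (u i - v i) ^ 2 := sum_nonneg fun _ _ => sq_nonneg _
  grind

lemma mulVec_sub_dotProduct_self_le {n : ℕ} (P : Matrix (Fin n) (Fin n) ℝ)
    (x r z q : Fin n → ℝ) : nsq (P *ᵥ (x - (r + (z + q)))) ≤ 2 * nsq (P *ᵥ x) + 4 * nsq (P *ᵥ r)
        + 8 * nsq (P *ᵥ z) + 8 * nsq (P *ᵥ q) := by
  have a1 := add_dotProduct_self_le (P *ᵥ x) (-(P *ᵥ (r + (z + q))))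
  have a2 := add_dotProduct_self_le (P *ᵥ r) (P *ᵥ (z + q))
  have a3 := add_dotProduct_self_le (P *ᵥ z) (P *ᵥ q)
  rw [neg_dotProduct_neg, ← sub_eq_add_neg, ← mulVec_sub] at a1
  rw [← mulVec_add] at a2 a3
  linarith

namespace Experiment

variable {f : EZ d → Fin E.k → ℝ} {M h C₁ CR : ℝ} {s : E.Smp}

namespace Good

lemma stat_le (hg : E.Good K Z f M h s) (hE : E.Regular K Z) (hK : K.Valid d)
    (hb : E.SieveBasis f M) (hest : E.IsEstimated) (hh : E.Small K M h C₁) :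
    |E.stat s + (√n)⁻¹ * ∑ i, E.bb (s.1 i) * E.eps (s.1 i)| ≤ K.Cst C₁ * √h := by
  obtain ⟨w1, w2, w3, w4⟩ := hg.wts_le hE hK hb hest hh
  have h0 := hh.pos
  have hn := hh.scal.nR_pos
  have hs := hh.sqrt_pos
  have hsw := hh.sw_pos
  have hhs : h ≤ √h := Real.le_sqrt_of_sq_le (by nlinarith [hh.le_one])
  set A := E.wts (E.covs s)
  have aux : ∀ {x y : ℝ}, x ^ 2 ≤ n * y → |(√n)⁻¹ * x| ≤ √y := fun {x y} hx => by
    rw [abs_mul, abs_of_pos (inv_pos.2 hs), inv_mul_le_iff₀ hs, ← sqrt_mul hn.le]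
    exact abs_le_sqrt hx
  have hS : ∀ i, E.SHat s i = xx (s.1 i) ⬝ E.β0 + E.f0 (zz (s.1 i))
      + (E.zeta s.2 (s.1 i) + E.qErr s.2 (s.1 i)) := fun i => by rw [hg.SHat_eq]; ring
  have e : E.stat s + (√n)⁻¹ * ∑ i, E.bb (s.1 i) * E.eps (s.1 i)
      = √n * ((E.ξ + E.SigTil (E.covs s) *ᵥ E.wHat (E.covs s)) ⬝ (E.βHat s - E.β0))
        - (√n)⁻¹ * (A ⬝ fun i => E.rn (zz (s.1 i)))
        - (√n)⁻¹ * (∑ i, (A i - E.bb (s.1 i)) * E.eps (s.1 i))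
        - (√n)⁻¹ * (∑ i, A i * E.mErr s.2 (s.1 i))
        - (√n)⁻¹ * (A ⬝ fun i => E.qErr s.2 (s.1 i)) := by
    have e1 : (A ⬝ fun i => E.rn (zz (s.1 i)) + (E.zeta s.2 (s.1 i) + E.qErr s.2 (s.1 i)))
        = (A ⬝ fun i => E.rn (zz (s.1 i))) + ∑ i, (A i - E.bb (s.1 i)) * E.eps (s.1 i)
          + ∑ i, E.bb (s.1 i) * E.eps (s.1 i) + ∑ i, A i * E.mErr s.2 (s.1 i)
          + A ⬝ fun i => E.qErr s.2 (s.1 i) := by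
      simp only [dotProduct, ← sum_add_distrib, zeta]
      exact sum_congr rfl fun i _ => by ring
    have e2 : √n * (n : ℝ)⁻¹ = (√n)⁻¹ := by grind
    rw [stat, hb.THat_sub_eq (hg.cov.isUnit hK hh.scal.n_pos) hS, e1, mul_sub, ← mul_assoc, e2]
    ring
  have b1 : |√n * ((E.ξ + E.SigTil (E.covs s) *ᵥ E.wHat (E.covs s)) ⬝
      (E.βHat s - E.β0))| ≤ C₁ * K.Ct C₁ * √h := by
    rw [abs_mul, abs_of_pos hs, dotProduct_comm]
    calc _ ≤ √n * (E.lam' * ∑ j, |(E.βHat s - E.β0) j|) := by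
          gcongr; exact abs_dotProduct_le_of_forall_le w1
      _ ≤ √n * ((C₁ * E.rate) * ∑ j, |(E.βHat s - E.β0) j|) := by gcongr; exact hh.lam'_le
      _ = C₁ * (√(log E.p) * ∑ j, |(E.βHat s - E.β0) j|) := by rw [← hh.sqrt_mul_rate]; ring
      _ ≤ C₁ * (K.Ct C₁ * h) :=
          mul_le_mul_of_nonneg_left (hg.lasso_le hE hK hb hh).1 (hh.C₁_pos hK).le
      _ ≤ _ := by
          have hC := hh.C₁_pos hK
          have : 0 ≤ K.Ct C₁ := by
            have := hK.cSig; have := hK.Cl_pos; have := hK.ρ₀_pos; have := hK.one_le_A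
            unfold Consts.Ct; positivity
          rw [mul_assoc]; gcongr
  have b2 : |(√n)⁻¹ * (A ⬝ fun i => E.rn (zz (s.1 i)))| ≤ K.Cw * √h := by
    have hX : ∀ j, |∑ i, E.Xtil (E.covs s) i j * E.rn (zz (s.1 i))|
        ≤ √n * (h ^ 4 / E.sw) := fun j => by
      refine (abs_sum_le_sum_abs _ _).trans ((sum_le_sum fun i _ =>
        show _ ≤ h ^ 4 / E.sw / √n from ?_).trans_eq ?_)
      · rw [div_div, le_div_iff₀ (by positivity)]
        have := hg.rem (i, j)
        rwa [abs_mul, abs_of_nonneg (by positivity), mul_comm, mul_comm √n] at this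
      · simp only [sum_const, card_univ, Fintype.card_fin, nsmul_eq_mul]
        grind
    rw [abs_mul, abs_of_pos (inv_pos.2 hs), inv_mul_le_iff₀ hs,
      show A = _ from hb.wts_eq s, hb.residM_xx_dot]
    refine (abs_dotProduct_le_of_forall_le hX).trans ?_
    calc _ ≤ √n * (h ^ 4 / E.sw) * (K.Cw * (E.sw / h)) := by gcongr
      _ = √n * (K.Cw * (h ^ 2 * h)) := by field_simp
      _ ≤ √n * (K.Cw * (1 * √h)) := by
          have := hK.Cw_pos
          gcongr
          exact pow_le_one₀ h0.le hh.le_one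
      _ = _ := by ring
  have b3 := aux (hg.we w3)
  have b4 := aux (hg.wm w4)
  have b5 : |(√n)⁻¹ * (A ⬝ fun i => E.qErr s.2 (s.1 i))|
      ≤ √(2 * K.CA * K.Km ^ 2) * √h := by
    have hCA := hK.CA_pos
    rw [← sqrt_mul (by positivity)]
    refine aux ((sq_dotProduct_le _ _).trans ?_)
    simp only [dotProduct, ← sq]
    have h4 : h ^ 4 ≤ h := pow_le_of_le_one h0.le hh.le_one (by norm_num)
    calc _ ≤ n * K.CA * (2 * K.Km ^ 2 * h ^ 4) := by gcongr; exact hg.q_le hh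
      _ ≤ n * K.CA * (2 * K.Km ^ 2 * h) := by gcongr
      _ = _ := by ring
  rw [e]
  calc _ ≤ _ := (abs_sub _ _).trans (add_le_add ((abs_sub _ _).trans (add_le_add
        ((abs_sub _ _).trans (add_le_add ((abs_sub _ _).trans (add_le_add b1 b2)) b3)) b4)) b5)
    _ = _ := by unfold Consts.Cst; ring

lemma sieve_le (hg : E.Good K Z f M h s) (hE : E.Regular K Z) (hK : K.Valid d)
    (hb : E.SieveBasis f M) (hh : E.Small K M h C₁)
    (hR : 2 * E.lam ^ 2 * E.s0 / E.LamBar2 ≤ CR * E.R ^ 2) (hlc : |E.lk * E.ck| ≤ 1)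
    {t : Fin E.k → ℝ} (ht : E.resid s = (fun i => E.rn (zz (s.1 i)) + (E.zeta s.2 (s.1 i)
      + E.qErr s.2 (s.1 i))) - Xm s *ᵥ (E.βHat s - E.β0) + Zm f s.1 *ᵥ t) (i : Fin n) :
    |f (zz (s.1 i)) ⬝ t| ≤ √(K.Kφ CR) * h := by
  have h0 := hh.pos
  have hn := hh.scal.nR_pos
  have hM := hh.scal.one_le_Ξ
  have hX := (hg.lasso_le hE hK hb hh).2
  obtain ⟨nz, nq⟩ := hg.noise_le hK hh
  set ρ := K.ρ₀ * E.k / (n * h) with hρ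
  set P := projM (Zm f s.1)
  have hlc2 := (sq_le_one_iff_abs_le_one _).2 hlc
  have hcS := hK.cSig
  have hkn : 0 ≤ (E.k : ℝ) / n := by positivity
  have hs0 : 2 * E.lam ^ 2 * E.s0 ≤ |CR| / K.cSig * (2 * (E.k / n)) := by
    rcases Nat.eq_zero_or_pos E.s0 with hz | hp
    · rw [hz, Nat.cast_zero, mul_zero]; positivity
    · have hL0 := hK.Cx.trans (hE.restricted_eig hp)
      have hR2 : E.R ^ 2 ≤ 2 * (E.k / n) := by
        rw [hE.R_eq]
        have h1 := min_le_left (E.lk ^ 2 * E.ck ^ 2 * E.k / n) (E.ξ0 ^ 2 * E.ck ^ 2 / n)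
        have h2 : E.lk ^ 2 * E.ck ^ 2 * E.k / n = (E.lk * E.ck) ^ 2 * (E.k / n) := by ring
        linarith [mul_le_mul_of_nonneg_right hlc2 hkn]
      rw [div_le_iff₀ hL0] at hR
      calc _ ≤ _ := hR
        _ ≤ |CR| * (2 * (E.k / n)) * (1 / K.cSig) := by
            gcongr
            · exact le_abs_self CR
            · exact hE.LamBar2_le hK hp
        _ = _ := by ring
  have hr : (n : ℝ)⁻¹ * nsq (P *ᵥ fun l => E.rn (zz (s.1 l)))
      ≤ 4 * (E.k / (n * h)) := by
    have e : (fun l => E.rn (zz (s.1 l))) = fun l => E.rnI Z (zz (s.1 l)) := funext fun l =>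
      (Set.indicator_of_mem (hg.mem l) _).symm
    rw [inv_mul_le_iff₀ hn, e]
    refine (hg.cov.projM_le hK hh.scal.n_pos _).trans ?_
    calc _ ≤ 2 / n * (n * (E.k * (1 + 1)) / h) := by
          gcongr; exact hg.rv.trans (by gcongr)
      _ = _ := by field_simp; ring
  have hP : Zm f s.1 *ᵥ t = P *ᵥ (Xm s *ᵥ (E.βHat s - E.β0)
      - ((fun l => E.rn (zz (s.1 l))) + ((fun l => E.zeta s.2 (s.1 l))
        + fun l => E.qErr s.2 (s.1 l)))) := by
    have h1 := hb.projM_resid hh.scal.n_pos (hg.lasso.2 _ hg.lasso.1)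
    rw [ht, mulVec_add, mulVec_mulVec, projM_mul _ (hg.cov.isUnit hK hh.scal.n_pos)] at h1
    rw [eq_neg_of_add_eq_zero_right h1, ← mulVec_neg]
    congr 1
    funext l
    simp
  have hΦ : (n : ℝ)⁻¹ * nsq (Zm f s.1 *ᵥ t) ≤
      2 * (K.CX * (2 * E.lam ^ 2 * E.s0 + 2 * K.Cl * ρ)) + 16 * (E.k / (n * h)) + 16 * ρ := by
    rw [hP]
    have a1 := mulVec_sub_dotProduct_self_le P (Xm s *ᵥ (E.βHat s - E.β0))
      (fun l => E.rn (zz (s.1 l))) (fun l => E.zeta s.2 (s.1 l)) fun l => E.qErr s.2 (s.1 l)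
    have a4 := projM_dot_self_le (Zm f s.1) (Xm s *ᵥ (E.βHat s - E.β0))
    have a5 := projM_dot_self_le (Zm f s.1) fun l => E.qErr s.2 (s.1 l)
    have a6 : (n : ℝ)⁻¹ * nsq (Xm s *ᵥ (E.βHat s - E.β0))
        ≤ K.CX * (2 * E.lam ^ 2 * E.s0 + 2 * K.Cl * ρ) := by
      simpa only [Xm_mulVec, dotProduct, ← sq] using hX
    rw [inv_mul_le_iff₀ hn] at nz nq hr a6 ⊢
    linarith
  rw [← sqrt_sq h0.le, ← sqrt_mul (by
    have := hK.CX_pos; have := hK.Cl_pos; have := hK.ρ₀_pos; have := hK.one_le_A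
    unfold Consts.Kφ; positivity)]
  refine abs_le_sqrt ((sq_dotProduct_le _ _).trans ?_)
  have hg1 : nsq t ≤ 2 * ((n : ℝ)⁻¹ * nsq (Zm f s.1 *ᵥ t)) := by
    have := hg.cov.gram_ge hK hh.scal.n_pos t
    rw [← div_eq_inv_mul, ← mul_div_assoc, le_div_iff₀ hn]
    linarith
  have hΞk : M * (E.k / (n * h)) ≤ K.A * h ^ 2 := by
    rw [← mul_div_assoc, div_le_iff₀ (by positivity)]
    have : h ^ 4 ≤ h ^ 3 := pow_le_pow_of_le_one h0.le hh.le_one (by norm_num)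
    have hA := hK.one_le_A
    calc M * E.k ≤ K.A * h ^ 4 * n := by rw [mul_comm]; exact hh.kΞ_le
      _ ≤ K.A * h ^ 3 * n := by gcongr
      _ = _ := by ring
  have hk1 : E.k / (n : ℝ) ≤ E.k / (n * h) := by
    gcongr; exact mul_le_of_le_one_right hn.le hh.le_one
  have hρ' : ρ = K.ρ₀ * (E.k / (n * h)) := mul_div_assoc _ _ _
  have hCX := hK.CX_pos
  have hCl := hK.Cl_pos
  have hρ₀ := hK.ρ₀_pos
  calc _ ≤ M * (2 * (2 * (K.CX * (|CR| / K.cSig * (2 * (E.k / (n * h))) + 2 * K.Cl * ρ))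
        + 16 * (E.k / (n * h)) + 16 * ρ)) := by
        gcongr
        · exact nsq_nonneg t
        · exact hg.bound i
        · have hs1 := hs0.trans (mul_le_mul_of_nonneg_left (mul_le_mul_of_nonneg_left hk1
            two_pos.le) (by positivity))
          exact hg1.trans (mul_le_mul_of_nonneg_left (hΦ.trans (by gcongr)) two_pos.le)
    _ = 2 * (2 * K.CX * (2 * (|CR| / K.cSig) + 2 * K.Cl * K.ρ₀) + 16 + 16 * K.ρ₀)
        * (M * (E.k / (n * h))) := by rw [hρ']; ring
    _ ≤ 2 * (2 * K.CX * (2 * (|CR| / K.cSig) + 2 * K.Cl * K.ρ₀) + 16 + 16 * K.ρ₀)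
        * (K.A * h ^ 2) := by gcongr
    _ = _ := by unfold Consts.Kφ; ring

lemma resid_sub_le (hg : E.Good K Z f M h s) (hE : E.Regular K Z) (hK : K.Valid d)
    (hb : E.SieveBasis f M) (hh : E.Small K M h C₁)
    (hR : 2 * E.lam ^ 2 * E.s0 / E.LamBar2 ≤ CR * E.R ^ 2) (hlc : |E.lk * E.ck| ≤ h)
    (i : Fin n) : |E.resid s i - E.eps (s.1 i)| ≤ K.Ke C₁ CR * h * (1 + |E.eps (s.1 i)|) := by
  have h0 := hh.pos
  obtain ⟨t, ht⟩ := hb.exists_resid_eq (r := s)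
    (v := fun i => E.zeta s.2 (s.1 i) + E.qErr s.2 (s.1 i)) fun i => by rw [hg.SHat_eq]; ring
  have b1 := hg.sieve_le hE hK hb hh hR (hlc.trans hh.le_one) ht i
  have b2 := (hE.abs_rn_le (hg.mem i)).trans ((le_abs_self _).trans hlc)
  have b3 : |(E.βHat s - E.β0) ⬝ xx (s.1 i)| ≤ √(4 / K.cX) * (K.Ct C₁ * h) := by
    have hx : ∀ j, |xx (s.1 i) j| ≤ √(4 / K.cX) * √(log E.p) := fun j => by
      rw [← sqrt_mul (by have := hK.cX_pos; positivity)]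
      refine abs_le_sqrt ((hg.cov.fam.max (.inl (.inl j)) i).trans_eq ?_)
      ring
    refine (abs_dotProduct_le_of_forall_le hx).trans ?_
    rw [mul_assoc]
    exact mul_le_mul_of_nonneg_left (hg.lasso_le hE hK hb hh).1 (sqrt_nonneg _)
  have b4 := (hg.err i).abs_m
  have b5 := (hg.err i).abs_q.trans
    (mul_le_mul_of_nonneg_left (pow_le_of_le_one h0.le hh.le_one two_ne_zero)
      (by linarith [hK.one_le_Km]))
  have e : E.resid s i - E.eps (s.1 i) = E.rn (zz (s.1 i)) + E.mErr s.2 (s.1 i)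
      + E.qErr s.2 (s.1 i) + f (zz (s.1 i)) ⬝ t - (E.βHat s - E.β0) ⬝ xx (s.1 i) := by
    have := congrFun ht i
    have e : (Zm f s.1 *ᵥ t) i = f (zz (s.1 i)) ⬝ t := rfl
    simp only [Pi.add_apply, Pi.sub_apply, e, Xm_mulVec, zeta] at this
    linarith
  rw [e]
  refine ((abs_sub _ _).trans (add_le_add ((abs_add_le _ _).trans (add_le_add ((abs_add_le _ _).trans
    (add_le_add ((abs_add_le _ _).trans (add_le_add b2 b4)) b5)) b1)) b3)).trans ?_
  have : 0 ≤ (h + √(4 / K.cX) * (K.Ct C₁ * h) + √(K.Kφ CR) * h + K.Km * h)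
      * |E.eps (s.1 i)| := by
    have := (abs_nonneg _).trans b3; have := (abs_nonneg _).trans b5; positivity
  unfold Consts.Ke
  linarith

lemma VHat_sub_le (hg : E.Good K Z f M h s) (hE : E.Regular K Z) (hK : K.Valid d)
    (hb : E.SieveBasis f M) (hest : E.IsEstimated) (hh : E.Small K M h C₁)
    (hR : 2 * E.lam ^ 2 * E.s0 / E.LamBar2 ≤ CR * E.R ^ 2) (hlc : |E.lk * E.ck| ≤ h) :
    |E.VHat s - E.avar| ≤ K.Kv C₁ CR * √h := by
  obtain ⟨-, -, w3, w4⟩ := hg.wts_le hE hK hb hest hh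
  have h0 := hh.pos
  have h1 := hh.le_one
  have hn := hh.scal.nR_pos
  set A := E.wts (E.covs s)
  set D := ∑ i, (E.resid s i * A i - E.bb (s.1 i) * E.eps (s.1 i)) ^ 2
  set S := ∑ i, (E.bb (s.1 i) * E.eps (s.1 i)) ^ 2
  have w5 : ∑ i, (A i - E.bb (s.1 i)) ^ 2 * E.eps (s.1 i) ^ 2 ≤ n * h := hg.wv w3
  set cv := K.COm * K.wMax ^ 2
  have hav := hg.av
  have hcv : 0 ≤ cv := by have := hK.COm; positivity
  have hS : S ≤ n * (cv + h) := by
    rw [← inv_mul_le_iff₀ hn]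
    linarith [(abs_le.1 hav).2, hE.avar_le hK]
  have hCA := hK.CA_pos
  have hD : D ≤ n * (K.Kd C₁ CR * h) := by
    have e : ∀ i, (E.resid s i * A i - E.bb (s.1 i) * E.eps (s.1 i)) ^ 2
        ≤ 2 * (K.Ke C₁ CR * h) ^ 2 * (2 * A i ^ 2
          + 4 * ((A i - E.bb (s.1 i)) ^ 2 * E.eps (s.1 i) ^ 2)
          + 4 * (E.bb (s.1 i) * E.eps (s.1 i)) ^ 2)
          + 2 * ((A i - E.bb (s.1 i)) ^ 2 * E.eps (s.1 i) ^ 2) := fun i => by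
      have hr := hg.resid_sub_le hE hK hb hh hR hlc i
      have hr2 := sq_le_sq' (neg_le_of_abs_le hr) (le_of_abs_le hr)
      set a := A i
      set b := E.bb (s.1 i)
      set x := E.eps (s.1 i)
      have f1 : (E.resid s i * a - b * x) ^ 2
          ≤ 2 * ((E.resid s i - x) ^ 2 * a ^ 2) + 2 * ((a - b) ^ 2 * x ^ 2) := by
        nlinarith [sq_nonneg ((E.resid s i - x) * a - (a - b) * x)]
      have f2 : (1 + |x|) ^ 2 * a ^ 2 ≤ 2 * a ^ 2 + 4 * ((a - b) ^ 2 * x ^ 2)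
          + 4 * (b * x) ^ 2 := by
        have g1 : (1 + |x|) ^ 2 ≤ 2 + 2 * x ^ 2 := by nlinarith [sq_nonneg (1 - |x|), sq_abs x]
        nlinarith [mul_le_mul_of_nonneg_right g1 (sq_nonneg a),
          mul_nonneg (sq_nonneg (a - 2 * b)) (sq_nonneg x)]
      have f3 := mul_le_mul_of_nonneg_right hr2 (sq_nonneg a)
      have f4 := mul_le_mul_of_nonneg_left f2 (sq_nonneg (K.Ke C₁ CR * h))
      nlinarith
    refine (sum_le_sum fun i _ => e i).trans ?_
    simp only [sum_add_distrib, ← mul_sum]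
    calc _ ≤ 2 * (K.Ke C₁ CR * h) ^ 2 * (2 * (n * K.CA) + 4 * (n * h) + 4 * (n * (cv + h)))
          + 2 * (n * h) := by gcongr
      _ ≤ 2 * (K.Ke C₁ CR ^ 2 * h) * (2 * (n * K.CA) + 4 * (n * 1) + 4 * (n * (cv + 1)))
          + 2 * (n * h) := by
        rw [mul_pow]
        gcongr
        exact pow_le_of_le_one h0.le h1 two_ne_zero
      _ = _ := by unfold Consts.Kd; ring
  have hKd : 0 ≤ K.Kd C₁ CR := by unfold Consts.Kd; positivity
  have hhs : h ≤ √h := Real.le_sqrt_of_sq_le (by nlinarith)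
  have hm := abs_sum_sq_sub_le (fun i => E.resid s i * A i) fun i => E.bb (s.1 i) * E.eps (s.1 i)
  have hsq : √(D * S) ≤ n * (√(K.Kd C₁ CR * (cv + 1)) * √h) := by
    rw [← sqrt_mul (by positivity)]
    refine Real.sqrt_le_iff.2 ⟨by positivity, ?_⟩
    rw [mul_pow, sq_sqrt (by positivity)]
    calc D * S ≤ n * (K.Kd C₁ CR * h) * (n * (cv + 1)) := by
          gcongr; exact hS.trans (by gcongr)
      _ = _ := by ring
  have hmn : |E.VHat s - (n : ℝ)⁻¹ * S| ≤ K.Kd C₁ CR * h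
      + 2 * (√(K.Kd C₁ CR * (cv + 1)) * √h) := by
    rw [VHat_eq, ← mul_sub, abs_mul, abs_of_pos (inv_pos.2 hn), inv_mul_le_iff₀ hn]
    exact hm.trans (by linarith)
  calc _ ≤ _ := abs_sub_le _ ((n : ℝ)⁻¹ * S) _
    _ ≤ K.Kd C₁ CR * h + 2 * (√(K.Kd C₁ CR * (cv + 1)) * √h) + h := add_le_add hmn hav
    _ ≤ K.Kd C₁ CR * √h + 2 * (√(K.Kd C₁ CR * (cv + 1)) * √h) + √h := by gcongr
    _ = _ := by unfold Consts.Kv; ring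

end Good

end Experiment

lemma measure_ge_le_of_integral {α : Type*} [MeasurableSpace α] {μ : Measure α} {f : α → ℝ}
    (h0 : ∀ a, 0 ≤ f a) (hf : Measurable f) (hi : Integrable f μ) {M h : ℝ} (hM : 0 < M)
    (hh : 0 < h) (hfM : ∫ a, f a ∂μ ≤ M) : μ {a | M / h ≤ f a} ≤ ofReal h := by
  refine (meas_ge_le_of_lintegral hf (C := M) (by positivity) ?_).trans_eq ?_
  · rw [← ofReal_integral_eq_lintegral_ofReal hi (.of_forall h0)]
    exact ofReal_le_ofReal hfM
  · congr 1
    field_simp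

namespace Experiment

variable {q : EZ d → Fin E.k → ℝ} {Q h C₁ : ℝ} {y : E.Aux}

lemma μ_fst (E : Experiment d n) (S : Set (Fin n → Rec E.p d)) :
    E.μ {s | s.1 ∈ S} = iid E.P n S := by
  have : {s : E.Smp | s.1 ∈ S} = S ×ˢ Set.univ := by ext; simp
  rw [this, μ, Measure.prod_prod, measure_univ, mul_one]

lemma μ_snd (E : Experiment d n) (S : Set E.Aux) : E.μ {s | s.2 ∈ S} = E.ν S := by
  have : {s : E.Smp | s.2 ∈ S} = Set.univ ×ˢ S := by ext; simp
  rw [this, μ, Measure.prod_prod, measure_univ, one_mul]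

lemma μ_le_of_section {B : Set E.Smp} (hB : MeasurableSet B) {G : Set E.Aux} {a : ℝ≥0∞}
    (h : ∀ y ∈ G, iid E.P n {x | (x, y) ∈ B} ≤ a) : E.μ B ≤ a + E.ν Gᶜ := by
  rw [μ, Measure.prod_apply_symm hB, ← measure_toMeasurable Gᶜ,
    ← lintegral_indicator_one (measurableSet_toMeasurable _ _)]
  calc _ ≤ ∫⁻ y, a + (toMeasurable E.ν Gᶜ).indicator 1 y ∂E.ν := lintegral_mono fun y => by
        by_cases hy : y ∈ G
        · exact (h y hy).trans le_self_add
        · rw [Set.indicator_of_mem (subset_toMeasurable _ _ hy)]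
          exact prob_le_one.trans le_add_self
    _ = _ := by simp

def _root_.DiD.Consts.Kp (K : Consts) : ℝ := K.A / K.τ ^ 2 + 66 + K.vε * (1 + 4 / K.cX ^ 2)
  + 2 * K.Km ^ 2 * (1 + K.vε) * K.CA

lemma _root_.DiD.Consts.Valid.Kp_ge (hK : K.Valid d) : K.A / K.τ ^ 2 + 66 ≤ K.Kp ∧
    K.vε * (1 + 4 / K.cX ^ 2) ≤ K.Kp ∧ 2 * K.Km ^ 2 * (1 + K.vε) * K.CA ≤ K.Kp ∧ 66 ≤ K.Kp := by
  have := hK.one_le_A; have := hK.vε_pos; have := hK.CA_pos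
  have h1 : 0 ≤ K.A / K.τ ^ 2 := by positivity
  have h2 : 0 ≤ K.vε * (1 + 4 / K.cX ^ 2) := by positivity
  have h3 : 0 ≤ 2 * K.Km ^ 2 * (1 + K.vε) * K.CA := by positivity
  unfold Consts.Kp
  grind

lemma bb_eq (E : Experiment d n) (o : Rec E.p d) :
    E.bb o = E.w0 ⬝ ((cov o).1 - E.piZ (cov o).2) := by rw [bb, Xbar_eq_cov]

lemma Regular.memLp_bb_eps_sq (hE : E.Regular K Z) (hK : K.Valid d) :
    MemLp (fun o => (E.bb o * E.eps o) ^ 2) 2 E.P ∧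
      ∫ o, ((E.bb o * E.eps o) ^ 2) ^ 2 ∂E.P ≤ K.vε * (4 / K.cX ^ 2) := by
  have h := (hE.sg_bb hK).mul_sq (hE.sg_bb hK) hK.cX_pos
  have e : ∀ o, E.bb o ^ 2 * E.bb o ^ 2 = (E.w0 ⬝ ((cov o).1 - E.piZ (cov o).2)) ^ 4 :=
    fun o => by rw [bb_eq]; ring
  simp only [e] at h
  have hm : Measurable fun w : Cov E.p d => (E.w0 ⬝ (w.1 - E.piZ w.2)) ^ 4 :=
    (measurable_dotProduct measurable_const (measurable_fst.sub
      (E.measurable_piZ.comp measurable_snd))).pow_const 4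
  have h2 := (hE.condSqLE_eps_sq hK).integrable_mul (E.measurable_eps.pow_const 2) measurable_cov
    hm (fun _ => by positivity) h.1 hK.vε_pos.le
  have e2 : ∀ o, ((E.bb o * E.eps o) ^ 2) ^ 2
      = (E.w0 ⬝ ((cov o).1 - E.piZ (cov o).2)) ^ 4 * (E.eps o ^ 2) ^ 2 :=
    fun o => by rw [bb_eq]; ring
  simp only [← e2] at h2
  exact ⟨(memLp_two_iff_integrable_sq ((E.measurable_bb.mul
    E.measurable_eps).pow_const 2).aestronglyMeasurable).2 h2.1,
    h2.2.trans (mul_le_mul_of_nonneg_left h.2 hK.vε_pos.le)⟩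

lemma SieveBasis.iid_rv_le (hb : E.SieveBasis q Q) (hE : E.Regular K Z) (hZ : IsCompact Z)
    (hh : 0 < h) (hn : 0 < n) : iid E.P n {s | n * (E.k * ((E.lk * E.ck) ^ 2 + 1)) / h
      ≤ ∑ a, (∑ i, q (zz (s i)) a * E.rnI Z (zz (s i))) ^ 2} ≤ ofReal h := by
  have hrm : Measurable fun o : Rec E.p d => E.rnI Z (zz o) :=
    (hE.measurable_rnI hZ).comp measurable_zz
  have hr := hE.memLp_rnI hZ
  have h0 : ∀ a, ∫ o, q (zz o) a * E.rnI Z (zz o) ∂E.P = 0 := fun a => by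
    rw [← hb.ortho_rn a]
    exact integral_congr_ae (hE.rnI_ae.mono fun o ho => by simp only [ho])
  obtain ⟨hi, hI⟩ := hb.ortho.integral_sq_sum_le (n := n) hrm hr h0
  have hk := hE.k_pos
  refine measure_ge_le_of_integral (fun _ => sum_nonneg fun _ _ => sq_nonneg _)
    (measurable_sum _ fun a _ => (measurable_sum _ fun i _ => ?_).pow_const 2) hi
    (by positivity) hh ?_
  · exact (((measurable_pi_apply a).comp hb.meas).comp (measurable_zz.comp
      (measurable_pi_apply i))).mul (hrm.comp (measurable_pi_apply i))
  · rw [hI]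
    have hq : Integrable (fun o => q (zz o) ⬝ q (zz o)) E.P := by
      simp only [dotProduct, ← sq]
      exact integrable_finsetSum _ fun a _ => (hb.ortho.memLp a).integrable_sq
    have hφ1 : ∫ o, q (zz o) ⬝ q (zz o) ∂E.P = E.k := by
      simp only [dotProduct]
      rw [integral_finsetSum _ fun a _ => by simpa only [← sq] using (hb.ortho.memLp a).integrable_sq]
      simp [hb.ortho.ortho]
    rw [← hφ1, ← integral_mul_const]
    refine mul_le_mul_of_nonneg_left (integral_mono_of_nonneg (.of_forall fun o =>
      mul_nonneg (nsq_nonneg _) (sq_nonneg _)) (hq.mul_const _) ?_) (Nat.cast_nonneg n)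
    filter_upwards [hE.zz_mem] with o ho
    refine mul_le_mul_of_nonneg_left ?_ (nsq_nonneg _)
    have := hE.abs_rn_le ho
    rw [rnI, Set.indicator_of_mem ho]
    nlinarith [sq_le_sq' (neg_le_of_abs_le this) (le_of_abs_le this)]

lemma Regular.iid_pi_le (hE : E.Regular K Z) (hK : K.Valid d) (hb : E.SieveBasis q Q)
    (hh : E.Small K Q h C₁) :
    iid E.P n {s | (n * ((∑ j, |E.w0 j|) ^ 2 * (K.Cproj * E.rate))
      + (E.k * log n + 2) / K.cX) / h ≤ nsq (residM (Zm q s) (fun l => E.w0 ⬝ E.XPi (s l)))} ≤ ofReal h := by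
  have h2 : MemLp (fun o => E.w0 ⬝ E.XPi o) 2 E.P := memLp_dotProduct hE.memLp_XPi _
  have hm : Measurable fun o : Rec E.p d => E.w0 ⬝ E.XPi o :=
    measurable_dotProduct measurable_const E.measurable_XPi
  have hR : Measurable fun s : Fin n → Rec E.p d => residM (Zm q s) (fun l => E.w0 ⬝ E.XPi (s l)) :=
    measurable_pi_lambda _ (measurable_residM measurable_zz hb.meas hm)
  have hi := integrable_residM_dot (n := n) measurable_zz hb.meas hm h2 hm h2
  have hI := hE.integral_iid_residM_XPi hK hb hh.scal.n_pos (hE.w0_sq_le hK)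
  have hcX := hK.cX_pos; have := hK.Cproj; have := hh.rate_pos; have := hh.scal.log_n
  exact measure_ge_le_of_integral (fun _ => nsq_nonneg _)
    (measurable_dotProduct hR hR) hi (by positivity) hh.pos hI

lemma Regular.iid_not_goodFst_le (hE : E.Regular K Z) (hK : K.Valid d) (hZ : IsCompact Z)
    (hb : E.SieveBasis q Q) (hh : E.Small K Q h C₁) (hQ : 256 * (E.k * Q) ≤ n) :
    iid E.P n {s | ¬ E.GoodFst K Z q h s} ≤ ofReal (2 * K.vε * (n : ℝ) ^ (1 - min (K.rε / 4) 2))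
        + 6 * ofReal (K.Kp * h) := by
  have h0 := hh.pos
  have hn := hh.scal.nR_pos
  have hv := hK.vε_pos
  obtain ⟨k1, k2, k3, k4⟩ := hK.Kp_ge
  have h4 : h ^ 4 ≤ h := pow_le_of_le_one h0.le hh.le_one (by norm_num)
  have hn4 := hh.one_le_n
  have toK : ∀ {x c : ℝ}, c ≤ K.Kp → x ≤ c * h → ofReal x ≤ ofReal (K.Kp * h) :=
    fun hc hx => ofReal_le_ofReal (hx.trans (by gcongr))
  have b1 := (hE.measure_not_covGood hK hb hh.scal hQ).trans (toK k1 (by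
    have hτ := hK.τ_pos
    have e1 : E.k * Q / (n * K.τ ^ 2) ≤ K.A / K.τ ^ 2 * h := by
      rw [div_le_iff₀ (by positivity)]
      calc E.k * Q ≤ K.A * h ^ 4 * n := hh.kΞ_le
        _ ≤ K.A * h * n := by have := hK.one_le_A; gcongr
        _ = _ := by field_simp
    have e2 : 66 / (n : ℝ) ≤ 66 * h := by rw [div_le_iff₀ hn]; nlinarith
    linarith))
  have b2 := hE.iid_eps_four hK hh.scal.n_pos
  have b3 := (hE.iid_pi_le hK hb hh).trans (toK k4 (by linarith))
  have ha : ∀ i : Fin n, Measurable fun t : Fin n → Cov E.p d =>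
      E.wts t i - E.w0 ⬝ ((t i).1 - E.piZ (t i).2) := fun i => (E.measurable_wts i).sub
    (measurable_dotProduct measurable_const ((measurable_fst.comp (measurable_pi_apply i)).sub
      (E.measurable_piZ.comp (measurable_snd.comp (measurable_pi_apply i)))))
  have hk : K.vε * (n * h ^ 2) / (n * h) ≤ K.vε * (1 + 4 / K.cX ^ 2) * h := by
    rw [div_le_iff₀ (by positivity)]
    have : 0 ≤ K.vε * (4 / K.cX ^ 2) * h * (n * h) := by positivity
    nlinarith
  have b4 := ((hE.condZero_eps hK).iid_weighted_le measurable_cov E.measurable_eps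
    (hE.memLp_eps hK) hv.le (by positivity : 0 ≤ n * h ^ 2) (by positivity : 0 < n * h)
    (hE.condSqLE_eps hK) ha).trans (toK k2 hk)
  have b5 := ((hE.condSqLE_eps hK).iid_weighted_le measurable_cov E.measurable_eps hv.le
    (by positivity : 0 ≤ n * h ^ 2) (by positivity : 0 < n * h) ha).trans (toK k2 hk)
  have b6 := (hb.iid_rv_le hE hZ h0 hh.scal.n_pos).trans (toK k4 (by linarith))
  obtain ⟨m1, m2⟩ := hE.memLp_bb_eps_sq hK
  have b7 := (iid_abs_avg_sub_gt_le m1 h0 m2 hh.scal.n_pos).trans (toK k2 (by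
    rw [div_le_iff₀ (by positivity)]
    have e : 1 ≤ h * (n * h ^ 2) := by
      nlinarith [mul_le_mul_of_nonneg_right (pow_le_pow_of_le_one h0.le hh.le_one
        (by norm_num : 3 ≤ 4)) hn.le]
    have : 0 ≤ K.vε * (4 / K.cX ^ 2) := by positivity
    nlinarith [mul_le_mul_of_nonneg_left e this, mul_le_mul_of_nonneg_left e hv.le]))
  refine (measure_mono fun s hs => ?_).trans ((measure_union_le _ _).trans (add_le_add b2
    ((measure_union_le _ _).trans ((add_le_add b1 ((measure_union_le _ _).trans (add_le_add b3
      ((measure_union_le _ _).trans (add_le_add b4 ((measure_union_le _ _).trans (add_le_add b5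
        ((measure_union_le _ _).trans (add_le_add b6 b7))))))))).trans_eq (by ring)))))
  by_contra hc
  simp only [Set.mem_union, not_or, Set.mem_ofPred_eq, not_and, not_le, not_not, ← bb_eq,
    ← hE.avar_eq hK] at hc
  obtain ⟨c2, c1, c3, c4, c5, c6, c7⟩ := hc
  exact hs ⟨c1, c2.le, c3.le, fun a => (c4 a).le, fun a => (c5 a).le, c6.le, c7.le⟩

variable {f : EZ d → Fin E.k → ℝ} {M h C₁ : ℝ} {y : E.Aux}

/-- The samples whose errors, perturbed by the first stage, misbehave. -/
def BadSnd (E : Experiment d n) (K : Consts) (f : EZ d → Fin E.k → ℝ) (h : ℝ) : Set E.Smp :=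
  {r | (∀ j, ∑ i, xx (r.1 i) j ^ 4 ≤ n * (32 / K.cX ^ 2)) ∧
      ∑ i, E.eps (r.1 i) ^ 4 ≤ n * K.C₄ ∧ ∃ j, 8 * (n * K.Lz) * (2 * log E.p)
        ≤ (∑ i, xx (r.1 i) j * E.zeta r.2 (r.1 i)) ^ 2} ∪
    ({r | 8 * (1 + K.vε) * E.k / h ≤ nsq (projM (Zm f r.1) *ᵥ fun l => E.zeta r.2 (r.1 l))} ∪
      {r | ∑ i, E.wts (fun l => cov (r.1 l)) i ^ 2 ≤ n * K.CA ∧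
        n * h ≤ (∑ i, E.wts (fun l => cov (r.1 l)) i * E.mErr r.2 (r.1 i)) ^ 2})

lemma SieveBasis.measurableSet_badSnd (hb : E.SieveBasis f M) (K : Consts) (h : ℝ) :
    MeasurableSet (E.BadSnd K f h) := by
  have h0 : ∀ i, Measurable fun r : E.Smp => r.1 i := fun i =>
    (measurable_pi_apply i).comp measurable_fst
  have he := fun i => E.measurable_eps.comp (h0 i)
  have hm := fun i => E.measurable_mErr.comp (measurable_snd.prodMk (h0 i))
  have hz : ∀ i, Measurable fun r : E.Smp => E.zeta r.2 (r.1 i) := fun i => (he i).add (hm i)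
  have hx := fun i j => (measurable_xx_apply j).comp (h0 i)
  have hw := fun i => (E.measurable_wts i).comp E.measurable_covs
  have hs := (measurable_pi_lambda _ fun l => measurable_zz.comp (h0 l)).prodMk (measurable_pi_lambda _ hz)
  have hp := fun i l => (measurable_projM_rowsM hb.meas i l).comp (measurable_fst.comp hs)
  have hP : Measurable fun r : E.Smp => projM (Zm f r.1) *ᵥ fun l => E.zeta r.2 (r.1 l) :=
    measurable_pi_lambda _ fun i => by
      simp only [mulVec, dotProduct]
      fun_prop
  have hP' := measurable_dotProduct hP hP
  refine MeasurableSet.union ?_ (MeasurableSet.union (measurableSet_le measurable_const hP') ?_)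
  · simp only [Set.ofPred_and, Set.ofPred_forall, Set.ofPred_exists]
    exact (MeasurableSet.iInter fun j => measurableSet_le (by fun_prop) measurable_const).inter
      ((measurableSet_le (by fun_prop) measurable_const).inter
        (MeasurableSet.iUnion fun j => measurableSet_le measurable_const (by fun_prop)))
  · rw [Set.ofPred_and]
    exact (measurableSet_le (by fun_prop) measurable_const).inter
      (measurableSet_le measurable_const (by fun_prop))

lemma AuxGood.iid_badSnd_le (hy : E.AuxGood h y) (hE : E.Regular K Z) (hK : K.Valid d)
    (hb : E.SieveBasis f M) (hh : E.Small K M h C₁) (hδ : h ≤ K.cπ / 2) (hδ1 : K.Km * h ≤ 1) :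
    iid E.P n {x | (x, y) ∈ E.BadSnd K f h} ≤ 3 * ofReal (K.Kp * h) := by
  have h0 := hh.pos
  have hn := hh.scal.nR_pos
  have hk := hh.scal.one_le_k
  have hv := hK.vε_pos
  have hCA := hK.CA_pos
  obtain ⟨-, -, k3, k4⟩ := hK.Kp_ge
  have hn4 := hh.one_le_n
  have h4 : h ^ 4 ≤ h := pow_le_of_le_one h0.le hh.le_one (by norm_num)
  have toK : ∀ {x c : ℝ}, c ≤ K.Kp → x ≤ c * h → ofReal x ≤ ofReal (K.Kp * h) :=
    fun hc hx => ofReal_le_ofReal (hx.trans (by gcongr))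
  have z0 := hy.condZero_zeta hE hK hδ
  have z1 := hy.abs_zeta_le hE hK hδ hδ1
  have z2 := hE.memLp_of_le hK (E.measurable_zeta y) z1
  have z3 := hE.condSqLE_of_le hK z1
  have b1 := (hE.iid_xx_mul hK hh.scal.n_pos (E.measurable_zeta y) z0 z1).trans (toK k4 (by
    rw [div_le_iff₀ hn]; nlinarith))
  have hP := measurable_pi_lambda _ (measurable_projM_mulVec (n := n) measurable_zz hb.meas
    (E.measurable_zeta y))
  have z4 : CondZero E.P (zz : Rec E.p d → EZ d) (E.zeta y) :=
    fun g hg => z0 (fun w => g w.2) (hg.comp measurable_snd)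
  have hI := z4.integral_projM_le_of_condSqLE (n := n) measurable_zz hb.meas
    (E.measurable_zeta y) z2 (by positivity)
    (fun g hg => z3 (fun w => g w.2) (hg.comp measurable_snd))
  have hi : Integrable (fun r : Fin n → Rec E.p d => nsq (projM (Zm f r) *ᵥ fun l => E.zeta y (r l))) (iid E.P n) := by
    refine ((integrable_finsetSum univ fun i _ =>
      (memLp_iid_eval z2 i).integrable_sq).mono' (measurable_dotProduct hP hP).aestronglyMeasurable
        (.of_forall fun r => ?_))
    rw [norm_of_nonneg (nsq_nonneg _)]
    refine (projM_dot_self_le _ _).trans_eq ?_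
    simp only [dotProduct, ← sq]
  have b2 := (measure_ge_le_of_integral (fun _ => nsq_nonneg _)
    (measurable_dotProduct hP hP) hi (by positivity : 0 < 8 * (1 + K.vε) * E.k) h0
    (hI.trans_eq (by ring))).trans (toK k4 (by linarith))
  have m1 := (hy.errGood hE hK hδ).mono fun _ h => h.abs_m
  have b3 := ((hy.condZero_mErr hE hK hδ).iid_weighted_le measurable_cov
    (E.measurable_mErr_right y) (hE.memLp_of_le hK (E.measurable_mErr_right y) m1)
    (by positivity) (by positivity : 0 ≤ n * K.CA) (by positivity : 0 < n * h)
    (hE.condSqLE_of_le hK m1) E.measurable_wts).trans (toK k3 (by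
      rw [div_le_iff₀ (by positivity)]; exact le_of_eq (by ring)))
  exact ((measure_union_le _ _).trans (add_le_add b1 ((measure_union_le _ _).trans
    (add_le_add b2 b3)))).trans_eq (by ring)

/-- The samples where one of the assumed `o_p(1)` quantities exceeds `δ`. -/
def Fail (E : Experiment d n) (δ : ℝ) : Set E.Smp :=
  {r | ∃ w : E.𝒲, δ < |errPr E r w|} ∪ ({r | ∃ w : E.𝒲, δ < |errΦ1 E r w|} ∪
    ({r | ∃ w : E.𝒲, δ < |errΦ0 E r w|} ∪
    ({r | ∃ ij : Fin n × Fin E.p, δ < |√n * E.sw *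
      (E.Xtil (E.covs r) ij.1 ij.2 * E.rn (zz (r.1 ij.1)))|} ∪
    ({r | δ < |min ((E.sw : ℝ) ^ 2 * n) (E.k * n) *
      empSq E r (fun w => errPr E r w * errΦ1 E r w)|} ∪
    {r | δ < |min ((E.sw : ℝ) ^ 2 * n) (E.k * n) *
      empSq E r (fun w => errPr E r w * errΦ0 E r w)|}))))

lemma Regular.measure_not_good_le (hE : E.Regular K Z) (hK : K.Valid d) (hZ : IsCompact Z)
    (hb : E.SieveBasis f M) (hest : E.IsEstimated) (hh : E.Small K M h C₁)
    (hM : 256 * (E.k * M) ≤ n) (hδ : h ≤ K.cπ / 2) (hδ1 : K.Km * h ≤ 1) :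
    E.μ {r | ¬ E.Good K Z f M h r} ≤ ofReal (2 * K.vε * (n : ℝ) ^ (1 - min (K.rε / 4) 2))
        + 9 * ofReal (K.Kp * h) + 2 * E.μ (E.Fail (h ^ 4)) := by
  have h4 : h ^ 4 ≤ h := pow_le_of_le_one hh.pos.le hh.le_one (by norm_num)
  have b1 := (E.μ_fst _).trans_le (hE.iid_not_goodFst_le hK hZ hb hh hM)
  have hF : ∀ r, r ∉ E.Fail (h ^ 4) → E.AuxGood h r.2 := fun r hc w hw => by
    simp only [Fail, Set.mem_union, not_or, Set.mem_ofPred_eq, not_exists, not_lt] at hc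
    exact ⟨(hc.1 ⟨w, hw⟩).trans h4, (hc.2.1 ⟨w, hw⟩).trans h4, (hc.2.2.1 ⟨w, hw⟩).trans h4⟩
  have b2 := (μ_le_of_section (hb.measurableSet_badSnd K h) (G := {y | E.AuxGood h y})
    fun y hy => AuxGood.iid_badSnd_le hy hE hK hb hh hδ hδ1).trans (add_le_add_right
      ((E.μ_snd {y | E.AuxGood h y}ᶜ).symm.trans_le (measure_mono fun r hr => not_not.1 (mt (hF r) hr))) _)
  have h1 : ∀ᵐ o ∂E.P, (∀ y, E.AuxGood h y → ErrGood K E h y o) ∧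
      score E.pr E.Φ1 E.Φ0 o = xx o ⬝ E.β0 + E.f0 (zz o) + E.eps o ∧
      zz o ∈ Z ∧ f (zz o) ⬝ f (zz o) ≤ M := by
    filter_upwards [hE.errGood_ae hK hδ, hE.score_eq hK hZ, hE.zz_mem, hb.ortho.bound]
      with o a1 a2 a3 a4 using ⟨a1, a2, a3, a4⟩
  have h2 := (E.μ_fst _).trans (ae_iid_of_ae (n := n) h1)
  refine (measure_mono_ae ?_).trans (((measure_union_le _ _).trans (add_le_add b1
    ((measure_union_le _ (E.Fail (h ^ 4))).trans (add_le_add b2 le_rfl)))).trans_eq (by ring))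
  filter_upwards [h2, hest.lasso] with r g1 g2 hr
  by_contra (hc : r ∉ (_ ∪ (_ ∪ _) : Set E.Smp))
  simp only [Set.mem_union, not_or, Set.mem_ofPred_eq, not_not, BadSnd, not_and, not_le,
    not_exists] at hc
  obtain ⟨c1, ⟨c2, c3, c4⟩, c5⟩ := hc
  have hA := hF r c5
  simp only [Fail, Set.mem_union, not_or, Set.mem_ofPred_eq, not_exists, not_lt] at c5
  exact hr ⟨c1, fun i => (g1 i).1 _ hA, fun i => (g1 i).2.1, fun i => (g1 i).2.2.1,
    fun i => (g1 i).2.2.2, g2, fun j => (c2 (fun j => c1.cov.fam.four (.inl (.inl j))) c1.four j).le,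
    c3.le, fun a => (c4 a).le, c5.2.2.2.1, c5.2.2.2.2.1, c5.2.2.2.2.2⟩

end Experiment

section Op

variable {O : ℕ → Type*} [∀ n, MeasurableSpace (O n)] {μ : ∀ n, Measure (O n)} {X Y : ∀ n, O n → ℝ}

lemma op_of_eventually_le {a : ℝ → ℝ} {b : ℝ → ℝ≥0∞} (ha : Tendsto a (𝓝[>] 0) (𝓝 0))
    (hb : Tendsto b (𝓝[>] 0) (𝓝 0))
    (H : ∀ᶠ h in 𝓝[>] 0, ∀ᶠ n in atTop, μ n {r | ¬ |Y n r| ≤ a h} ≤ b h) : Op μ Y := by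
  refine fun δ hδ => tendsto_order.2 ⟨fun _ h => absurd h not_lt_zero, fun ε hε => ?_⟩
  obtain ⟨h, h1, h2, h3⟩ := (H.and ((ha.eventually_lt_const hδ).and
    (hb.eventually_lt_const hε))).exists
  filter_upwards [h1] with n hn
  exact (measure_mono fun r (hr : δ < _) => not_le.2 (h2.trans hr)).trans_lt (hn.trans_lt h3)

lemma Op.of_abs_le (hX : Op μ X) {B : ℝ} (hB : 0 < B)
    (h : ∀ᶠ n in atTop, ∀ r, |Y n r| ≤ B * |X n r|) : Op μ Y := fun δ hδ =>
  tendsto_of_tendsto_of_tendsto_of_le_of_le' tendsto_const_nhds (hX (δ / B) (by positivity))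
    (.of_forall fun _ => zero_le) (h.mono fun n hn => measure_mono fun r (hr : δ < _) =>
      (div_lt_iff₀' hB).2 (hr.trans_le (hn r)))

end Op

variable {d : ℕ} {E : ∀ n, Experiment d n} {K : Consts} {Z : Set (EZ d)} {C₁ : ℝ}

lemma tendsto_measure_fail (hF : FirstStage E) (hG : Growth E) {δ : ℝ} (hδ : 0 < δ) :
    Tendsto (fun n => (E n).μ ((E n).Fail δ)) atTop (𝓝 0) := by
  have h := (hF.pr_sup δ hδ).add ((hF.Φ1_sup δ hδ).add ((hF.Φ0_sup δ hδ).add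
    ((hG.remainder δ hδ).add ((hF.prod1 δ hδ).add (hF.prod0 δ hδ)))))
  simp only [add_zero] at h
  refine tendsto_of_tendsto_of_tendsto_of_le_of_le tendsto_const_nhds h (fun _ => zero_le)
    fun n => ?_
  iterate 4 refine (measure_union_le _ _).trans (add_le_add le_rfl ?_)
  exact measure_union_le _ _

lemma eventually_scal (hK : K.Valid d) (hE : ∀ᶠ n in atTop, (E n).Regular K Z)
    (hG : Growth E) (hZ : IsCompact Z) : ∀ᶠ n : ℕ in atTop,
      Scal K.A n (E n).k (log (E n).p) ((E n).ξ0 ^ 2 / K.cψ) := by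
  have hl : Tendsto (fun n : ℕ => log n) atTop atTop :=
    Real.tendsto_log_atTop.comp tendsto_natCast_atTop_atTop
  have h4 := ((Real.isLittleO_pow_log_id_atTop (n := 4)).bound one_pos).filter_mono
    (tendsto_natCast_atTop_atTop (R := ℝ))
  filter_upwards [hE, eventually_gt_atTop 0, hl.eventually_ge_atTop 1, eventually_map.1 h4,
    hG.sparse_w.eventually_lt_const one_pos] with n hn h0 h1 h4 hw
  have hn0 : (0 : ℝ) < n := by exact_mod_cast h0
  have hs := Real.sqrt_pos.2 hn0
  have hss := sq_sqrt hn0.le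
  have hsw : (1 : ℝ) ≤ (E n).sw := by exact_mod_cast hn.sw_pos hK
  have hL : log n ≤ log (E n).p := Real.log_le_log hn0 (by exact_mod_cast hn.p_gt.le)
  have hL1 : log (E n).p ≤ √n := by
    rw [div_lt_one hs] at hw
    nlinarith [(le_max_right _ _).trans hw.le]
  have hl2 : log n ^ 2 ≤ √n := by
    simp only [norm_eq_abs, one_mul, id] at h4
    exact Real.le_sqrt_of_sq_le (by
      rw [abs_of_pos hn0] at h4; nlinarith [le_abs_self (log (n : ℝ) ^ 4)])
  obtain ⟨f, hb⟩ := hn.exists_sieveBasis hK hZ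
  have hψ := hK.cψ
  refine ⟨?_, h1, hL, by nlinarith, ?_, hn.k_pos, hb.ortho.k_le, ?_⟩
  · linarith [(div_pos hK.Cψ hψ : 0 < K.Cψ / K.cψ), show K.A = 1 + K.Cψ / K.cψ from rfl]
  · nlinarith [mul_le_mul hL1 hl2 (by positivity) hs.le]
  · have h := (div_le_iff₀ hn0).1 hn.ξ0_growth
    calc _ = (E n).k * (E n).ξ0 ^ 2 * log (E n).p / K.cψ := by ring
      _ ≤ K.Cψ * n / K.cψ := by gcongr
      _ = K.Cψ / K.cψ * n := by ring
      _ ≤ _ := by rw [Consts.A]; gcongr; linarith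

lemma eventually_small (hK : K.Valid d) (hE : ∀ᶠ n in atTop, (E n).Regular K Z)
    (hG : Growth E) (hZ : IsCompact Z) (hT : Tuning E K.C₀ C₁) :
    ∀ᶠ h in 𝓝[>] (0 : ℝ), ∀ᶠ n : ℕ in atTop, (E n).Small K ((E n).ξ0 ^ 2 / K.cψ) h C₁ ∧
      256 * ((E n).k * ((E n).ξ0 ^ 2 / K.cψ)) ≤ n ∧ h ≤ K.cπ / 2 ∧ K.Km * h ≤ 1 := by
  have ev : ∀ c {b : ℝ}, 0 < b → ∀ᶠ h in 𝓝[>] (0 : ℝ), c * h ≤ b := fun c b hb =>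
    ((((continuous_const.mul continuous_id).tendsto' (0 : ℝ) 0 (mul_zero c)).mono_left
      nhdsWithin_le_nhds).eventually_lt_const hb).mono fun _ => le_of_lt
  have hl := Real.tendsto_log_atTop.comp tendsto_natCast_atTop_atTop
  filter_upwards [self_mem_nhdsWithin, ev 1 one_pos, ev _ one_pos, ev _ one_pos,
    ev _ (lt_min (half_pos hK.cSig) one_pos), ev 1 (half_pos hK.cπ), ev K.Km one_pos,
    ev (256 * K.A) one_pos] with h h0 h1 h2 h3 h4 h5 h6 h7
  have h0 : 0 < h := h0
  rw [one_mul] at h1 h5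
  have hp : 0 < h ^ 4 := by positivity
  filter_upwards [eventually_scal hK hE hG hZ, hE, hG.sparse_w.eventually_lt_const hp,
    hG.sparse_β.eventually_lt_const hp, hl.eventually_ge_atTop (1 / h ^ 4), hT.lam_ge, hT.lam_le,
    hT.lam'_ge, hT.lam'_le] with n a1 a2 a3 a4 a5 a6 a7 a8 a9
  have hs := Real.sqrt_pos.2 a1.nR_pos
  have hS : (E n).Small K ((E n).ξ0 ^ 2 / K.cψ) h C₁ := by
    refine ⟨h0, h1, a1, (div_le_iff₀' hp).1 (a5.trans a1.L_ge), a2.sw_pos hK, ?_,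
      (div_le_iff₀ hs).1 a4.le, a6, a7, a8, a9, h2, h3, h4⟩
    rw [Experiment.rate, Real.sqrt_div (by linarith [a1.one_le_L]), ← mul_div_assoc]
    exact (div_le_div_of_nonneg_right (le_max_left _ _) hs.le).trans a3.le
  refine ⟨hS, ?_, h5, h6⟩
  have : h ^ 4 ≤ h := pow_le_of_le_one h0.le h1 (by norm_num)
  have := hS.kΞ_le
  have : 256 * (K.A * h ^ 4) ≤ 1 := by nlinarith
  nlinarith [a1.nR_pos]

/-- A quantity that is small on the good samples is `o_p(1)`. -/
lemma op_of_good (hK : K.Valid d) (hE : ∀ᶠ n in atTop, (E n).Regular K Z)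
    (hest : ∀ᶠ n in atTop, (E n).IsEstimated) (hF : FirstStage E) (hG : Growth E)
    (hZ : IsCompact Z) (hT : Tuning E K.C₀ C₁) {Y : ∀ n, (E n).Smp → ℝ} {C : ℝ}
    (H : ∀ h > 0, ∀ᶠ n in atTop, ∀ f r, (E n).Regular K Z → (E n).IsEstimated →
      (E n).SieveBasis f ((E n).ξ0 ^ 2 / K.cψ) → (E n).Small K ((E n).ξ0 ^ 2 / K.cψ) h C₁ →
      (E n).Good K Z f ((E n).ξ0 ^ 2 / K.cψ) h r → |Y n r| ≤ C * √h) :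
    Op (fun n => (E n).μ) Y := by
  have hb : Tendsto (fun h : ℝ => ofReal h + 9 * ofReal (K.Kp * h))
      (𝓝[>] 0) (𝓝 0) := by
    refine Tendsto.mono_left (Continuous.tendsto' ?_ _ _ (by simp)) nhdsWithin_le_nhds
    exact ENNReal.continuous_ofReal.add ((ENNReal.continuous_const_mul (by simp)).comp
      (ENNReal.continuous_ofReal.comp (continuous_const.mul continuous_id)))
  refine op_of_eventually_le (a := fun h => C * √h) (Tendsto.mono_left
    ((continuous_const.mul Real.continuous_sqrt).tendsto' _ _ (by simp)) nhdsWithin_le_nhds) hb ?_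
  filter_upwards [self_mem_nhdsWithin, eventually_small hK hE hG hZ hT] with h h0 hS
  have h0 := h0
  have hz : Tendsto (fun n : ℕ => ofReal (2 * K.vε * (n : ℝ) ^ (1 - min (K.rε / 4) 2))
      + 2 * (E n).μ ((E n).Fail (h ^ 4))) atTop (𝓝 0) := by
    have e : 0 < min (K.rε / 4) 2 - 1 := by
      rw [sub_pos, lt_min_iff]; constructor <;> linarith [hK.rε]
    have t := ((tendsto_rpow_neg_atTop e).comp tendsto_natCast_atTop_atTop).const_mul (2 * K.vε)
    simp only [neg_sub, mul_zero] at t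
    have t1 := ENNReal.tendsto_ofReal t
    have t2 := ENNReal.Tendsto.const_mul (tendsto_measure_fail hF hG (pow_pos h0 4))
      (.inr ENNReal.ofNat_ne_top : (0 : ℝ≥0∞) ≠ 0 ∨ (2 : ℝ≥0∞) ≠ ⊤)
    simpa using t1.add t2
  filter_upwards [hS, hE, hest, H h h0,
    hz.eventually_lt_const (ENNReal.ofReal_pos.2 h0)] with n a1 a2 a3 a4 a5
  obtain ⟨f, hf⟩ := a2.exists_sieveBasis hK hZ
  obtain ⟨b1, b2, b3, b4⟩ := a1
  refine (measure_mono (t := {r | ¬ (E n).Good K Z f _ h r}) fun r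
    (hr : ¬ |Y n r| ≤ C * √h) hg => hr (a4 f r a2 a3 hf b1 hg)).trans ((a2.measure_not_good_le hK hZ hf a3 b1 b2 b3 b4).trans ?_)
  rw [add_right_comm]
  gcongr

lemma op_stat (hK : K.Valid d) (hE : ∀ᶠ n in atTop, (E n).Regular K Z)
    (hest : ∀ᶠ n in atTop, (E n).IsEstimated) (hF : FirstStage E) (hG : Growth E)
    (hZ : IsCompact Z) (hT : Tuning E K.C₀ C₁) : Op (fun n => (E n).μ) fun n r =>
      (E n).stat r + (√n)⁻¹ * ∑ i, (E n).bb (r.1 i) * (E n).eps (r.1 i) :=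
  op_of_good hK hE hest hF hG hZ hT fun _ _ => .of_forall fun _ _ _ a1 a2 a3 a4 a5 =>
    a5.stat_le a1 hK a3 a2 a4

lemma op_VHat (hK : K.Valid d) (hE : ∀ᶠ n in atTop, (E n).Regular K Z)
    (hest : ∀ᶠ n in atTop, (E n).IsEstimated) (hF : FirstStage E) (hG : Growth E)
    (hZ : IsCompact Z) (hT : Tuning E K.C₀ C₁) (hV : VarianceRate E) :
    Op (fun n => (E n).μ) fun n r => (E n).VHat r - (E n).avar := by
  obtain ⟨CR, hR⟩ := hT.R_ge
  refine op_of_good hK hE hest hF hG hZ hT (C := K.Kv C₁ CR) fun h h0 => ?_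
  filter_upwards [hR, hV.eventually_lt_const h0] with n hR hV f r a1 a2 a3 a4 a5
  refine a5.VHat_sub_le a1 hK a3 a2 a4 hR ?_
  obtain ⟨o, ho⟩ := a1.zz_mem.exists
  have hlc := (abs_nonneg _).trans (a1.abs_rn_le ho)
  have hL := a4.scal.log_n.trans (by
    have : (1 : ℝ) ≤ (E n).p := by exact_mod_cast a4.scal.n_pos.trans a1.p_gt
    exact Real.log_le_log a4.scal.nR_pos (le_mul_of_one_le_right a4.scal.nR_pos.le this))
  have h1 : 0 ≤ (E n).s0 * log (E n).p / n :=
    div_nonneg (mul_nonneg (Nat.cast_nonneg _) (by linarith [a4.scal.one_le_L])) a4.scal.nR_pos.le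
  have h2 := sqrt_nonneg ((E n).ξ0 ^ 2 * (E n).k / n)
  rw [abs_of_nonneg hlc]
  exact le_trans (by nlinarith) hV.le

lemma tendsto_charFun_stat (hK : K.Valid d) (hE : ∀ᶠ n in atTop, (E n).Regular K Z)
    (hest : ∀ᶠ n in atTop, (E n).IsEstimated) (hF : FirstStage E) (hG : Growth E)
    (hZ : IsCompact Z) (hT : Tuning E K.C₀ C₁) {t : ℕ → ℝ} {t₀ : ℝ}
    (ht : Tendsto t atTop (𝓝 t₀)) :
    Tendsto (fun n => ∫ r, Complex.exp ((t n * ((E n).stat r / √(E n).avar) : ℝ) * Complex.I)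
      ∂(E n).μ) atTop (𝓝 (Complex.exp (-(t₀ ^ 2 / 2) : ℝ))) := by
  set q := K.cOm * (K.cξ * K.cSig) ^ 2
  have hq := mul_pos hK.cOm (pow_pos (mul_pos hK.cξ hK.cSig) 2)
  set Y : ∀ n, Rec (E n).p d → ℝ := fun n o => -((E n).bb o * (E n).eps o) / √(E n).avar
  have hm : ∀ n, Measurable (Y n) := fun n =>
    ((E n).measurable_bb.mul (E n).measurable_eps).neg.div_const _
  have hS : ∀ n, Measurable fun x : Fin n → Rec (E n).p d => t n * ((√n)⁻¹ * ∑ i, Y n (x i)) :=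
    fun n => ((measurable_sum _ fun i _ => (hm n).comp (measurable_pi_apply i)).const_mul
      _).const_mul _
  have e4 : ∀ n o, (E n).Regular K Z →
      Y n o ^ 4 = (((E n).bb o * (E n).eps o) ^ 2) ^ 2 / (E n).avar ^ 2 := fun n o hn => by
    have := sq_sqrt (hq.le.trans (hn.avar_ge hK))
    rw [← this, div_pow]; ring
  have hc := tendsto_charFun_iid (fun n => (E n).P) Y hm (B := K.vε * (4 / K.cX ^ 2) / q ^ 2)
    (hE.mono fun n hn => by
      simp only [e4 n _ hn]
      exact (hn.memLp_bb_eps_sq hK).1.integrable_sq.div_const _)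
    (hE.mono fun n hn => by
      simp only [Y]
      rw [integral_div, integral_neg, neg_div, neg_eq_zero, div_eq_zero_iff]
      left
      have h2 := ((hn.memLp_bb_eps_sq hK).1.integrable (by norm_num))
      have hi : Integrable (fun o => (E n).bb o * (E n).eps o) (E n).P :=
        ((memLp_two_iff_integrable_sq ((E n).measurable_bb.mul
          (E n).measurable_eps).aestronglyMeasurable).2 h2).integrable (by norm_num)
      simp only [Experiment.bb_eq] at hi ⊢
      exact hn.condZero_eps hK (fun w => (E n).w0 ⬝ (w.1 - (E n).piZ w.2))
        (measurable_dotProduct measurable_const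
          (measurable_fst.sub ((E n).measurable_piZ.comp measurable_snd))) hi)
    (hE.mono fun n hn => by
      have h0 := hq.trans_le (hn.avar_ge hK)
      simp only [Y, div_pow, neg_sq]
      rw [integral_div, ← hn.avar_eq hK, sq_sqrt h0.le, div_self h0.ne'])
    (hE.mono fun n hn => by
      simp only [e4 n _ hn]
      rw [integral_div]
      have := (hn.memLp_bb_eps_sq hK).2
      have := hn.avar_ge hK
      have : 0 ≤ K.vε * (4 / K.cX ^ 2) := by have := hK.vε_pos; positivity
      gcongr) ht
  refine tendsto_charFun_of_op (fun n => (E n).μ) (fun n =>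
    ((E n).measurable_stat.div_const _).const_mul _) (Y := fun n r =>
      t n * ((√n)⁻¹ * ∑ i, Y n (r.1 i))) (fun n => (hS n).comp measurable_fst) ?_
    (hc.congr fun n => ?_)
  · refine (op_stat hK hE hest hF hG hZ hT).of_abs_le (B := (|t₀| + 1) / √q) (by positivity) ?_
    filter_upwards [hE, ht.abs.eventually_lt_const (lt_add_one |t₀|)] with n hn htn r
    have e : t n * ((E n).stat r / √(E n).avar) - t n * ((√n)⁻¹ * ∑ i, Y n (r.1 i))
        = t n / √(E n).avar * ((E n).stat r
          + (√n)⁻¹ * ∑ i, (E n).bb (r.1 i) * (E n).eps (r.1 i)) := by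
      simp only [Y, neg_div, Finset.sum_neg_distrib, ← sum_div]
      ring
    rw [e, abs_mul, abs_div, abs_of_nonneg (sqrt_nonneg _)]
    have := hn.avar_ge hK
    gcongr
  · rw [Experiment.μ]
    rw [integral_fun_fst (μ := iid (E n).P n) (ν := (E n).ν)
      fun x => Complex.exp ((t n * ((√n)⁻¹ * ∑ i, Y n (x i)) : ℝ) * Complex.I)]
    simp

end DiD

end

theorem mainTheorem3 {d : ℕ} (𝒵 : Set (DiD.EZ d)) (h𝒵 : IsCompact 𝒵)
    (κ : DiD.Consts) (hκ : κ.Valid d) :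
    ∃ C₀ : ℝ, 0 < C₀ ∧ ∀ (C₁ : ℝ) (E : ∀ n : ℕ, DiD.Experiment.{u} d n),
      (∀ᶠ n in atTop, (E n).Regular κ 𝒵) →
      (∀ᶠ n in atTop, (E n).IsEstimated) →
      DiD.FirstStage E → DiD.Growth E → DiD.Tuning E C₀ C₁ →
        TendstoInDistribution (fun n ω => (E n).stat ω / √((E n).avar)) atTop
            (id : ℝ → ℝ) (fun n => (E n).μ) (gaussianReal 0 1) ∧
        (∀ v : ℝ≥0, Tendsto (fun n => (E n).avar) atTop (𝓝 (v : ℝ)) →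
          TendstoInDistribution (fun n ω => (E n).stat ω) atTop
            (id : ℝ → ℝ) (fun n => (E n).μ) (gaussianReal 0 v)) ∧
        (DiD.VarianceRate E →
          DiD.Op (fun n => (E n).μ) (fun n ω => (E n).VHat ω - (E n).avar)) := by
  refine ⟨κ.C₀, one_pos.trans_le hκ.C₀_ge.1, fun C₁ E hE hest hF hG hT => ?_⟩
  have hc : ∀ (t : ℕ → ℝ) (t₀ : ℝ), _ := fun t t₀ =>
    DiD.tendsto_charFun_stat hκ hE hest hF hG h𝒵 hT (t := t) (t₀ := t₀)
  have hm := fun n => (E n).measurable_stat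
  refine ⟨?_, fun v hv => ?_, DiD.op_VHat hκ hE hest hF hG h𝒵 hT⟩
  · refine DiD.tendstoInDistribution_gaussian _ (fun n => (hm n).div_const _) 1 fun t => ?_
    simpa using hc _ _ tendsto_const_nhds
  · refine DiD.tendstoInDistribution_gaussian _ hm v fun t => ?_
    have h := hc (fun n => t * √(E n).avar) _ (hv.sqrt.const_mul t)
    rw [mul_pow, Real.sq_sqrt v.coe_nonneg, mul_comm (t ^ 2)] at h
    refine h.congr' (hE.mono fun n hn => ?_)
    have ha : 0 < (E n).avar := (mul_pos hκ.cOm (pow_pos (mul_pos hκ.cξ hκ.cSig) 2)).trans_le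
      (hn.avar_ge hκ)
    simp only [mul_assoc, mul_div_cancel₀ _ (Real.sqrt_pos.2 ha).ne']
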